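/- **Setting.** Fix $\lambda>0$, $p\in(0,1)$, $q\in[0,1]$, a horizon $H>0$, and windows $\delta_\gamma\ge 0$ with $\delta_\gamma\to0$ as $\gamma\to\infty$. Put $\lambda_{0,1}=\lambda p$, $\lambda_{1,0}=\lambda(1-p)$. By *the chain* we mean the càdlàg Markov jump process on $\{0,1\}$ with jump rates $\lambda_{0,1}$ from $0$ to $1$ and $\lambda_{1,0}$ from $1$ to $0$, and with $\mathbb P(\mathbf x_0=1)=q$. *Filter and smoother.* For $\gamma>0$ let $\mathbf x^\gamma$ be a copy of the chain (the signal), $B^\gamma$ a standard Brownian motion with continuous paths independent of $\mathbf x^\gamma$, and $\mathbf y^\gamma_t=\int_0^t\mathbf x^\gamma_s\,ds+\gamma^{-1/2}B^\gamma_t$. For $0\le s\le t$ let $\pi^\gamma_{s,t}=\mathbb P(\mathbf x^\gamma_s=1\mid(\mathbf y^\gamma_u)_{u\le t})$, where we take the version that is a continuous function of the path $\mathbf y^\gamma|_{[0,t]}$ for the uniform norm. Put $\pi^\gamma_t=\pi^\gamma_{t,t}$, and $\pi^{\delta_\gamma,\gamma}_t=\pi^\gamma_{t-\delta_\gamma,t}$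 for $t\ge\delta_\gamma$ (for $t<\delta_\gamma$ the value is arbitrary). *Graphs and distances.* Let $d_{\mathbb L}(f,g)=\int_0^H(|f(t)-g(t)|\wedge1)\,dt$ and let $d_{\mathbb H}$ be the Hausdorff distance of subsets of the Euclidean plane. The graph $\mathcal G(f)$ of a càdlàg function $f:I\to[0,1]$ on a closed set $I\subset[0,H]$ consists of the points $(t,f_t)$ at the continuity points $t\in I$ and of the full bars $\{t\}\times[0,1]$ at the discontinuities of $f$. *Spike process.* Let $\mathbf x$ be the chain. Given $\mathbf x$, let $S$ be a Poisson point process on $[0,H]\times(0,1)$ with intensity $\lambda\,(p\mathbf 1_{\{\mathbf x_t=0\}}+(1-p)\mathbf 1_{\{\mathbf x_t=1\}})\,dt\otimes m^{-2}dm$, and let $R$ be an independent variable with density $\frac{r}{1-r}m^{-2}$ on $[r,1]$, where $r=|q-\mathbf x_0|$ ($R=0$ if $r=0$). The spike process $\mathbb X$ is the union of the graph of $\mathbf x$ on $[0,H]$ and, for each $(t,m)\in S\cup\{(0,R)\}$, of the segment $\{t\}\times[0,m]$ if $\mathbf x_t=0$ and $\{t\}\times[1-m,1]$ if $\mathbf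 x_t=1$. *Damping.* Let $$D^\gamma_t=\int_{t-\delta_\gamma}^t\Big(\lambda_{1,0}\frac{\pi^\gamma_u}{1-\pi^\gamma_u}+\lambda_{0,1}\frac{1-\pi^\gamma_u}{\pi^\gamma_u}\Big)du\in[0,\infty],\qquad e^{-\infty}=0 .$$ Let $\mathcal G^\gamma=\{(t,\pi^{\delta_\gamma,\gamma}_t):t\in[\delta_\gamma,H]\}$. Let $\mathcal G^{\gamma,\circ}$ be the graph over $[\delta_\gamma,H]$ whose slice at $t$ is $\{\mathbf x_t+(\pi^\gamma_t-\mathbf x_t)e^{-D^\gamma_t}\}$ if $t$ is not a jump time of $\mathbf x$, and $[0,1]$ if $t$ is a jump time of $\mathbf x$. **Proposition.** Suppose that $\mathbf x$, $\mathbb X$ and all $(\mathbf x^\gamma,B^\gamma)$, $\gamma>0$, are defined on one probability space (with any joint law for different $\gamma$; for instance $\mathbf x^\gamma=\mathbf x$), and that almost surely $$\lim_{\gamma\to\infty}d_{\mathbb L}(\pi^\gamma,\mathbf x)=0,\qquad \lim_{\gamma\to\infty}d_{\mathbb H}(\mathcal G(\pi^\gamma),\mathbb X)=0 .$$ Then,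 almost surely, $$\lim_{\gamma\to\infty}d_{\mathbb L}(\pi^{\delta_\gamma,\gamma},\mathbf x)=0,\qquad \lim_{\gamma\to\infty}d_{\mathbb H}(\mathcal G^\gamma,\mathcal G^{\gamma,\circ})=0 .$$ -/

import Mathlib

open Set Filter Topology MeasureTheory ProbabilityTheory
open scoped NNReal ENNReal

namespace WonhamFilter

noncomputable section

/-! ### The hidden two-state Markov chain -/

/-- The generator of the two-state chain: jump rate `lam * p` from `0` to `1`
and jump rate `lam * (1 - p)` from `1` to `0`. -/
def generator (lam p : ℝ) : Matrix (Fin 2) (Fin 2) ℝ :=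
  !![-(lam * p), lam * p; lam * (1 - p), -(lam * (1 - p))]

/-- The transition matrix over a time span `t`. -/
def transition (lam p t : ℝ) : Matrix (Fin 2) (Fin 2) ℝ :=
  NormedSpace.exp (t • generator lam p)

/-- `x` is the pure jump Markov process on `{0, 1}` with càdlàg trajectories, with jump rates
`lam * p` (from `0` to `1`) and `lam * (1 - p)` (from `1` to `0`), and with Bernoulli initial law
`ℙ(x_0 = 1) = q`.  Only times `t ≥ 0` matter. -/
structure IsTwoStateChain {Ω : Type*} [MeasurableSpace Ω] (P : Measure Ω) (lam p q : ℝ)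
    (x : ℝ → Ω → ℝ) : Prop where
  measurable : ∀ t, 0 ≤ t → Measurable (x t)
  mem_states : ∀ t, 0 ≤ t → ∀ ω, x t ω = 0 ∨ x t ω = 1
  right_continuous : ∀ ω t, 0 ≤ t → ContinuousWithinAt (fun s => x s ω) (Ici t) t
  left_limits : ∀ ω t, 0 < t → ∃ l, Tendsto (fun s => x s ω) (𝓝[<] t) (𝓝 l)
  law : ∀ (n : ℕ) (τ : Fin (n + 1) → ℝ) (i : Fin (n + 1) → Fin 2), τ 0 = 0 → Monotone τ →
    P {ω | ∀ k, x (τ k) ω = ((i k : ℕ) : ℝ)} =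
      ENNReal.ofReal ((![1 - q, q] : Fin 2 → ℝ) (i 0) *
        ∏ k : Fin n, transition lam p (τ k.succ - τ k.castSucc) (i k.castSucc) (i k.succ))

/-! ### Observation, filter and smoother -/

/-- The observation process `y_t = ∫_0^t x_s ds + γ^{-1/2} B_t`. -/
def observation {Ω : Type*} (γ : ℝ) (x : ℝ → Ω → ℝ) (B : ℝ≥0 → Ω → ℝ) (t : ℝ) (ω : Ω) : ℝ :=
  (∫ s in (0 : ℝ)..t, x s ω) + (1 / Real.sqrt γ) * B t.toNNReal ω

/-- The σ-algebra generated by `y_u`, `0 ≤ u ≤ t`. -/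
abbrev pastSigma {Ω : Type*} (y : ℝ → Ω → ℝ) (t : ℝ) : MeasurableSpace Ω :=
  ⨆ u ∈ Icc (0 : ℝ) t, MeasurableSpace.comap (y u) inferInstance

/-- The signal plus noise model with parameter `γ`, and its conditional probabilities
`π s t = ℙ(x_s = 1 | (y_u)_{u ≤ t})`, `0 ≤ s ≤ t`.  The filter is `π t t` and the smoothed filter
with window `δ` is `π (t - δ) t`.

A conditional probability is only determined up to a null set. Since uncountably many values of `γ`
are considered at the same time, a version has to be selected: it is the one which is a continuous
function of the observed path `y|[0,t]` for the uniform norm. The law of `y` charges every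
nonempty open set of continuous paths starting from `0`, so there is at most one such version. -/
structure IsFilteringModel {Ω : Type*} [MeasurableSpace Ω] (P : Measure Ω) (lam p q γ : ℝ)
    (x : ℝ → Ω → ℝ) (B : ℝ≥0 → Ω → ℝ) (π : ℝ → ℝ → Ω → ℝ) : Prop where
  chain : IsTwoStateChain P lam p q x
  brownian : IsBrownianReal B P
  measurable_noise : ∀ t, Measurable (B t)
  continuous_noise : ∀ ω, Continuous fun t => B t ω
  noise_zero : ∀ ω, B 0 ω = 0
  indep : IndepFun (fun ω (t : ℝ≥0) => B t ω) (fun ω (t : ℝ≥0) => x (t : ℝ) ω) P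
  condProb : ∀ s t, 0 ≤ s → s ≤ t →
    π s t =ᵐ[P] P[({ω | x s ω = 1}.indicator fun _ => (1 : ℝ)) | pastSigma (observation γ x B) t]
  version : ∀ s t, 0 ≤ s → s ≤ t → ∃ F : C(Icc (0 : ℝ) t, ℝ) → ℝ, Continuous F ∧
    ∀ (ω : Ω) (c : C(Icc (0 : ℝ) t, ℝ)),
      (∀ u : Icc (0 : ℝ) t, c u = observation γ x B (u : ℝ) ω) → π s t ω = F c

/-! ### Distances and graphs -/

/-- `d_L(f, g) = ∫_0^H (|f(t) - g(t)| ∧ 1) dt`. -/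
def dL (H : ℝ) (f g : ℝ → ℝ) : ℝ≥0∞ :=
  ∫⁻ t in Icc (0 : ℝ) H, ENNReal.ofReal (min |f t - g t| 1)

/-- The graph of a càdlàg function `f : I → [0,1]`, with the full vertical bar `[0,1]` at each
discontinuity, as a subset of the Euclidean plane. For continuous `f` it is the usual graph. -/
def graph (I : Set ℝ) (f : ℝ → ℝ) : Set (EuclideanSpace ℝ (Fin 2)) :=
  {z | z 0 ∈ I ∧ ((ContinuousWithinAt f I (z 0) ∧ z 1 = f (z 0)) ∨
    (¬ ContinuousWithinAt f I (z 0) ∧ z 1 ∈ Icc (0 : ℝ) 1))}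

/-! ### The spike process -/

/-- The intensity `λ (p 1_{x_t = 0} + (1 - p) 1_{x_t = 1}) dt ⊗ dm / m²` of the spikes, given a
path of the chain. -/
def spikeIntensity (lam p : ℝ) (path : ℝ → ℝ) (A : Set (ℝ × ℝ)) : ℝ≥0∞ :=
  ∫⁻ z in A, ENNReal.ofReal (lam * (if path z.1 = 0 then p else 1 - p) / z.2 ^ 2)

/-- Distance from the initial value `q` of the filter to the initial state `x0 ∈ {0, 1}`. -/
def initialGap (q x0 : ℝ) : ℝ := if x0 = 0 then q else 1 - q

/-- The decorations of the chain `x`. Given `x`: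
* the random set `S ω` of pairs (time, size) is a Poisson point process on `[0,H] × (0,1)` with the
  above intensity, i.e. the numbers of points in disjoint sets are independent Poisson variables
  (the intensity of a set whose sizes are bounded below by some `ε > 0` is finite);
* the size `R` of the initial spike is independent of `S`, and, with `r = initialGap q x_0`,
  it has density `(r / (1 - r)) m⁻²` on `[r,1]`, i.e. `ℙ(R ≥ u) = min 1 ((r / (1 - r)) (1/u - 1))`
  for `0 < u ≤ 1` (and `R = 0` if `r = 0`). -/
structure IsSpikeDecoration {Ω : Type*} [MeasurableSpace Ω] (P : Measure Ω) (lam p q H : ℝ)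
    (x : ℝ → Ω → ℝ) (S : Ω → Set (ℝ × ℝ)) (R : Ω → ℝ) : Prop where
  subset : ∀ ω, S ω ⊆ Icc (0 : ℝ) H ×ˢ Ioo (0 : ℝ) 1
  measurable : ∀ A : Set (ℝ × ℝ), MeasurableSet A → ∀ k : ℕ,
    MeasurableSet {ω | (S ω ∩ A).encard = (k : ℕ∞)}
  initial_mem : ∀ ω, R ω ∈ Icc (0 : ℝ) 1
  initial_measurable : Measurable R
  law : ∀ (n : ℕ) (A : Fin n → Set (ℝ × ℝ)) (ε : ℝ), 0 < ε →
    (∀ i, MeasurableSet (A i)) → (∀ i, A i ⊆ Icc (0 : ℝ) H ×ˢ Ico ε 1) →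
    Pairwise (fun i j => Disjoint (A i) (A j)) →
    ∀ (E : Set Ω),
      MeasurableSet[⨆ t ∈ Ici (0 : ℝ), MeasurableSpace.comap (x t) inferInstance] E →
    ∀ (k : Fin n → ℕ) (u : ℝ), u ∈ Ioc (0 : ℝ) 1 →
      P (E ∩ {ω | ∀ i, (S ω ∩ A i).encard = (k i : ℕ∞)} ∩ {ω | u ≤ R ω}) =
        ∫⁻ ω in E, (∏ i, poissonMeasure
            (spikeIntensity lam p (fun t => x t ω) (A i)).toNNReal {k i}) *
          ENNReal.ofReal (min 1
            (initialGap q (x 0 ω) / (1 - initialGap q (x 0 ω)) * (1 / u - 1))) ∂P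

/-- The spike process as a subset of `[0,H] × [0,1]`: the graph of the chain, with a vertical bar
`[0,1]` at each jump, decorated by the spike `{t} × [0,m]` (if `x_t = 0`) or
`{t} × [1-m,1]` (if `x_t = 1`) for each point `(t,m)` of the spike point process and for
the initial spike `(0,R)`. -/
def spikeSet (H : ℝ) (path : ℝ → ℝ) (S : Set (ℝ × ℝ)) (R : ℝ) :
    Set (EuclideanSpace ℝ (Fin 2)) :=
  graph (Icc 0 H) path ∪
    {z | ∃ m : ℝ, (z 0, m) ∈ insert ((0 : ℝ), R) S ∧ ((path (z 0) = 0 ∧ z 1 ∈ Icc 0 m) ∨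
      (path (z 0) = 1 ∧ z 1 ∈ Icc (1 - m) 1))}

/-! ### Damping -/

/-- The damping integral `∫_s^t (λ_{1,0} f_u / (1 - f_u) + λ_{0,1} (1 - f_u) / f_u) du` along a path
`f` of the filter, with `λ_{0,1} = λ p` and `λ_{1,0} = λ (1 - p)`, as an element of `[0,∞]`. -/
def damping (lam p : ℝ) (f : ℝ → ℝ) (s t : ℝ) : ℝ≥0∞ :=
  ∫⁻ u in Icc s t, ENNReal.ofReal
    (lam * (1 - p) * (f u / (1 - f u)) + lam * p * ((1 - f u) / f u))

/-- `e^{-D}` for `D ∈ [0,∞]`, with `e^{-∞} = 0`. -/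
def expNeg (D : ℝ≥0∞) : ℝ := if D = ∞ then 0 else Real.exp (-D.toReal)

/-- The graph over `[δ,H]` whose slice at time `t` is `x_t + (f_t - x_t) e^{-D_t}`, where `D_t` is
the damping integral of `f` over `[t-δ,t]`, if `t` is not a jump time of `x`, and is the full
vertical bar `[0,1]` if `t` is a jump time of `x`. -/
def dampedGraph (lam p H δ : ℝ) (path f : ℝ → ℝ) : Set (EuclideanSpace ℝ (Fin 2)) :=
  {z | z 0 ∈ Icc δ H ∧
    ((ContinuousWithinAt path (Icc 0 H) (z 0) ∧
      z 1 = path (z 0) + (f (z 0) - path (z 0)) * expNeg (damping lam p f (z 0 - δ) (z 0))) ∨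
    (¬ ContinuousWithinAt path (Icc 0 H) (z 0) ∧ z 1 ∈ Icc (0 : ℝ) 1))}

end

end WonhamFilter

/-! Fix one trajectory. With `μ t = γ y_t - γ t / 2` and the gauge `ρ₁ = exp μ * w`, the two-state
Zakai equation becomes a linear ODE in which the observation enters only through the values of `μ`.
Filter and smoother are then explicit and differentiable in the past time. If `f` is the filter, `a
= λ₁₀ f / (1 - f)` and `b = λ₀₁ (1 - f) / f`, then `s ↦ π_{s,t}` solves `g' = (a + b) g - a` with
terminal value `f_t`. Variation of constants writes `π_{t-δ,t}` as `f_t e^{-D_t}` plus an error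
between `0` and `δ sup a`. If `f ≤ 1 - η` on the window, the error is at most `δ λ / η`; near the
state `1` the same holds for `1 - π` (`damping_bound_zero`, `damping_bound_one`). Away from the
jumps of `x`, everything thus reduces to keeping the filter away from the state opposite to `x`,
uniformly in large `γ`.

This separation says that the limit of the graphs has no full spike away from the jumps, and it is
read off the filters. If the filter is within `η` of the state `1 - e` at time `s`, then given the
observations the signal is in `1 - e` with probability at least `1 - η`, and it stays there for a
time `m` up to probability `λ m`. Decomposing at the first such time of a finite set, the signal is
nevertheless in `e` shortly afterwards with probability at most `η + λ m` (`measure_hot_le`). The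
signals converge to `x` in probability at fixed times, because `E|X - Z| ≤ 3 E|π - Z|` for every
`{0,1}`-valued `Z` (`integral_abs_sub_le`). Hence almost surely `x` is not constant equal to `e`
around a point where the filters approach `1 - e` (`ae_not_hot`, `ae_notMem_closure`), and
compactness yields a uniform `η` (`exists_separation`).

Uncountably many `γ` occur at once, so the ODE representation of the conditional probabilities is
needed on every trajectory (`eq_smoother`). Almost surely it follows from Bayes' formula on dyadic
grids, Lévy's upward theorem and the convergence of the grid likelihoods to Feynman–Kac functionals
solving the gauged equation. Both sides are continuous in the observed path, and the law of that
path has full support (`measure_observation_near_pos`), which removes the exceptional set.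

The chain has finitely many jumps on `[0,H]`. Near a jump, convergence in `dL` brings the smoother
close to both states on the two sides, so by continuity it sweeps almost all of `[0,1]` and matches
the full bar. -/

namespace WonhamFilter

/-! ### The robust filtering equation -/

/-- The linear vector field of the two-state Zakai equation, after the observation has been removed
by the gauge transform `ρ₁ = exp m * w`. -/
noncomputable def gaugeField (l0 l1 m : ℝ) (u : ℝ × ℝ) : ℝ × ℝ :=
  (-l0 * u.1 + l1 * Real.exp m * u.2, l0 * Real.exp (-m) * u.1 - l1 * u.2)

/-- `u` solves the gauge transformed Zakai equation driven by `μ` on `[s,t]`. -/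
structure IsGaugeSol (l0 l1 : ℝ) (μ : ℝ → ℝ) (s t : ℝ) (u : ℝ → ℝ × ℝ) : Prop where
  cont : ContinuousOn u (Icc s t)
  deriv : ∀ x ∈ Ico s t, HasDerivWithinAt u (gaugeField l0 l1 (μ x) (u x)) (Ici x) x

section Gauge

variable {l0 l1 : ℝ}

lemma gaugeField_sub (m : ℝ) (u v : ℝ × ℝ) :
    gaugeField l0 l1 m u - gaugeField l0 l1 m v = gaugeField l0 l1 m (u - v) := by
  ext <;> simp [gaugeField] <;> ring

lemma gaugeField_add (m : ℝ) (u v : ℝ × ℝ) :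
    gaugeField l0 l1 m u + gaugeField l0 l1 m v = gaugeField l0 l1 m (u + v) := by
  ext <;> simp [gaugeField] <;> ring

lemma gaugeField_smul (m c : ℝ) (u : ℝ × ℝ) :
    c • gaugeField l0 l1 m u = gaugeField l0 l1 m (c • u) := by
  ext <;> simp [gaugeField] <;> ring

lemma norm_gaugeField_le (h0 : 0 ≤ l0) (h1 : 0 ≤ l1) {m C : ℝ} (hm : |m| ≤ C) (u : ℝ × ℝ) :
    ‖gaugeField l0 l1 m u‖ ≤ (l0 + l1) * Real.exp C * ‖u‖ := by
  have hC : 0 ≤ C := (abs_nonneg m).trans hm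
  have e1 : Real.exp m ≤ Real.exp C := Real.exp_le_exp.2 ((le_abs_self m).trans hm)
  have e2 : Real.exp (-m) ≤ Real.exp C := Real.exp_le_exp.2 ((neg_le_abs m).trans hm)
  have e3 : 1 ≤ Real.exp C := Real.one_le_exp hC
  have n1 : |u.1| ≤ ‖u‖ := norm_fst_le u
  have n2 : |u.2| ≤ ‖u‖ := norm_snd_le u
  have aux : ∀ l a : ℝ, ∀ x : ℝ, 0 ≤ l → 0 ≤ a → a ≤ Real.exp C → |x| ≤ ‖u‖ →
      |l * a * x| ≤ l * Real.exp C * ‖u‖ := by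
    intro l a x hl ha hae hx
    rw [abs_mul, abs_mul, abs_of_nonneg hl, abs_of_nonneg ha]
    gcongr
  have a1 := aux l0 1 u.1 h0 zero_le_one e3 n1
  have a2 := aux l1 _ u.2 h1 (Real.exp_pos m).le e1 n2
  have a3 := aux l0 _ u.1 h0 (Real.exp_pos _).le e2 n1
  have a4 := aux l1 1 u.2 h1 zero_le_one e3 n2
  rw [Prod.norm_def]
  refine max_le ?_ ?_
  · simp only [gaugeField, Real.norm_eq_abs]
    calc |-l0 * u.1 + l1 * Real.exp m * u.2| ≤ |-l0 * u.1| + |l1 * Real.exp m * u.2| :=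
          abs_add_le _ _
      _ = |l0 * 1 * u.1| + |l1 * Real.exp m * u.2| := by rw [neg_mul, abs_neg, mul_one]
      _ ≤ _ := by linarith
  · simp only [gaugeField, Real.norm_eq_abs]
    calc |l0 * Real.exp (-m) * u.1 - l1 * u.2| ≤ |l0 * Real.exp (-m) * u.1| + |l1 * u.2| :=
          abs_sub _ _
      _ = |l0 * Real.exp (-m) * u.1| + |l1 * 1 * u.2| := by rw [mul_one]
      _ ≤ _ := by linarith

lemma abs_exp_sub_exp_le {a b C : ℝ} (ha : a ≤ C) (hb : b ≤ C) :
    |Real.exp a - Real.exp b| ≤ Real.exp C * |a - b| := by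
  wlog hab : b ≤ a generalizing a b
  · rw [abs_sub_comm, abs_sub_comm a]
    exact this hb ha (le_of_not_ge hab)
  rw [abs_of_nonneg (sub_nonneg.2 (Real.exp_le_exp.2 hab)), abs_of_nonneg (sub_nonneg.2 hab)]
  have h1 := Real.add_one_le_exp (b - a)
  have h2 : Real.exp b = Real.exp a * Real.exp (b - a) := by rw [← Real.exp_add]; ring_nf
  have h3 : Real.exp a ≤ Real.exp C := Real.exp_le_exp.2 ha
  have h4 := Real.exp_pos a
  have h5 : Real.exp a * (b - a + 1) ≤ Real.exp a * Real.exp (b - a) := by gcongr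
  have h6 : Real.exp a * (a - b) ≤ Real.exp C * (a - b) := by
    have := sub_nonneg.2 hab
    gcongr
  linarith

lemma dist_gaugeField_le (h0 : 0 ≤ l0) (h1 : 0 ≤ l1) {m m' C : ℝ} (hm : |m| ≤ C) (hm' : |m'| ≤ C)
    (u : ℝ × ℝ) :
    dist (gaugeField l0 l1 m u) (gaugeField l0 l1 m' u) ≤
      (l0 + l1) * Real.exp C * |m - m'| * ‖u‖ := by
  have n1 : |u.1| ≤ ‖u‖ := norm_fst_le u
  have n2 : |u.2| ≤ ‖u‖ := norm_snd_le u
  have aux : ∀ l a b : ℝ, ∀ x : ℝ, 0 ≤ l → |a - b| ≤ Real.exp C * |m - m'| → |x| ≤ ‖u‖ →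
      |l * (a - b) * x| ≤ l * (Real.exp C * |m - m'|) * ‖u‖ := by
    intro l a b x hl ha hx
    rw [abs_mul, abs_mul, abs_of_nonneg hl]
    gcongr
  have a1 := aux l1 (Real.exp m) (Real.exp m') u.2 h1
    (abs_exp_sub_exp_le ((le_abs_self m).trans hm) ((le_abs_self _).trans hm')) n2
  have a2 := aux l0 (Real.exp (-m)) (Real.exp (-m')) u.1 h0 (by
    have := abs_exp_sub_exp_le ((neg_le_abs m).trans hm) ((neg_le_abs _).trans hm')
    rwa [neg_sub_neg, abs_sub_comm m' m] at this) n1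
  have hp : 0 ≤ Real.exp C * |m - m'| * ‖u‖ := by positivity
  rw [dist_eq_norm, Prod.norm_def]
  refine max_le ?_ ?_
  · have : (gaugeField l0 l1 m u - gaugeField l0 l1 m' u).1
        = l1 * (Real.exp m - Real.exp m') * u.2 := by simp [gaugeField]; ring
    rw [this, Real.norm_eq_abs]
    nlinarith
  · have : (gaugeField l0 l1 m u - gaugeField l0 l1 m' u).2
        = l0 * (Real.exp (-m) - Real.exp (-m')) * u.1 := by simp [gaugeField]; ring
    rw [this, Real.norm_eq_abs]
    nlinarith

namespace IsGaugeSol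

variable {μ ν : ℝ → ℝ} {s t : ℝ} {u v : ℝ → ℝ × ℝ}

lemma mono {s' t' : ℝ} (hu : IsGaugeSol l0 l1 μ s t u) (hs : s ≤ s') (ht : t' ≤ t) :
    IsGaugeSol l0 l1 μ s' t' u :=
  ⟨hu.cont.mono (Icc_subset_Icc hs ht), fun x hx => hu.deriv x ⟨hs.trans hx.1, hx.2.trans_le ht⟩⟩

lemma add (hu : IsGaugeSol l0 l1 μ s t u) (hv : IsGaugeSol l0 l1 μ s t v) :
    IsGaugeSol l0 l1 μ s t (fun x => u x + v x) :=
  ⟨hu.cont.add hv.cont, fun x hx => by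
    rw [← gaugeField_add]; exact (hu.deriv x hx).add (hv.deriv x hx)⟩

lemma smul (c : ℝ) (hu : IsGaugeSol l0 l1 μ s t u) :
    IsGaugeSol l0 l1 μ s t (fun x => c • u x) :=
  ⟨hu.cont.const_smul c, fun x hx => by
    rw [← gaugeField_smul]; exact (hu.deriv x hx).const_smul c⟩

lemma norm_le (h0 : 0 < l0) (h1 : 0 < l1) {C : ℝ} (hC : ∀ x ∈ Icc s t, |μ x| ≤ C)
    (hu : IsGaugeSol l0 l1 μ s t u) :
    ∀ x ∈ Icc s t, ‖u x‖ ≤ ‖u s‖ * Real.exp ((l0 + l1) * Real.exp C * (x - s)) := by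
  intro x hx
  have := norm_le_gronwallBound_of_norm_deriv_right_le (δ := ‖u s‖)
    (K := (l0 + l1) * Real.exp C) (ε := 0) hu.cont hu.deriv le_rfl
    (fun y hy => by
      rw [add_zero]
      exact norm_gaugeField_le h0.le h1.le (hC y (Ico_subset_Icc_self hy)) _) x hx
  rwa [gronwallBound_ε0] at this

/-- Stability of the gauge transformed equation with respect to the driving path. -/
lemma dist_le (h0 : 0 < l0) (h1 : 0 < l1) {C ε : ℝ} (hC : ∀ x ∈ Icc s t, |μ x| ≤ C)
    (hC' : ∀ x ∈ Icc s t, |ν x| ≤ C) (hε : ∀ x ∈ Icc s t, |μ x - ν x| ≤ ε) (hst : s ≤ t)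
    (hu : IsGaugeSol l0 l1 μ s t u) (hv : IsGaugeSol l0 l1 ν s t v) :
    dist (u t) (v t) ≤ (dist (u s) (v s) + ε * ‖v s‖ *
      Real.exp ((l0 + l1) * Real.exp C * (t - s))) *
        Real.exp ((l0 + l1) * Real.exp C * (t - s)) := by
  set K := (l0 + l1) * Real.exp C with hK
  have hK0 : 0 < K := by positivity
  have hε0 : 0 ≤ ε := (abs_nonneg _).trans (hε s (left_mem_Icc.2 hst))
  set E := Real.exp (K * (t - s)) with hE
  have hbound : ∀ x ∈ Icc s t, ‖v x‖ ≤ ‖v s‖ * E := fun x hx =>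
    (norm_le h0 h1 hC' hv x hx).trans (by
      refine mul_le_mul_of_nonneg_left (Real.exp_le_exp.2 ?_) (norm_nonneg _)
      exact mul_le_mul_of_nonneg_left (by linarith [hx.2]) hK0.le)
  have key : ∀ x ∈ Icc s t, ‖u x - v x‖ ≤
      gronwallBound (dist (u s) (v s)) K (K * ε * (‖v s‖ * E)) (x - s) := by
    refine norm_le_gronwallBound_of_norm_deriv_right_le (hu.cont.sub hv.cont)
      (fun x hx => (hu.deriv x hx).sub (hv.deriv x hx)) (dist_eq_norm _ _).ge ?_
    intro x hx
    have hx' := Ico_subset_Icc_self hx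
    -- By linearity the difference of the fields is the `μ`-field at `u - v` plus the change of the
    -- field at `v` when `μ` is replaced by `ν`. Gronwall absorbs the first term; the second is a
    -- forcing of order `ε`.
    calc ‖gaugeField l0 l1 (μ x) (u x) - gaugeField l0 l1 (ν x) (v x)‖
        = ‖gaugeField l0 l1 (μ x) (u x - v x) +
            (gaugeField l0 l1 (μ x) (v x) - gaugeField l0 l1 (ν x) (v x))‖ := by
          rw [← gaugeField_sub]; congr 1; abel
      _ ≤ K * ‖u x - v x‖ + K * |μ x - ν x| * ‖v x‖ := by
          refine (norm_add_le _ _).trans (add_le_add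
            (norm_gaugeField_le h0.le h1.le (hC x hx') _) ?_)
          rw [← dist_eq_norm]
          exact dist_gaugeField_le h0.le h1.le (hC x hx') (hC' x hx') _
      _ ≤ K * ‖u x - v x‖ + K * ε * (‖v s‖ * E) := by
          gcongr
          · exact hε x hx'
          · exact hbound x hx'
  have := key t (right_mem_Icc.2 hst)
  rw [gronwallBound_of_K_ne_0 hK0.ne', ← dist_eq_norm] at this
  refine this.trans ?_
  beta_reduce
  rw [← hE]
  have hc : K * ε * (‖v s‖ * E) / K = ε * ‖v s‖ * E := by field_simp
  rw [hc]
  -- Gronwall gives `d * E + c * (E - 1)` with `c` this quantity; the term `-c` is discarded.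
  have : 0 ≤ ε * ‖v s‖ * E := by positivity
  nlinarith

/-- Uniqueness is stability with equal driving paths and equal initial values. -/
lemma eqOn (h0 : 0 < l0) (h1 : 0 < l1) (hμ : ContinuousOn μ (Icc s t))
    (hu : IsGaugeSol l0 l1 μ s t u) (hv : IsGaugeSol l0 l1 μ s t v) (h : u s = v s) :
    ∀ x ∈ Icc s t, u x = v x := by
  intro x hx
  obtain ⟨C, hC⟩ := isCompact_Icc.exists_bound_of_continuousOn hμ
  have hC' : ∀ y ∈ Icc s x, |μ y| ≤ C := fun y hy => hC y ⟨hy.1, hy.2.trans hx.2⟩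
  have := dist_le (ε := 0) h0 h1 hC' hC' (by simp) hx.1 (hu.mono le_rfl hx.2) (hv.mono le_rfl hx.2)
  rw [h] at this
  simpa using this

/-- Robustness: only the values of the driving path enter the equation, never its increments, so
uniform convergence of the paths suffices. It is used both for the grid approximations of the
observation and for the continuity of the smoother in the observed path. -/
lemma tendsto (h0 : 0 < l0) (h1 : 0 < l1) {ι : Type*} {l : Filter ι} {μn : ι → ℝ → ℝ}
    {un : ι → ℝ → ℝ × ℝ} (hst : s ≤ t) (hμ : ContinuousOn μ (Icc s t))
    (hunif : TendstoUniformlyOn μn μ l (Icc s t))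
    (hu : IsGaugeSol l0 l1 μ s t u) (hun : ∀ n, IsGaugeSol l0 l1 (μn n) s t (un n))
    (hini : Tendsto (fun n => un n s) l (𝓝 (u s))) :
    Tendsto (fun n => un n t) l (𝓝 (u t)) := by
  obtain ⟨C, hC⟩ := isCompact_Icc.exists_bound_of_continuousOn hμ
  have hCabs : ∀ x ∈ Icc s t, |μ x| ≤ C + 1 := fun x hx => (hC x hx).trans (by linarith)
  set E := Real.exp ((l0 + l1) * Real.exp (C + 1) * (t - s)) with hE
  rw [Metric.tendsto_nhds]
  intro ε hε
  have hu0 : 0 ≤ ‖u s‖ := norm_nonneg _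
  have hE0 : 0 < E := Real.exp_pos _
  -- The constraint `η ≤ 1` keeps the approximating paths below `C + 1`, so that the single Gronwall
  -- factor `E` serves for all of them.
  obtain ⟨η, hη, hη1, hηε⟩ : ∃ η > 0, η ≤ 1 ∧ (η + η * ‖u s‖ * E) * E < ε := by
    have hc : ContinuousAt (fun η : ℝ => (η + η * ‖u s‖ * E) * E) 0 := by fun_prop
    have : ∀ᶠ η in 𝓝[>] (0 : ℝ), (η + η * ‖u s‖ * E) * E < ε := by
      refine (hc.tendsto.mono_left nhdsWithin_le_nhds).eventually_lt_const ?_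
      simpa using hε
    have h1' : ∀ᶠ η in 𝓝[>] (0 : ℝ), η ≤ 1 :=
      (eventually_le_nhds one_pos).filter_mono nhdsWithin_le_nhds
    obtain ⟨η, ⟨h, h'⟩, hp⟩ := ((this.and h1').and self_mem_nhdsWithin).exists
    exact ⟨η, hp, h', h⟩
  rw [Metric.tendstoUniformlyOn_iff] at hunif
  filter_upwards [hunif η hη, Metric.tendsto_nhds.1 hini η hη] with n hn hn'
  have hd : ∀ x ∈ Icc s t, |μn n x - μ x| ≤ η := fun x hx => by
    have := (hn x hx).le
    rwa [dist_comm, Real.dist_eq] at this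
  have hCn : ∀ x ∈ Icc s t, |μn n x| ≤ C + 1 := fun x hx => by
    have e1 : |μ x| ≤ C := hC x hx
    have e2 := abs_sub_abs_le_abs_sub (μn n x) (μ x)
    have e3 := hd x hx
    linarith
  refine (dist_le h0 h1 hCn hCabs hd hst (hun n) hu).trans_lt (lt_of_le_of_lt ?_ hηε)
  rw [← hE]
  gcongr

end IsGaugeSol

end Gauge

/-! ### Global existence and positivity for the gauged equation -/

section Gauge

variable {l0 l1 : ℝ}

/-- Clipping makes the linear field bounded without increasing its Lipschitz constant, so that
Picard–Lindelöf covers a prescribed interval in one application. -/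
lemma lipschitzWith_clip (M : ℝ) : LipschitzWith 1 (fun u : ℝ × ℝ =>
    (max (-M) (min M u.1), max (-M) (min M u.2))) := by
  have h : LipschitzWith 1 (fun x : ℝ => max (-M) (min M x)) :=
    (LipschitzWith.id.const_min M).const_max (-M)
  have h1 := h.comp (LipschitzWith.prod_fst (α := ℝ) (β := ℝ))
  have h2 := h.comp (LipschitzWith.prod_snd (α := ℝ) (β := ℝ))
  simpa using h1.prodMk h2

lemma abs_clip_le {M : ℝ} (hM : 0 ≤ M) (x : ℝ) : |max (-M) (min M x)| ≤ M :=
  abs_le.2 ⟨le_max_left _ _, max_le (by linarith) (min_le_left _ _)⟩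

lemma abs_clip_le_abs {M : ℝ} (hM : 0 ≤ M) (x : ℝ) : |max (-M) (min M x)| ≤ |x| := by
  rcases le_total 0 x with h | h
  · rw [max_eq_right ((neg_nonpos.2 hM).trans (le_min hM h)), abs_of_nonneg (le_min hM h),
      abs_of_nonneg h]
    exact min_le_right _ _
  · rw [min_eq_right (h.trans hM), abs_of_nonpos (max_le (by linarith) h), abs_of_nonpos h]
    exact neg_le_neg (le_max_right _ _)

lemma clip_eq_self {M x : ℝ} (h : |x| ≤ M) : max (-M) (min M x) = x := by
  rw [min_eq_right (abs_le.1 h).2, max_eq_right (abs_le.1 h).1]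

lemma continuous_gaugeField_left (u : ℝ × ℝ) : Continuous fun m => gaugeField l0 l1 m u := by
  unfold gaugeField; fun_prop

/-- Global existence for the gauge transformed Zakai equation. -/
lemma exists_isGaugeSol (h0 : 0 < l0) (h1 : 0 < l1) {μ : ℝ → ℝ} {s t : ℝ} (hst : s ≤ t)
    (hμ : ContinuousOn μ (Icc s t)) (u0 : ℝ × ℝ) :
    ∃ u, u s = u0 ∧ IsGaugeSol l0 l1 μ s t u ∧
      ∀ x ∈ Icc s t, HasDerivWithinAt u (gaugeField l0 l1 (μ x) (u x)) (Icc s t) x := by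
  obtain ⟨C, hC⟩ := isCompact_Icc.exists_bound_of_continuousOn hμ
  have hC' : ∀ x ∈ Icc s t, |μ x| ≤ C := hC
  set K := (l0 + l1) * Real.exp C with hK
  have hK0 : 0 < K := by positivity
  -- `M` is the a priori Gronwall bound. The clipped field obeys the same linear growth bound, so
  -- its solution stays in the ball of radius `M`, where clipping does nothing.
  set M := ‖u0‖ * Real.exp (K * (t - s)) with hMdef
  have hM : 0 ≤ M := by positivity
  set cl : ℝ × ℝ → ℝ × ℝ := fun u => (max (-M) (min M u.1), max (-M) (min M u.2)) with hcl
  have hcln : ∀ u, ‖cl u‖ ≤ M := fun u => by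
    rw [Prod.norm_def]; exact max_le (abs_clip_le hM _) (abs_clip_le hM _)
  have hcln' : ∀ u, ‖cl u‖ ≤ ‖u‖ := fun u => by
    rw [Prod.norm_def]
    exact max_le ((abs_clip_le_abs hM _).trans (norm_fst_le u))
      ((abs_clip_le_abs hM _).trans (norm_snd_le u))
  have hpl : IsPicardLindelof (fun x u => gaugeField l0 l1 (μ x) (cl u)) (tmin := s) (tmax := t)
      ⟨s, left_mem_Icc.2 hst⟩ u0 (K * M * (t - s)).toNNReal 0 (K * M).toNNReal K.toNNReal := by
    have hts : 0 ≤ t - s := sub_nonneg.2 hst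
    refine ⟨fun x hx => LipschitzOnWith.of_dist_le_mul fun u _ v _ => ?_, fun u _ => ?_,
      fun x hx u _ => ?_, ?_⟩
    · rw [dist_eq_norm, gaugeField_sub, Real.coe_toNNReal _ hK0.le]
      refine (norm_gaugeField_le h0.le h1.le (hC' x hx) _).trans ?_
      rw [← dist_eq_norm]
      have := (lipschitzWith_clip M).dist_le_mul u v
      rw [NNReal.coe_one, one_mul] at this
      gcongr
    · exact (continuous_gaugeField_left _).comp_continuousOn hμ
    · rw [Real.coe_toNNReal _ (by positivity)]
      refine (norm_gaugeField_le h0.le h1.le (hC' x hx) _).trans ?_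
      gcongr
      exact hcln u
    · rw [Real.coe_toNNReal _ (by positivity), Real.coe_toNNReal _ (by positivity)]
      simp [hts]
  obtain ⟨u, hu0, hu⟩ := hpl.exists_eq_forall_mem_Icc_hasDerivWithinAt₀
  have hu0 : u s = u0 := hu0
  have hcont : ContinuousOn u (Icc s t) := fun x hx => (hu x hx).continuousWithinAt
  have hright : ∀ x ∈ Ico s t, Icc s t ∈ 𝓝[Ici x] x := fun x hx =>
    mem_of_superset (Icc_mem_nhdsGE hx.2) (Icc_subset_Icc_left hx.1)
  have hbound : ∀ x ∈ Icc s t, ‖u x‖ ≤ M := by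
    intro x hx
    have := norm_le_gronwallBound_of_norm_deriv_right_le (δ := ‖u0‖) (K := K) (ε := 0) hcont
      (fun y hy => (hu y (Ico_subset_Icc_self hy)).mono_of_mem_nhdsWithin (hright y hy))
      (by rw [hu0]) (fun y hy => by
        rw [add_zero]
        refine (norm_gaugeField_le h0.le h1.le (hC' y (Ico_subset_Icc_self hy)) _).trans ?_
        gcongr
        exact hcln' _) x hx
    rw [gronwallBound_ε0] at this
    refine this.trans (mul_le_mul_of_nonneg_left (Real.exp_le_exp.2 ?_) (norm_nonneg _))
    exact mul_le_mul_of_nonneg_left (by linarith [hx.2]) hK0.le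
  have hclu : ∀ x ∈ Icc s t, cl (u x) = u x := fun x hx =>
    Prod.ext (clip_eq_self ((norm_fst_le _).trans (hbound x hx)))
      (clip_eq_self ((norm_snd_le _).trans (hbound x hx)))
  have hd : ∀ x ∈ Icc s t, HasDerivWithinAt u (gaugeField l0 l1 (μ x) (u x)) (Icc s t) x := by
    intro x hx
    have := hu x hx
    rwa [hclu x hx] at this
  exact ⟨u, hu0, ⟨hcont, fun x hx =>
    (hd x (Ico_subset_Icc_self hx)).mono_of_mem_nhdsWithin (hright x hx)⟩, hd⟩

namespace IsGaugeSol

variable {μ : ℝ → ℝ} {s t : ℝ} {u v : ℝ → ℝ × ℝ}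

/-- The definition only provides right derivatives. By uniqueness the solution coincides with the
one constructed above, which is differentiable within the whole interval. -/
lemma hasDerivWithinAt (h0 : 0 < l0) (h1 : 0 < l1) (hμ : ContinuousOn μ (Icc s t))
    (hu : IsGaugeSol l0 l1 μ s t u) {x : ℝ} (hx : x ∈ Icc s t) :
    HasDerivWithinAt u (gaugeField l0 l1 (μ x) (u x)) (Icc s t) x := by
  obtain ⟨v, hv0, hv, hvd⟩ := exists_isGaugeSol h0 h1 (hx.1.trans hx.2) hμ (u s)
  have heq := hu.eqOn h0 h1 hμ hv hv0.symm
  rw [heq x hx]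
  exact (hvd x hx).congr heq (heq x hx)

lemma hasDerivAt (h0 : 0 < l0) (h1 : 0 < l1) (hμ : ContinuousOn μ (Icc s t))
    (hu : IsGaugeSol l0 l1 μ s t u) {x : ℝ} (hx : x ∈ Ioo s t) :
    HasDerivAt u (gaugeField l0 l1 (μ x) (u x)) x :=
  (hu.hasDerivWithinAt h0 h1 hμ (Ioo_subset_Icc_self hx)).hasDerivAt (Icc_mem_nhds hx.1 hx.2)

/-- With the integrating factors, both coordinates have derivatives that are nonnegative multiples
of the other one. -/
lemma hasDerivAt_exp_mul (h0 : 0 < l0) (h1 : 0 < l1) (hμ : ContinuousOn μ (Icc s t))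
    (hu : IsGaugeSol l0 l1 μ s t u) {x : ℝ} (hx : x ∈ Ioo s t) :
    HasDerivAt (fun y => Real.exp (l0 * y) * (u y).1)
        (Real.exp (l0 * x) * (l1 * Real.exp (μ x) * (u x).2)) x ∧
      HasDerivAt (fun y => Real.exp (l1 * y) * (u y).2)
        (Real.exp (l1 * x) * (l0 * Real.exp (-μ x) * (u x).1)) x := by
  have hd := hu.hasDerivAt h0 h1 hμ hx
  have e : ∀ l : ℝ, HasDerivAt (fun y => Real.exp (l * y)) (Real.exp (l * x) * l) x := fun l => by
    simpa using ((hasDerivAt_id x).const_mul l).exp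
  have d1 : HasDerivAt (fun y => (u y).1) (gaugeField l0 l1 (μ x) (u x)).1 x :=
    hd.fst
  have d2 : HasDerivAt (fun y => (u y).2) (gaugeField l0 l1 (μ x) (u x)).2 x :=
    hd.snd
  refine ⟨((e l0).mul d1).congr_deriv ?_, ((e l1).mul d2).congr_deriv ?_⟩ <;>
  · simp only [gaugeField]; ring

lemma continuousOn_exp_mul (hu : IsGaugeSol l0 l1 μ s t u) :
    ContinuousOn (fun y => Real.exp (l0 * y) * (u y).1) (Icc s t) ∧
    ContinuousOn (fun y => Real.exp (l1 * y) * (u y).2) (Icc s t) := by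
  have := hu.cont
  constructor <;> fun_prop

lemma monotoneOn_exp_mul (h0 : 0 < l0) (h1 : 0 < l1) (hμ : ContinuousOn μ (Icc s t))
    (hu : IsGaugeSol l0 l1 μ s t u) (hn : ∀ x ∈ Ico s t, 0 ≤ (u x).1 ∧ 0 ≤ (u x).2) :
    MonotoneOn (fun y => Real.exp (l0 * y) * (u y).1) (Icc s t) ∧
    MonotoneOn (fun y => Real.exp (l1 * y) * (u y).2) (Icc s t) := by
  have hc := hu.continuousOn_exp_mul
  constructor
  · refine monotoneOn_of_hasDerivWithinAt_nonneg (convex_Icc _ _) hc.1 (fun x hx =>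
      (hu.hasDerivAt_exp_mul h0 h1 hμ (by simpa using hx)).1.hasDerivWithinAt) fun x hx => ?_
    rw [interior_Icc] at hx
    have := (hn x (Ioo_subset_Ico_self hx)).2
    positivity
  · refine monotoneOn_of_hasDerivWithinAt_nonneg (convex_Icc _ _) hc.2 (fun x hx =>
      (hu.hasDerivAt_exp_mul h0 h1 hμ (by simpa using hx)).2.hasDerivWithinAt) fun x hx => ?_
    rw [interior_Icc] at hx
    have := (hn x (Ioo_subset_Ico_self hx)).1
    positivity

/-- Before the first time at which a coordinate reaches `0`, both are nonnegative, so with their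
integrating factors both are nondecreasing. They are then still positive at that time, a
contradiction. -/
lemma pos_of_pos (h0 : 0 < l0) (h1 : 0 < l1) (hμ : ContinuousOn μ (Icc s t))
    (hu : IsGaugeSol l0 l1 μ s t u) (ha : 0 < (u s).1) (hb : 0 < (u s).2) :
    ∀ x ∈ Icc s t, 0 < (u x).1 ∧ 0 < (u x).2 := by
  by_contra! hcon
  obtain ⟨x, hx, hx'⟩ := hcon
  set Z := {y ∈ Icc s t | min (u y).1 (u y).2 ≤ 0} with hZ
  have hfc : ContinuousOn (fun y => min (u y).1 (u y).2) (Icc s t) := by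
    have := hu.cont
    fun_prop
  have hZc : IsCompact Z := by
    refine isCompact_Icc.of_isClosed_subset ?_ (sep_subset _ _)
    exact hfc.preimage_isClosed_of_isClosed isClosed_Icc isClosed_Iic
  have hZn : Z.Nonempty := ⟨x, hx, by
    by_cases h : 0 < (u x).1
    · exact (min_le_right _ _).trans (hx' h)
    · exact (min_le_left _ _).trans (not_lt.1 h)⟩
  obtain ⟨T, ⟨hT, hT0⟩, hTmin⟩ := hZc.exists_isLeast hZn
  have hn : ∀ y ∈ Ico s T, 0 ≤ (u y).1 ∧ 0 ≤ (u y).2 := by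
    intro y hy
    by_contra hne
    have : min (u y).1 (u y).2 ≤ 0 := by
      by_contra hpos
      push Not at hpos
      exact hne ⟨(lt_min_iff.1 hpos).1.le, (lt_min_iff.1 hpos).2.le⟩
    exact absurd (hTmin ⟨⟨hy.1, hy.2.le.trans hT.2⟩, this⟩) (not_le.2 hy.2)
  obtain ⟨m1, m2⟩ := (hu.mono le_rfl hT.2).monotoneOn_exp_mul h0 h1
    (hμ.mono (Icc_subset_Icc_right hT.2)) hn
  have a1 := m1 (left_mem_Icc.2 hT.1) (right_mem_Icc.2 hT.1) hT.1
  have a2 := m2 (left_mem_Icc.2 hT.1) (right_mem_Icc.2 hT.1) hT.1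
  have b1 : 0 < Real.exp (l0 * T) * (u T).1 := lt_of_lt_of_le (by positivity) a1
  have b2 : 0 < Real.exp (l1 * T) * (u T).2 := lt_of_lt_of_le (by positivity) a2
  have c1 := (mul_pos_iff_of_pos_left (Real.exp_pos _)).1 b1
  have c2 := (mul_pos_iff_of_pos_left (Real.exp_pos _)).1 b2
  exact absurd hT0 (not_le.2 (lt_min c1 c2))

/-- Add `ε` times a strictly positive solution, apply `pos_of_pos`, and let `ε → 0`. -/
lemma nonneg_of_nonneg (h0 : 0 < l0) (h1 : 0 < l1) (hμ : ContinuousOn μ (Icc s t))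
    (hu : IsGaugeSol l0 l1 μ s t u) (ha : 0 ≤ (u s).1) (hb : 0 ≤ (u s).2) :
    ∀ x ∈ Icc s t, 0 ≤ (u x).1 ∧ 0 ≤ (u x).2 := by
  intro x hx
  obtain ⟨v, hv0, hv, -⟩ := exists_isGaugeSol h0 h1 (hx.1.trans hx.2) hμ (1, 1)
  have key : ∀ ε : ℝ, 0 < ε → 0 < (u x + ε • v x).1 ∧ 0 < (u x + ε • v x).2 := fun ε hε =>
    (hu.add (hv.smul ε)).pos_of_pos h0 h1 hμ (by simp [hv0]; positivity)
      (by simp [hv0]; positivity) x hx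
  have lim : ∀ a b : ℝ, (∀ ε : ℝ, 0 < ε → 0 < a + ε * b) → 0 ≤ a := by
    intro a b h
    have hc : Tendsto (fun ε : ℝ => a + ε * b) (𝓝[>] 0) (𝓝 a) := by
      have : ContinuousAt (fun ε : ℝ => a + ε * b) 0 := by fun_prop
      simpa using this.tendsto.mono_left nhdsWithin_le_nhds
    exact ge_of_tendsto hc (by filter_upwards [self_mem_nhdsWithin] with ε hε using (h ε hε).le)
  exact ⟨lim _ (v x).1 fun ε hε => by simpa using (key ε hε).1,
    lim _ (v x).2 fun ε hε => by simpa using (key ε hε).2⟩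

lemma fst_pos (h0 : 0 < l0) (h1 : 0 < l1) (hμ : ContinuousOn μ (Icc s t))
    (hu : IsGaugeSol l0 l1 μ s t u) (ha : 0 < (u s).1) (hb : 0 ≤ (u s).2) :
    ∀ x ∈ Icc s t, 0 < (u x).1 := by
  intro x hx
  have hn := hu.nonneg_of_nonneg h0 h1 hμ ha.le hb
  have := (hu.monotoneOn_exp_mul h0 h1 hμ fun y hy => hn y (Ico_subset_Icc_self hy)).1
    (left_mem_Icc.2 (hx.1.trans hx.2)) hx hx.1
  exact (mul_pos_iff_of_pos_left (Real.exp_pos _)).1 (lt_of_lt_of_le (by positivity) this)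

lemma snd_pos (h0 : 0 < l0) (h1 : 0 < l1) (hμ : ContinuousOn μ (Icc s t))
    (hu : IsGaugeSol l0 l1 μ s t u) (ha : 0 ≤ (u s).1) (hb : 0 < (u s).2) :
    ∀ x ∈ Icc s t, 0 < (u x).2 := by
  intro x hx
  have hn := hu.nonneg_of_nonneg h0 h1 hμ ha hb.le
  have := (hu.monotoneOn_exp_mul h0 h1 hμ fun y hy => hn y (Ico_subset_Icc_self hy)).2
    (left_mem_Icc.2 (hx.1.trans hx.2)) hx hx.1
  exact (mul_pos_iff_of_pos_left (Real.exp_pos _)).1 (lt_of_lt_of_le (by positivity) this)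

/-- Instantaneous positivity. -/
lemma pos_of_lt (h0 : 0 < l0) (h1 : 0 < l1) (hμ : ContinuousOn μ (Icc s t))
    (hu : IsGaugeSol l0 l1 μ s t u) (ha : 0 ≤ (u s).1) (hb : 0 ≤ (u s).2)
    (hab : 0 < (u s).1 + (u s).2) :
    ∀ x ∈ Ioc s t, 0 < (u x).1 ∧ 0 < (u x).2 := by
  intro x hx
  have hx' := Ioc_subset_Icc_self hx
  have hc := (hu.mono le_rfl hx.2).continuousOn_exp_mul
  rcases ha.lt_or_eq with ha' | ha'
  · have hp := hu.fst_pos h0 h1 hμ ha' hb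
    refine ⟨hp x hx', ?_⟩
    -- The second coordinate may start at `0`, but it is fed at a positive rate by the first one,
    -- which stays positive.
    have : StrictMonoOn (fun y => Real.exp (l1 * y) * (u y).2) (Icc s x) := by
      refine strictMonoOn_of_hasDerivWithinAt_pos (convex_Icc _ _) hc.2 (fun y hy =>
        (hu.hasDerivAt_exp_mul h0 h1 hμ (?_ : y ∈ Ioo s t)).2.hasDerivWithinAt) fun y hy => ?_
      · rw [interior_Icc] at hy; exact ⟨hy.1, hy.2.trans_le hx.2⟩
      · rw [interior_Icc] at hy
        have := hp y ⟨hy.1.le, hy.2.le.trans hx.2⟩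
        positivity
    have := this (left_mem_Icc.2 hx.1.le) (right_mem_Icc.2 hx.1.le) hx.1
    exact (mul_pos_iff_of_pos_left (Real.exp_pos _)).1 (lt_of_le_of_lt (by positivity) this)
  · have hp := hu.snd_pos h0 h1 hμ ha (by rw [← ha'] at hab; simpa using hab)
    refine ⟨?_, hp x hx'⟩
    have : StrictMonoOn (fun y => Real.exp (l0 * y) * (u y).1) (Icc s x) := by
      refine strictMonoOn_of_hasDerivWithinAt_pos (convex_Icc _ _) hc.1 (fun y hy =>
        (hu.hasDerivAt_exp_mul h0 h1 hμ (?_ : y ∈ Ioo s t)).1.hasDerivWithinAt) fun y hy => ?_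
      · rw [interior_Icc] at hy; exact ⟨hy.1, hy.2.trans_le hx.2⟩
      · rw [interior_Icc] at hy
        have := hp y ⟨hy.1.le, hy.2.le.trans hx.2⟩
        positivity
    have := this (left_mem_Icc.2 hx.1.le) (right_mem_Icc.2 hx.1.le) hx.1
    exact (mul_pos_iff_of_pos_left (Real.exp_pos _)).1 (lt_of_le_of_lt (by positivity) this)

end IsGaugeSol

end Gauge

/-! ### The damping factor -/

lemma expNeg_of_ne_top {D : ℝ≥0∞} (h : D ≠ ∞) : expNeg D = Real.exp (-D.toReal) := by
  rw [expNeg, if_neg h]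

lemma expNeg_nonneg (D : ℝ≥0∞) : 0 ≤ expNeg D := by
  unfold expNeg; split_ifs <;> positivity

lemma expNeg_antitone : Antitone expNeg := by
  intro D E h
  by_cases hE : E = ∞
  · simp [hE, expNeg]
    split_ifs <;> positivity
  · have hD : D ≠ ∞ := ne_top_of_le_ne_top hE h
    rw [expNeg_of_ne_top hE, expNeg_of_ne_top hD]
    exact Real.exp_le_exp.2 (neg_le_neg (ENNReal.toReal_mono hE h))

lemma expNeg_le_one (D : ℝ≥0∞) : expNeg D ≤ 1 := by
  simpa [expNeg] using expNeg_antitone (zero_le (a := D))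

/-- Continuity at `∞` matters: for `q = 0` or `q = 1` the damping integral diverges at time `0`, and
estimates proved for windows starting at positive times are passed to the limit. -/
lemma continuous_expNeg : Continuous expNeg := by
  rw [continuous_iff_continuousAt]
  intro D
  by_cases hD : D = ∞
  · subst hD
    have h0 : expNeg ∞ = 0 := by simp [expNeg]
    rw [ContinuousAt, h0, Metric.tendsto_nhds]
    intro ε hε
    obtain ⟨N, hN⟩ : ∃ N : ℝ≥0, Real.exp (-(N : ℝ)) < ε := by
      have : Tendsto (fun N : ℕ => Real.exp (-(N : ℝ))) atTop (𝓝 0) :=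
        Real.tendsto_exp_neg_atTop_nhds_zero.comp tendsto_natCast_atTop_atTop
      obtain ⟨n, hn⟩ := (this.eventually_lt_const hε).exists
      exact ⟨n, by simpa using hn⟩
    filter_upwards [lt_mem_nhds (ENNReal.coe_lt_top (r := N))] with E hE
    rw [Real.dist_eq, sub_zero, abs_of_nonneg (expNeg_nonneg _)]
    have := expNeg_antitone hE.le
    rw [expNeg_of_ne_top ENNReal.coe_ne_top] at this
    exact this.trans_lt hN
  · have : expNeg =ᶠ[𝓝 D] fun E => Real.exp (-E.toReal) := by
      filter_upwards [IsOpen.mem_nhds ENNReal.isOpen_ne_top hD] with E hE using expNeg_of_ne_top hE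
    refine ContinuousAt.congr ?_ this.symm
    exact Real.continuous_exp.continuousAt.comp (ENNReal.continuousAt_toReal hD).neg

lemma damping_mono {lam p : ℝ} {f : ℝ → ℝ} {s s' t : ℝ} (h : s ≤ s') :
    damping lam p f s' t ≤ damping lam p f s t :=
  lintegral_mono_set (Icc_subset_Icc_left h)

lemma tendsto_damping {lam p : ℝ} {f : ℝ → ℝ} {t : ℝ} (ht : 0 < t) :
    Tendsto (fun n : ℕ => damping lam p f (t / (n + 1)) t) atTop (𝓝 (damping lam p f 0 t)) := by
  have hmono : Monotone fun n : ℕ => Icc (t / ((n : ℝ) + 1)) t := fun m n hmn =>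
    Icc_subset_Icc_left (by gcongr)
  have hU : ⋃ n : ℕ, Icc (t / ((n : ℝ) + 1)) t = Ioc 0 t := by
    ext x
    simp only [mem_iUnion, mem_Icc, mem_Ioc]
    constructor
    · rintro ⟨n, h1, h2⟩
      exact ⟨lt_of_lt_of_le (by positivity) h1, h2⟩
    · rintro ⟨h1, h2⟩
      obtain ⟨n, hn⟩ := exists_nat_gt (t / x)
      refine ⟨n, ?_, h2⟩
      rw [div_lt_iff₀ h1] at hn
      rw [div_le_iff₀ (by positivity)]
      nlinarith
  have heq : damping lam p f 0 t = ⨆ n : ℕ, damping lam p f (t / (n + 1)) t := by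
    unfold damping
    rw [← setLIntegral_iUnion_of_directed _ hmono.directed_le, hU]
    exact setLIntegral_congr Ioc_ae_eq_Icc.symm
  rw [heq]
  exact tendsto_atTop_iSup fun m n hmn => damping_mono (by gcongr)

/-! ### Pathwise filter and smoother -/

section Smoother

variable {lam p q T : ℝ} {μ : ℝ → ℝ}

/-- The filter and the smoother attached to a log-gauge path `μ` on `[0,T]`, characterised through
the gauge transformed Zakai equation, with their regularity and the damping estimates. -/
structure IsPathSmoother (lam p q T : ℝ) (μ : ℝ → ℝ) (G : ℝ → ℝ → ℝ) : Prop where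
  eq_ratio : ∀ s t : ℝ, 0 ≤ s → s ≤ t → t ≤ T → ∀ u z : ℝ → ℝ × ℝ,
    IsGaugeSol (lam * p) (lam * (1 - p)) μ 0 t u → u 0 = (1 - q, q) →
    IsGaugeSol (lam * p) (lam * (1 - p)) μ s t z → z s = (0, (u s).2) →
    G s t = ((z t).1 + Real.exp (μ t) * (z t).2) / ((u t).1 + Real.exp (μ t) * (u t).2)
  continuousOn : ContinuousOn (Function.uncurry G) {z : ℝ × ℝ | 0 ≤ z.1 ∧ z.1 ≤ z.2 ∧ z.2 ≤ T}
  mem_Icc : ∀ s t, 0 ≤ s → s ≤ t → t ≤ T → G s t ∈ Icc (0 : ℝ) 1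
  initial : μ 0 = 0 → G 0 0 = q
  pos : ∀ t, 0 < t → t ≤ T → G t t ∈ Ioo (0 : ℝ) 1
  hasDerivAt : ∀ s t, 0 < s → s < t → t ≤ T → HasDerivAt (fun x => G x t)
    (lam * p * ((1 - G s s) / G s s) * G s t - lam * (1 - p) * (G s s / (1 - G s s)) * (1 - G s t)) s

/-- Forward–backward duality. With the fundamental solutions `φ` and `ψ`, the masses at time `t`
issued from unit vectors at time `s` follow from Cramer's rule, since the determinant of the
fundamental matrix is explicit. The smoother is the forward mass in state `1` at time `s` times the
backward weight, divided by the total mass. This formula depends on `s` only through solutions at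
time `s`, so it can be differentiated in `s`. -/
lemma IsPathSmoother.exists (hlam : 0 < lam) (hp : p ∈ Ioo (0 : ℝ) 1) (hq : q ∈ Icc (0 : ℝ) 1)
    (hT : 0 ≤ T) (hμ : ContinuousOn μ (Icc 0 T)) : ∃ G, IsPathSmoother lam p q T μ G := by
  set l0 := lam * p with hl0
  set l1 := lam * (1 - p) with hl1
  have h0 : 0 < l0 := mul_pos hlam hp.1
  have h1 : 0 < l1 := mul_pos hlam (by linarith [hp.2])
  have hll : lam = l0 + l1 := by rw [hl0, hl1]; ring
  obtain ⟨φ, hφ0, hφ, -⟩ := exists_isGaugeSol h0 h1 hT hμ (1, 0)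
  obtain ⟨ψ, hψ0, hψ, -⟩ := exists_isGaugeSol h0 h1 hT hμ (0, 1)
  set w : ℝ → ℝ × ℝ := fun x => (1 - q) • φ x + q • ψ x with hw
  have hws : IsGaugeSol l0 l1 μ 0 T w := (hφ.smul _).add (hψ.smul _)
  have hw0 : w 0 = (1 - q, q) := by simp [hw, hφ0, hψ0]
  have hq0 : 0 ≤ (w 0).1 := by rw [hw0]; simpa using hq.2
  have hq1 : 0 ≤ (w 0).2 := by rw [hw0]; exact hq.1
  have hqs : 0 < (w 0).1 + (w 0).2 := by rw [hw0]; simp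
  have hwn := hws.nonneg_of_nonneg h0 h1 hμ hq0 hq1
  have hwp := hws.pos_of_lt h0 h1 hμ hq0 hq1 hqs
  -- the total mass
  set ρ : ℝ → ℝ := fun t => (w t).1 + Real.exp (μ t) * (w t).2 with hρ
  have hρpos : ∀ t ∈ Icc 0 T, 0 < ρ t := by
    intro t ht
    rcases ht.1.eq_or_lt with h | h
    · rw [← h]
      simp only [hρ]
      rcases hq0.lt_or_eq with h' | h'
      · positivity
      · have : 0 < (w 0).2 := by linarith
        positivity
    · have := hwp t ⟨h, ht.2⟩
      have h1 := this.1
      have h2 := this.2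
      positivity
  set ea : ℝ → ℝ := fun t => (φ t).1 + Real.exp (μ t) * (φ t).2 with hea
  set eb : ℝ → ℝ := fun t => (ψ t).1 + Real.exp (μ t) * (ψ t).2 with heb
  have hρe : ∀ t, ρ t = (1 - q) * ea t + q * eb t := fun t => by
    simp only [hρ, hea, heb, hw, Prod.fst_add, Prod.snd_add, Prod.smul_fst, Prod.smul_snd,
      smul_eq_mul]
    ring
  -- Wronskian
  set Wr : ℝ → ℝ := fun s => Real.exp (lam * s) * ((φ s).1 * (ψ s).2 - (ψ s).1 * (φ s).2) with hWr
  have dexp : ∀ x : ℝ, HasDerivAt (fun y => Real.exp (lam * y)) (Real.exp (lam * x) * lam) x :=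
    fun x => by simpa using ((hasDerivAt_id x).const_mul lam).exp
  have hφc := hφ.cont
  have hψc := hψ.cont
  have hwc := hws.cont
  have dφ : ∀ x ∈ Ioo 0 T, HasDerivAt (fun y => (φ y).1) (gaugeField l0 l1 (μ x) (φ x)).1 x ∧
      HasDerivAt (fun y => (φ y).2) (gaugeField l0 l1 (μ x) (φ x)).2 x := fun x hx =>
    ⟨(hφ.hasDerivAt h0 h1 hμ hx).fst, (hφ.hasDerivAt h0 h1 hμ hx).snd⟩
  have dψ : ∀ x ∈ Ioo 0 T, HasDerivAt (fun y => (ψ y).1) (gaugeField l0 l1 (μ x) (ψ x)).1 x ∧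
      HasDerivAt (fun y => (ψ y).2) (gaugeField l0 l1 (μ x) (ψ x)).2 x := fun x hx =>
    ⟨(hψ.hasDerivAt h0 h1 hμ hx).fst, (hψ.hasDerivAt h0 h1 hμ hx).snd⟩
  have dw : ∀ x ∈ Ioo 0 T, HasDerivAt (fun y => (w y).1) (gaugeField l0 l1 (μ x) (w x)).1 x ∧
      HasDerivAt (fun y => (w y).2) (gaugeField l0 l1 (μ x) (w x)).2 x := fun x hx =>
    ⟨(hws.hasDerivAt h0 h1 hμ hx).fst, (hws.hasDerivAt h0 h1 hμ hx).snd⟩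
  -- Liouville's formula: the field has trace `-(l0 + l1) = -lam` whatever `μ` is, and the factor
  -- `exp (lam * s)` compensates it.
  have hWr1 : ∀ s ∈ Icc 0 T, Wr s = 1 := by
    have hc : ContinuousOn Wr (Icc 0 T) := by
      simp only [hWr]; fun_prop
    have hd : ∀ x ∈ Ioo 0 T, HasDerivAt Wr 0 x := by
      intro x hx
      refine ((dexp x).mul (((dφ x hx).1.mul (dψ x hx).2).sub
        ((dψ x hx).1.mul (dφ x hx).2))).congr_deriv ?_
      simp only [gaugeField, hll, Pi.sub_apply, Pi.mul_apply]
      ring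
    intro s hs
    have h00 : Wr 0 = 1 := by simp [hWr, hφ0, hψ0]
    rw [← h00]
    rcases hs.1.eq_or_lt with h | h
    · rw [← h]
    · have m1 := monotoneOn_of_hasDerivWithinAt_nonneg (convex_Icc 0 T) hc
        (fun x hx => (hd x (by simpa using hx)).hasDerivWithinAt) (fun _ _ => le_rfl)
      have m2 := antitoneOn_of_hasDerivWithinAt_nonpos (convex_Icc 0 T) hc
        (fun x hx => (hd x (by simpa using hx)).hasDerivWithinAt) (fun _ _ => le_rfl)
      exact le_antisymm (m2 (left_mem_Icc.2 hT) hs hs.1) (m1 (left_mem_Icc.2 hT) hs hs.1)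
  -- the backward equation
  set zb : ℝ → ℝ → ℝ := fun s t => Real.exp (lam * s) * ((φ s).1 * eb t - (ψ s).1 * ea t) with hzb
  set vb : ℝ → ℝ → ℝ := fun s t => Real.exp (lam * s) * ((ψ s).2 * ea t - (φ s).2 * eb t) with hvb
  -- The pairing of the forward and backward solutions does not depend on `s`; this gives both `G ≤
  -- 1` and the formula for `1 - G`.
  have hsum : ∀ s ∈ Icc 0 T, ∀ t, (w s).1 * vb s t + (w s).2 * zb s t = ρ t := by
    intro s hs t
    have : (w s).1 * vb s t + (w s).2 * zb s t = Wr s * ((1 - q) * ea t + q * eb t) := by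
      simp only [hzb, hvb, hWr, hw, Prod.fst_add, Prod.snd_add, Prod.smul_fst, Prod.smul_snd,
        smul_eq_mul]
      ring
    rw [this, hWr1 s hs, hρe, one_mul]
  -- propagation of a solution started at time `s`
  have hprop : ∀ s t, 0 ≤ s → s ≤ t → t ≤ T → ∀ z : ℝ → ℝ × ℝ, IsGaugeSol l0 l1 μ s t z →
      (z t).1 + Real.exp (μ t) * (z t).2 = (z s).1 * vb s t + (z s).2 * zb s t := by
    intro s t hs hst htT z hz
    set c1 := Real.exp (lam * s) * ((ψ s).2 * (z s).1 - (ψ s).1 * (z s).2)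
    set c2 := Real.exp (lam * s) * ((φ s).1 * (z s).2 - (φ s).2 * (z s).1)
    have hW := hWr1 s ⟨hs, hst.trans htT⟩
    have hsol : IsGaugeSol l0 l1 μ s t (fun x => c1 • φ x + c2 • ψ x) :=
      ((hφ.smul _).add (hψ.smul _)).mono hs htT
    have hini : z s = c1 • φ s + c2 • ψ s := by
      simp only [hWr] at hW
      ext
      · simp only [Prod.fst_add, Prod.smul_fst, smul_eq_mul, c1, c2]
        linear_combination (-(z s).1) * hW
      · simp only [Prod.snd_add, Prod.smul_snd, smul_eq_mul, c1, c2]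
        linear_combination (-(z s).2) * hW
    have := hz.eqOn h0 h1 (hμ.mono (Icc_subset_Icc hs htT)) hsol hini t (right_mem_Icc.2 hst)
    rw [this]
    simp only [Prod.fst_add, Prod.snd_add, Prod.smul_fst, Prod.smul_snd, smul_eq_mul, c1, c2, hzb,
      hvb, hea, heb]
    ring
  -- `vb s t` and `zb s t` are the total masses at time `t` of the solutions started at time `s`
  -- from `(1, 0)` and `(0, 1)`, so positivity of the forward flow applies.
  have hback : ∀ s t, 0 ≤ s → s ≤ t → t ≤ T → 0 ≤ vb s t ∧ 0 ≤ zb s t := by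
    intro s t hs hst htT
    have hμ' := hμ.mono (Icc_subset_Icc hs htT)
    constructor
    · obtain ⟨z, hz0, hz, -⟩ := exists_isGaugeSol h0 h1 hst hμ' (1, 0)
      have := hprop s t hs hst htT z hz
      rw [hz0] at this
      have hn := hz.nonneg_of_nonneg h0 h1 hμ' (by simp [hz0]) (by simp [hz0]) t
        (right_mem_Icc.2 hst)
      have e1 := hn.1
      have e2 := hn.2
      have : vb s t = (z t).1 + Real.exp (μ t) * (z t).2 := by rw [this]; ring
      rw [this]; positivity
    · obtain ⟨z, hz0, hz, -⟩ := exists_isGaugeSol h0 h1 hst hμ' (0, 1)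
      have := hprop s t hs hst htT z hz
      rw [hz0] at this
      have hn := hz.nonneg_of_nonneg h0 h1 hμ' (by simp [hz0]) (by simp [hz0]) t
        (right_mem_Icc.2 hst)
      have e1 := hn.1
      have e2 := hn.2
      have : zb s t = (z t).1 + Real.exp (μ t) * (z t).2 := by rw [this]; ring
      rw [this]; positivity
  have hdiag : ∀ t ∈ Icc 0 T, vb t t = 1 ∧ zb t t = Real.exp (μ t) := by
    intro t ht
    have hW := hWr1 t ht
    simp only [hWr] at hW
    constructor
    · simp only [hvb, hea, heb]; linear_combination hW
    · simp only [hzb, hea, heb]; linear_combination Real.exp (μ t) * hW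
  refine ⟨fun s t => (w s).2 * zb s t / ρ t, ?_, ?_, ?_, ?_, ?_, ?_⟩
  · intro s t hs hst htT u z hu hu0 hz hz0
    have hμ0 := hμ.mono (Icc_subset_Icc_right htT)
    have huw : ∀ x ∈ Icc 0 t, u x = w x :=
      hu.eqOn h0 h1 hμ0 (hws.mono le_rfl htT) (by rw [hu0, hw0])
    rw [hprop s t hs hst htT z hz, hz0, huw s ⟨hs, hst⟩, huw t ⟨hs.trans hst, le_rfl⟩]
    simp [hρ]
  · have hρc : ContinuousOn ρ (Icc 0 T) := by simp only [hρ]; fun_prop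
    have heac : ContinuousOn ea (Icc 0 T) := by simp only [hea]; fun_prop
    have hebc : ContinuousOn eb (Icc 0 T) := by simp only [heb]; fun_prop
    set D := {z : ℝ × ℝ | 0 ≤ z.1 ∧ z.1 ≤ z.2 ∧ z.2 ≤ T} with hD
    have m1 : MapsTo Prod.fst D (Icc 0 T) := fun z hz => ⟨hz.1, hz.2.1.trans hz.2.2⟩
    have m2 : MapsTo Prod.snd D (Icc 0 T) := fun z hz => ⟨hz.1.trans hz.2.1, hz.2.2⟩
    have c1 := hwc.comp continuousOn_fst m1
    have c2 := hφc.comp continuousOn_fst m1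
    have c3 := hψc.comp continuousOn_fst m1
    have c4 := heac.comp continuousOn_snd m2
    have c5 := hebc.comp continuousOn_snd m2
    have c6 := hρc.comp continuousOn_snd m2
    simp only [Function.comp_def] at c1 c2 c3 c4 c5 c6
    refine ContinuousOn.div ?_ c6 fun z hz => (hρpos _ (m2 hz)).ne'
    simp only [hzb]
    fun_prop
  · intro s t hs hst htT
    have hsT : s ∈ Icc 0 T := ⟨hs, hst.trans htT⟩
    have hb := hback s t hs hst htT
    have hn := hwn s hsT
    have hr := hρpos t ⟨hs.trans hst, htT⟩
    refine ⟨div_nonneg (mul_nonneg hn.2 hb.2) hr.le, (div_le_one hr).2 ?_⟩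
    rw [← hsum s hsT t]
    have := mul_nonneg hn.1 hb.1
    linarith
  · intro hμ0
    have := hdiag 0 ⟨le_rfl, hT⟩
    simp [this.2, hρ, hw0, hμ0]
  · intro t ht htT
    have htm : t ∈ Icc 0 T := ⟨ht.le, htT⟩
    have hr := hρpos t htm
    obtain ⟨p1, p2⟩ := hwp t ⟨ht, htT⟩
    simp only [(hdiag t htm).2]
    refine ⟨by positivity, (div_lt_one hr).2 ?_⟩
    simp only [hρ]; linarith
  · intro s t hs hst htT
    have hsI : s ∈ Ioo 0 T := ⟨hs, hst.trans_le htT⟩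
    have hsm := Ioo_subset_Icc_self hsI
    have hr := hρpos t ⟨(hs.trans hst).le, htT⟩
    have hrs := hρpos s hsm
    obtain ⟨p1, p2⟩ := hwp s ⟨hs, hst.le.trans htT⟩
    have dz : HasDerivAt (fun x => zb x t)
        (Real.exp (lam * s) * lam * ((φ s).1 * eb t - (ψ s).1 * ea t) + Real.exp (lam * s) *
          ((gaugeField l0 l1 (μ s) (φ s)).1 * eb t - (gaugeField l0 l1 (μ s) (ψ s)).1 * ea t)) s :=
      (dexp s).mul (((dφ s hsI).1.mul_const _).sub ((dψ s hsI).1.mul_const _))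
    refine (((dw s hsI).2.mul dz).div_const (ρ t)).congr_deriv ?_
    -- On the diagonal the backward weight is `exp (μ s)`, so the odds of the filter are gauged
    -- ratios of the coordinates of `w`. This turns the coefficients of the backward equation into
    -- functions of the filter.
    have e1 : (1 - (w s).2 * zb s s / ρ s) / ((w s).2 * zb s s / ρ s)
        = (w s).1 / (w s).2 * Real.exp (-μ s) := by
      rw [(hdiag s hsm).2, Real.exp_neg]
      have := Real.exp_pos (μ s)
      simp only [hρ] at hrs ⊢
      field_simp
      ring
    have e2 : ((w s).2 * zb s s / ρ s) / (1 - (w s).2 * zb s s / ρ s)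
        = (w s).2 / (w s).1 * Real.exp (μ s) := by
      rw [(hdiag s hsm).2]
      have := Real.exp_pos (μ s)
      have hne : 1 - (w s).2 * Real.exp (μ s) / ρ s = (w s).1 / ρ s := by
        simp only [hρ] at hrs ⊢
        field_simp
        ring
      rw [hne]
      field_simp
    have e3 : 1 - (w s).2 * zb s t / ρ t = (w s).1 * vb s t / ρ t := by
      have := hsum s hsm t
      field_simp
      linarith
    rw [e1, e2, e3]
    have hne : (w s).1 ≠ 0 := p1.ne'
    have hne' : (w s).2 ≠ 0 := p2.ne'
    have : l0 * ((w s).1 / (w s).2 * Real.exp (-μ s)) * ((w s).2 * zb s t / ρ t) -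
        l1 * ((w s).2 / (w s).1 * Real.exp (μ s)) * ((w s).1 * vb s t / ρ t)
        = (l0 * (w s).1 * Real.exp (-μ s) * zb s t - l1 * (w s).2 * Real.exp (μ s) * vb s t) / ρ t := by
      field_simp
    rw [this]
    congr 1
    simp only [gaugeField, hzb, hvb, hll]
    ring

end Smoother

/-! ### Regularity of the smoother and the damping estimates -/

namespace IsPathSmoother

variable {lam p q T : ℝ} {μ : ℝ → ℝ} {G : ℝ → ℝ → ℝ}

lemma continuousOn_diag (hG : IsPathSmoother lam p q T μ G) :
    ContinuousOn (fun t => G t t) (Icc 0 T) := by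
  refine hG.continuousOn.comp (f := fun t : ℝ => (t, t)) (by fun_prop) fun t ht => ?_
  exact ⟨ht.1, le_rfl, ht.2⟩

lemma continuousOn_left (hG : IsPathSmoother lam p q T μ G) {t : ℝ} (ht : t ≤ T) :
    ContinuousOn (fun s => G s t) (Icc 0 t) := by
  refine hG.continuousOn.comp (f := fun s : ℝ => (s, t)) (by fun_prop) fun s hs => ?_
  exact ⟨hs.1, hs.2, ht⟩

lemma continuousOn_shift (hG : IsPathSmoother lam p q T μ G) {δ : ℝ} (hδ : 0 ≤ δ) :
    ContinuousOn (fun t => G (t - δ) t) (Icc δ T) := by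
  refine hG.continuousOn.comp (f := fun t : ℝ => (t - δ, t)) (by fun_prop) fun t ht => ?_
  exact ⟨sub_nonneg.2 ht.1, by simpa using hδ, ht.2⟩

/-- A linear equation `g' = (a + b) g - a` with `0 ≤ a ≤ C`. -/
lemma damped_bound {a b g : ℝ → ℝ} {s t C : ℝ} (hst : s ≤ t)
    (ha : ContinuousOn a (Icc s t)) (hb : ContinuousOn b (Icc s t))
    (hg : ContinuousOn g (Icc s t))
    (hd : ∀ x ∈ Ioo s t, HasDerivAt g ((a x + b x) * g x - a x) x)
    (ha0 : ∀ x ∈ Icc s t, 0 ≤ a x) (haC : ∀ x ∈ Icc s t, a x ≤ C)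
    (hb0 : ∀ x ∈ Icc s t, 0 ≤ b x) :
    0 ≤ g s - g t * Real.exp (-∫ x in s..t, (a x + b x)) ∧
      g s - g t * Real.exp (-∫ x in s..t, (a x + b x)) ≤ (t - s) * C := by
  rcases hst.eq_or_lt with rfl | hlt
  · simp
  have hab : ContinuousOn (fun x => a x + b x) (Icc s t) := ha.add hb
  set A : ℝ → ℝ := fun y => ∫ x in s..y, (a x + b x) with hA
  have hAc : ContinuousOn A (Icc s t) := by
    have := intervalIntegral.continuousOn_primitive_interval (μ := volume)
      (f := fun x => a x + b x) (a := s) (b := t)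
      (by rw [uIcc_of_le hst]; exact hab.integrableOn_Icc)
    rwa [uIcc_of_le hst] at this
  have hAd : ∀ x ∈ Ioo s t, HasDerivAt A (a x + b x) x := by
    intro x hx
    refine intervalIntegral.integral_hasDerivAt_right ?_ ?_ ?_
    · exact (hab.mono (Icc_subset_Icc_right hx.2.le)).intervalIntegrable_of_Icc hx.1.le
    · exact hab.stronglyMeasurableAtFilter_nhdsWithin measurableSet_Icc x |>.filter_mono
        (by rw [nhdsWithin_eq_nhds.2 (Icc_mem_nhds hx.1 hx.2)])
    · exact hab.continuousAt (Icc_mem_nhds hx.1 hx.2)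
  -- Variation of constants: `h' = -a * exp (-A)` lies between `-C` and `0`, so `h` decreases while
  -- `h y + C * y` increases. Comparing the endpoints gives the two bounds.
  set h : ℝ → ℝ := fun y => g y * Real.exp (-A y) with hh
  have hhc : ContinuousOn h (Icc s t) := by simp only [hh]; fun_prop
  have hhd : ∀ x ∈ Ioo s t, HasDerivAt h (-(a x * Real.exp (-A x))) x := by
    intro x hx
    refine ((hd x hx).mul (hAd x hx).neg.exp).congr_deriv ?_
    rw [Pi.neg_apply]
    ring
  have hA0 : ∀ x ∈ Icc s t, 0 ≤ A x := fun x hx =>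
    intervalIntegral.integral_nonneg hx.1 fun y hy =>
      add_nonneg (ha0 y ⟨hy.1, hy.2.trans hx.2⟩) (hb0 y ⟨hy.1, hy.2.trans hx.2⟩)
  have hanti : AntitoneOn h (Icc s t) := by
    refine antitoneOn_of_hasDerivWithinAt_nonpos (convex_Icc _ _) hhc
      (fun x hx => (hhd x (by simpa using hx)).hasDerivWithinAt) fun x hx => ?_
    rw [interior_Icc] at hx
    have := ha0 x (Ioo_subset_Icc_self hx)
    have : 0 ≤ a x * Real.exp (-A x) := by positivity
    linarith
  have hmono : MonotoneOn (fun y => h y + C * y) (Icc s t) := by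
    refine monotoneOn_of_hasDerivWithinAt_nonneg (f' := fun x => -(a x * Real.exp (-A x)) + C * 1)
      (convex_Icc _ _) (by fun_prop)
      (fun x hx => ((hhd x (by simpa using hx)).add
        ((hasDerivAt_id x).const_mul C)).hasDerivWithinAt) fun x hx => ?_
    rw [interior_Icc] at hx
    have h1 := ha0 x (Ioo_subset_Icc_self hx)
    have h2 := haC x (Ioo_subset_Icc_self hx)
    have h3 : Real.exp (-A x) ≤ 1 :=
      Real.exp_le_one_iff.2 (neg_nonpos.2 (hA0 x (Ioo_subset_Icc_self hx)))
    nlinarith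
  have e1 := hanti (left_mem_Icc.2 hst) (right_mem_Icc.2 hst) hst
  have e2 := hmono (left_mem_Icc.2 hst) (right_mem_Icc.2 hst) hst
  have hs : h s = g s := by simp [hh, hA]
  simp only [hs] at e1 e2
  have ht : h t = g t * Real.exp (-∫ x in s..t, (a x + b x)) := rfl
  rw [← ht]
  constructor <;> linarith

lemma rates_continuousOn (hG : IsPathSmoother lam p q T μ G) {s t : ℝ} (hs : 0 < s)
    (htT : t ≤ T) :
    ContinuousOn (fun x => lam * (1 - p) * (G x x / (1 - G x x))) (Icc s t) ∧
    ContinuousOn (fun x => lam * p * ((1 - G x x) / G x x)) (Icc s t) := by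
  have hc : ContinuousOn (fun x => G x x) (Icc s t) :=
    hG.continuousOn_diag.mono (Icc_subset_Icc hs.le htT)
  have hp := fun x (hx : x ∈ Icc s t) => hG.pos x (hs.trans_le hx.1) (hx.2.trans htT)
  constructor
  · exact continuousOn_const.mul (hc.div (continuousOn_const.sub hc)
      fun x hx => (sub_pos.2 (hp x hx).2).ne')
  · exact continuousOn_const.mul ((continuousOn_const.sub hc).div hc fun x hx => (hp x hx).1.ne')

lemma expNeg_damping_eq (hlam : 0 < lam) (hp : p ∈ Ioo (0 : ℝ) 1)
    (hG : IsPathSmoother lam p q T μ G) {s t : ℝ} (hs : 0 < s) (hst : s ≤ t) (htT : t ≤ T) :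
    expNeg (damping lam p (fun x => G x x) s t) = Real.exp (-∫ x in s..t,
      (lam * (1 - p) * (G x x / (1 - G x x)) + lam * p * ((1 - G x x) / G x x))) := by
  have hc := hG.rates_continuousOn hs htT
  have hpos := fun x (hx : x ∈ Icc s t) => hG.pos x (hs.trans_le hx.1) (hx.2.trans htT)
  have hnn : ∀ x ∈ Icc s t, 0 ≤ lam * (1 - p) * (G x x / (1 - G x x)) +
      lam * p * ((1 - G x x) / G x x) := by
    intro x hx
    have h1 := (hpos x hx).1.le
    have h2 := sub_nonneg.2 (hpos x hx).2.le
    have h3 := hp.1.le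
    have h4 := sub_nonneg.2 hp.2.le
    positivity
  have hi : damping lam p (fun x => G x x) s t = ENNReal.ofReal (∫ x in s..t,
      (lam * (1 - p) * (G x x / (1 - G x x)) + lam * p * ((1 - G x x) / G x x))) := by
    rw [intervalIntegral.integral_of_le hst, ← integral_Icc_eq_integral_Ioc,
      ofReal_integral_eq_lintegral_ofReal (f := fun x =>
        lam * (1 - p) * (G x x / (1 - G x x)) + lam * p * ((1 - G x x) / G x x))
        (hc.1.add hc.2).integrableOn_Icc
        ((ae_restrict_iff' measurableSet_Icc).2 (ae_of_all _ hnn))]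
    rfl
  rw [hi, expNeg_of_ne_top ENNReal.ofReal_ne_top, ENNReal.toReal_ofReal]
  exact intervalIntegral.integral_nonneg hst hnn

/-- Closed inequalities between the smoother and its damping factor extend from `s > 0` to `s = 0`,
where the filter may sit at `0` or `1` and the rates may fail to be integrable. -/
lemma le_of_forall_pos (hG : IsPathSmoother lam p q T μ G) {t : ℝ} (htT : t ≤ T) (c : ℝ)
    (F : ℝ → ℝ → ℝ) (hF : Continuous (Function.uncurry F))
    (h : ∀ s, 0 < s → s ≤ t →
      F (G s t) (expNeg (damping lam p (fun x => G x x) s t)) ≤ c) {s : ℝ} (hs : 0 ≤ s)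
    (hst : s ≤ t) (ht : 0 < t) :
    F (G s t) (expNeg (damping lam p (fun x => G x x) s t)) ≤ c := by
  rcases hs.eq_or_lt with rfl | hs
  · have hlim : Tendsto (fun n : ℕ => t / ((n : ℝ) + 1)) atTop (𝓝[Icc 0 t] 0) := by
      refine tendsto_nhdsWithin_iff.2 ⟨?_, Eventually.of_forall fun n =>
        ⟨by positivity, div_le_self ht.le (by simp)⟩⟩
      exact tendsto_const_nhds.div_atTop (tendsto_atTop_add_const_right _ _
        tendsto_natCast_atTop_atTop)
    have l1 := ((hG.continuousOn_left htT) 0 (left_mem_Icc.2 ht.le)).tendsto.comp hlim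
    have l2 := (continuous_expNeg.tendsto _).comp
      (tendsto_damping (lam := lam) (p := p) (f := fun x => G x x) ht)
    have l3 := (hF.tendsto _).comp (l1.prodMk_nhds l2)
    refine le_of_tendsto l3 (Eventually.of_forall fun n => ?_)
    exact h _ (by positivity) (div_le_self ht.le (by simp))
  · exact h s hs hst

/-- If the filter stays away from `1`, then the smoother is the damped filter, up to an error
proportional to the length of the window. -/
lemma damping_bound_zero (hlam : 0 < lam) (hp : p ∈ Ioo (0 : ℝ) 1)
    (hG : IsPathSmoother lam p q T μ G) {s t η : ℝ} (hs : 0 ≤ s) (hst : s ≤ t) (htT : t ≤ T)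
    (hη : 0 < η) (hf : ∀ x ∈ Icc s t, G x x ≤ 1 - η) :
    |G s t - G t t * expNeg (damping lam p (fun x => G x x) s t)| ≤ (t - s) * (lam / η) := by
  rcases hst.eq_or_lt with rfl | hlt
  · simp [damping, expNeg]
  have ht : 0 < t := hs.trans_lt hlt
  have h1p := sub_pos.2 hp.2
  have key : ∀ r, 0 < r → s ≤ r → r ≤ t →
      |G r t - G t t * expNeg (damping lam p (fun x => G x x) r t)| ≤ (t - s) * (lam / η) := by
    intro r hr hsr hrt
    rw [hG.expNeg_damping_eq hlam hp hr hrt htT]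
    have hc := hG.rates_continuousOn hr htT
    have hpos := fun x (hx : x ∈ Icc r t) => hG.pos x (hr.trans_le hx.1) (hx.2.trans htT)
    -- Only the rate `lam * (1 - p) * f / (1 - f)` needs an upper bound. The other one, arbitrarily
    -- large when the filter is near `0`, merely adds damping.
    obtain ⟨b1, b2⟩ := damped_bound (C := lam / η) hrt hc.1 hc.2
      ((hG.continuousOn_left htT).mono (Icc_subset_Icc_left hr.le))
      (fun x hx => (hG.hasDerivAt x t (hr.trans hx.1) hx.2 htT).congr_deriv (by ring))
      (fun x hx => by
        have h1 := (hpos x hx).1.le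
        have h2 := sub_nonneg.2 (hpos x hx).2.le
        positivity)
      (fun x hx => by
        have h1 := (hpos x hx).1
        have h2 := hf x ⟨hsr.trans hx.1, hx.2⟩
        have h3 : η ≤ 1 - G x x := by linarith
        have h4 : lam * (1 - p) ≤ lam := by nlinarith [hp.1]
        have h5 : G x x / (1 - G x x) ≤ 1 / η := by
          gcongr
          linarith
        calc lam * (1 - p) * (G x x / (1 - G x x)) ≤ lam * (1 / η) := by
              gcongr
              exact div_nonneg h1.le (by linarith)
          _ = lam / η := by ring)
      (fun x hx => by
        have h1 := (hpos x hx).1.le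
        have h2 := sub_nonneg.2 (hpos x hx).2.le
        have := hp.1
        positivity)
    rw [abs_of_nonneg b1]
    refine b2.trans ?_
    gcongr
  rcases hs.eq_or_lt with rfl | hs'
  · exact hG.le_of_forall_pos htT _ (fun g e => |g - G t t * e|)
      (by simp only [Function.uncurry_def]; fun_prop)
      (fun r hr hrt => key r hr hr.le hrt) le_rfl hst ht
  · exact key s hs' le_rfl hst

/-- If the filter stays away from `0`, then the smoother is the damped filter, up to an error
proportional to the length of the window. -/
lemma damping_bound_one (hlam : 0 < lam) (hp : p ∈ Ioo (0 : ℝ) 1)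
    (hG : IsPathSmoother lam p q T μ G) {s t η : ℝ} (hs : 0 ≤ s) (hst : s ≤ t) (htT : t ≤ T)
    (hη : 0 < η) (hf : ∀ x ∈ Icc s t, η ≤ G x x) :
    |G s t - (1 + (G t t - 1) * expNeg (damping lam p (fun x => G x x) s t))| ≤
      (t - s) * (lam / η) := by
  rcases hst.eq_or_lt with rfl | hlt
  · simp [damping, expNeg]
  have ht : 0 < t := hs.trans_lt hlt
  have h1p := sub_pos.2 hp.2
  have key : ∀ r, 0 < r → s ≤ r → r ≤ t →
      |G r t - (1 + (G t t - 1) * expNeg (damping lam p (fun x => G x x) r t))| ≤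
        (t - s) * (lam / η) := by
    intro r hr hsr hrt
    rw [hG.expNeg_damping_eq hlam hp hr hrt htT]
    have hc := hG.rates_continuousOn hr htT
    have hpos := fun x (hx : x ∈ Icc r t) => hG.pos x (hr.trans_le hx.1) (hx.2.trans htT)
    -- `1 - G` solves the same linear equation with the two rates exchanged.
    obtain ⟨b1, b2⟩ := damped_bound (C := lam / η) (g := fun x => 1 - G x t) hrt hc.2 hc.1
      (continuousOn_const.sub ((hG.continuousOn_left htT).mono (Icc_subset_Icc_left hr.le)))
      (fun x hx => ((hG.hasDerivAt x t (hr.trans hx.1) hx.2 htT).const_sub 1).congr_deriv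
        (by ring))
      (fun x hx => by
        have h1 := (hpos x hx).1.le
        have h2 := sub_nonneg.2 (hpos x hx).2.le
        have := hp.1
        positivity)
      (fun x hx => by
        have h1 := (hpos x hx).1
        have h0 := (hpos x hx).2
        have h2 := hf x ⟨hsr.trans hx.1, hx.2⟩
        have h4 : lam * p ≤ lam := by nlinarith [hp.2]
        have h5 : (1 - G x x) / G x x ≤ 1 / η := by
          refine div_le_div₀ zero_le_one (by linarith) hη h2
        calc lam * p * ((1 - G x x) / G x x) ≤ lam * (1 / η) := by
              gcongr
          _ = lam / η := by ring)
      (fun x hx => by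
        have h1 := (hpos x hx).1.le
        have h2 := sub_nonneg.2 (hpos x hx).2.le
        positivity)
    have hcomm : ∫ x in r..t, (lam * p * ((1 - G x x) / G x x) +
        lam * (1 - p) * (G x x / (1 - G x x))) = ∫ x in r..t,
        (lam * (1 - p) * (G x x / (1 - G x x)) + lam * p * ((1 - G x x) / G x x)) := by
      congr 1; ext x; ring
    rw [hcomm] at b1 b2
    rw [abs_sub_comm, show ∀ g f e : ℝ, 1 + (f - 1) * e - g = (1 - g) - (1 - f) * e by
      intros; ring, abs_of_nonneg b1]
    refine b2.trans ?_
    gcongr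
  rcases hs.eq_or_lt with rfl | hs'
  · exact hG.le_of_forall_pos htT _ (fun g e => |g - (1 + (G t t - 1) * e)|)
      (by simp only [Function.uncurry_def]; fun_prop)
      (fun r hr hrt => key r hr hr.le hrt) le_rfl hst ht
  · exact key s hs' le_rfl hst

end IsPathSmoother

/-! ### The transition matrix -/

/-- The generator is diagonalised by the right eigenvectors `(1, 1)` for `0` and `(p, p - 1)` for
`-lam`; the first row of the inverse matrix is the stationary law `(1 - p, p)`. -/
lemma transition_eq (lam p t : ℝ) : transition lam p t =
    !![1 - p + p * Real.exp (-(lam * t)), p * (1 - Real.exp (-(lam * t)));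
      (1 - p) * (1 - Real.exp (-(lam * t))), p + (1 - p) * Real.exp (-(lam * t))] := by
  let U : (Matrix (Fin 2) (Fin 2) ℝ)ˣ :=
    ⟨!![1, p; 1, p - 1], !![1 - p, p; 1, -1],
      by ext i j; fin_cases i <;> fin_cases j <;> simp,
      by ext i j; fin_cases i <;> fin_cases j <;> simp <;> ring⟩
  have hdiag : ∀ a b : ℝ, Matrix.diagonal ![a, b] = !![a, 0; 0, b] := fun a b => by
    ext i j; fin_cases i <;> fin_cases j <;> simp
  have h : t • generator lam p =
      (U : Matrix (Fin 2) (Fin 2) ℝ) * Matrix.diagonal ![0, -(lam * t)] *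
        ((U⁻¹ : (Matrix (Fin 2) (Fin 2) ℝ)ˣ) : Matrix (Fin 2) (Fin 2) ℝ) := by
    change _ = !![1, p; 1, p - 1] * Matrix.diagonal ![0, -(lam * t)] * !![1 - p, p; 1, -1]
    rw [hdiag]
    ext i j
    fin_cases i <;> fin_cases j <;>
      simp [generator, Matrix.mul_apply, Fin.sum_univ_two] <;> ring
  rw [transition, h, Matrix.exp_units_conj, Matrix.exp_diagonal]
  change !![1, p; 1, p - 1] * Matrix.diagonal (NormedSpace.exp ![0, -(lam * t)]) *
    !![1 - p, p; 1, -1] = _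
  have h0 : NormedSpace.exp ![0, -(lam * t)] = ![1, Real.exp (-(lam * t))] := by
    ext i
    rw [Pi.coe_exp]
    fin_cases i <;> simp [Real.exp_eq_exp_ℝ]
  rw [h0, hdiag]
  ext i j
  fin_cases i <;> fin_cases j <;>
    simp [Matrix.mul_apply, Fin.sum_univ_two] <;> ring

lemma transition_nonneg {lam p t : ℝ} (hlam : 0 ≤ lam) (hp : p ∈ Icc (0 : ℝ) 1) (ht : 0 ≤ t)
    (i j : Fin 2) : 0 ≤ transition lam p t i j := by
  have h1 : 0 ≤ 1 - Real.exp (-(lam * t)) :=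
    sub_nonneg.2 (Real.exp_le_one_iff.2 (neg_nonpos.2 (mul_nonneg hlam ht)))
  have h2 := Real.exp_pos (-(lam * t))
  have h3 := hp.1
  have h4 := sub_nonneg.2 hp.2
  rw [transition_eq]
  fin_cases i <;> fin_cases j <;> simp <;> positivity

lemma transition_le {lam p t : ℝ} (hlam : 0 ≤ lam) (hp : p ∈ Icc (0 : ℝ) 1) (ht : 0 ≤ t)
    {i j : Fin 2} (hij : i ≠ j) : transition lam p t i j ≤ lam * t := by
  have h0 := Real.add_one_le_exp (-(lam * t))
  have h5 := mul_nonneg hlam ht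
  have h1 : 1 - Real.exp (-(lam * t)) ≤ lam * t := by linarith
  have h1' : 0 ≤ 1 - Real.exp (-(lam * t)) :=
    sub_nonneg.2 (Real.exp_le_one_iff.2 (neg_nonpos.2 h5))
  have h3 := hp.1
  have h4 := hp.2
  rw [transition_eq]
  fin_cases i <;> fin_cases j <;> simp at hij ⊢ <;> nlinarith

/-! ### The Markov property -/

namespace IsTwoStateChain

section

variable {Ω : Type*} [MeasurableSpace Ω] {P : Measure Ω} {lam p q : ℝ} {x : ℝ → Ω → ℝ}

lemma pastSigma_le (hx : IsTwoStateChain P lam p q x) (t : ℝ) :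
    pastSigma x t ≤ (inferInstance : MeasurableSpace Ω) :=
  iSup₂_le fun u hu => (hx.measurable u hu.1).comap_le

lemma exists_state (hx : IsTwoStateChain P lam p q x) {t : ℝ} (ht : 0 ≤ t) (ω : Ω) :
    ∃ i : Fin 2, x t ω = ((i : ℕ) : ℝ) := by
  rcases hx.mem_states t ht ω with h | h
  · exact ⟨0, by simp [h]⟩
  · exact ⟨1, by simp [h]⟩

lemma state_inj {i j : Fin 2} : ((i : ℕ) : ℝ) = ((j : ℕ) : ℝ) ↔ i = j := by
  rw [Nat.cast_inj, Fin.val_inj]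

lemma measurableSet_state (hx : IsTwoStateChain P lam p q x) {t : ℝ} (ht : 0 ≤ t) (i : Fin 2) :
    MeasurableSet {ω | x t ω = ((i : ℕ) : ℝ)} :=
  hx.measurable t ht (measurableSet_singleton _)

/-- Appending one more time to the grid multiplies the finite-dimensional law by one transition
factor. -/
lemma measure_word_inter (hlam : 0 ≤ lam) (hp : p ∈ Icc (0 : ℝ) 1)
    (hx : IsTwoStateChain P lam p q x) {n : ℕ} {τ : Fin (n + 1) → ℝ} (hτ0 : τ 0 = 0)
    (hτ : Monotone τ) (w : Fin (n + 1) → Fin 2) {r : ℝ} (hr : τ (Fin.last n) ≤ r) (j : Fin 2) :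
    P ({ω | ∀ k, x (τ k) ω = ((w k : ℕ) : ℝ)} ∩ {ω | x r ω = ((j : ℕ) : ℝ)}) =
      ENNReal.ofReal (transition lam p (r - τ (Fin.last n)) (w (Fin.last n)) j) *
        P {ω | ∀ k, x (τ k) ω = ((w k : ℕ) : ℝ)} := by
  have hmono : Monotone (Fin.snoc (α := fun _ => ℝ) τ r) := by
    rw [Fin.monotone_iff_le_succ]
    intro k
    rw [Fin.snoc_castSucc]
    rcases Fin.eq_castSucc_or_eq_last k with ⟨k, rfl⟩ | rfl
    · rw [Fin.succ_castSucc, Fin.snoc_castSucc]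
      exact hτ (Fin.castSucc_lt_succ).le
    · rw [Fin.succ_last, Fin.snoc_last]
      exact hr
  have h0 : (Fin.snoc (α := fun _ => ℝ) τ r) 0 = 0 := by
    rw [← Fin.castSucc_zero, Fin.snoc_castSucc, hτ0]
  have hlaw := hx.law (n + 1) (Fin.snoc (α := fun _ => ℝ) τ r)
    (Fin.snoc (α := fun _ => Fin 2) w j) h0 hmono
  have hset : {ω | ∀ k, x (Fin.snoc (α := fun _ => ℝ) τ r k) ω =
      ((Fin.snoc (α := fun _ => Fin 2) w j k : ℕ) : ℝ)} =
      {ω | ∀ k, x (τ k) ω = ((w k : ℕ) : ℝ)} ∩ {ω | x r ω = ((j : ℕ) : ℝ)} := by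
    ext ω
    simp only [mem_ofPred_eq, mem_inter_iff]
    rw [Fin.forall_fin_succ']
    simp only [Fin.snoc_castSucc, Fin.snoc_last]
  rw [← hset, hlaw, hx.law n τ w hτ0 hτ, Fin.prod_univ_castSucc, ← mul_assoc, mul_comm,
    ENNReal.ofReal_mul]
  · congr 2
    · simp only [Fin.snoc_castSucc, Fin.snoc_last, Fin.succ_last]
    · rw [← Fin.castSucc_zero, Fin.snoc_castSucc]
      simp only [Fin.succ_castSucc, Fin.snoc_castSucc]
  · refine transition_nonneg hlam hp ?_ _ _
    exact sub_nonneg.2 (hmono (Fin.castSucc_lt_succ).le)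

/-- The Markov property, for cylinder events. -/
lemma measure_cylinder_inter (hlam : 0 ≤ lam) (hp : p ∈ Icc (0 : ℝ) 1)
    (hx : IsTwoStateChain P lam p q x) {t r : ℝ} (ht : 0 ≤ t) (htr : t ≤ r) (I : Finset ℝ)
    (hI : (I : Set ℝ) ⊆ Icc 0 t) (D : ℝ → Set ℝ) (i j : Fin 2) :
    P ((⋂ u ∈ I, x u ⁻¹' D u) ∩ ({ω | x t ω = ((i : ℕ) : ℝ)} ∩ {ω | x r ω = ((j : ℕ) : ℝ)})) =
      ENNReal.ofReal (transition lam p (r - t) i j) *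
        P ((⋂ u ∈ I, x u ⁻¹' D u) ∩ {ω | x t ω = ((i : ℕ) : ℝ)}) := by
  classical
  -- The laws are given on grids starting at `0`, and the transition factor needs `t` as last time.
  -- On this enlarged grid the event is a finite disjoint union of words ending in `i`.
  set J := insert 0 (insert t I) with hJ
  have hJpos : 0 < J.card := Finset.card_pos.2 ⟨0, Finset.mem_insert_self _ _⟩
  obtain ⟨n, hn⟩ : ∃ n, J.card = n + 1 := ⟨J.card - 1, by omega⟩
  set τ := J.orderEmbOfFin hn with hτ
  have hJmem : ∀ u ∈ J, u ∈ Icc 0 t := by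
    intro u hu
    simp only [hJ, Finset.mem_insert] at hu
    rcases hu with rfl | rfl | hu
    · exact ⟨le_rfl, ht⟩
    · exact ⟨ht, le_rfl⟩
    · exact hI hu
  have hrange : ∀ u ∈ J, ∃ k, τ k = u := by
    intro u hu
    have : u ∈ Set.range τ := by rw [hτ, Finset.range_orderEmbOfFin]; exact hu
    exact this
  have hτmem : ∀ k, τ k ∈ J := fun k => J.orderEmbOfFin_mem hn k
  have hτ0 : τ 0 = 0 := by
    obtain ⟨k, hk⟩ := hrange 0 (Finset.mem_insert_self _ _)
    refine le_antisymm ?_ (hJmem _ (hτmem 0)).1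
    rw [← hk]
    exact τ.monotone (Fin.zero_le k)
  have hτl : τ (Fin.last n) = t := by
    obtain ⟨k, hk⟩ := hrange t (Finset.mem_insert_of_mem (Finset.mem_insert_self _ _))
    refine le_antisymm (hJmem _ (hτmem _)).2 ?_
    rw [← hk]
    exact τ.monotone (Fin.le_last k)
  set word : (Fin (n + 1) → Fin 2) → Set Ω := fun w => {ω | ∀ k, x (τ k) ω = ((w k : ℕ) : ℝ)}
    with hword
  set Wd : Finset (Fin (n + 1) → Fin 2) := Finset.univ.filter fun w =>
    (∀ k, τ k ∈ I → ((w k : ℕ) : ℝ) ∈ D (τ k)) ∧ w (Fin.last n) = i with hWd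
  have hdecomp : (⋂ u ∈ I, x u ⁻¹' D u) ∩ {ω | x t ω = ((i : ℕ) : ℝ)} = ⋃ w ∈ Wd, word w := by
    ext ω
    simp only [mem_inter_iff, mem_iInter, mem_preimage, mem_ofPred_eq, mem_iUnion, hword, hWd,
      Finset.mem_filter, Finset.mem_univ, true_and, exists_prop]
    constructor
    · rintro ⟨h1, h2⟩
      choose w hw using fun k => hx.exists_state (hJmem _ (hτmem k)).1 ω
      refine ⟨w, ⟨fun k hk => ?_, ?_⟩, hw⟩
      · rw [← hw k]; exact h1 _ hk
      · rw [← state_inj, ← hw, hτl, h2]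
    · rintro ⟨w, ⟨h1, h2⟩, h3⟩
      refine ⟨fun u hu => ?_, ?_⟩
      · obtain ⟨k, rfl⟩ := hrange u (Finset.mem_insert_of_mem (Finset.mem_insert_of_mem hu))
        rw [h3 k]
        exact h1 k hu
      · rw [← hτl, h3, h2]
  have hdisj : Pairwise (fun w w' => Disjoint (word w) (word w')) := by
    intro w w' hne
    rw [Set.disjoint_left]
    intro ω h1 h2
    apply hne
    ext k : 1
    rw [← state_inj, ← h1 k, h2 k]
  have hmeas : ∀ w, MeasurableSet (word w) := by
    intro w
    have : word w = ⋂ k, {ω | x (τ k) ω = ((w k : ℕ) : ℝ)} := by ext; simp [hword]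
    rw [this]
    exact MeasurableSet.iInter fun k => hx.measurableSet_state (hJmem _ (hτmem k)).1 _
  have hr0 : 0 ≤ r := ht.trans htr
  rw [← inter_assoc, hdecomp, iUnion₂_inter,
    measure_biUnion_finset (fun w _ w' _ hne => (hdisj hne).mono inter_subset_left
      inter_subset_left) (fun w _ => (hmeas w).inter (hx.measurableSet_state hr0 j)),
    measure_biUnion_finset (fun w _ w' _ hne => hdisj hne) (fun w _ => hmeas w),
    Finset.mul_sum]
  refine Finset.sum_congr rfl fun w hw => ?_
  have := hx.measure_word_inter hlam hp hτ0 τ.monotone w (r := r) (by rwa [hτl]) j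
  rw [hτl, (Finset.mem_filter.1 hw).2.2] at this
  exact this

/-- The Markov property. -/
lemma measure_past_inter [IsProbabilityMeasure P] (hlam : 0 ≤ lam) (hp : p ∈ Icc (0 : ℝ) 1)
    (hx : IsTwoStateChain P lam p q x) {t r : ℝ} (ht : 0 ≤ t) (htr : t ≤ r) {A : Set Ω}
    (hA : MeasurableSet[pastSigma x t] A) (i j : Fin 2) :
    P (A ∩ ({ω | x t ω = ((i : ℕ) : ℝ)} ∩ {ω | x r ω = ((j : ℕ) : ℝ)})) =
      ENNReal.ofReal (transition lam p (r - t) i j) * P (A ∩ {ω | x t ω = ((i : ℕ) : ℝ)}) := by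
  set C := piiUnionInter (fun u => {s | MeasurableSet[MeasurableSpace.comap (x u) inferInstance] s})
    (Icc 0 t) with hC
  have hgen : pastSigma x t = MeasurableSpace.generateFrom C :=
    (generateFrom_piiUnionInter_measurableSet _ _).symm
  have hpi : IsPiSystem C := isPiSystem_piiUnionInter _
    (fun u => @MeasurableSpace.isPiSystem_measurableSet Ω
      (MeasurableSpace.comap (x u) inferInstance)) _
  have hle := hx.pastSigma_le t
  have key : ∀ A ∈ C, P (A ∩ ({ω | x t ω = ((i : ℕ) : ℝ)} ∩ {ω | x r ω = ((j : ℕ) : ℝ)})) =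
      ENNReal.ofReal (transition lam p (r - t) i j) * P (A ∩ {ω | x t ω = ((i : ℕ) : ℝ)}) := by
    rintro A ⟨I, hI, f, hf, rfl⟩
    have hf' : ∀ u, ∃ D : Set ℝ, u ∈ I → x u ⁻¹' D = f u := by
      intro u
      by_cases hu : u ∈ I
      · obtain ⟨D, -, hD⟩ := hf u hu
        exact ⟨D, fun _ => hD⟩
      · exact ⟨∅, fun h => absurd h hu⟩
    choose D hD using hf'
    have : ⋂ u ∈ I, f u = ⋂ u ∈ I, x u ⁻¹' D u := iInter₂_congr fun u hu => (hD u hu).symm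
    rw [this]
    exact hx.measure_cylinder_inter hlam hp ht htr I hI D i j
  have hCm : ∀ A ∈ C, MeasurableSet A := fun A hA =>
    hle A (by rw [hgen]; exact MeasurableSpace.measurableSet_generateFrom hA)
  have m1 := hx.measurableSet_state ht i
  have m2 := m1.inter (hx.measurableSet_state (ht.trans htr) j)
  have huniv := hx.measure_cylinder_inter hlam hp ht htr ∅ (by simp) (fun _ => univ) i j
  simp only [Finset.notMem_empty, iInter_of_empty, iInter_univ, univ_inter] at huniv
  have := ext_on_measurableSpace_of_generate_finite (m₀ := inferInstance)
    (μ := P.restrict ({ω | x t ω = ((i : ℕ) : ℝ)} ∩ {ω | x r ω = ((j : ℕ) : ℝ)}))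
    (ν := ENNReal.ofReal (transition lam p (r - t) i j) • P.restrict {ω | x t ω = ((i : ℕ) : ℝ)})
    C (fun A hA => by
      rw [Measure.restrict_apply (hCm A hA), Measure.smul_apply,
        Measure.restrict_apply (hCm A hA), key A hA, smul_eq_mul])
    hle hgen hpi (by
      rw [Measure.restrict_apply_univ, Measure.smul_apply, Measure.restrict_apply_univ, huniv,
        smul_eq_mul]) hA
  rwa [Measure.restrict_apply (hle A hA), Measure.smul_apply, Measure.restrict_apply (hle A hA),
    smul_eq_mul] at this

/-- The chain is continuous in probability. -/
lemma measure_ne_le [IsProbabilityMeasure P] (hlam : 0 ≤ lam) (hp : p ∈ Icc (0 : ℝ) 1)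
    (hx : IsTwoStateChain P lam p q x) {t r : ℝ} (ht : 0 ≤ t) (htr : t ≤ r) :
    P {ω | x t ω ≠ x r ω} ≤ ENNReal.ofReal (lam * (r - t)) := by
  have hsub : {ω | x t ω ≠ x r ω} ⊆
      ({ω | x t ω = (((0 : Fin 2) : ℕ) : ℝ)} ∩ {ω | x r ω = (((1 : Fin 2) : ℕ) : ℝ)}) ∪
      ({ω | x t ω = (((1 : Fin 2) : ℕ) : ℝ)} ∩ {ω | x r ω = (((0 : Fin 2) : ℕ) : ℝ)}) := by
    intro ω hω
    rcases hx.mem_states t ht ω with h | h <;>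
      rcases hx.mem_states r (ht.trans htr) ω with h' | h' <;> simp_all
  have e := fun i j => hx.measure_past_inter hlam hp ht htr (A := univ) MeasurableSet.univ i j
  simp only [univ_inter] at e
  have hs := sub_nonneg.2 htr
  have hsum : P {ω | x t ω = (((0 : Fin 2) : ℕ) : ℝ)} + P {ω | x t ω = (((1 : Fin 2) : ℕ) : ℝ)}
      ≤ 1 := by
    rw [← measure_union _ (hx.measurableSet_state ht 1)]
    · exact prob_le_one
    · rw [Set.disjoint_left]
      intro ω h1 h2
      rw [mem_ofPred_eq] at h1 h2
      rw [h1] at h2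
      simp at h2
  calc P {ω | x t ω ≠ x r ω} ≤ _ := (measure_mono hsub).trans (measure_union_le _ _)
    _ ≤ ENNReal.ofReal (lam * (r - t)) * P {ω | x t ω = (((0 : Fin 2) : ℕ) : ℝ)} +
        ENNReal.ofReal (lam * (r - t)) * P {ω | x t ω = (((1 : Fin 2) : ℕ) : ℝ)} := by
      rw [e, e]
      gcongr
      · exact transition_le hlam hp hs (by decide)
      · exact transition_le hlam hp hs (by decide)
    _ ≤ _ := by
      rw [← mul_add]
      exact mul_le_of_le_one_right' hsum

end

/-- The Markov property, in the presence of independent noise. -/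
lemma measure_past_noise_inter {Ω : Type*} {mB : MeasurableSpace Ω} [MeasurableSpace Ω]
    {P : Measure Ω} [IsProbabilityMeasure P] {lam p q : ℝ} {x : ℝ → Ω → ℝ} (hlam : 0 ≤ lam) (hp : p ∈ Icc (0 : ℝ) 1)
    (hx : IsTwoStateChain P lam p q x)
    (hB : mB ≤ (inferInstance : MeasurableSpace Ω))
    (hind : ∀ t, 0 ≤ t → Indep mB (pastSigma x t) P)
    {t r : ℝ} (ht : 0 ≤ t) (htr : t ≤ r) {A : Set Ω}
    (hA : MeasurableSet[pastSigma x t ⊔ mB] A) (i j : Fin 2) :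
    P (A ∩ ({ω | x t ω = ((i : ℕ) : ℝ)} ∩ {ω | x r ω = ((j : ℕ) : ℝ)})) =
      ENNReal.ofReal (transition lam p (r - t) i j) * P (A ∩ {ω | x t ω = ((i : ℕ) : ℝ)}) := by
  set C : Set (Set Ω) := {A | ∃ A1 A2, MeasurableSet[pastSigma x t] A1 ∧ MeasurableSet[mB] A2 ∧
    A = A1 ∩ A2} with hC
  have hle := hx.pastSigma_le t
  have hgen : pastSigma x t ⊔ mB = MeasurableSpace.generateFrom C := by
    apply le_antisymm
    · refine sup_le ?_ ?_
      · intro s hs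
        exact MeasurableSpace.measurableSet_generateFrom
          ⟨s, univ, hs, MeasurableSet.univ, (inter_univ s).symm⟩
      · intro s hs
        exact MeasurableSpace.measurableSet_generateFrom
          ⟨univ, s, MeasurableSet.univ, hs, (univ_inter s).symm⟩
    · refine MeasurableSpace.generateFrom_le ?_
      rintro _ ⟨A1, A2, h1, h2, rfl⟩
      exact MeasurableSet.inter ((le_sup_left : pastSigma x t ≤ pastSigma x t ⊔ mB) _ h1)
        ((le_sup_right : mB ≤ pastSigma x t ⊔ mB) _ h2)
  have hpi : IsPiSystem C := by
    rintro _ ⟨A1, A2, h1, h2, rfl⟩ _ ⟨B1, B2, h3, h4, rfl⟩ -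
    exact ⟨A1 ∩ B1, A2 ∩ B2, MeasurableSet.inter h1 h3, MeasurableSet.inter h2 h4,
      by rw [inter_inter_inter_comm]⟩
  have hle' : pastSigma x t ⊔ mB ≤ (inferInstance : MeasurableSpace Ω) := sup_le hle hB
  have hst : ∀ u, 0 ≤ u → ∀ v, u ≤ v → ∀ i : Fin 2,
      MeasurableSet[pastSigma x v] {ω | x u ω = ((i : ℕ) : ℝ)} := by
    intro u hu v huv i
    refine (le_iSup₂ (f := fun u (_ : u ∈ Icc (0 : ℝ) v) =>
      MeasurableSpace.comap (x u) inferInstance) u ⟨hu, huv⟩) _ ?_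
    exact ⟨{((i : ℕ) : ℝ)}, measurableSet_singleton _, rfl⟩
  have key : ∀ A ∈ C, P (A ∩ ({ω | x t ω = ((i : ℕ) : ℝ)} ∩ {ω | x r ω = ((j : ℕ) : ℝ)})) =
      ENNReal.ofReal (transition lam p (r - t) i j) * P (A ∩ {ω | x t ω = ((i : ℕ) : ℝ)}) := by
    rintro _ ⟨A1, A2, h1, h2, rfl⟩
    -- The noise is independent of the chain up to the later time `r`, so the noise event factors
    -- out of both sides and leaves the Markov property of the chain alone.
    have hmono : pastSigma x t ≤ pastSigma x r := biSup_mono fun u hu => ⟨hu.1, hu.2.trans htr⟩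
    have e1 := (Indep_iff _ _ _).1 (hind r (ht.trans htr)) _ _ h2
      (MeasurableSet.inter (hmono _ h1)
        (MeasurableSet.inter (hst t ht r htr i) (hst r (ht.trans htr) r le_rfl j)))
    have e2 := (Indep_iff _ _ _).1 (hind t ht) _ _ h2 (MeasurableSet.inter h1 (hst t ht t le_rfl i))
    rw [inter_comm A1 A2, inter_assoc, inter_assoc, e1, e2,
      hx.measure_past_inter hlam hp ht htr h1 i j]
    ring
  have m1 := hx.measurableSet_state ht i
  have m2 := m1.inter (hx.measurableSet_state (ht.trans htr) j)
  have hCm : ∀ A ∈ C, MeasurableSet A := fun A hA =>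
    hle' A (by rw [hgen]; exact MeasurableSpace.measurableSet_generateFrom hA)
  have huniv := hx.measure_past_inter hlam hp ht htr (A := univ) MeasurableSet.univ i j
  simp only [univ_inter] at huniv
  have := ext_on_measurableSpace_of_generate_finite (m₀ := inferInstance)
    (μ := P.restrict ({ω | x t ω = ((i : ℕ) : ℝ)} ∩ {ω | x r ω = ((j : ℕ) : ℝ)}))
    (ν := ENNReal.ofReal (transition lam p (r - t) i j) • P.restrict {ω | x t ω = ((i : ℕ) : ℝ)})
    C (fun A hA => by
      rw [Measure.restrict_apply (hCm A hA), Measure.smul_apply,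
        Measure.restrict_apply (hCm A hA), key A hA, smul_eq_mul])
    hle' hgen hpi (by
      rw [Measure.restrict_apply_univ, Measure.smul_apply, Measure.restrict_apply_univ, huniv,
        smul_eq_mul]) hA
  rwa [Measure.restrict_apply (hle' A hA), Measure.smul_apply, Measure.restrict_apply (hle' A hA),
    smul_eq_mul] at this

end IsTwoStateChain

/-! ### Time integrals of right-continuous processes -/

/-- Joint measurability by approximation from the right along finer and finer grids. Truncating
times at `t` means that only the variables `x u` with `u ≤ t` are consulted, so the lemma also
applies with the σ-algebra of the past up to `t`. -/
lemma measurable_clamp {Ω : Type*} [MeasurableSpace Ω] {x : ℝ → Ω → ℝ} {t : ℝ} (ht : 0 ≤ t)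
    (hm : ∀ u ∈ Icc 0 t, Measurable (x u))
    (hr : ∀ ω u, 0 ≤ u → ContinuousWithinAt (fun s => x s ω) (Ici u) u) :
    Measurable fun z : ℝ × Ω => x (min t (max z.1 0)) z.2 := by
  set f : ℕ → ℝ × Ω → ℝ := fun n z =>
    x (min t ((⌊((n : ℝ) + 1) * max z.1 0⌋₊ + 1 : ℝ) / ((n : ℝ) + 1))) z.2 with hf
  refine measurable_of_tendsto_metrizable (f := f) (fun n => ?_) ?_
  · have h1 : Measurable fun w : ℕ × Ω => x (min t (((w.1 : ℝ) + 1) / ((n : ℝ) + 1))) w.2 := by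
      refine measurable_from_prod_countable_right fun k => ?_
      exact hm (min t (((k : ℝ) + 1) / ((n : ℝ) + 1))) ⟨le_min ht (by positivity), min_le_left _ _⟩
    have h2 : Measurable fun z : ℝ × Ω => (⌊((n : ℝ) + 1) * max z.1 0⌋₊, z.2) := by
      fun_prop
    exact h1.comp h2
  · rw [tendsto_pi_nhds]
    intro z
    set u := max z.1 0 with hu
    have hu0 : 0 ≤ u := le_max_right _ _
    have hb : ∀ n : ℕ, u ≤ (⌊((n : ℝ) + 1) * u⌋₊ + 1 : ℝ) / ((n : ℝ) + 1) ∧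
        (⌊((n : ℝ) + 1) * u⌋₊ + 1 : ℝ) / ((n : ℝ) + 1) ≤ u + 1 / ((n : ℝ) + 1) := by
      intro n
      have hn : (0 : ℝ) < (n : ℝ) + 1 := by positivity
      have h1 := Nat.lt_floor_add_one (((n : ℝ) + 1) * u)
      have h2 := Nat.floor_le (a := ((n : ℝ) + 1) * u) (by positivity)
      constructor
      · rw [le_div_iff₀ hn]; nlinarith
      · have h3 : (u + 1 / ((n : ℝ) + 1)) * ((n : ℝ) + 1) = ((n : ℝ) + 1) * u + 1 := by field_simp
        rw [div_le_iff₀ hn, h3]; linarith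
    have hlim : Tendsto (fun n : ℕ => (⌊((n : ℝ) + 1) * u⌋₊ + 1 : ℝ) / ((n : ℝ) + 1)) atTop
        (𝓝 u) := by
      refine tendsto_of_tendsto_of_tendsto_of_le_of_le tendsto_const_nhds ?_
        (fun n => (hb n).1) (fun n => (hb n).2)
      simpa using tendsto_const_nhds.add (tendsto_one_div_add_atTop_nhds_zero_nat (𝕜 := ℝ))
    have hlim' : Tendsto (fun n : ℕ => min t ((⌊((n : ℝ) + 1) * u⌋₊ + 1 : ℝ) / ((n : ℝ) + 1))) atTop
        (𝓝[Ici (min t u)] (min t u)) :=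
      tendsto_nhdsWithin_iff.2 ⟨tendsto_const_nhds.min hlim, Eventually.of_forall fun n =>
        min_le_min le_rfl (hb n).1⟩
    exact (hr z.2 (min t u) (le_min ht hu0)).tendsto.comp hlim'

lemma clamp_eq {t u : ℝ} (hu : u ∈ Icc 0 t) : min t (max u 0) = u := by
  rw [max_eq_left hu.1, min_eq_right hu.2]

lemma measurable_timeIntegral {Ω : Type*} [MeasurableSpace Ω] {x : ℝ → Ω → ℝ} {t : ℝ}
    (hm : ∀ u ∈ Icc 0 t, Measurable (x u))
    (hr : ∀ ω u, 0 ≤ u → ContinuousWithinAt (fun s => x s ω) (Ici u) u) {V : ℝ → ℝ}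
    (hV : Measurable V) {a b : ℝ} (ha : 0 ≤ a) (hab : a ≤ b) (hbt : b ≤ t) :
    Measurable fun ω => ∫ u in a..b, V u * x u ω := by
  have ht : 0 ≤ t := ha.trans (hab.trans hbt)
  have h1 : Measurable fun z : ℝ × Ω => V z.1 * x (min t (max z.1 0)) z.2 :=
    (hV.comp measurable_fst).mul (measurable_clamp ht hm hr)
  have h2 := h1.stronglyMeasurable.integral_prod_left'
    (μ := volume.restrict (Ioc a b))
  have h3 : (fun ω => ∫ u in a..b, V u * x u ω) =
      fun ω => ∫ u in Ioc a b, V u * x (min t (max u 0)) ω := by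
    ext ω
    rw [intervalIntegral.integral_of_le hab]
    refine setIntegral_congr_fun measurableSet_Ioc fun u hu => ?_
    simp only [clamp_eq ⟨ha.trans hu.1.le, hu.2.trans hbt⟩]
  rw [h3]
  exact h2.measurable

/-! ### The Feynman–Kac formula -/

namespace IsTwoStateChain

variable {Ω : Type*} [MeasurableSpace Ω] {P : Measure Ω} {lam p q : ℝ} {x : ℝ → Ω → ℝ}

lemma mem_Icc (hx : IsTwoStateChain P lam p q x) {t : ℝ} (ht : 0 ≤ t) (ω : Ω) :
    x t ω ∈ Icc (0 : ℝ) 1 := by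
  rcases hx.mem_states t ht ω with h | h <;> simp [h]

lemma abs_le_one (hx : IsTwoStateChain P lam p q x) {t : ℝ} (ht : 0 ≤ t) (ω : Ω) :
    |x t ω| ≤ 1 := by
  rcases hx.mem_states t ht ω with h | h <;> simp [h]

lemma measurable_path (hx : IsTwoStateChain P lam p q x) {t : ℝ} (ht : 0 ≤ t) (ω : Ω) :
    Measurable fun u => x (min t (max u 0)) ω :=
  (measurable_clamp ht (fun u hu => hx.measurable u hu.1) hx.right_continuous).comp
    (measurable_id.prodMk measurable_const)

lemma intervalIntegrable (hx : IsTwoStateChain P lam p q x) {V : ℝ → ℝ} (hV : Measurable V) {C : ℝ}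
    (hC : ∀ u, |V u| ≤ C) (ω : Ω) {a b : ℝ} (ha : 0 ≤ a) (hab : a ≤ b) :
    IntervalIntegrable (fun u => V u * x u ω) volume a b := by
  rw [intervalIntegrable_iff_integrableOn_Ioc_of_le hab]
  have hm : Measurable fun u => V u * x (min b (max u 0)) ω :=
    hV.mul (hx.measurable_path (ha.trans hab) ω)
  refine (Measure.integrableOn_of_bounded (M := C) (by simp) hm.aestronglyMeasurable
    (ae_of_all _ fun u => ?_)).congr_fun (fun u hu => ?_) measurableSet_Ioc
  · rw [Real.norm_eq_abs, abs_mul]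
    have h1 := hx.abs_le_one (t := min b (max u 0))
      (le_min (ha.trans hab) (le_max_right _ _)) ω
    have h2 := hC u
    have := abs_nonneg (V u)
    nlinarith
  · simp only [clamp_eq ⟨ha.trans hu.1.le, hu.2⟩]

lemma abs_integral_le (hx : IsTwoStateChain P lam p q x) {V : ℝ → ℝ} {C : ℝ}
    (hC : ∀ u, |V u| ≤ C) (ω : Ω) {a b : ℝ} (ha : 0 ≤ a) (hab : a ≤ b) :
    |∫ u in a..b, V u * x u ω| ≤ C * (b - a) := by
  have := intervalIntegral.norm_integral_le_of_norm_le_const (a := a) (b := b)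
    (f := fun u => V u * x u ω) (C := C) fun u hu => by
      rw [uIoc_of_le hab] at hu
      rw [Real.norm_eq_abs, abs_mul]
      have h1 := hx.abs_le_one (ha.trans hu.1.le) ω
      have h2 := hC u
      have := abs_nonneg (V u)
      nlinarith
  rwa [abs_of_nonneg (sub_nonneg.2 hab)] at this

lemma measurable_past (hx : IsTwoStateChain P lam p q x) {V : ℝ → ℝ} (hV : Measurable V)
    {a b t : ℝ} (ha : 0 ≤ a) (hab : a ≤ b) (hbt : b ≤ t) :
    Measurable[pastSigma x t] fun ω => ∫ u in a..b, V u * x u ω := by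
  refine @measurable_timeIntegral Ω (pastSigma x t) x t (fun u hu => ?_) hx.right_continuous V hV
    a b ha hab hbt
  exact Measurable.of_comap_le (le_iSup₂ (f := fun u (_ : u ∈ Icc (0 : ℝ) t) =>
      MeasurableSpace.comap (x u) inferInstance) u hu)

/-- Restricted to the past σ-algebra, the two measures are proportional by the Markov property,
hence so are the integrals of past-measurable functions. -/
lemma setIntegral_past [IsProbabilityMeasure P] (hlam : 0 ≤ lam) (hp : p ∈ Icc (0 : ℝ) 1)
    (hx : IsTwoStateChain P lam p q x) {t r : ℝ} (ht : 0 ≤ t) (htr : t ≤ r) {Y : Ω → ℝ}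
    (hY : Measurable[pastSigma x t] Y) (i j : Fin 2) :
    ∫ ω in {ω | x t ω = ((i : ℕ) : ℝ)} ∩ {ω | x r ω = ((j : ℕ) : ℝ)}, Y ω ∂P =
      transition lam p (r - t) i j * ∫ ω in {ω | x t ω = ((i : ℕ) : ℝ)}, Y ω ∂P := by
  have hle := hx.pastSigma_le t
  have htrim : (P.restrict ({ω | x t ω = ((i : ℕ) : ℝ)} ∩ {ω | x r ω = ((j : ℕ) : ℝ)})).trim hle =
      (ENNReal.ofReal (transition lam p (r - t) i j) •
        P.restrict {ω | x t ω = ((i : ℕ) : ℝ)}).trim hle := by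
    refine @Measure.ext _ (pastSigma x t) _ _ fun A hA => ?_
    rw [trim_measurableSet_eq hle hA, trim_measurableSet_eq hle hA,
      Measure.restrict_apply (hle A hA), Measure.smul_apply, Measure.restrict_apply (hle A hA),
      smul_eq_mul, hx.measure_past_inter hlam hp ht htr hA]
  have hYs : StronglyMeasurable[pastSigma x t] Y := hY.stronglyMeasurable
  rw [integral_trim hle hYs, htrim, ← integral_trim hle hYs, integral_smul_measure,
    ENNReal.toReal_ofReal (transition_nonneg hlam hp (sub_nonneg.2 htr) i j), smul_eq_mul]

lemma integral_mul_eq_setIntegral (hx : IsTwoStateChain P lam p q x) {t : ℝ} (ht : 0 ≤ t)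
    (Y : Ω → ℝ) :
    ∫ ω, Y ω * x t ω ∂P = ∫ ω in {ω | x t ω = (((1 : Fin 2) : ℕ) : ℝ)}, Y ω ∂P ∧
    ∫ ω, Y ω * (1 - x t ω) ∂P = ∫ ω in {ω | x t ω = (((0 : Fin 2) : ℕ) : ℝ)}, Y ω ∂P := by
  constructor
  · rw [← integral_indicator (hx.measurableSet_state ht 1)]
    congr 1; ext ω
    rcases hx.mem_states t ht ω with h | h <;> simp [Set.indicator, h]
  · rw [← integral_indicator (hx.measurableSet_state ht 0)]
    congr 1; ext ω
    rcases hx.mem_states t ht ω with h | h <;> simp [Set.indicator, h]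

/-- The Markov property in integrated form. -/
lemma integral_past_mul [IsProbabilityMeasure P] (hlam : 0 ≤ lam) (hp : p ∈ Icc (0 : ℝ) 1)
    (hx : IsTwoStateChain P lam p q x) {t r : ℝ} (ht : 0 ≤ t) (htr : t ≤ r) {Y : Ω → ℝ}
    (hY : Measurable[pastSigma x t] Y) (hYi : Integrable Y P) :
    ∫ ω, Y ω * x r ω ∂P =
      (p + (1 - p) * Real.exp (-(lam * (r - t)))) * ∫ ω, Y ω * x t ω ∂P +
      p * (1 - Real.exp (-(lam * (r - t)))) * ∫ ω, Y ω * (1 - x t ω) ∂P := by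
  have hr := ht.trans htr
  have e1 := hx.setIntegral_past hlam hp ht htr hY 1 1
  have e0 := hx.setIntegral_past hlam hp ht htr hY 0 1
  rw [← (hx.integral_mul_eq_setIntegral ht Y).1] at e1
  rw [← (hx.integral_mul_eq_setIntegral ht Y).2] at e0
  simp only [transition_eq, Matrix.of_apply, Matrix.cons_val', Matrix.cons_val_one,
    Matrix.cons_val_zero, Matrix.cons_val_fin_one] at e0 e1
  rw [← e0, ← e1, (hx.integral_mul_eq_setIntegral hr Y).1, inter_comm,
    inter_comm {ω | x t ω = (((0 : Fin 2) : ℕ) : ℝ)}]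
  have hc : {ω | x t ω = (((0 : Fin 2) : ℕ) : ℝ)} = {ω | x t ω = (((1 : Fin 2) : ℕ) : ℝ)}ᶜ := by
    ext ω
    rcases hx.mem_states t ht ω with h | h <;> simp [h]
  rw [hc, ← Set.sdiff_eq]
  exact (integral_inter_add_sdiff (hx.measurableSet_state ht 1) hYi.integrableOn).symm

/-- The Feynman–Kac weight. -/
noncomputable def fkWeight (V : ℝ → ℝ) (x : ℝ → Ω → ℝ) (t : ℝ) (ω : Ω) : ℝ :=
  Real.exp (∫ u in (0 : ℝ)..t, V u * x u ω)

section FeynmanKac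

variable {V : ℝ → ℝ} {C : ℝ}

lemma fkWeight_le (hx : IsTwoStateChain P lam p q x) (hC : ∀ u, |V u| ≤ C) {t : ℝ} (ht : 0 ≤ t)
    (ω : Ω) : fkWeight V x t ω ≤ Real.exp (C * t) := by
  refine Real.exp_le_exp.2 ((le_abs_self _).trans ?_)
  simpa using hx.abs_integral_le hC ω le_rfl ht

lemma fkWeight_sub_le (hx : IsTwoStateChain P lam p q x) (hV : Measurable V)
    (hC : ∀ u, |V u| ≤ C) {t r : ℝ} (ht : 0 ≤ t) (htr : t ≤ r) (ω : Ω) :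
    |fkWeight V x r ω - fkWeight V x t ω| ≤ Real.exp (C * r) * (C * (r - t)) := by
  have hC0 : 0 ≤ C := (abs_nonneg _).trans (hC 0)
  have h1 := (le_abs_self _).trans (hx.abs_integral_le hC ω le_rfl (ht.trans htr))
  have h2 := (le_abs_self _).trans (hx.abs_integral_le hC ω le_rfl ht)
  refine (abs_exp_sub_exp_le (C := C * r) (by simpa using h1)
    (h2.trans (by rw [sub_zero]; gcongr))).trans ?_
  rw [intervalIntegral.integral_interval_sub_left
    (hx.intervalIntegrable hV hC ω le_rfl (ht.trans htr)) (hx.intervalIntegrable hV hC ω le_rfl ht)]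
  gcongr
  exact hx.abs_integral_le hC ω ht htr

lemma measurable_fkWeight (hx : IsTwoStateChain P lam p q x) (hV : Measurable V) {t : ℝ}
    (ht : 0 ≤ t) : Measurable[pastSigma x t] (fkWeight V x t) :=
  Real.measurable_exp.comp (hx.measurable_past hV le_rfl ht le_rfl)

lemma hasDerivWithinAt_fkWeight (hx : IsTwoStateChain P lam p q x) (hV : Measurable V)
    (hC : ∀ u, |V u| ≤ C) {t : ℝ} (hVr : ContinuousWithinAt V (Ici t) t) (ht : 0 ≤ t) (ω : Ω) :
    HasDerivWithinAt (fun r => fkWeight V x r ω) (fkWeight V x t ω * (V t * x t ω)) (Ici t) t := by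
  refine HasDerivWithinAt.exp ?_
  refine intervalIntegral.integral_hasDerivWithinAt_right
    (hx.intervalIntegrable hV hC ω le_rfl ht) ?_
    ((hVr.mul (hx.right_continuous ω t ht)).mono Ioi_subset_Ici_self)
  refine ⟨Ioc t (t + 1), Ioc_mem_nhdsGT (by linarith), ?_⟩
  exact (hx.intervalIntegrable hV hC ω ht (by linarith : t ≤ t + 1)).1.aestronglyMeasurable

/-- The right derivative of the contribution of the growth of the Feynman–Kac weight. -/
lemma hasDerivWithinAt_integral_fkWeight_sub [IsProbabilityMeasure P]
    (hx : IsTwoStateChain P lam p q x) (hV : Measurable V)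
    (hC : ∀ u, |V u| ≤ C) {t : ℝ} (hVr : ContinuousWithinAt V (Ici t) t) (ht : 0 ≤ t)
    {U : Ω → ℝ} (hU : Measurable U) (hUb : ∀ ω, |U ω| ≤ 1) {φ : ℝ → ℝ} (hφ : Continuous φ)
    (hφ1 : ∀ y ∈ Icc (0 : ℝ) 1, |φ y| ≤ 1) :
    HasDerivWithinAt (fun r => ∫ ω, U ω * (fkWeight V x r ω - fkWeight V x t ω) * φ (x r ω) ∂P)
      (∫ ω, U ω * (fkWeight V x t ω * (V t * x t ω)) * φ (x t ω) ∂P) (Ici t) t := by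
  have hC0 : 0 ≤ C := (abs_nonneg _).trans (hC 0)
  have hWm : ∀ r, 0 ≤ r → Measurable (fkWeight V x r) := fun r hr =>
    (hx.measurable_fkWeight hV hr).mono (hx.pastSigma_le r) le_rfl
  rw [hasDerivWithinAt_iff_tendsto_slope, Ici_sdiff_left]
  have heq : ∀ r, slope (fun r => ∫ ω, U ω * (fkWeight V x r ω - fkWeight V x t ω) *
      φ (x r ω) ∂P) t r = ∫ ω, U ω * slope (fun r => fkWeight V x r ω) t r * φ (x r ω) ∂P := by
    intro r
    simp only [slope_def_field, sub_self, mul_zero, zero_mul, integral_zero, sub_zero]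
    rw [← integral_div]
    congr 1; ext ω; ring
  refine Tendsto.congr (fun r => (heq r).symm) ?_
  refine tendsto_integral_filter_of_dominated_convergence
    (fun _ => Real.exp (C * (t + 1)) * C) ?_ ?_ (integrable_const _) ?_
  · filter_upwards [self_mem_nhdsWithin] with r hr
    have hr' : t < r := hr
    simp only [slope_def_field]
    exact ((hU.mul (((hWm r (ht.trans hr'.le)).sub (hWm t ht)).div_const _)).mul
      (hφ.measurable.comp (hx.measurable r (ht.trans hr'.le)))).aestronglyMeasurable
  · filter_upwards [Ioc_mem_nhdsGT (show t < t + 1 by linarith)] with r hr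
    refine ae_of_all _ fun ω => ?_
    have hrt : 0 < r - t := sub_pos.2 hr.1
    have h1 : |slope (fun r => fkWeight V x r ω) t r| ≤ Real.exp (C * (t + 1)) * C := by
      rw [slope_def_field, abs_div, abs_of_pos hrt, div_le_iff₀ hrt]
      refine (hx.fkWeight_sub_le hV hC ht hr.1.le ω).trans ?_
      rw [mul_assoc]
      gcongr
      exact hr.2
    have h2 := hφ1 _ (hx.mem_Icc (ht.trans hr.1.le) ω)
    rw [Real.norm_eq_abs, abs_mul, abs_mul]
    calc _ ≤ 1 * (Real.exp (C * (t + 1)) * C) * 1 := by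
          gcongr
          exact hUb ω
      _ = _ := by ring
  · refine ae_of_all _ fun ω => ?_
    have h1 := hasDerivWithinAt_iff_tendsto_slope.1
      (hx.hasDerivWithinAt_fkWeight hV hC hVr ht ω)
    rw [Ici_sdiff_left] at h1
    have h2 : Tendsto (fun r => φ (x r ω)) (𝓝[>] t) (𝓝 (φ (x t ω))) :=
      (hφ.tendsto _).comp ((hx.right_continuous ω t ht).tendsto.mono_left
        (nhdsWithin_mono _ Ioi_subset_Ici_self))
    exact (h1.const_mul _).mul h2

/-- The weight varies by at most `exp (C * T) * C * (r - t)`; the state changes with probability at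
most `lam * (r - t)`, at a cost of at most `2 * exp (C * T)`. This supplies the continuity required
of a gauge solution. -/
lemma lipschitz_fk [IsProbabilityMeasure P] (hlam : 0 ≤ lam) (hp : p ∈ Icc (0 : ℝ) 1)
    (hx : IsTwoStateChain P lam p q x) (hV : Measurable V)
    (hC : ∀ u, |V u| ≤ C) {U : Ω → ℝ} (hU : Measurable U) (hUb : ∀ ω, |U ω| ≤ 1) {φ : ℝ → ℝ}
    (hφ : Continuous φ) (hφ1 : ∀ y ∈ Icc (0 : ℝ) 1, |φ y| ≤ 1) {t r T : ℝ} (ht : 0 ≤ t)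
    (htr : t ≤ r) (hrT : r ≤ T) :
    |∫ ω, U ω * fkWeight V x r ω * φ (x r ω) ∂P - ∫ ω, U ω * fkWeight V x t ω * φ (x t ω) ∂P| ≤
      Real.exp (C * T) * (C + 2 * lam) * (r - t) := by
  have hC0 : 0 ≤ C := (abs_nonneg _).trans (hC 0)
  have hWm : ∀ r, 0 ≤ r → Measurable (fkWeight V x r) := fun r hr =>
    (hx.measurable_fkWeight hV hr).mono (hx.pastSigma_le r) le_rfl
  have hr := ht.trans htr
  have hint : ∀ r, 0 ≤ r → r ≤ T → Integrable (fun ω => U ω * fkWeight V x r ω * φ (x r ω)) P := by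
    intro r hr hrT
    refine Integrable.of_bound ((hU.mul (hWm r hr)).mul
      (hφ.measurable.comp (hx.measurable r hr))).aestronglyMeasurable (Real.exp (C * T))
      (ae_of_all _ fun ω => ?_)
    have h1 := hx.fkWeight_le hC hr ω
    have h2 : Real.exp (C * r) ≤ Real.exp (C * T) := by gcongr
    have h3 : 0 ≤ fkWeight V x r ω := (Real.exp_pos _).le
    rw [Real.norm_eq_abs, abs_mul, abs_mul, abs_of_nonneg h3]
    calc _ ≤ 1 * Real.exp (C * T) * 1 := by
          gcongr
          · exact hUb ω
          · linarith
          · exact hφ1 _ (hx.mem_Icc hr ω)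
      _ = _ := by ring
  have hne : MeasurableSet {ω | x t ω ≠ x r ω} :=
    (measurableSet_eq_fun (hx.measurable t ht) (hx.measurable r hr)).compl
  rw [← integral_sub (hint r hr hrT) (hint t ht (htr.trans hrT)), ← Real.norm_eq_abs]
  have hbd : ∀ ω, ‖U ω * fkWeight V x r ω * φ (x r ω) - U ω * fkWeight V x t ω * φ (x t ω)‖ ≤
      Real.exp (C * T) * (C * (r - t)) +
        {ω | x t ω ≠ x r ω}.indicator (fun _ => 2 * Real.exp (C * T)) ω := by
    intro ω
    have h1 := hx.fkWeight_sub_le hV hC ht htr ω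
    have h2 : Real.exp (C * r) ≤ Real.exp (C * T) := by gcongr
    have h3 : 0 ≤ fkWeight V x t ω := (Real.exp_pos _).le
    have h4 := hx.fkWeight_le hC ht ω
    have h5 : Real.exp (C * t) ≤ Real.exp (C * T) := by gcongr; exact htr.trans hrT
    have h6 := hφ1 _ (hx.mem_Icc hr ω)
    have h7 := hφ1 _ (hx.mem_Icc ht ω)
    have hsub := sub_nonneg.2 htr
    have e : U ω * fkWeight V x r ω * φ (x r ω) - U ω * fkWeight V x t ω * φ (x t ω) =
        U ω * (fkWeight V x r ω - fkWeight V x t ω) * φ (x r ω) +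
        U ω * fkWeight V x t ω * (φ (x r ω) - φ (x t ω)) := by ring
    rw [e]
    refine (norm_add_le _ _).trans (add_le_add ?_ ?_)
    · rw [Real.norm_eq_abs, abs_mul, abs_mul]
      calc _ ≤ 1 * (Real.exp (C * T) * (C * (r - t))) * 1 := by
            gcongr
            · exact hUb ω
            · exact h1.trans (by gcongr)
        _ = _ := by ring
    · by_cases hxx : x t ω = x r ω
      · have : ω ∉ {ω | x t ω ≠ x r ω} := by simpa using hxx
        rw [indicator_of_notMem this, hxx]
        simp
      · have : ω ∈ {ω | x t ω ≠ x r ω} := hxx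
        rw [indicator_of_mem this, Real.norm_eq_abs, abs_mul, abs_mul, abs_of_nonneg h3]
        calc _ ≤ 1 * Real.exp (C * T) * (1 + 1) := by
              gcongr
              · exact hUb ω
              · exact h4.trans h5
              · exact (abs_sub _ _).trans (add_le_add h6 h7)
          _ = _ := by ring
  refine (norm_integral_le_of_norm_le ((integrable_const _).add
    ((integrable_const _).indicator hne)) (ae_of_all _ hbd)).trans ?_
  rw [integral_add' (integrable_const _) ((integrable_const _).indicator hne), integral_const,
    integral_indicator hne, setIntegral_const, probReal_univ, one_smul, smul_eq_mul]
  have hP : P.real {ω | x t ω ≠ x r ω} ≤ lam * (r - t) := by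
    rw [measureReal_def]
    exact ENNReal.toReal_le_of_le_ofReal (mul_nonneg hlam (sub_nonneg.2 htr))
      (hx.measure_ne_le hlam hp ht htr)
  have := Real.exp_pos (C * T)
  nlinarith

/-- The **Feynman–Kac formula** for the two-state chain, in gauge transformed form. -/
theorem feynmanKac [IsProbabilityMeasure P] (hlam : 0 < lam) (hp : p ∈ Ioo (0 : ℝ) 1)
    (hx : IsTwoStateChain P lam p q x) (hV : Measurable V)
    (hC : ∀ u, |V u| ≤ C) (hVr : ∀ t, 0 ≤ t → ContinuousWithinAt V (Ici t) t) {s : ℝ} (hs : 0 ≤ s)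
    {U : Ω → ℝ} (hU : Measurable[pastSigma x s] U) (hUb : ∀ ω, |U ω| ≤ 1) (T : ℝ) :
    IsGaugeSol (lam * p) (lam * (1 - p)) (fun t => ∫ u in (0 : ℝ)..t, V u) s T (fun t =>
      (∫ ω, U ω * fkWeight V x t ω * (1 - x t ω) ∂P,
        Real.exp (-∫ u in (0 : ℝ)..t, V u) * ∫ ω, U ω * fkWeight V x t ω * x t ω ∂P)) := by
  have hp' : p ∈ Icc (0 : ℝ) 1 := Ioo_subset_Icc_self hp
  have hC0 : 0 ≤ C := (abs_nonneg _).trans (hC 0)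
  have hUm : Measurable U := hU.mono (hx.pastSigma_le s) le_rfl
  have hφ0 : ∀ y ∈ Icc (0 : ℝ) 1, |1 - y| ≤ 1 := fun y hy => by
    rw [abs_of_nonneg (by linarith [hy.2])]; linarith [hy.1]
  have hφ1 : ∀ y ∈ Icc (0 : ℝ) 1, |y| ≤ 1 := fun y hy => by
    rw [abs_of_nonneg hy.1]; exact hy.2
  have hVi : ∀ a b : ℝ, IntervalIntegrable V volume a b := fun a b =>
    (intervalIntegrable_const (c := C)).mono_fun hV.aestronglyMeasurable
      (ae_of_all _ fun u => (hC u).trans (le_abs_self C))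
  have hcont : ∀ φ : ℝ → ℝ, Continuous φ → (∀ y ∈ Icc (0 : ℝ) 1, |φ y| ≤ 1) →
      ContinuousOn (fun t => ∫ ω, U ω * fkWeight V x t ω * φ (x t ω) ∂P) (Icc s T) := by
    intro φ hφ hφb
    set K := Real.exp (C * T) * (C + 2 * lam) with hK
    have hK0 : 0 ≤ K := by positivity
    refine LipschitzOnWith.continuousOn (K := K.toNNReal) ?_
    refine LipschitzOnWith.of_dist_le_mul fun a ha b hb => ?_
    rw [Real.coe_toNNReal _ hK0]
    wlog hab : b ≤ a generalizing a b
    · rw [dist_comm, dist_comm a]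
      exact this b hb a ha (le_of_not_ge hab)
    rw [Real.dist_eq, Real.dist_eq a, abs_of_nonneg (sub_nonneg.2 hab)]
    exact hx.lipschitz_fk hlam.le hp' hV hC hUm hUb hφ hφb (hs.trans hb.1) hab ha.2
  have hΓc : Continuous fun t => ∫ u in (0 : ℝ)..t, V u :=
    intervalIntegral.continuous_primitive hVi 0
  refine ⟨(hcont (fun y => 1 - y) (by fun_prop) hφ0).prodMk
    ((by fun_prop : Continuous fun t => Real.exp (-∫ u in (0 : ℝ)..t, V u)).continuousOn.mul
      (hcont (fun y => y) continuous_id hφ1)), ?_⟩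
  intro t ht
  have ht0 : 0 ≤ t := hs.trans ht.1
  have hWm := hx.measurable_fkWeight hV ht0
  have hle := hx.pastSigma_le t
  -- The weight is frozen at time `t`. The right derivative at `t` is then the sum of the change of
  -- state tested against the past-measurable `Y`, given by the Markov property, and of the growth
  -- of the weight itself.
  set Y : Ω → ℝ := fun ω => U ω * fkWeight V x t ω with hY
  have hYm : Measurable[pastSigma x t] Y :=
    (hU.mono (biSup_mono fun u hu => ⟨hu.1, hu.2.trans ht.1⟩) le_rfl).mul hWm
  have hYi : Integrable Y P := by
    refine Integrable.of_bound (hYm.mono hle le_rfl).aestronglyMeasurable (Real.exp (C * t))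
      (ae_of_all _ fun ω => ?_)
    have h1 := hx.fkWeight_le hC ht0 ω
    have h3 : 0 ≤ fkWeight V x t ω := (Real.exp_pos _).le
    rw [Real.norm_eq_abs, abs_mul, abs_of_nonneg h3]
    calc _ ≤ 1 * Real.exp (C * t) := by
          gcongr
          exact hUb ω
      _ = _ := one_mul _
  set N1 := ∫ ω, Y ω * x t ω ∂P with hN1
  set N0 := ∫ ω, Y ω * (1 - x t ω) ∂P with hN0
  have hbx : ∀ r, 0 ≤ r → Integrable (fun ω => Y ω * x r ω) P := fun r hr =>
    hYi.mul_bdd (c := 1) (hx.measurable r hr).aestronglyMeasurable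
      (ae_of_all _ fun ω => by rw [Real.norm_eq_abs]; exact hx.abs_le_one hr ω)
  have hsum : ∫ ω, Y ω ∂P = N0 + N1 := by
    rw [hN0, hN1, ← integral_add _ (hbx t ht0)]
    · congr 1; ext ω; ring
    · simp_rw [mul_sub, mul_one]
      exact hYi.sub (hbx t ht0)
  have hexp : HasDerivWithinAt (fun r => Real.exp (-(lam * (r - t)))) (-lam) (Ici t) t := by
    have : HasDerivAt (fun r => Real.exp (-(lam * (r - t))))
        (Real.exp (-(lam * (t - t))) * -(lam * 1)) t :=
      (((hasDerivAt_id t).sub_const t).const_mul lam).neg.exp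
    simpa using this.hasDerivWithinAt
  -- the part coming from the jumps
  have hj1 : HasDerivWithinAt (fun r => ∫ ω, Y ω * x r ω ∂P)
      (lam * p * N0 - lam * (1 - p) * N1) (Ici t) t := by
    have hd : HasDerivWithinAt (fun r => (p + (1 - p) * Real.exp (-(lam * (r - t)))) * N1 +
        p * (1 - Real.exp (-(lam * (r - t)))) * N0) (((1 - p) * -lam) * N1 + p * (-(-lam)) * N0)
        (Ici t) t :=
      (((hexp.const_mul (1 - p)).const_add p).mul_const N1).add
        (((hexp.const_sub 1).const_mul p).mul_const N0)
    refine (hd.congr_deriv (by ring)).congr (fun r hr => ?_) ?_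
    · exact hx.integral_past_mul hlam.le hp' ht0 hr hYm hYi
    · exact hx.integral_past_mul hlam.le hp' ht0 le_rfl hYm hYi
  have hj0 : HasDerivWithinAt (fun r => ∫ ω, Y ω * (1 - x r ω) ∂P)
      (-(lam * p * N0 - lam * (1 - p) * N1)) (Ici t) t := by
    have heq : ∀ r ∈ Ici t, ∫ ω, Y ω * (1 - x r ω) ∂P = (N0 + N1) - ∫ ω, Y ω * x r ω ∂P := by
      intro r hr
      rw [← hsum, ← integral_sub hYi (hbx r (ht0.trans hr))]
      congr 1; ext ω; ring
    exact (hj1.const_sub _).congr heq (heq t self_mem_Ici)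
  -- the part coming from the weight
  have hw1 := hx.hasDerivWithinAt_integral_fkWeight_sub hV hC (hVr t ht0) ht0 hUm hUb
    (φ := fun y => y) continuous_id hφ1
  have hw0 := hx.hasDerivWithinAt_integral_fkWeight_sub hV hC (hVr t ht0) ht0 hUm hUb
    (φ := fun y => 1 - y) (by fun_prop) hφ0
  have hw1' : ∫ ω, U ω * (fkWeight V x t ω * (V t * x t ω)) * x t ω ∂P = V t * N1 := by
    rw [hN1, ← integral_const_mul]
    congr 1; ext ω
    rcases hx.mem_states t ht0 ω with h | h <;> simp [h, hY] <;> ring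
  have hw0' : ∫ ω, U ω * (fkWeight V x t ω * (V t * x t ω)) * (1 - x t ω) ∂P = 0 := by
    rw [← integral_zero Ω ℝ]
    congr 1; ext ω
    rcases hx.mem_states t ht0 ω with h | h <;> simp [h]
  rw [hw1'] at hw1
  rw [hw0'] at hw0
  have hsplit : ∀ φ : ℝ → ℝ, Continuous φ → (∀ y ∈ Icc (0 : ℝ) 1, |φ y| ≤ 1) → ∀ r ∈ Ici t,
      ∫ ω, U ω * fkWeight V x r ω * φ (x r ω) ∂P = ∫ ω, Y ω * φ (x r ω) ∂P +
        ∫ ω, U ω * (fkWeight V x r ω - fkWeight V x t ω) * φ (x r ω) ∂P := by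
    intro φ hφ hφb r hr
    have hr0 : 0 ≤ r := ht0.trans hr
    have hbφ : ∀ {Z : Ω → ℝ}, Integrable Z P → Integrable (fun ω => Z ω * φ (x r ω)) P :=
      fun hZ => hZ.mul_bdd (c := 1) (hφ.measurable.comp (hx.measurable r hr0)).aestronglyMeasurable
        (ae_of_all _ fun ω => by rw [Real.norm_eq_abs]; exact hφb _ (hx.mem_Icc hr0 ω))
    rw [← integral_add (hbφ hYi)]
    · congr 1; ext ω; simp only [hY]; ring
    · refine hbφ (Integrable.of_bound (hUm.mul (((hx.measurable_fkWeight hV hr0).mono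
        (hx.pastSigma_le r) le_rfl).sub (hWm.mono hle le_rfl))).aestronglyMeasurable
        (Real.exp (C * r) * (C * (r - t))) (ae_of_all _ fun ω => ?_))
      rw [Real.norm_eq_abs, abs_mul]
      calc _ ≤ 1 * (Real.exp (C * r) * (C * (r - t))) := by
            gcongr
            · exact hUb ω
            · exact hx.fkWeight_sub_le hV hC ht0 hr ω
        _ = _ := one_mul _
  have hd1 : HasDerivWithinAt (fun r => ∫ ω, U ω * fkWeight V x r ω * x r ω ∂P)
      (lam * p * N0 - lam * (1 - p) * N1 + V t * N1) (Ici t) t :=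
    (hj1.add hw1).congr (hsplit (fun y => y) continuous_id hφ1)
      (hsplit (fun y => y) continuous_id hφ1 t self_mem_Ici)
  have hd0 : HasDerivWithinAt (fun r => ∫ ω, U ω * fkWeight V x r ω * (1 - x r ω) ∂P)
      (-(lam * p * N0 - lam * (1 - p) * N1) + 0) (Ici t) t :=
    (hj0.add hw0).congr (hsplit (fun y => 1 - y) (by fun_prop) hφ0)
      (hsplit (fun y => 1 - y) (by fun_prop) hφ0 t self_mem_Ici)
  have hΓ : HasDerivWithinAt (fun r => ∫ u in (0 : ℝ)..r, V u) (V t) (Ici t) t :=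
    intervalIntegral.integral_hasDerivWithinAt_right (hVi 0 t)
      hV.stronglyMeasurable.stronglyMeasurableAtFilter ((hVr t ht0).mono Ioi_subset_Ici_self)
  refine (hd0.prodMk (hΓ.neg.exp.mul hd1)).congr_deriv ?_
  have hee : Real.exp (∫ u in (0 : ℝ)..t, V u) * Real.exp (-∫ u in (0 : ℝ)..t, V u) = 1 := by
    rw [← Real.exp_add]; simp
  ext
  · simp only [gaugeField]
    linear_combination (-(lam * (1 - p) * N1)) * hee
  · simp only [gaugeField]
    change Real.exp (-∫ u in (0 : ℝ)..t, V u) * -V t * N1 +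
      Real.exp (-∫ u in (0 : ℝ)..t, V u) * _ = lam * p * Real.exp (-∫ u in (0 : ℝ)..t, V u) * N0 -
        lam * (1 - p) * (Real.exp (-∫ u in (0 : ℝ)..t, V u) * N1)
    ring

end FeynmanKac

end IsTwoStateChain

/-! ### Gaussian shifts in finite dimension -/

/-- The likelihood of the mean `a` for a Gaussian vector with independent coordinates of
variance `v`. -/
noncomputable def likelihood {n : ℕ} (v : ℝ) (a z : Fin n → ℝ) : ℝ :=
  Real.exp (∑ k, (a k * z k / v - a k ^ 2 / (2 * v)))

/-- The law of a Gaussian vector with independent centred coordinates of variance `v`. -/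
noncomputable abbrev noiseLaw (n : ℕ) (v : ℝ≥0) : Measure (Fin n → ℝ) :=
  Measure.pi fun _ => gaussianReal 0 v

lemma gaussianReal_eq_withDensity {v : ℝ≥0} (hv : v ≠ 0) (a : ℝ) :
    gaussianReal a v = (gaussianReal 0 v).withDensity
      fun z => ENNReal.ofReal (Real.exp (a * z / v - a ^ 2 / (2 * v))) := by
  have hv' : (v : ℝ) ≠ 0 := by exact_mod_cast hv
  rw [gaussianReal_of_var_ne_zero _ hv, gaussianReal_of_var_ne_zero _ hv,
    ← withDensity_mul _ (measurable_gaussianPDF _ _) (by fun_prop)]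
  congr 1
  ext z
  rw [Pi.mul_apply, gaussianPDF, gaussianPDF, ← ENNReal.ofReal_mul (gaussianPDFReal_nonneg _ _ _)]
  congr 1
  rw [gaussianPDFReal, gaussianPDFReal, mul_assoc (√(2 * Real.pi * v))⁻¹, ← Real.exp_add]
  congr 2
  field_simp
  ring

lemma measurable_likelihood {n : ℕ} (v : ℝ) :
    Measurable fun w : (Fin n → ℝ) × (Fin n → ℝ) => likelihood v w.1 w.2 := by
  unfold likelihood; fun_prop

lemma likelihood_pos {n : ℕ} (v : ℝ) (a z : Fin n → ℝ) : 0 < likelihood v a z := Real.exp_pos _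

/-- The Cameron–Martin formula in finite dimension: on boxes both sides are products of
one-dimensional Gaussian integrals. -/
lemma map_add_noiseLaw {n : ℕ} {v : ℝ≥0} (hv : v ≠ 0) (a : Fin n → ℝ) :
    (noiseLaw n v).map (fun z => a + z) =
      (noiseLaw n v).withDensity fun z => ENNReal.ofReal (likelihood v a z) := by
  have h1 : (noiseLaw n v).map (fun z => a + z) = Measure.pi fun k => gaussianReal (a k) v := by
    have := Measure.pi_map_pi (μ := fun _ : Fin n => gaussianReal 0 v)
      (f := fun k (z : ℝ) => a k + z) (fun k => by fun_prop)
    simp only [gaussianReal_map_const_add, zero_add] at this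
    exact this
  rw [h1]
  refine Measure.pi_eq fun s hs => ?_
  have hset : MeasurableSet (Set.pi univ s) := MeasurableSet.univ_pi hs
  rw [withDensity_apply _ hset, ← lintegral_indicator hset]
  have hind : iIndepFun (fun (k : Fin n) (z : Fin n → ℝ) => z k) (noiseLaw n v) :=
    iIndepFun_pi (X := fun _ (y : ℝ) => y) (fun _ => aemeasurable_id)
  have hm : ∀ k : Fin n, Measurable ((s k).indicator
      fun y : ℝ => ENNReal.ofReal (Real.exp (a k * y / v - a k ^ 2 / (2 * v)))) := fun k =>
    Measurable.indicator (by fun_prop) (hs k)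
  have hind' := hind.comp (fun k => (s k).indicator
      fun y : ℝ => ENNReal.ofReal (Real.exp (a k * y / v - a k ^ 2 / (2 * v)))) hm
  have hprod := lintegral_prod_eq_prod_lintegral_of_indepFun Finset.univ _ hind'
    (fun k => (hm k).comp (measurable_pi_apply k))
  have heq : (Set.pi univ s).indicator (fun z => ENNReal.ofReal (likelihood v a z)) = fun z =>
      ∏ k, (s k).indicator
        (fun y : ℝ => ENNReal.ofReal (Real.exp (a k * y / v - a k ^ 2 / (2 * v)))) (z k) := by
    ext z
    by_cases hz : z ∈ Set.pi univ s
    · rw [indicator_of_mem hz, likelihood, Real.exp_sum,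
        ENNReal.ofReal_prod_of_nonneg fun _ _ => (Real.exp_pos _).le]
      exact Finset.prod_congr rfl fun k _ => by rw [indicator_of_mem (hz k (mem_univ k))]
    · rw [indicator_of_notMem hz]
      simp only [Set.mem_pi, mem_univ, true_imp_iff, not_forall] at hz
      obtain ⟨k, hk⟩ := hz
      exact (Finset.prod_eq_zero (Finset.mem_univ k) (indicator_of_notMem hk _)).symm
  rw [heq]
  refine hprod.trans (Finset.prod_congr rfl fun k _ => ?_)
  simp only [Function.comp_def]
  have hmp := measurePreserving_eval (fun _ : Fin n => gaussianReal 0 v) k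
  rw [gaussianReal_eq_withDensity hv (a k), withDensity_apply _ (hs k),
    ← lintegral_indicator (hs k)]
  exact hmp.lintegral_comp (hm k)

lemma lintegral_add_noiseLaw {n : ℕ} {v : ℝ≥0} (hv : v ≠ 0) (a : Fin n → ℝ)
    {ψ : (Fin n → ℝ) → ℝ≥0∞} (hψ : Measurable ψ) :
    ∫⁻ z, ψ (a + z) ∂noiseLaw n v =
      ∫⁻ z, ENNReal.ofReal (likelihood v a z) * ψ z ∂noiseLaw n v := by
  rw [← lintegral_map hψ (by fun_prop : Measurable fun z : Fin n → ℝ => a + z),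
    map_add_noiseLaw hv a]
  exact lintegral_withDensity_eq_lintegral_mul _ (by unfold likelihood; fun_prop) hψ

/-- A lower bound for the probability of a shifted event. -/
lemma noiseLaw_shift_ge {n : ℕ} {v : ℝ≥0} (hv : v ≠ 0) (b : Fin n → ℝ) {κ E : ℝ} (hκ : 0 ≤ κ)
    (hE : 0 < E) (hb : Real.exp (∑ k, b k ^ 2 / v) ≤ E) {A : Set (Fin n → ℝ)}
    (hA : MeasurableSet A) (hκA : ENNReal.ofReal κ ≤ noiseLaw n v A) :
    ENNReal.ofReal (κ ^ 2 / E) ≤ noiseLaw n v {z | b + z ∈ A} := by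
  have h1 : noiseLaw n v {z | b + z ∈ A} =
      ∫⁻ z in A, ENNReal.ofReal (likelihood v b z) ∂noiseLaw n v := by
    have := lintegral_add_noiseLaw hv b (ψ := A.indicator 1) (measurable_one.indicator hA)
    have hm : MeasurableSet {z : Fin n → ℝ | b + z ∈ A} :=
      (by fun_prop : Measurable fun z : Fin n → ℝ => b + z) hA
    rw [← lintegral_indicator_one hm, ← lintegral_indicator hA]
    refine Eq.trans ?_ (this.trans ?_)
    · rfl
    · congr 1; ext z
      by_cases hz : z ∈ A <;> simp [hz]
  have h2 : ∫⁻ z, ENNReal.ofReal (likelihood v (-b) z) ∂noiseLaw n v = 1 := by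
    have := lintegral_add_noiseLaw hv (-b) (ψ := fun _ => 1) measurable_const
    simpa using this.symm
  have hm1 : ∀ c : Fin n → ℝ, Measurable fun z => ENNReal.ofReal (likelihood v c z) := fun c => by
    unfold likelihood; fun_prop
  -- This value maximises `2 * θ * κ - θ ^ 2 * E`, the lower bound obtained below, and the maximum
  -- is `κ ^ 2 / E`.
  set θ := κ / E with hθ
  have hθ0 : 0 ≤ θ := by positivity
  -- Since `likelihood b * (E * likelihood (-b)) ≥ 1`, this is the arithmetic–geometric inequality
  -- `2 * θ ≤ X + θ ^ 2 * Y` for `X * Y ≥ 1`. The reversed likelihood has total mass `1`, so its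
  -- contribution is controlled on every event.
  have hpt : ∀ z, ENNReal.ofReal (2 * θ) ≤ ENNReal.ofReal (likelihood v b z) +
      ENNReal.ofReal (θ ^ 2 * E) * ENNReal.ofReal (likelihood v (-b) z) := by
    intro z
    rw [← ENNReal.ofReal_mul (by positivity), ← ENNReal.ofReal_add (likelihood_pos _ _ _).le
      (mul_nonneg (by positivity) (likelihood_pos _ _ _).le)]
    refine ENNReal.ofReal_le_ofReal ?_
    have hprod : 1 ≤ likelihood v b z * (E * likelihood v (-b) z) := by
      have e : likelihood v b z * likelihood v (-b) z * Real.exp (∑ k, b k ^ 2 / v) = 1 := by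
        rw [likelihood, likelihood, ← Real.exp_add, ← Real.exp_add, ← Finset.sum_add_distrib,
          ← Finset.sum_add_distrib, Real.exp_eq_one_iff]
        refine Finset.sum_eq_zero fun k _ => ?_
        have hv' : (v : ℝ) ≠ 0 := by exact_mod_cast hv
        simp only [Pi.neg_apply]
        field_simp
        ring
      have := mul_pos (likelihood_pos v b z) (likelihood_pos v (-b) z)
      calc 1 = likelihood v b z * likelihood v (-b) z * Real.exp (∑ k, b k ^ 2 / v) := e.symm
        _ ≤ likelihood v b z * likelihood v (-b) z * E := by gcongr
        _ = _ := by ring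
    set X := likelihood v b z
    set Y := E * likelihood v (-b) z with hY
    have hX0 : 0 < X := likelihood_pos _ _ _
    have e : θ ^ 2 * E * likelihood v (-b) z = θ ^ 2 * Y := by rw [hY]; ring
    rw [e]
    by_contra hcon
    push Not at hcon
    have : X * (X + θ ^ 2 * Y) < X * (2 * θ) := by gcongr
    nlinarith [sq_nonneg (X - θ), mul_le_mul_of_nonneg_left hprod (sq_nonneg θ)]
  have h3 : ENNReal.ofReal (2 * θ) * noiseLaw n v A ≤ noiseLaw n v {z | b + z ∈ A} +
      ENNReal.ofReal (θ ^ 2 * E) := by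
    calc ENNReal.ofReal (2 * θ) * noiseLaw n v A
        = ∫⁻ z in A, ENNReal.ofReal (2 * θ) ∂noiseLaw n v := by rw [setLIntegral_const]
      _ ≤ ∫⁻ z in A, (ENNReal.ofReal (likelihood v b z) +
          ENNReal.ofReal (θ ^ 2 * E) * ENNReal.ofReal (likelihood v (-b) z)) ∂noiseLaw n v :=
          lintegral_mono fun z => hpt z
      _ = noiseLaw n v {z | b + z ∈ A} + ENNReal.ofReal (θ ^ 2 * E) *
          ∫⁻ z in A, ENNReal.ofReal (likelihood v (-b) z) ∂noiseLaw n v := by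
          rw [lintegral_add_left (hm1 b), ← h1, lintegral_const_mul _ (hm1 _)]
      _ ≤ _ := by
          gcongr
          refine mul_le_of_le_one_right' ?_
          rw [← h2]
          exact setLIntegral_le_lintegral _ _
  have h4 : ENNReal.ofReal (2 * θ * κ) ≤ noiseLaw n v {z | b + z ∈ A} +
      ENNReal.ofReal (θ ^ 2 * E) := by
    rw [ENNReal.ofReal_mul (by positivity)]
    exact le_trans (by gcongr) h3
  have h5 : κ ^ 2 / E = 2 * θ * κ - θ ^ 2 * E := by rw [hθ]; field_simp; ring
  rw [h5, ENNReal.ofReal_sub _ (by positivity)]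
  exact tsub_le_iff_right.2 h4

/-! ### Bayes' formula for a signal in Gaussian noise -/

section Bayes

variable {Ω : Type*} [MeasurableSpace Ω] {P : Measure Ω} [IsProbabilityMeasure P] {n : ℕ}
  {v : ℝ≥0} {a ξ : Ω → Fin n → ℝ} {U : Ω → ℝ}

/-- Independence allows the noise to be integrated first at a fixed signal; the Gaussian shift
formula moves the signal into the likelihood, and Tonelli exchanges the integrals. This is the
unnormalised form of Bayes' formula. -/
lemma lintegral_signal_noise (hv : v ≠ 0) (ha : Measurable a) (hξ : Measurable ξ)
    (hU : Measurable U) (hlaw : P.map ξ = noiseLaw n v)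
    (hind : IndepFun ξ (fun ω => (U ω, a ω)) P) {ψ : (Fin n → ℝ) → ℝ≥0∞} (hψ : Measurable ψ) :
    ∫⁻ ω, ENNReal.ofReal (U ω) * ψ (a ω + ξ ω) ∂P =
      ∫⁻ z, (∫⁻ ω, ENNReal.ofReal (U ω) * ENNReal.ofReal (likelihood v (a ω) z) ∂P) * ψ z
        ∂noiseLaw n v := by
  have hjoint := (indepFun_iff_map_prod_eq_prod_map_map hξ.aemeasurable
    (hU.prodMk ha).aemeasurable).1 hind
  have hFm : Measurable fun w : (Fin n → ℝ) × (ℝ × (Fin n → ℝ)) =>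
      ENNReal.ofReal w.2.1 * ψ (w.2.2 + w.1) := by
    have h1 : Measurable fun w : (Fin n → ℝ) × (ℝ × (Fin n → ℝ)) => ENNReal.ofReal w.2.1 := by
      fun_prop
    have h2 : Measurable fun w : (Fin n → ℝ) × (ℝ × (Fin n → ℝ)) => w.2.2 + w.1 := by fun_prop
    exact h1.mul (hψ.comp h2)
  have hlm : ∀ c : Fin n → ℝ, Measurable fun z => ENNReal.ofReal (likelihood v c z) := fun c => by
    unfold likelihood; fun_prop
  have hl2 : Measurable fun w : Ω × (Fin n → ℝ) => ENNReal.ofReal (likelihood v (a w.1) w.2) := by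
    have h1 : Measurable fun w : Ω × (Fin n → ℝ) => (a w.1, w.2) :=
      (ha.comp measurable_fst).prodMk measurable_snd
    exact ((measurable_likelihood (n := n) (v : ℝ)).comp h1).ennreal_ofReal
  have hl3 : ∀ z, Measurable fun ω => ENNReal.ofReal (likelihood v (a ω) z) := fun z => by
    unfold likelihood; fun_prop
  have e1 : ∫⁻ ω, ENNReal.ofReal (U ω) * ψ (a ω + ξ ω) ∂P =
      ∫⁻ ω, ∫⁻ z, ENNReal.ofReal (U ω) * ψ (a ω + z) ∂noiseLaw n v ∂P := by
    have s1 := lintegral_map (μ := P) hFm (hξ.prodMk (hU.prodMk ha))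
    rw [hjoint, hlaw, lintegral_prod_symm' _ hFm,
      lintegral_map hFm.lintegral_prod_left' (hU.prodMk ha)] at s1
    exact s1.symm
  have e2 : ∀ ω, ∫⁻ z, ENNReal.ofReal (U ω) * ψ (a ω + z) ∂noiseLaw n v =
      ∫⁻ z, ENNReal.ofReal (U ω) * ENNReal.ofReal (likelihood v (a ω) z) * ψ z
        ∂noiseLaw n v := by
    intro ω
    have h2 : Measurable fun z : Fin n → ℝ => ψ (a ω + z) := by fun_prop
    have h3 : Measurable fun z => ENNReal.ofReal (likelihood v (a ω) z) * ψ z :=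
      (hlm (a ω)).mul hψ
    rw [lintegral_const_mul _ h2, lintegral_add_noiseLaw hv _ hψ, ← lintegral_const_mul _ h3]
    simp only [mul_assoc]
  have hsw : Measurable fun w : Ω × (Fin n → ℝ) =>
      ENNReal.ofReal (U w.1) * ENNReal.ofReal (likelihood v (a w.1) w.2) * ψ w.2 :=
    ((hU.comp measurable_fst).ennreal_ofReal.mul hl2).mul (hψ.comp measurable_snd)
  have e3 : ∫⁻ ω, ∫⁻ z, ENNReal.ofReal (U ω) * ENNReal.ofReal (likelihood v (a ω) z) * ψ z
        ∂noiseLaw n v ∂P =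
      ∫⁻ z, ∫⁻ ω, ENNReal.ofReal (U ω) * ENNReal.ofReal (likelihood v (a ω) z) * ψ z ∂P
        ∂noiseLaw n v := lintegral_lintegral_swap hsw.aemeasurable
  rw [e1, lintegral_congr e2, e3]
  refine lintegral_congr fun z => ?_
  exact lintegral_mul_const _ (hU.ennreal_ofReal.mul (hl3 z))

/-- **Bayes' formula** for a bounded signal observed in finite-dimensional Gaussian noise. -/
theorem condExp_signal (hv : v ≠ 0) (ha : Measurable a) (hξ : Measurable ξ)
    (hU : Measurable U) (hU0 : ∀ ω, U ω ∈ Icc (0 : ℝ) 1) {c : ℝ} (hac : ∀ ω k, |a ω k| ≤ c)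
    (hlaw : P.map ξ = noiseLaw n v) (hind : IndepFun ξ (fun ω => (U ω, a ω)) P) :
    P[U | MeasurableSpace.comap (fun ω => a ω + ξ ω) inferInstance] =ᵐ[P] fun ω =>
      (∫ ω', U ω' * likelihood v (a ω') (a ω + ξ ω) ∂P) /
        (∫ ω', likelihood v (a ω') (a ω + ξ ω) ∂P) := by
  set Y : Ω → Fin n → ℝ := fun ω => a ω + ξ ω with hY
  have hYm : Measurable Y := ha.add hξ
  set ρU : (Fin n → ℝ) → ℝ := fun z => ∫ ω', U ω' * likelihood v (a ω') z ∂P with hρU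
  set ρ : (Fin n → ℝ) → ℝ := fun z => ∫ ω', likelihood v (a ω') z ∂P with hρ
  have hlm : Measurable fun w : (Fin n → ℝ) × Ω => likelihood v (a w.2) w.1 :=
    (measurable_likelihood (n := n) (v : ℝ)).comp
      ((ha.comp measurable_snd).prodMk measurable_fst)
  have hlz : ∀ z, Measurable fun ω => likelihood v (a ω) z := fun z => by
    unfold likelihood; fun_prop
  have hli : ∀ z, Integrable (fun ω => likelihood v (a ω) z) P := by
    intro z
    refine Integrable.of_bound (hlz z).aestronglyMeasurable
      (Real.exp (∑ k, (c * |z k| / v))) (ae_of_all _ fun ω => ?_)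
    rw [Real.norm_eq_abs, abs_of_pos (likelihood_pos _ _ _), likelihood]
    refine Real.exp_le_exp.2 (Finset.sum_le_sum fun k _ => ?_)
    have h1 : a ω k * z k ≤ c * |z k| := by
      refine (le_abs_self _).trans ?_
      rw [abs_mul]
      gcongr
      exact hac ω k
    have h2 : 0 ≤ a ω k ^ 2 / (2 * (v : ℝ)) := by positivity
    have h3 : a ω k * z k / v ≤ c * |z k| / v := by gcongr
    linarith
  have hUi : ∀ z, Integrable (fun ω => U ω * likelihood v (a ω) z) P := fun z =>
    (hli z).bdd_mul (c := 1) hU.aestronglyMeasurable (ae_of_all _ fun ω => by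
      rw [Real.norm_eq_abs, abs_of_nonneg (hU0 ω).1]; exact (hU0 ω).2)
  have hρUm : Measurable ρU := by
    have : Measurable fun w : (Fin n → ℝ) × Ω => U w.2 * likelihood v (a w.2) w.1 :=
      (hU.comp measurable_snd).mul hlm
    exact this.stronglyMeasurable.integral_prod_right'.measurable
  have hρm : Measurable ρ := hlm.stronglyMeasurable.integral_prod_right'.measurable
  have hρpos : ∀ z, 0 < ρ z := fun z => by
    refine (integral_pos_iff_support_of_nonneg (fun ω => (likelihood_pos _ _ _).le) (hli z)).2 ?_
    have : Function.support (fun ω => likelihood v (a ω) z) = univ :=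
      Function.support_eq_univ fun ω => (likelihood_pos _ _ _).ne'
    rw [this]; simp
  have hρU0 : ∀ z, 0 ≤ ρU z := fun z => integral_nonneg fun ω =>
    mul_nonneg (hU0 ω).1 (likelihood_pos _ _ _).le
  have hρUρ : ∀ z, ρU z ≤ ρ z := fun z => integral_mono (hUi z) (hli z) fun ω =>
    mul_le_of_le_one_left (likelihood_pos _ _ _).le (hU0 ω).2
  have e1 : ∀ z, ∫⁻ ω, ENNReal.ofReal (U ω) * ENNReal.ofReal (likelihood v (a ω) z) ∂P =
      ENNReal.ofReal (ρU z) := by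
    intro z
    rw [hρU, ofReal_integral_eq_lintegral_ofReal (hUi z) (ae_of_all _ fun ω =>
      mul_nonneg (hU0 ω).1 (likelihood_pos _ _ _).le)]
    exact lintegral_congr fun ω => (ENNReal.ofReal_mul (hU0 ω).1).symm
  have e2 : ∀ z, ∫⁻ ω, ENNReal.ofReal ((fun _ => 1 : Ω → ℝ) ω) *
      ENNReal.ofReal (likelihood v (a ω) z) ∂P = ENNReal.ofReal (ρ z) := by
    intro z
    rw [hρ, ofReal_integral_eq_lintegral_ofReal (hli z) (ae_of_all _ fun ω =>
      (likelihood_pos _ _ _).le)]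
    exact lintegral_congr fun ω => by simp
  have hind1 : IndepFun ξ (fun ω => ((fun _ => 1 : Ω → ℝ) ω, a ω)) P :=
    hind.comp (φ := id) (ψ := fun w : ℝ × (Fin n → ℝ) => ((1 : ℝ), w.2)) measurable_id
      (by fun_prop)
  have hle : MeasurableSpace.comap Y inferInstance ≤ (inferInstance : MeasurableSpace Ω) :=
    hYm.comap_le
  have hr01 : ∀ z, ρU z / ρ z ∈ Icc (0 : ℝ) 1 := fun z =>
    ⟨div_nonneg (hρU0 z) (hρpos z).le, (div_le_one (hρpos z)).2 (hρUρ z)⟩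
  have hrm : Measurable fun z => ρU z / ρ z := hρUm.div hρm
  have hri : Integrable (fun ω => ρU (Y ω) / ρ (Y ω)) P :=
    Integrable.of_bound (hrm.comp hYm).aestronglyMeasurable 1 (ae_of_all _ fun ω => by
      rw [Real.norm_eq_abs, abs_of_nonneg (hr01 _).1]; exact (hr01 _).2)
  have hUint : Integrable U P := Integrable.of_bound hU.aestronglyMeasurable 1
    (ae_of_all _ fun ω => by rw [Real.norm_eq_abs, abs_of_nonneg (hU0 ω).1]; exact (hU0 ω).2)
  symm
  refine ae_eq_condExp_of_forall_setIntegral_eq hle hUint (fun s _ _ => hri.integrableOn) ?_ ?_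
  · rintro _ ⟨D, hD, rfl⟩ -
    have hDm : MeasurableSet (Y ⁻¹' D) := hYm hD
    rw [integral_eq_lintegral_of_nonneg_ae (ae_of_all _ fun ω => (hr01 _).1)
      hri.integrableOn.aestronglyMeasurable, integral_eq_lintegral_of_nonneg_ae
      (ae_of_all _ fun ω => (hU0 ω).1) hUint.integrableOn.aestronglyMeasurable]
    congr 1
    -- The formula is used twice: for `U` against the indicator of `D`, and for the constant `1`
    -- against the candidate ratio on `D`. Both give the integral of `ρU` over `D` under the noise
    -- law.
    have f1 := lintegral_signal_noise hv ha hξ hU hlaw hind (ψ := D.indicator 1)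
      (measurable_one.indicator hD)
    have f2 := lintegral_signal_noise hv ha hξ (U := fun _ => 1) measurable_const hlaw hind1
      (ψ := D.indicator fun z => ENNReal.ofReal (ρU z / ρ z)) (hrm.ennreal_ofReal.indicator hD)
    rw [← lintegral_indicator hDm, ← lintegral_indicator hDm]
    calc ∫⁻ ω, (Y ⁻¹' D).indicator (fun ω => ENNReal.ofReal (ρU (Y ω) / ρ (Y ω))) ω ∂P
        = ∫⁻ ω, ENNReal.ofReal ((fun _ => 1 : Ω → ℝ) ω) *
            D.indicator (fun z => ENNReal.ofReal (ρU z / ρ z)) (a ω + ξ ω) ∂P := by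
          refine lintegral_congr fun ω => ?_
          rw [ENNReal.ofReal_one, one_mul]
          rfl
      _ = ∫⁻ ω, ENNReal.ofReal (U ω) * D.indicator 1 (a ω + ξ ω) ∂P := by
          rw [f1, f2]
          refine lintegral_congr fun z => ?_
          rw [e1, e2]
          by_cases hz : z ∈ D
          · rw [indicator_of_mem hz, indicator_of_mem hz, ← ENNReal.ofReal_mul (hρpos z).le,
              Pi.one_apply, mul_one, mul_div_cancel₀ _ (hρpos z).ne']
          · rw [indicator_of_notMem hz, indicator_of_notMem hz, mul_zero, mul_zero]
      _ = _ := by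
          refine lintegral_congr fun ω => ?_
          by_cases hω : a ω + ξ ω ∈ D
          · rw [indicator_of_mem hω, indicator_of_mem (show ω ∈ Y ⁻¹' D from hω), Pi.one_apply,
              mul_one]
          · rw [indicator_of_notMem hω, indicator_of_notMem (show ω ∉ Y ⁻¹' D from hω), mul_zero]
  · refine StronglyMeasurable.aestronglyMeasurable (Measurable.stronglyMeasurable ?_)
    exact hrm.comp (comap_measurable Y)

end Bayes

/-! ### Limits of Feynman–Kac functionals -/

namespace IsTwoStateChain

variable {Ω : Type*} [MeasurableSpace Ω] {P : Measure Ω} {lam p q : ℝ} {x : ℝ → Ω → ℝ}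

lemma measure_initial (hx : IsTwoStateChain P lam p q x) :
    P {ω | x 0 ω = 1} = ENNReal.ofReal q := by
  have := hx.law 0 (fun _ => 0) (fun _ => 1) rfl monotone_const
  simpa using this

lemma integral_initial [IsProbabilityMeasure P] (hq : 0 ≤ q) (hx : IsTwoStateChain P lam p q x) :
    ∫ ω, x 0 ω ∂P = q := by
  have h := (hx.integral_mul_eq_setIntegral le_rfl (fun _ => 1)).1
  simp only [one_mul] at h
  rw [h, setIntegral_const, smul_eq_mul, mul_one, measureReal_def]
  have : {ω | x 0 ω = (((1 : Fin 2) : ℕ) : ℝ)} = {ω | x 0 ω = 1} := by simp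
  rw [this, hx.measure_initial, ENNReal.toReal_ofReal hq]

lemma sq_eq (hx : IsTwoStateChain P lam p q x) {t : ℝ} (ht : 0 ≤ t) (ω : Ω) :
    x t ω * x t ω = x t ω := by
  rcases hx.mem_states t ht ω with h | h <;> simp [h]

lemma integrable_mul_fkWeight [IsProbabilityMeasure P] (hx : IsTwoStateChain P lam p q x)
    {V : ℝ → ℝ} {C : ℝ} (hV : Measurable V) (hC : ∀ u, |V u| ≤ C) {t : ℝ} (ht : 0 ≤ t)
    {U : Ω → ℝ} (hU : Measurable U) (hUb : ∀ ω, |U ω| ≤ 1) :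
    Integrable (fun ω => U ω * fkWeight V x t ω) P := by
  have hm : Measurable (fkWeight V x t) := (hx.measurable_fkWeight hV ht).mono (hx.pastSigma_le t)
    le_rfl
  refine Integrable.of_bound (hU.mul hm).aestronglyMeasurable (Real.exp (C * t))
    (ae_of_all _ fun ω => ?_)
  rw [Real.norm_eq_abs, abs_mul]
  have h1 := hx.fkWeight_le hC ht ω
  have h2 : 0 < fkWeight V x t ω := Real.exp_pos _
  rw [abs_of_pos h2]
  calc |U ω| * fkWeight V x t ω ≤ 1 * Real.exp (C * t) := by gcongr; exact hUb ω
    _ = _ := one_mul _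

lemma integral_fkWeight_split [IsProbabilityMeasure P] (hx : IsTwoStateChain P lam p q x)
    {V : ℝ → ℝ} {C : ℝ} (hV : Measurable V) (hC : ∀ u, |V u| ≤ C) {t : ℝ} (ht : 0 ≤ t)
    {U : Ω → ℝ} (hU : Measurable U) (hUb : ∀ ω, |U ω| ≤ 1) :
    ∫ ω, U ω * fkWeight V x t ω ∂P = ∫ ω, U ω * fkWeight V x t ω * (1 - x t ω) ∂P +
      ∫ ω, U ω * fkWeight V x t ω * x t ω ∂P := by
  have hi := hx.integrable_mul_fkWeight hV hC ht hU hUb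
  have hxm := hx.measurable t ht
  rw [← integral_add]
  · exact integral_congr_ae (ae_of_all _ fun ω => by ring)
  · exact hi.mul_bdd (c := 1) (by fun_prop) (ae_of_all _ fun ω => by
      rw [Real.norm_eq_abs, abs_le]; constructor <;> linarith [(hx.mem_Icc ht ω).1, (hx.mem_Icc ht ω).2])
  · exact hi.mul_bdd (c := 1) (by fun_prop) (ae_of_all _ fun ω => hx.abs_le_one ht ω)

/-- Convergence of Feynman-Kac functionals when the primitives of the potentials converge
uniformly. -/
theorem tendsto_feynmanKac [IsProbabilityMeasure P] (hlam : 0 < lam) (hp : p ∈ Ioo (0 : ℝ) 1)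
    (hq : 0 ≤ q) (hx : IsTwoStateChain P lam p q x) {V : ℕ → ℝ → ℝ} (hV : ∀ n, Measurable (V n))
    {C : ℕ → ℝ} (hC : ∀ n u, |V n u| ≤ C n)
    (hVr : ∀ n t, 0 ≤ t → ContinuousWithinAt (V n) (Ici t) t) {s t : ℝ} (hs : 0 ≤ s) (hst : s ≤ t)
    {μ : ℝ → ℝ} (hμ : ContinuousOn μ (Icc 0 t))
    (hunif : TendstoUniformlyOn (fun n r => ∫ u in (0 : ℝ)..r, V n u) μ atTop (Icc 0 t))
    {u z : ℝ → ℝ × ℝ} (hu : IsGaugeSol (lam * p) (lam * (1 - p)) μ 0 t u) (hu0 : u 0 = (1 - q, q))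
    (hz : IsGaugeSol (lam * p) (lam * (1 - p)) μ s t z) (hz0 : z s = (0, (u s).2)) :
    Tendsto (fun n => ∫ ω, fkWeight (V n) x t ω ∂P) atTop
      (𝓝 ((u t).1 + Real.exp (μ t) * (u t).2)) ∧
    Tendsto (fun n => ∫ ω, x s ω * fkWeight (V n) x t ω ∂P) atTop
      (𝓝 ((z t).1 + Real.exp (μ t) * (z t).2)) := by
  have h0 : 0 < lam * p := mul_pos hlam hp.1
  have h1 : 0 < lam * (1 - p) := mul_pos hlam (by linarith [hp.2])
  have ht := hs.trans hst
  set Γ : ℕ → ℝ → ℝ := fun n r => ∫ u in (0 : ℝ)..r, V n u with hΓ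
  have hexp : ∀ r ∈ Icc 0 t, ∀ c : ℝ × ℝ, ∀ F : ℕ → ℝ × ℝ, ∀ I J : ℕ → ℝ,
      (∀ n, F n = (I n, Real.exp (-Γ n r) * J n)) → Tendsto F atTop (𝓝 c) →
      Tendsto (fun n => I n + J n) atTop (𝓝 (c.1 + Real.exp (μ r) * c.2)) := by
    intro r hr c F I J hF hlim
    have e : Tendsto (fun n => Real.exp (Γ n r)) atTop (𝓝 (Real.exp (μ r))) :=
      (Real.continuous_exp.tendsto _).comp (hunif.tendsto_at hr)
    have a1 := (continuous_fst.tendsto c).comp hlim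
    have a2 := (continuous_snd.tendsto c).comp hlim
    refine (a1.add (e.mul a2)).congr fun n => ?_
    simp only [Function.comp_apply, hF]
    rw [← mul_assoc, ← Real.exp_add, add_neg_cancel, Real.exp_zero, one_mul]
  have hone : ∀ ω : Ω, |(fun _ => (1 : ℝ)) ω| ≤ 1 := fun _ => by simp
  set un : ℕ → ℝ → ℝ × ℝ := fun n r => (∫ ω, 1 * fkWeight (V n) x r ω * (1 - x r ω) ∂P,
    Real.exp (-Γ n r) * ∫ ω, 1 * fkWeight (V n) x r ω * x r ω ∂P) with hun
  have hun_sol : ∀ n, IsGaugeSol (lam * p) (lam * (1 - p)) (Γ n) 0 t (un n) := fun n =>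
    hx.feynmanKac hlam hp (hV n) (hC n) (hVr n) le_rfl (U := fun _ => 1) measurable_const hone t
  have hw0 : ∀ n ω, fkWeight (V n) x 0 ω = 1 := fun n ω => by simp [fkWeight]
  have hΓ0 : ∀ n, Γ n 0 = 0 := fun n => by simp [hΓ]
  have hxi : Integrable (x 0) P := Integrable.of_bound (hx.measurable 0 le_rfl).aestronglyMeasurable
    1 (ae_of_all _ fun ω => hx.abs_le_one le_rfl ω)
  have hun0 : ∀ n, un n 0 = u 0 := by
    intro n
    simp only [hun, hw0, hΓ0, one_mul, neg_zero, Real.exp_zero, hx.integral_initial hq, hu0]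
    rw [integral_sub (integrable_const _) hxi, hx.integral_initial hq]
    simp
  have hunt : ∀ r ∈ Icc 0 t, Tendsto (fun n => un n r) atTop (𝓝 (u r)) := by
    intro r hr
    have hsub : Icc 0 r ⊆ Icc 0 t := Icc_subset_Icc_right hr.2
    exact IsGaugeSol.tendsto h0 h1 hr.1 (hμ.mono hsub) (hunif.mono hsub)
      (hu.mono le_rfl hr.2) (fun n => (hun_sol n).mono le_rfl hr.2)
      (by simp only [hun0]; exact tendsto_const_nhds)
  constructor
  · refine (hexp t ⟨ht, le_rfl⟩ (u t) (fun n => un n t) _ _ (fun n => rfl)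
      (hunt t ⟨ht, le_rfl⟩)).congr fun n => ?_
    rw [← hx.integral_fkWeight_split (hV n) (hC n) ht measurable_const hone]
    simp
  · have hxs : Measurable[pastSigma x s] (x s) :=
      Measurable.of_comap_le (le_iSup₂ (f := fun u (_ : u ∈ Icc (0 : ℝ) s) =>
        MeasurableSpace.comap (x u) inferInstance) s ⟨hs, le_rfl⟩)
    -- The factor `x s` selects the trajectories in state `1` at time `s`. As `x s` is idempotent,
    -- the value at `s` is `(0, (un n s).2)`, the datum prescribed for `z` in the limit.
    set zn : ℕ → ℝ → ℝ × ℝ := fun n r => (∫ ω, x s ω * fkWeight (V n) x r ω * (1 - x r ω) ∂P,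
      Real.exp (-Γ n r) * ∫ ω, x s ω * fkWeight (V n) x r ω * x r ω ∂P) with hzn
    have hzn_sol : ∀ n, IsGaugeSol (lam * p) (lam * (1 - p)) (Γ n) s t (zn n) := fun n =>
      hx.feynmanKac hlam hp (hV n) (hC n) (hVr n) hs hxs (fun ω => hx.abs_le_one hs ω) t
    have hzns : ∀ n, zn n s = (0, (un n s).2) := by
      intro n
      simp only [hzn, hun, Prod.mk.injEq]
      constructor
      · refine (integral_congr_ae (ae_of_all _ fun ω => ?_)).trans (integral_zero _ _)
        linear_combination -fkWeight (V n) x s ω * hx.sq_eq hs ω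
      · congr 1
        refine integral_congr_ae (ae_of_all _ fun ω => ?_)
        linear_combination fkWeight (V n) x s ω * hx.sq_eq hs ω
    have hsub : Icc s t ⊆ Icc 0 t := Icc_subset_Icc_left hs
    have hznt : Tendsto (fun n => zn n t) atTop (𝓝 (z t)) := by
      refine IsGaugeSol.tendsto h0 h1 hst (hμ.mono hsub) (hunif.mono hsub) hz hzn_sol ?_
      simp only [hzns, hz0]
      exact tendsto_const_nhds.prodMk_nhds
        ((continuous_snd.tendsto _).comp (hunt s ⟨hs, hst⟩))
    refine (hexp t ⟨ht, le_rfl⟩ (z t) (fun n => zn n t) _ _ (fun n => rfl) hznt).congr fun n => ?_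
    rw [← hx.integral_fkWeight_split (hV n) (hC n) ht (hx.measurable s hs)
      (fun ω => hx.abs_le_one hs ω)]

/-- The perturbed Feynman-Kac functional: a small correction of the exponent is negligible. -/
theorem tendsto_perturbed_feynmanKac [IsProbabilityMeasure P] (hlam : 0 < lam)
    (hp : p ∈ Ioo (0 : ℝ) 1)
    (hq : 0 ≤ q) (hx : IsTwoStateChain P lam p q x) {V : ℕ → ℝ → ℝ} (hV : ∀ n, Measurable (V n))
    {C : ℕ → ℝ} (hC : ∀ n u, |V n u| ≤ C n)
    (hVr : ∀ n t, 0 ≤ t → ContinuousWithinAt (V n) (Ici t) t) {t : ℝ} (ht : 0 ≤ t)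
    {μ : ℝ → ℝ} (hμ : ContinuousOn μ (Icc 0 t))
    (hunif : TendstoUniformlyOn (fun n r => ∫ u in (0 : ℝ)..r, V n u) μ atTop (Icc 0 t))
    {ε : ℕ → Ω → ℝ} (hεm : ∀ n, Measurable (ε n)) {K : ℝ} (hε : ∀ n ω, ε n ω ∈ Icc 0 K)
    (hε0 : Tendsto (fun n => ∫ ω, ε n ω ∂P) atTop (𝓝 0))
    {U : Ω → ℝ} (hU : Measurable U) (hUb : ∀ ω, |U ω| ≤ 1) {L : ℝ}
    (hL : Tendsto (fun n => ∫ ω, U ω * fkWeight (V n) x t ω ∂P) atTop (𝓝 L)) :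
    Tendsto (fun n => ∫ ω, U ω * (fkWeight (V n) x t ω * Real.exp (ε n ω)) ∂P) atTop (𝓝 L) := by
  have h0 : 0 < lam * p := mul_pos hlam hp.1
  have h1 : 0 < lam * (1 - p) := mul_pos hlam (by linarith [hp.2])
  -- second moments
  have hunif2 : TendstoUniformlyOn (fun n r => ∫ u in (0 : ℝ)..r, 2 * V n u) (fun r => 2 * μ r)
      atTop (Icc 0 t) := by
    rw [Metric.tendstoUniformlyOn_iff] at hunif ⊢
    intro e he
    filter_upwards [hunif (e / 2) (by positivity)] with n hn r hr
    have := hn r hr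
    rw [intervalIntegral.integral_const_mul, Real.dist_eq, ← mul_sub, abs_mul, abs_two]
    rw [Real.dist_eq] at this
    linarith
  have hμ2 : ContinuousOn (fun r => 2 * μ r) (Icc 0 t) := by fun_prop
  obtain ⟨u, hu0, hu, -⟩ := exists_isGaugeSol h0 h1 ht hμ2 (1 - q, q)
  obtain ⟨z, hz0, hz, -⟩ := exists_isGaugeSol h0 h1 ht hμ2 (0, (u 0).2)
  have hV2 : ∀ n, Measurable fun r => 2 * V n r := fun n => (hV n).const_mul 2
  have hC2 : ∀ n r, |2 * V n r| ≤ 2 * C n := fun n r => by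
    rw [abs_mul, abs_two]; exact mul_le_mul_of_nonneg_left (hC n r) zero_le_two
  have hM := (hx.tendsto_feynmanKac hlam hp hq hV2 hC2
    (fun n r hr => (hVr n r hr).const_mul 2) le_rfl ht hμ2 hunif2 hu hu0 hz hz0).1
  set M := (u t).1 + Real.exp (2 * μ t) * (u t).2 with hMdef
  have hsq : ∀ n ω, fkWeight (fun r => 2 * V n r) x t ω = fkWeight (V n) x t ω ^ 2 := by
    intro n ω
    rw [fkWeight, fkWeight, ← Real.exp_nat_mul]
    congr 1
    simp only [mul_assoc]
    rw [intervalIntegral.integral_const_mul]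
    simp
  have hMn0 : ∀ n, 0 ≤ ∫ ω, fkWeight (fun r => 2 * V n r) x t ω ∂P := fun n =>
    integral_nonneg fun ω => (Real.exp_pos _).le
  have hM0 : 0 ≤ M := ge_of_tendsto' hM hMn0
  -- the difference
  have hdiff : ∀ n (κ : ℝ), 0 < κ →
      |∫ ω, U ω * (fkWeight (V n) x t ω * Real.exp (ε n ω)) ∂P -
        ∫ ω, U ω * fkWeight (V n) x t ω ∂P| ≤
      κ * ∫ ω, fkWeight (fun r => 2 * V n r) x t ω ∂P +
        (Real.exp K ^ 2 * K / κ) * ∫ ω, ε n ω ∂P := by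
    intro n κ hκ
    have hi1 := hx.integrable_mul_fkWeight (hV n) (hC n) ht hU hUb
    have hi2 : Integrable (fun ω => U ω * (fkWeight (V n) x t ω * Real.exp (ε n ω))) P := by
      simp only [← mul_assoc]
      refine hi1.mul_bdd (c := Real.exp K) ((hεm n).exp.aestronglyMeasurable)
        (ae_of_all _ fun ω => ?_)
      rw [Real.norm_eq_abs, abs_of_pos (Real.exp_pos _)]
      exact Real.exp_le_exp.2 (hε n ω).2
    have hi3 : Integrable (fkWeight (fun r => 2 * V n r) x t) P := by
      have := hx.integrable_mul_fkWeight (hV2 n) (hC2 n) ht (U := fun _ => 1) measurable_const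
        (fun _ => by simp)
      simpa using this
    have hi4 : Integrable (ε n) P := Integrable.of_bound (hεm n).aestronglyMeasurable K
      (ae_of_all _ fun ω => by rw [Real.norm_eq_abs, abs_of_nonneg (hε n ω).1]; exact (hε n ω).2)
    rw [← integral_sub hi2 hi1, ← integral_const_mul, ← integral_const_mul,
      ← integral_add (hi3.const_mul _) (hi4.const_mul _), ← Real.norm_eq_abs]
    refine norm_integral_le_of_norm_le ((hi3.const_mul _).add (hi4.const_mul _))
      (ae_of_all _ fun ω => ?_)
    have hK := (hε n ω).1.trans (hε n ω).2
    have e1 : |Real.exp (ε n ω) - 1| ≤ Real.exp K * ε n ω := by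
      have := abs_exp_sub_exp_le (hε n ω).2 hK
      rwa [Real.exp_zero, sub_zero, abs_of_nonneg (hε n ω).1] at this
    set W := fkWeight (V n) x t ω with hW
    have hW0 : 0 < W := Real.exp_pos _
    rw [hsq, Real.norm_eq_abs]
    set D := Real.exp (ε n ω) - 1 with hD
    have e2 : U ω * (W * Real.exp (ε n ω)) - U ω * W = U ω * (W * D) := by rw [hD]; ring
    have e3 : D ^ 2 ≤ Real.exp K ^ 2 * K * ε n ω := by
      rw [← sq_abs]
      calc |D| ^ 2 ≤ (Real.exp K * ε n ω) ^ 2 := by gcongr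
        _ = Real.exp K ^ 2 * (ε n ω * ε n ω) := by ring
        _ ≤ Real.exp K ^ 2 * (K * ε n ω) := by
          gcongr
          · exact (hε n ω).1
          · exact (hε n ω).2
        _ = _ := by ring
    -- A weighted Young inequality. The weights are not bounded uniformly in `n`, but their second
    -- moments converge, being Feynman–Kac functionals for the doubled potential.
    have e4 : W * |D| ≤ κ * W ^ 2 + D ^ 2 / κ := by
      rw [← sq_abs D, ← sub_nonneg]
      have : κ * W ^ 2 + |D| ^ 2 / κ - W * |D| =
          ((κ * W - |D| / 2) ^ 2 + 3 / 4 * |D| ^ 2) / κ := by field_simp; ring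
      rw [this]; positivity
    rw [e2, abs_mul, abs_mul, abs_of_pos hW0]
    calc |U ω| * (W * |D|) ≤ 1 * (κ * W ^ 2 + D ^ 2 / κ) := by
          gcongr; exact hUb ω
      _ ≤ κ * W ^ 2 + (Real.exp K ^ 2 * K * ε n ω) / κ := by rw [one_mul]; gcongr
      _ = _ := by ring
  have hlim : Tendsto (fun n => ∫ ω, U ω * (fkWeight (V n) x t ω * Real.exp (ε n ω)) ∂P -
      ∫ ω, U ω * fkWeight (V n) x t ω ∂P) atTop (𝓝 0) := by
    rw [Metric.tendsto_nhds]
    intro e he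
    -- The limit `κ * M` of the second-moment term is then below `e`; the other term vanishes for
    -- fixed `κ` because the mean correction tends to `0`.
    set κ := e / (2 * (M + 1)) with hκ
    have hκ0 : 0 < κ := by positivity
    have hb : Tendsto (fun n => κ * ∫ ω, fkWeight (fun r => 2 * V n r) x t ω ∂P +
        (Real.exp K ^ 2 * K / κ) * ∫ ω, ε n ω ∂P) atTop
        (𝓝 (κ * M + (Real.exp K ^ 2 * K / κ) * 0)) :=
      (hM.const_mul _).add (hε0.const_mul _)
    have hlt : κ * M + (Real.exp K ^ 2 * K / κ) * 0 < e := by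
      have : κ * M = e * (M / (2 * (M + 1))) := by rw [hκ]; ring
      rw [mul_zero, add_zero, this]
      have h2 : M / (2 * (M + 1)) < 1 := by rw [div_lt_one (by positivity)]; linarith
      nlinarith
    filter_upwards [hb.eventually_lt_const hlt] with n hn
    rw [Real.dist_eq, sub_zero]
    exact (hdiff n κ hκ0).trans_lt hn
  have := hlim.add hL
  simpa using this

end IsTwoStateChain

/-! ### Step functions on a regular grid -/

/-- The step function with value `w k` on `[k h, (k+1) h)`. -/
noncomputable def stepFun (h : ℝ) (w : ℕ → ℝ) (u : ℝ) : ℝ := w ⌊u / h⌋₊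

/-- The increments of `c` along the grid of mesh `h`. -/
def gridIncrement (c : ℝ → ℝ) (h : ℝ) (N : ℕ) : Fin N → ℝ := fun k =>
  c (((k : ℕ) + 1 : ℝ) * h) - c ((k : ℕ) * h)

section StepFun

variable {h : ℝ} {w : ℕ → ℝ}

lemma measurable_stepFun : Measurable (stepFun h w) :=
  (measurable_from_nat (f := w)).comp (Nat.measurable_floor.comp (measurable_id.div_const h))

lemma stepFun_eq (hh : 0 < h) {k : ℕ} {u : ℝ} (hu : u ∈ Ico (k * h) ((k + 1 : ℝ) * h)) :
    stepFun h w u = w k := by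
  have h0 : 0 ≤ u / h := div_nonneg ((by positivity : (0 : ℝ) ≤ k * h).trans hu.1) hh.le
  rw [stepFun, (Nat.floor_eq_iff h0).2 ⟨(le_div_iff₀ hh).2 hu.1, (div_lt_iff₀ hh).2 hu.2⟩]

lemma continuousWithinAt_stepFun (hh : 0 < h) {t : ℝ} (ht : 0 ≤ t) :
    ContinuousWithinAt (stepFun h w) (Ici t) t := by
  set k := ⌊t / h⌋₊ with hk
  have h1 : (k : ℝ) ≤ t / h := Nat.floor_le (by positivity)
  have h2 : t / h < k + 1 := Nat.lt_floor_add_one _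
  rw [le_div_iff₀ hh] at h1
  rw [div_lt_iff₀ hh] at h2
  have hev : stepFun h w =ᶠ[𝓝[≥] t] fun _ => w k := by
    filter_upwards [self_mem_nhdsWithin, mem_nhdsWithin_of_mem_nhds (Iio_mem_nhds h2)] with u hu hu'
    exact stepFun_eq hh ⟨h1.trans hu, hu'⟩
  exact (continuousWithinAt_const (b := w k)).congr_of_eventuallyEq hev
    (stepFun_eq hh ⟨h1, h2⟩)

lemma integral_stepFun_cell (hh : 0 < h) (f : ℝ → ℝ) {k : ℕ} {r : ℝ} (h1 : k * h ≤ r)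
    (h2 : r ≤ (k + 1 : ℝ) * h) :
    ∫ u in (k * h)..r, stepFun h w u * f u = w k * ∫ u in (k * h)..r, f u := by
  rw [← intervalIntegral.integral_const_mul]
  refine intervalIntegral.integral_congr_Ioo_of_le h1 fun u hu => ?_
  rw [stepFun_eq hh ⟨hu.1.le, hu.2.trans_le h2⟩]

lemma integral_stepFun_mul (hh : 0 < h) (f : ℝ → ℝ) (N : ℕ)
    (hint : ∀ k < N, IntervalIntegrable (fun u => stepFun h w u * f u) volume (k * h)
      ((k + 1 : ℝ) * h)) :
    ∫ u in (0 : ℝ)..(N * h), stepFun h w u * f u =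
      ∑ k ∈ Finset.range N, w k * ∫ u in (k * h)..((k + 1 : ℝ) * h), f u := by
  have := intervalIntegral.sum_integral_adjacent_intervals (a := fun k : ℕ => (k : ℝ) * h) (n := N)
    (f := fun u => stepFun h w u * f u) (μ := volume) fun k hk => by simpa using hint k hk
  simp only [Nat.cast_zero, zero_mul, Nat.cast_add, Nat.cast_one] at this
  rw [← this]
  refine Finset.sum_congr rfl fun k _ => integral_stepFun_cell hh f ?_ le_rfl
  nlinarith

lemma intervalIntegrable_stepFun {C : ℝ} (hC : ∀ k, |w k| ≤ C) (a b : ℝ) :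
    IntervalIntegrable (stepFun h w) volume a b := by
  rw [intervalIntegrable_iff]
  refine Measure.integrableOn_of_bounded (M := C) (by simp)
    measurable_stepFun.aestronglyMeasurable (ae_of_all _ fun u => hC _)

/-- The potential on the grid attached to the observed path `c`. -/
noncomputable def gridPotential (γ : ℝ) (c : ℝ → ℝ) (h : ℝ) (N : ℕ) (k : ℕ) : ℝ :=
  if k < N then γ * (c ((k + 1 : ℝ) * h) - c (k * h)) / h - γ / 2 else 0

lemma abs_gridPotential_le (γ : ℝ) (c : ℝ → ℝ) (h : ℝ) (N k : ℕ) :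
    |gridPotential γ c h N k| ≤ ∑ j ∈ Finset.range N, |gridPotential γ c h N j| := by
  by_cases hk : k < N
  · exact Finset.single_le_sum (f := fun j => |gridPotential γ c h N j|)
      (fun j _ => abs_nonneg _) (Finset.mem_range.2 hk)
  · rw [gridPotential, if_neg hk, abs_zero]
    exact Finset.sum_nonneg fun j _ => abs_nonneg _

/-- Telescoping: the potential is designed so that its primitive equals the log-gauge path at the
grid points. -/
lemma integral_gridPotential (hh : 0 < h) (γ : ℝ) (c : ℝ → ℝ) {N k : ℕ} (hk : k ≤ N) :
    ∫ u in (0 : ℝ)..(k * h), stepFun h (gridPotential γ c h N) u =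
      γ * (c (k * h) - c 0) - γ / 2 * (k * h) := by
  have := integral_stepFun_mul (w := gridPotential γ c h N) hh (fun _ => 1) k fun j _ => by
    simpa using intervalIntegrable_stepFun (abs_gridPotential_le γ c h N) _ _
  simp only [mul_one] at this
  rw [this]
  clear this
  induction k with
  | zero => simp
  | succ k ih =>
    rw [Finset.sum_range_succ, ih (by omega), gridPotential, if_pos (by omega)]
    simp
    field_simp
    ring

lemma exists_cell (hh : 0 < h) {N : ℕ} (hN : 0 < N) {r : ℝ} (hr : r ∈ Icc 0 (N * h)) :
    ∃ k < N, (k : ℝ) * h ≤ r ∧ r ≤ (k + 1 : ℝ) * h := by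
  rcases hr.2.eq_or_lt with h1 | h1
  · refine ⟨N - 1, by omega, ?_, ?_⟩ <;> rw [Nat.cast_sub hN, h1] <;> push_cast <;> nlinarith
  · refine ⟨⌊r / h⌋₊, ?_, ?_, ?_⟩
    · rw [Nat.floor_lt (div_nonneg hr.1 hh.le), div_lt_iff₀ hh]; exact h1
    · rw [← le_div_iff₀ hh]; exact Nat.floor_le (div_nonneg hr.1 hh.le)
    · rw [← div_le_iff₀ hh]; exact (Nat.lt_floor_add_one _).le

/-- Inside a cell the primitive interpolates the log-gauge path linearly; the term linear in time
cancels exactly, so the error is `γ` times the oscillation of `c` over one mesh. -/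
lemma abs_integral_gridPotential_sub_le (hh : 0 < h) {γ : ℝ} (hγ : 0 ≤ γ) {c : ℝ → ℝ}
    (hc0 : c 0 = 0) {N : ℕ} (hN : 0 < N) {e : ℝ}
    (hc : ∀ a ∈ Icc 0 (N * h), ∀ b ∈ Icc 0 (N * h), |a - b| ≤ h → |c a - c b| ≤ e)
    {r : ℝ} (hr : r ∈ Icc 0 (N * h)) :
    |(∫ u in (0 : ℝ)..r, stepFun h (gridPotential γ c h N) u) - (γ * c r - γ * r / 2)| ≤ γ * e := by
  obtain ⟨k, hk, h1, h2⟩ := exists_cell hh hN hr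
  have hii := fun a b : ℝ => intervalIntegrable_stepFun (h := h) (abs_gridPotential_le γ c h N) a b
  rw [← intervalIntegral.integral_add_adjacent_intervals (hii 0 (k * h)) (hii _ _),
    integral_gridPotential hh γ c hk.le, hc0]
  have e1 := integral_stepFun_cell (w := gridPotential γ c h N) hh (fun _ => 1) h1 h2
  simp only [mul_one, intervalIntegral.integral_const, smul_eq_mul] at e1
  rw [e1, gridPotential, if_pos hk]
  set θ := (r - k * h) / h with hθ
  have hθ0 : 0 ≤ θ := div_nonneg (by linarith) hh.le
  have hθ1 : θ ≤ 1 := (div_le_one hh).2 (by linarith)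
  have hkN : ((k : ℝ) + 1) * h ≤ N * h := by
    gcongr; exact_mod_cast hk
  have hk0 : 0 ≤ (k : ℝ) * h := by positivity
  have b1 := hc (k * h) ⟨hk0, by linarith⟩ r hr (by rw [abs_le]; constructor <;> linarith)
  have b2 := hc ((k + 1 : ℝ) * h) ⟨by linarith, hkN⟩ r hr (by rw [abs_le]; constructor <;> linarith)
  have e2 : γ * (c (k * h) - 0) - γ / 2 * (k * h) + (γ * (c ((k + 1 : ℝ) * h) - c (k * h)) / h
      - γ / 2) * (r - k * h) - (γ * c r - γ * r / 2) =
      γ * ((1 - θ) * (c (k * h) - c r) + θ * (c ((k + 1 : ℝ) * h) - c r)) := by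
    rw [hθ]; field_simp; ring
  rw [e2, abs_mul, abs_of_nonneg hγ]
  refine mul_le_mul_of_nonneg_left ?_ hγ
  calc |(1 - θ) * (c (k * h) - c r) + θ * (c ((k + 1 : ℝ) * h) - c r)|
      ≤ |(1 - θ) * (c (k * h) - c r)| + |θ * (c ((k + 1 : ℝ) * h) - c r)| := abs_add_le _ _
    _ = (1 - θ) * |c (k * h) - c r| + θ * |c ((k + 1 : ℝ) * h) - c r| := by
        rw [abs_mul, abs_mul, abs_of_nonneg hθ0, abs_of_nonneg (by linarith : 0 ≤ 1 - θ)]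
    _ ≤ (1 - θ) * e + θ * e := by
        gcongr
    _ = e := by ring

lemma tendstoUniformlyOn_gridPotential {γ t : ℝ} (hγ : 0 < γ) (ht : 0 < t) {c : ℝ → ℝ}
    (hc : ContinuousOn c (Icc 0 t)) (hc0 : c 0 = 0) :
    TendstoUniformlyOn (fun (n : ℕ) r => ∫ u in (0 : ℝ)..r,
      stepFun (t / 2 ^ n) (gridPotential γ c (t / 2 ^ n) (2 ^ n)) u)
      (fun r => γ * c r - γ * r / 2) atTop (Icc 0 t) := by
  have huc : UniformContinuousOn c (Icc 0 t) := isCompact_Icc.uniformContinuousOn_of_continuous hc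
  rw [Metric.uniformContinuousOn_iff] at huc
  rw [Metric.tendstoUniformlyOn_iff]
  intro e he
  obtain ⟨d, hd, hcd⟩ := huc (e / (2 * γ)) (by positivity)
  have hlim : Tendsto (fun n : ℕ => t / (2 : ℝ) ^ n) atTop (𝓝 0) :=
    tendsto_const_nhds.div_atTop (tendsto_pow_atTop_atTop_of_one_lt one_lt_two)
  filter_upwards [hlim.eventually_lt_const hd] with n hn r hr
  have hNh : ((2 ^ n : ℕ) : ℝ) * (t / 2 ^ n) = t := by push_cast; field_simp
  have := abs_integral_gridPotential_sub_le (h := t / 2 ^ n) (by positivity) hγ.le hc0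
    (N := 2 ^ n) (by positivity) (e := e / (2 * γ)) (by
      rw [hNh]
      intro a ha b hb hab
      have := hcd a ha b hb (by rw [Real.dist_eq]; exact hab.trans_lt hn)
      rw [Real.dist_eq] at this
      exact this.le) (r := r) (by rwa [hNh])
  rw [dist_comm, Real.dist_eq]
  refine this.trans_lt ?_
  have : γ * (e / (2 * γ)) = e / 2 := by field_simp
  rw [this]; linarith

end StepFun

/-! ### The likelihood on the grid -/

namespace IsTwoStateChain

variable {Ω : Type*} [MeasurableSpace Ω] {P : Measure Ω} {lam p q : ℝ} {x : ℝ → Ω → ℝ}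

/-- The time spent at `1` in each cell of the grid of mesh `h`. -/
noncomputable def cellIntegral (x : ℝ → Ω → ℝ) (h : ℝ) (N : ℕ) (ω : Ω) : Fin N → ℝ := fun k =>
  ∫ u in ((k : ℕ) * h)..(((k : ℕ) + 1 : ℝ) * h), x u ω

lemma intervalIntegrable_path (hx : IsTwoStateChain P lam p q x) (ω : Ω) {a b : ℝ} (ha : 0 ≤ a)
    (hab : a ≤ b) : IntervalIntegrable (fun u => x u ω) volume a b := by
  simpa using hx.intervalIntegrable (V := fun _ => 1) measurable_const (C := 1) (by simp) ω ha hab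

lemma integral_mem (hx : IsTwoStateChain P lam p q x) (ω : Ω) {a b : ℝ} (ha : 0 ≤ a)
    (hab : a ≤ b) : ∫ u in a..b, x u ω ∈ Icc 0 (b - a) := by
  constructor
  · exact intervalIntegral.integral_nonneg hab fun u hu => (hx.mem_Icc (ha.trans hu.1) ω).1
  · have := hx.abs_integral_le (V := fun _ => 1) (C := 1) (by simp) ω ha hab
    simp only [one_mul] at this
    exact (le_abs_self _).trans this

lemma cellIntegral_mem (hx : IsTwoStateChain P lam p q x) {h : ℝ} (hh : 0 ≤ h) {N : ℕ} (k : Fin N)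
    (ω : Ω) : cellIntegral x h N ω k ∈ Icc 0 h := by
  have := hx.integral_mem ω (a := (k : ℕ) * h) (b := ((k : ℕ) + 1 : ℝ) * h) (by positivity)
    (by gcongr; linarith)
  have e : ((k : ℕ) + 1 : ℝ) * h - (k : ℕ) * h = h := by ring
  rwa [e] at this

lemma measurable_cellIntegral_past (hx : IsTwoStateChain P lam p q x) {h : ℝ} (hh : 0 ≤ h) {N : ℕ}
    {t : ℝ} (hNt : N * h ≤ t) : Measurable[pastSigma x t] (cellIntegral x h N) := by
  refine @measurable_pi_lambda _ _ _ (pastSigma x t) _ _ fun k => ?_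
  have hk : (((k : ℕ) + 1 : ℝ)) * h ≤ t :=
    le_trans (mul_le_mul_of_nonneg_right (by exact_mod_cast k.2) hh) hNt
  have := hx.measurable_past (V := fun _ => 1) measurable_const (a := (k : ℕ) * h)
    (b := ((k : ℕ) + 1 : ℝ) * h) (t := t) (by positivity) (by gcongr; linarith) hk
  simp only [one_mul] at this
  exact this

lemma measurable_cellIntegral (hx : IsTwoStateChain P lam p q x) {h : ℝ} (hh : 0 ≤ h) {N : ℕ} :
    Measurable (cellIntegral x h N) :=
  (hx.measurable_cellIntegral_past hh le_rfl).mono (hx.pastSigma_le _) le_rfl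

/-- The correction between the likelihood on the grid and the Feynman-Kac weight. -/
noncomputable def gridCorrection (γ : ℝ) (x : ℝ → Ω → ℝ) (h : ℝ) (N : ℕ) (ω : Ω) : ℝ :=
  γ / 2 * ∑ k : Fin N, (cellIntegral x h N ω k - cellIntegral x h N ω k ^ 2 / h)

/-- With variance `h / γ`, the likelihood exponent of a cell is `γ (a z - a ^ 2 / 2) / h`, where `a`
is the time spent at `1`, whereas the potential contributes `(γ z / h - γ / 2) a`. Their difference
`γ / 2 * (a - a ^ 2 / h)` vanishes when the chain is constant on the cell. -/
lemma likelihood_grid (hx : IsTwoStateChain P lam p q x) {h γ : ℝ} (hh : 0 < h) (hγ : 0 < γ)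
    (c : ℝ → ℝ) (N : ℕ) (ω : Ω) :
    likelihood (h / γ) (cellIntegral x h N ω) (gridIncrement c h N) =
      fkWeight (stepFun h (gridPotential γ c h N)) x (N * h) ω *
        Real.exp (gridCorrection γ x h N ω) := by
  rw [likelihood, fkWeight, ← Real.exp_add, integral_stepFun_mul hh, gridCorrection,
    Finset.sum_range, Finset.mul_sum, ← Finset.sum_add_distrib]
  · congr 1
    refine Finset.sum_congr rfl fun k _ => ?_
    rw [gridPotential, if_pos k.2]
    simp only [cellIntegral, gridIncrement]
    field_simp
    ring
  · intro k _
    exact hx.intervalIntegrable measurable_stepFun (fun u => abs_gridPotential_le γ c h N _) ω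
      (by positivity) (by gcongr; linarith)

lemma gridCorrection_mem (hx : IsTwoStateChain P lam p q x) {h γ : ℝ} (hh : 0 < h) (hγ : 0 < γ)
    (N : ℕ) (ω : Ω) : gridCorrection γ x h N ω ∈ Icc 0 (γ / 2 * (N * h)) := by
  have h1 : ∀ k : Fin N, cellIntegral x h N ω k - cellIntegral x h N ω k ^ 2 / h ∈ Icc 0 h := by
    intro k
    obtain ⟨h2, h3⟩ := hx.cellIntegral_mem hh.le k ω
    have h4 : cellIntegral x h N ω k ^ 2 / h ≤ cellIntegral x h N ω k := by
      rw [div_le_iff₀ hh, sq]; gcongr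
    have h5 : 0 ≤ cellIntegral x h N ω k ^ 2 / h := by positivity
    constructor <;> linarith
  rw [gridCorrection]
  constructor
  · exact mul_nonneg (by positivity) (Finset.sum_nonneg fun k _ => (h1 k).1)
  · gcongr
    refine (Finset.sum_le_sum fun k _ => (h1 k).2).trans ?_
    simp

lemma measurable_gridCorrection (hx : IsTwoStateChain P lam p q x) {h γ : ℝ} (hh : 0 ≤ h) (N : ℕ) :
    Measurable (gridCorrection γ x h N) := by
  have : ∀ k, Measurable fun ω => cellIntegral x h N ω k := fun k =>
    (measurable_pi_apply k).comp (hx.measurable_cellIntegral hh)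
  unfold gridCorrection
  fun_prop

/-- With `A` the time spent at `1`, `A - A ^ 2 / h = A (1 - A / h)` is at most the time spent in the
cell away from the state at its left end. By continuity in probability the mean of that time is at
most `h` times `lam * h`. -/
lemma integral_sub_sq_le [IsProbabilityMeasure P] (hlam : 0 ≤ lam) (hp : p ∈ Icc (0 : ℝ) 1)
    (hx : IsTwoStateChain P lam p q x) {a h : ℝ} (ha : 0 ≤ a) (hh : 0 < h) :
    ∫ ω, ((∫ u in a..(a + h), x u ω) - (∫ u in a..(a + h), x u ω) ^ 2 / h) ∂P ≤ lam * h * h := by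
  have hab : a ≤ a + h := by linarith
  have hb : 0 ≤ a + h := by linarith
  have hcl := measurable_clamp hb (fun u hu => hx.measurable u hu.1) hx.right_continuous
  set f : Ω → ℝ → ℝ := fun ω u => |x (min (a + h) (max u 0)) ω - x a ω| with hf
  have hfm : Measurable (Function.uncurry f) := by
    have h1 : Measurable fun z : Ω × ℝ => x (min (a + h) (max z.2 0)) z.1 :=
      hcl.comp (measurable_snd.prodMk measurable_fst)
    have h2 : Measurable fun z : Ω × ℝ => x a z.1 := (hx.measurable a ha).comp measurable_fst
    exact (h1.sub h2).abs
  have hmin : ∀ u, 0 ≤ min (a + h) (max u 0) := fun u => le_min hb (le_max_right _ _)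
  have hf1 : ∀ ω u, f ω u ∈ Icc (0 : ℝ) 1 := fun ω u => ⟨abs_nonneg _, by
    have h1 := hx.mem_Icc (hmin u) ω
    have h2 := hx.mem_Icc ha ω
    rw [hf, abs_le]; constructor <;> linarith [h1.1, h1.2, h2.1, h2.2]⟩
  have hfi : Integrable (Function.uncurry f) (P.prod (volume.restrict (Ioc a (a + h)))) :=
    Integrable.of_bound hfm.aestronglyMeasurable 1 (ae_of_all _ fun z => by
      rw [Real.norm_eq_abs, Function.uncurry, abs_of_nonneg (hf1 _ _).1]; exact (hf1 _ _).2)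
  have hcell : ∀ ω, (∫ u in a..(a + h), x u ω) - (∫ u in a..(a + h), x u ω) ^ 2 / h ≤
      ∫ u in Ioc a (a + h), f ω u := by
    intro ω
    obtain ⟨A0, A1⟩ := hx.integral_mem ω ha hab
    set A := ∫ u in a..(a + h), x u ω with hA
    have A1' : A ≤ h := by linarith
    have hq0 : 0 ≤ A ^ 2 / h := by positivity
    rcases hx.mem_states a ha ω with h0 | h0
    · have : ∫ u in Ioc a (a + h), f ω u = A := by
        rw [hA, intervalIntegral.integral_of_le hab]
        refine setIntegral_congr_fun measurableSet_Ioc fun u hu => ?_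
        have hu0 : 0 ≤ u := ha.trans hu.1.le
        simp only [hf]
        rw [clamp_eq ⟨hu0, hu.2⟩, h0, sub_zero, abs_of_nonneg (hx.mem_Icc hu0 ω).1]
      rw [this]; linarith
    · have : ∫ u in Ioc a (a + h), f ω u = h - A := by
        have : h - A = ∫ u in a..(a + h), (1 - x u ω) := by
          rw [intervalIntegral.integral_sub (by simp) (hx.intervalIntegrable_path ω ha hab)]
          simp [hA]
        rw [this, intervalIntegral.integral_of_le hab]
        refine setIntegral_congr_fun measurableSet_Ioc fun u hu => ?_
        have hu0 : 0 ≤ u := ha.trans hu.1.le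
        simp only [hf]
        rw [clamp_eq ⟨hu0, hu.2⟩, h0, abs_sub_comm, abs_of_nonneg]
        linarith [(hx.mem_Icc hu0 ω).2]
      rw [this]
      have : A - A ^ 2 / h = (h - A) * (A / h) := by field_simp
      rw [this]
      refine mul_le_of_le_one_right (by linarith) ((div_le_one hh).2 A1')
  have hAm : Measurable fun ω => ∫ u in a..(a + h), x u ω := by
    have := (hx.measurable_past (V := fun _ => 1) measurable_const ha hab le_rfl).mono
      (hx.pastSigma_le (a + h)) le_rfl
    simpa using this
  have hli : Integrable (fun ω => (∫ u in a..(a + h), x u ω) -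
      (∫ u in a..(a + h), x u ω) ^ 2 / h) P := by
    refine Integrable.of_bound (by fun_prop) (h + h) (ae_of_all _ fun ω => ?_)
    obtain ⟨A0, A1⟩ := hx.integral_mem ω ha hab
    set A := ∫ u in a..(a + h), x u ω with hA
    have A1' : A ≤ h := by linarith
    have : A ^ 2 / h ≤ A := by rw [div_le_iff₀ hh, sq]; gcongr
    have : 0 ≤ A ^ 2 / h := by positivity
    rw [Real.norm_eq_abs, abs_le]; constructor <;> linarith
  calc ∫ ω, ((∫ u in a..(a + h), x u ω) - (∫ u in a..(a + h), x u ω) ^ 2 / h) ∂P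
      ≤ ∫ ω, (∫ u in Ioc a (a + h), f ω u) ∂P := integral_mono hli hfi.integral_prod_left hcell
    _ = ∫ u in Ioc a (a + h), ∫ ω, f ω u ∂P := integral_integral_swap hfi
    _ ≤ ∫ u in Ioc a (a + h), lam * h := by
        refine setIntegral_mono_on hfi.integral_prod_right (integrable_const _) measurableSet_Ioc fun u hu => ?_
        have hu0 : 0 ≤ u := ha.trans hu.1.le
        have hne := hx.measure_ne_le hlam hp ha hu.1.le
        have hmeas : MeasurableSet {ω | x a ω ≠ x u ω} :=
          (measurableSet_eq_fun (hx.measurable a ha) (hx.measurable u hu0)).compl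
        have : ∀ ω, f ω u = {ω | x a ω ≠ x u ω}.indicator 1 ω := by
          intro ω
          simp only [hf]
          rw [clamp_eq ⟨hu0, hu.2⟩]
          by_cases he : x a ω = x u ω
          · simp [he]
          · rw [indicator_of_mem (show ω ∈ {ω | x a ω ≠ x u ω} from he)]
            rcases hx.mem_states a ha ω with h1 | h1 <;> rcases hx.mem_states u hu0 ω with h2 | h2 <;>
              simp [h1, h2] at he ⊢
        simp only [this]
        rw [integral_indicator_one hmeas, measureReal_def]
        refine ENNReal.toReal_le_of_le_ofReal (by positivity) (hne.trans ?_)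
        refine ENNReal.ofReal_le_ofReal ?_
        gcongr
        linarith [hu.2]
    _ = lam * h * h := by
        rw [setIntegral_const, measureReal_def, Real.volume_Ioc, smul_eq_mul,
          ENNReal.toReal_ofReal (by linarith)]
        ring

/-- There are `t / h` cells, each with mean of order `h ^ 2`. -/
lemma tendsto_integral_gridCorrection [IsProbabilityMeasure P] (hlam : 0 ≤ lam)
    (hp : p ∈ Icc (0 : ℝ) 1) (hx : IsTwoStateChain P lam p q x) {γ t : ℝ} (hγ : 0 < γ)
    (ht : 0 < t) :
    Tendsto (fun n : ℕ => ∫ ω, gridCorrection γ x (t / 2 ^ n) (2 ^ n) ω ∂P) atTop (𝓝 0) := by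
  have hlim : Tendsto (fun n : ℕ => t / (2 : ℝ) ^ n) atTop (𝓝 0) :=
    tendsto_const_nhds.div_atTop (tendsto_pow_atTop_atTop_of_one_lt one_lt_two)
  have hlim2 := hlim.const_mul (γ / 2 * (lam * t))
  rw [mul_zero] at hlim2
  refine squeeze_zero (fun n => integral_nonneg fun ω =>
    (hx.gridCorrection_mem (by positivity) hγ _ ω).1) (fun n => ?_) hlim2
  set h := t / (2 : ℝ) ^ n with hh
  have hh0 : 0 < h := by positivity
  have hint : ∀ k : Fin (2 ^ n), Integrable (fun ω =>
      cellIntegral x h (2 ^ n) ω k - cellIntegral x h (2 ^ n) ω k ^ 2 / h) P := by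
    intro k
    have hm : Measurable fun ω => cellIntegral x h (2 ^ n) ω k :=
      (measurable_pi_apply k).comp (hx.measurable_cellIntegral hh0.le)
    refine Integrable.of_bound (by fun_prop) (h + h) (ae_of_all _ fun ω => ?_)
    obtain ⟨A0, A1⟩ := hx.cellIntegral_mem hh0.le k ω
    have : cellIntegral x h (2 ^ n) ω k ^ 2 / h ≤ cellIntegral x h (2 ^ n) ω k := by
      rw [div_le_iff₀ hh0, sq]; gcongr
    have : 0 ≤ cellIntegral x h (2 ^ n) ω k ^ 2 / h := by positivity
    rw [Real.norm_eq_abs, abs_le]; constructor <;> linarith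
  simp only [gridCorrection]
  rw [integral_const_mul, integral_finsetSum _ fun k _ => hint k]
  have hk : ∀ k : Fin (2 ^ n), ∫ ω, (cellIntegral x h (2 ^ n) ω k -
      cellIntegral x h (2 ^ n) ω k ^ 2 / h) ∂P ≤ lam * h * h := by
    intro k
    have := hx.integral_sub_sq_le hlam hp (a := (k : ℕ) * h) (by positivity) hh0
    have e : ((k : ℕ) : ℝ) * h + h = (((k : ℕ) : ℝ) + 1) * h := by ring
    rw [e] at this
    exact this
  calc γ / 2 * ∑ k : Fin (2 ^ n), ∫ ω, (cellIntegral x h (2 ^ n) ω k -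
      cellIntegral x h (2 ^ n) ω k ^ 2 / h) ∂P ≤ γ / 2 * ∑ k : Fin (2 ^ n), lam * h * h := by
        gcongr with k; exact hk k
    _ = γ / 2 * (lam * t) * h := by
        simp only [Finset.sum_const, Finset.card_univ, Fintype.card_fin, nsmul_eq_mul]
        push_cast
        rw [hh]; field_simp

end IsTwoStateChain

/-- Convergence of the likelihood ratios on the dyadic grids to the robust smoother. -/
theorem tendsto_likelihood_ratio {Ω : Type*} [MeasurableSpace Ω] {P : Measure Ω}
    [IsProbabilityMeasure P] {lam p q : ℝ} {x : ℝ → Ω → ℝ} (hlam : 0 < lam)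
    (hp : p ∈ Ioo (0 : ℝ) 1) (hq : q ∈ Icc (0 : ℝ) 1) (hx : IsTwoStateChain P lam p q x)
    {γ s t : ℝ} (hγ : 0 < γ) (ht : 0 < t) (hs : 0 ≤ s) (hst : s ≤ t) {c : ℝ → ℝ}
    (hc : ContinuousOn c (Icc 0 t)) (hc0 : c 0 = 0) {T : ℝ} (htT : t ≤ T) {G : ℝ → ℝ → ℝ}
    (hG : IsPathSmoother lam p q T (fun r => γ * c r - γ * r / 2) G) :
    Tendsto (fun n : ℕ =>
      (∫ ω, x s ω * likelihood (t / 2 ^ n / γ) (IsTwoStateChain.cellIntegral x (t / 2 ^ n) (2 ^ n) ω)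
        (gridIncrement c (t / 2 ^ n) (2 ^ n)) ∂P) /
      (∫ ω, likelihood (t / 2 ^ n / γ) (IsTwoStateChain.cellIntegral x (t / 2 ^ n) (2 ^ n) ω)
        (gridIncrement c (t / 2 ^ n) (2 ^ n)) ∂P)) atTop (𝓝 (G s t)) := by
  have h0 : 0 < lam * p := mul_pos hlam hp.1
  have h1 : 0 < lam * (1 - p) := mul_pos hlam (by linarith [hp.2])
  have hp' : p ∈ Icc (0 : ℝ) 1 := ⟨hp.1.le, hp.2.le⟩
  set μ : ℝ → ℝ := fun r => γ * c r - γ * r / 2 with hμdef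
  have hμ : ContinuousOn μ (Icc 0 t) := by fun_prop
  obtain ⟨u, hu0, hu, -⟩ := exists_isGaugeSol h0 h1 ht.le hμ (1 - q, q)
  obtain ⟨z, hz0, hz, -⟩ := exists_isGaugeSol h0 h1 hst (hμ.mono (Icc_subset_Icc_left hs))
    (0, (u s).2)
  have hunif := tendstoUniformlyOn_gridPotential hγ ht hc hc0
  set V : ℕ → ℝ → ℝ := fun n => stepFun (t / 2 ^ n) (gridPotential γ c (t / 2 ^ n) (2 ^ n))
  have hV : ∀ n, Measurable (V n) := fun n => measurable_stepFun
  have hC : ∀ n r, |V n r| ≤ _ := fun n r => abs_gridPotential_le γ c (t / 2 ^ n) (2 ^ n) _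
  have hVr : ∀ n r, 0 ≤ r → ContinuousWithinAt (V n) (Ici r) r := fun n r hr =>
    continuousWithinAt_stepFun (by positivity) hr
  obtain ⟨l1, l2⟩ := hx.tendsto_feynmanKac hlam hp hq.1 hV hC hVr hs hst hμ hunif hu hu0 hz hz0
  have hNh : ∀ n : ℕ, ((2 ^ n : ℕ) : ℝ) * (t / 2 ^ n) = t := fun n => by push_cast; field_simp
  have hcor : ∀ n ω, IsTwoStateChain.gridCorrection γ x (t / 2 ^ n) (2 ^ n) ω ∈
      Icc 0 (γ / 2 * t) := fun n ω => by
    have := hx.gridCorrection_mem (h := t / 2 ^ n) (by positivity) hγ (2 ^ n) ω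
    rwa [hNh n] at this
  have hcm : ∀ n : ℕ, Measurable (IsTwoStateChain.gridCorrection γ x (t / 2 ^ n) (2 ^ n)) :=
    fun n => hx.measurable_gridCorrection (by positivity) _
  have hct := hx.tendsto_integral_gridCorrection hlam.le hp' hγ ht
  have hlik : ∀ n ω, likelihood (t / 2 ^ n / γ)
      (IsTwoStateChain.cellIntegral x (t / 2 ^ n) (2 ^ n) ω)
      (gridIncrement c (t / 2 ^ n) (2 ^ n)) = IsTwoStateChain.fkWeight (V n) x t ω *
        Real.exp (IsTwoStateChain.gridCorrection γ x (t / 2 ^ n) (2 ^ n) ω) := fun n ω => by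
    have := hx.likelihood_grid (h := t / 2 ^ n) (by positivity) hγ c (2 ^ n) ω
    rwa [hNh n] at this
  have m1 := hx.tendsto_perturbed_feynmanKac hlam hp hq.1 hV hC hVr ht.le hμ hunif hcm hcor hct
    (U := fun _ => 1) measurable_const (fun _ => by simp) (by simpa using l1)
  have m2 := hx.tendsto_perturbed_feynmanKac hlam hp hq.1 hV hC hVr ht.le hμ hunif hcm hcor hct
    (U := x s) (hx.measurable s hs) (fun ω => hx.abs_le_one hs ω) l2
  rw [hG.eq_ratio s t hs hst htT u z hu hu0 hz hz0]
  simp only [hlik]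
  simp only [one_mul] at m1
  refine m2.div m1 ?_
  have := hu.pos_of_lt h0 h1 hμ (by rw [hu0]; simpa using hq.2) (by rw [hu0]; exact hq.1)
    (by rw [hu0]; simp) t ⟨ht, le_rfl⟩
  have h3 := mul_pos (Real.exp_pos (μ t)) this.2
  linarith [this.1]

/-! ### The filtering model -/

lemma pastSigma_le_of_measurable {Ω : Type*} {m : MeasurableSpace Ω} {y : ℝ → Ω → ℝ} {t : ℝ}
    (h : ∀ u ∈ Icc 0 t, Measurable[m] (y u)) : pastSigma y t ≤ m :=
  iSup₂_le fun u hu => (h u hu).comap_le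

lemma measurable_pastSigma {Ω : Type*} {y : ℝ → Ω → ℝ} {u t : ℝ} (hu : u ∈ Icc 0 t) :
    Measurable[pastSigma y t] (y u) :=
  Measurable.of_comap_le (le_iSup₂ (f := fun u (_ : u ∈ Icc (0 : ℝ) t) =>
    MeasurableSpace.comap (y u) inferInstance) u hu)

/-- The σ-algebra of the noise. -/
abbrev noiseSigma {Ω : Type*} (B : ℝ≥0 → Ω → ℝ) : MeasurableSpace Ω :=
  MeasurableSpace.comap (fun ω (t : ℝ≥0) => B t ω) inferInstance

lemma measurable_noiseSigma {Ω : Type*} (B : ℝ≥0 → Ω → ℝ) (t : ℝ≥0) :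
    Measurable[noiseSigma B] (B t) :=
  (measurable_pi_apply t).comp (comap_measurable fun ω (t : ℝ≥0) => B t ω)

lemma measurable_gridIncrement {Ω : Type*} {m : MeasurableSpace Ω} {y : ℝ → Ω → ℝ} {h t : ℝ}
    (hh : 0 ≤ h) {N : ℕ} (hN : N * h ≤ t) (hy : ∀ u ∈ Icc 0 t, Measurable[m] (y u)) :
    Measurable[m] fun ω => gridIncrement (fun u => y u ω) h N := by
  refine measurable_pi_lambda _ fun k => ?_
  have hk : (((k : ℕ) : ℝ) + 1) * h ≤ t :=
    le_trans (mul_le_mul_of_nonneg_right (by exact_mod_cast k.2) hh) hN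
  have hk' : ((k : ℕ) : ℝ) * h ≤ t := le_trans (by gcongr; linarith) hk
  exact (hy _ ⟨by positivity, hk⟩).sub (hy _ ⟨by positivity, hk'⟩)

/-- The σ-algebra generated by the observations at the dyadic times of order `n` in `[0,t]`. -/
noncomputable abbrev dyadicSigma {Ω : Type*} (y : ℝ → Ω → ℝ) (t : ℝ) (n : ℕ) : MeasurableSpace Ω :=
  MeasurableSpace.comap (fun ω => gridIncrement (fun u => y u ω) (t / 2 ^ n) (2 ^ n)) inferInstance

/-- Each increment of order `n` is the sum of two increments of order `n + 1`. Nestedness is what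
allows Lévy's theorem to be applied along the grids. -/
lemma dyadicSigma_mono {Ω : Type*} (y : ℝ → Ω → ℝ) (t : ℝ) : Monotone (dyadicSigma y t) := by
  refine monotone_nat_of_le_succ fun n => Measurable.comap_le ?_
  set φ : (Fin (2 ^ (n + 1)) → ℝ) → Fin (2 ^ n) → ℝ := fun z k =>
    z ⟨2 * k + 1, by have := k.2; rw [pow_succ]; omega⟩ +
      z ⟨2 * k, by have := k.2; rw [pow_succ]; omega⟩ with hφ
  have hφm : Measurable φ := by
    refine measurable_pi_lambda _ fun k => ?_
    exact (measurable_pi_apply _).add (measurable_pi_apply _)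
  have : (fun ω => gridIncrement (fun u => y u ω) (t / 2 ^ n) (2 ^ n)) = φ ∘
      fun ω => gridIncrement (fun u => y u ω) (t / 2 ^ (n + 1)) (2 ^ (n + 1)) := by
    ext ω k
    simp only [hφ, Function.comp_apply, gridIncrement]
    push_cast
    have e1 : (2 * (k : ℕ) + 1 + 1 : ℝ) * (t / 2 ^ (n + 1)) = ((k : ℕ) + 1) * (t / 2 ^ n) := by
      rw [pow_succ]; field_simp; ring
    have e2 : (2 * (k : ℕ) : ℝ) * (t / 2 ^ (n + 1)) = (k : ℕ) * (t / 2 ^ n) := by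
      rw [pow_succ]; field_simp
    rw [e1, e2]
    ring
  rw [this]
  exact hφm.comp (comap_measurable _)

/-- The increments of the noise in the observation along the grid of mesh `h`. -/
noncomputable def noiseIncrement {Ω : Type*} (γ : ℝ) (B : ℝ≥0 → Ω → ℝ) (h : ℝ) (N : ℕ) (ω : Ω) : Fin N → ℝ :=
  gridIncrement (fun t => 1 / √γ * B t.toNNReal ω) h N

lemma measurable_noiseIncrement_noiseSigma {Ω : Type*} {γ : ℝ} {B : ℝ≥0 → Ω → ℝ} {h : ℝ} (hh : 0 ≤ h) (N : ℕ) :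
    Measurable[noiseSigma B] (noiseIncrement γ B h N) :=
  @measurable_gridIncrement Ω (noiseSigma B) (fun t ω => 1 / √γ * B t.toNNReal ω) h (N * h) hh N
    le_rfl fun _ _ => (measurable_noiseSigma B _).const_mul _

namespace IsFilteringModel

variable {Ω : Type*} [MeasurableSpace Ω] {P : Measure Ω} {lam p q γ : ℝ} {x : ℝ → Ω → ℝ}
  {B : ℝ≥0 → Ω → ℝ} {π : ℝ → ℝ → Ω → ℝ}

lemma indep_noise (hM : IsFilteringModel P lam p q γ x B π) (t : ℝ) :
    Indep (noiseSigma B) (pastSigma x t) P := by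
  have h := (IndepFun_iff_Indep _ _ _).1 hM.indep
  refine indep_of_indep_of_le_right h (pastSigma_le_of_measurable fun u hu => ?_)
  have := (measurable_pi_apply (X := fun _ : ℝ≥0 => ℝ) (⟨u, hu.1⟩ : ℝ≥0)).comp
    (comap_measurable fun ω (t : ℝ≥0) => x (t : ℝ) ω)
  exact this

lemma noiseSigma_le (hM : IsFilteringModel P lam p q γ x B π) :
    noiseSigma B ≤ (inferInstance : MeasurableSpace Ω) :=
  (measurable_pi_lambda _ hM.measurable_noise).comap_le

lemma measurable_observation_of_le (hM : IsFilteringModel P lam p q γ x B π) {u t : ℝ}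
    (hu : u ∈ Icc 0 t) : Measurable[pastSigma x t ⊔ noiseSigma B] (observation γ x B u) := by
  have h1 := (hM.chain.measurable_past (V := fun _ => 1) measurable_const le_rfl hu.1 hu.2).mono
    (le_sup_left (b := noiseSigma B)) le_rfl
  simp only [one_mul] at h1
  have h2 : Measurable[pastSigma x t ⊔ noiseSigma B] (B u.toNNReal) :=
    (measurable_noiseSigma B _).mono le_sup_right le_rfl
  exact h1.add (h2.const_mul _)

lemma measurable_observation (hM : IsFilteringModel P lam p q γ x B π) {t : ℝ} (ht : 0 ≤ t) :
    Measurable (observation γ x B t) :=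
  (hM.measurable_observation_of_le ⟨ht, le_rfl⟩).mono
    (sup_le (hM.chain.pastSigma_le t) hM.noiseSigma_le) le_rfl

lemma pastSigma_observation_le (hM : IsFilteringModel P lam p q γ x B π) (t : ℝ) :
    pastSigma (observation γ x B) t ≤ pastSigma x t ⊔ noiseSigma B :=
  pastSigma_le_of_measurable fun _ hu => hM.measurable_observation_of_le hu

lemma observation_zero (hM : IsFilteringModel P lam p q γ x B π) (ω : Ω) :
    observation γ x B 0 ω = 0 := by
  simp [observation, hM.noise_zero]

lemma continuousOn_observation (hM : IsFilteringModel P lam p q γ x B π) (ω : Ω) (t : ℝ) :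
    ContinuousOn (fun u => observation γ x B u ω) (Icc 0 t) := by
  rcases lt_or_ge t 0 with h | h
  · rw [Icc_eq_empty (not_le.2 h)]; exact continuousOn_empty _
  have h1 : ContinuousOn (fun u => ∫ s in (0 : ℝ)..u, x s ω) (Icc 0 t) := by
    have := intervalIntegral.continuousOn_primitive_interval (μ := volume) (a := 0) (b := t)
      (f := fun s => x s ω) (by
        rw [uIcc_of_le h, integrableOn_Icc_iff_integrableOn_Ioc,
          ← intervalIntegrable_iff_integrableOn_Ioc_of_le h]
        exact hM.chain.intervalIntegrable_path ω le_rfl h)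
    rwa [uIcc_of_le h] at this
  have h2 : Continuous fun u : ℝ => 1 / √γ * B u.toNNReal ω :=
    continuous_const.mul ((hM.continuous_noise ω).comp continuous_real_toNNReal)
  exact h1.add h2.continuousOn

lemma gridIncrement_observation (hM : IsFilteringModel P lam p q γ x B π) {h : ℝ} (hh : 0 ≤ h)
    (N : ℕ) (ω : Ω) : gridIncrement (fun u => observation γ x B u ω) h N =
      IsTwoStateChain.cellIntegral x h N ω + noiseIncrement γ B h N ω := by
  ext k
  have h1 : (0 : ℝ) ≤ (k : ℕ) * h := by positivity
  have h2 : ((k : ℕ) : ℝ) * h ≤ ((k : ℕ) + 1) * h := by gcongr; linarith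
  have := intervalIntegral.integral_add_adjacent_intervals
    (hM.chain.intervalIntegrable_path ω le_rfl h1) (hM.chain.intervalIntegrable_path ω h1 h2)
  simp only [gridIncrement, observation, IsTwoStateChain.cellIntegral, noiseIncrement, Pi.add_apply]
  rw [← this]
  ring

lemma measurable_noiseIncrement (hM : IsFilteringModel P lam p q γ x B π) {h : ℝ} (hh : 0 ≤ h)
    (N : ℕ) : Measurable (noiseIncrement γ B h N) :=
  (measurable_noiseIncrement_noiseSigma hh N).mono hM.noiseSigma_le le_rfl

lemma map_noiseIncrement [IsProbabilityMeasure P] (hM : IsFilteringModel P lam p q γ x B π)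
    (hγ : 0 < γ) {h : ℝ} (hh : 0 ≤ h) (N : ℕ) :
    P.map (noiseIncrement γ B h N) = noiseLaw N (h / γ).toNNReal := by
  have hpre := hM.brownian.toIsPreBrownianReal
  set τ : Fin (N + 1) → ℝ≥0 := fun i => ((i : ℕ) * h).toNNReal with hτ
  have hmono : Monotone τ := fun i j hij => Real.toNNReal_le_toNNReal (by gcongr; exact hij)
  have hind := (hpre.hasIndepIncrements N τ hmono).comp (fun _ z => 1 / √γ * z)
    (fun _ => measurable_const_mul _)
  have hcomp : ∀ i : Fin N, (fun z : ℝ => 1 / √γ * z) ∘ (fun ω => B (τ i.succ) ω -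
      B (τ i.castSucc) ω) = fun ω => noiseIncrement γ B h N ω i := by
    intro i
    ext ω
    simp [hτ, noiseIncrement, gridIncrement, mul_sub]
  simp only [hcomp] at hind
  have hm : ∀ i : Fin N, Measurable fun ω => noiseIncrement γ B h N ω i := fun i =>
    (measurable_pi_apply i).comp (hM.measurable_noiseIncrement hh N)
  have := (iIndepFun_iff_map_fun_eq_pi_map fun i => (hm i).aemeasurable).1 hind
  refine this.trans ?_
  congr 1
  ext1 i
  have hd : Measurable fun ω => B (τ i.succ) ω - B (τ i.castSucc) ω :=
    (hM.measurable_noise _).sub (hM.measurable_noise _)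
  rw [← hcomp i, ← Measure.map_map (measurable_const_mul _) hd]
  have hl := (hpre.hasLaw_sub (τ i.succ) (τ i.castSucc)).map_eq
  have e : (fun ω => B (τ i.succ) ω - B (τ i.castSucc) ω) = B (τ i.succ) - B (τ i.castSucc) := rfl
  rw [e, hl, gaussianReal_map_const_mul, mul_zero]
  congr 1
  ext
  have h1 : (0 : ℝ) ≤ (i : ℕ) * h := by positivity
  have h2 : (0 : ℝ) ≤ ((i : ℕ) + 1) * h := by positivity
  have h3 : 0 ≤ h / γ := by positivity
  have h4 : ((τ i.succ : ℝ≥0) : ℝ) = ((i : ℕ) + 1) * h := by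
    simp only [hτ, Fin.val_succ, Nat.cast_add, Nat.cast_one]
    rw [Real.coe_toNNReal _ h2]
  have h5 : ((τ i.castSucc : ℝ≥0) : ℝ) = (i : ℕ) * h := by
    simp only [hτ, Fin.val_castSucc]
    rw [Real.coe_toNNReal _ h1]
  rw [NNReal.coe_mul, coe_nndist, Real.coe_toNNReal _ h3]
  change (1 / √γ) ^ 2 * dist ((τ i.succ : ℝ≥0) : ℝ) ((τ i.castSucc : ℝ≥0) : ℝ) = h / γ
  rw [h4, h5, Real.dist_eq, div_pow, Real.sq_sqrt hγ.le, one_pow]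
  have : ((i : ℕ) + 1 : ℝ) * h - (i : ℕ) * h = h := by ring
  rw [this, abs_of_nonneg hh]
  ring

/-- The observation starts at `0`, so its increments determine it at the dyadic times, and
continuity of the trajectories determines the rest. No completion by null sets is involved. -/
lemma iSup_dyadicSigma (hM : IsFilteringModel P lam p q γ x B π) {t : ℝ} (ht : 0 < t) :
    ⨆ n, dyadicSigma (observation γ x B) t n = pastSigma (observation γ x B) t := by
  have hNh : ∀ n : ℕ, ((2 ^ n : ℕ) : ℝ) * (t / 2 ^ n) = t := fun n => by push_cast; field_simp
  apply le_antisymm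
  · exact iSup_le fun n => Measurable.comap_le (@measurable_gridIncrement Ω _ _ _ t (by positivity) _
      (hNh n).le fun u hu => measurable_pastSigma hu)
  · refine pastSigma_le_of_measurable fun u hu => ?_
    have hgrid : ∀ n k : ℕ, k ≤ 2 ^ n → Measurable[⨆ n, dyadicSigma (observation γ x B) t n]
        (observation γ x B (k * (t / 2 ^ n))) := by
      intro n k hk
      induction k with
      | zero =>
        have : observation γ x B ((0 : ℕ) * (t / 2 ^ n)) = fun _ => 0 := by
          ext ω; simp [hM.observation_zero]
        rw [this]; exact measurable_const
      | succ k ih =>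
        have h1 : Measurable[⨆ n, dyadicSigma (observation γ x B) t n] fun ω =>
            gridIncrement (fun u => observation γ x B u ω) (t / 2 ^ n) (2 ^ n) ⟨k, by omega⟩ :=
          by
          have h0 : Measurable[⨆ n, dyadicSigma (observation γ x B) t n] fun ω =>
              gridIncrement (fun u => observation γ x B u ω) (t / 2 ^ n) (2 ^ n) :=
            (comap_measurable _).mono (le_iSup (dyadicSigma (observation γ x B) t) n) le_rfl
          exact (measurable_pi_apply _).comp h0
        have : observation γ x B ((k + 1 : ℕ) * (t / 2 ^ n)) = fun ω =>
            observation γ x B (k * (t / 2 ^ n)) ω +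
            gridIncrement (fun u => observation γ x B u ω) (t / 2 ^ n) (2 ^ n) ⟨k, by omega⟩ := by
          ext ω; simp [gridIncrement]
        rw [this]
        exact (ih (by omega)).add h1
    have hpos : ∀ n : ℕ, 0 < t / (2 : ℝ) ^ n := fun n => by positivity
    set k : ℕ → ℕ := fun n => ⌊u / (t / 2 ^ n)⌋₊ with hk
    have hkle : ∀ n, (k n : ℝ) * (t / 2 ^ n) ≤ u := fun n => by
      rw [← le_div_iff₀ (hpos n)]; exact Nat.floor_le (div_nonneg hu.1 (hpos n).le)
    have hkgt : ∀ n, u - t / 2 ^ n ≤ (k n : ℝ) * (t / 2 ^ n) := fun n => by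
      have := (Nat.lt_floor_add_one (u / (t / 2 ^ n))).le
      rw [div_le_iff₀ (hpos n), add_mul, one_mul] at this
      rw [sub_le_iff_le_add]; exact this
    have hk2 : ∀ n, k n ≤ 2 ^ n := fun n => by
      have h1 : (k n : ℝ) * (t / 2 ^ n) ≤ ((2 ^ n : ℕ) : ℝ) * (t / 2 ^ n) := by
        rw [hNh n]; exact (hkle n).trans hu.2
      exact_mod_cast le_of_mul_le_mul_right h1 (hpos n)
    have hlim : Tendsto (fun n : ℕ => t / (2 : ℝ) ^ n) atTop (𝓝 0) :=
      tendsto_const_nhds.div_atTop (tendsto_pow_atTop_atTop_of_one_lt one_lt_two)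
    have hkt : Tendsto (fun n => (k n : ℝ) * (t / 2 ^ n)) atTop (𝓝 u) := by
      refine tendsto_of_tendsto_of_tendsto_of_le_of_le ?_ tendsto_const_nhds hkgt hkle
      simpa using (tendsto_const_nhds (x := u)).sub hlim
    refine @measurable_of_tendsto_metrizable _ _ (⨆ n, dyadicSigma (observation γ x B) t n) _ _ _ _
      _ _ (fun n => hgrid n (k n) (hk2 n)) ?_
    rw [tendsto_pi_nhds]
    intro ω
    have hc := (hM.continuousOn_observation ω t u hu).tendsto
    refine hc.comp (tendsto_nhdsWithin_iff.2 ⟨hkt, Eventually.of_forall fun n => ?_⟩)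
    exact ⟨by positivity, (hkle n).trans hu.2⟩

/-- The conditional probabilities are almost surely given by the robust smoother. -/
theorem ae_eq_smoother [IsProbabilityMeasure P] (hlam : 0 < lam) (hp : p ∈ Ioo (0 : ℝ) 1)
    (hq : q ∈ Icc (0 : ℝ) 1) (hγ : 0 < γ) (hM : IsFilteringModel P lam p q γ x B π) {s t T : ℝ}
    (hs : 0 ≤ s) (hst : s ≤ t) (ht : 0 < t) (htT : t ≤ T) {G : Ω → ℝ → ℝ → ℝ}
    (hG : ∀ ω, IsPathSmoother lam p q T (fun r => γ * observation γ x B r ω - γ * r / 2) (G ω)) :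
    ∀ᵐ ω ∂P, π s t ω = G ω s t := by
  have hx := hM.chain
  have hNh : ∀ n : ℕ, ((2 ^ n : ℕ) : ℝ) * (t / 2 ^ n) = t := fun n => by push_cast; field_simp
  have hpos : ∀ n : ℕ, 0 < t / (2 : ℝ) ^ n := fun n => by positivity
  have hind : {ω | x s ω = 1}.indicator (fun _ => (1 : ℝ)) = x s := by
    ext ω
    rcases hx.mem_states s hs ω with h | h <;> simp [indicator, h]
  have hcond := hM.condProb s t hs hst
  rw [hind, ← hM.iSup_dyadicSigma ht] at hcond
  set ℱ : Filtration ℕ (inferInstance : MeasurableSpace Ω) :=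
    { seq := dyadicSigma (observation γ x B) t
      mono' := dyadicSigma_mono _ _
      le' := fun n => (measurable_gridIncrement (hpos n).le (hNh n).le
        fun u hu => hM.measurable_observation hu.1).comap_le }
  -- The conditional expectations given the dyadic increments have two limits: the conditional
  -- probability by Lévy's upward theorem, and the robust smoother by Bayes' formula and the
  -- convergence of the likelihood ratios.
  have hlevy := tendsto_ae_condExp (μ := P) (ℱ := ℱ) (x s)
  have hbayes : ∀ n : ℕ, P[x s | ℱ n] =ᵐ[P] fun ω =>
      (∫ ω', x s ω' * likelihood (t / 2 ^ n / γ)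
          (IsTwoStateChain.cellIntegral x (t / 2 ^ n) (2 ^ n) ω')
        (gridIncrement (fun u => observation γ x B u ω) (t / 2 ^ n) (2 ^ n)) ∂P) /
      (∫ ω', likelihood (t / 2 ^ n / γ) (IsTwoStateChain.cellIntegral x (t / 2 ^ n) (2 ^ n) ω')
        (gridIncrement (fun u => observation γ x B u ω) (t / 2 ^ n) (2 ^ n)) ∂P) := by
    intro n
    have hv0 : 0 < t / 2 ^ n / γ := by have := hpos n; positivity
    have hv : (t / 2 ^ n / γ).toNNReal ≠ 0 := (Real.toNNReal_pos.2 hv0).ne'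
    have hamp := hx.measurable_cellIntegral_past (hpos n).le (hNh n).le
    have hUa : Measurable[pastSigma x t] fun ω =>
        (x s ω, IsTwoStateChain.cellIntegral x (t / 2 ^ n) (2 ^ n) ω) :=
      (measurable_pastSigma ⟨hs, hst⟩).prodMk hamp
    have hindep : IndepFun (noiseIncrement γ B (t / 2 ^ n) (2 ^ n)) (fun ω =>
        (x s ω, IsTwoStateChain.cellIntegral x (t / 2 ^ n) (2 ^ n) ω)) P := by
      rw [IndepFun_iff_Indep]
      exact indep_of_indep_of_le (hM.indep_noise t)
        (measurable_noiseIncrement_noiseSigma (hpos n).le _).comap_le hUa.comap_le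
    have key := condExp_signal (P := P) hv (hx.measurable_cellIntegral (hpos n).le)
      (hM.measurable_noiseIncrement (hpos n).le (2 ^ n)) (hx.measurable s hs)
      (fun ω => hx.mem_Icc hs ω) (c := t / 2 ^ n) (fun ω k => by
        have := hx.cellIntegral_mem (hpos n).le k ω
        rw [abs_of_nonneg this.1]; exact this.2)
      (hM.map_noiseIncrement hγ (hpos n).le _) hindep
    simp only [← hM.gridIncrement_observation (hpos n).le, Real.coe_toNNReal _ hv0.le] at key
    exact key
  filter_upwards [hcond, hlevy, ae_all_iff.2 hbayes] with ω h1 h2 h3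
  rw [h1]
  refine tendsto_nhds_unique h2 ?_
  simp only [h3]
  exact tendsto_likelihood_ratio hlam hp hq hx hγ ht hs hst (hM.continuousOn_observation ω t)
    (hM.observation_zero ω) htT (hG ω)

end IsFilteringModel

/-! ### Full support of the observed path -/

/-- The robust smoother depends continuously on the observed path. -/
lemma IsPathSmoother.tendsto {lam p q T s t : ℝ} (hlam : 0 < lam) (hp : p ∈ Ioo (0 : ℝ) 1)
    (hq : q ∈ Icc (0 : ℝ) 1) (hs : 0 ≤ s) (hst : s ≤ t) (htT : t ≤ T) (ht : 0 < t) {μ : ℝ → ℝ}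
    (hμ : ContinuousOn μ (Icc 0 t)) {μn : ℕ → ℝ → ℝ} (hμn : ∀ n, ContinuousOn (μn n) (Icc 0 t))
    (hunif : TendstoUniformlyOn μn μ atTop (Icc 0 t)) {G : ℝ → ℝ → ℝ} {Gn : ℕ → ℝ → ℝ → ℝ}
    (hG : IsPathSmoother lam p q T μ G) (hGn : ∀ n, IsPathSmoother lam p q T (μn n) (Gn n)) :
    Tendsto (fun n => Gn n s t) atTop (𝓝 (G s t)) := by
  have h0 : 0 < lam * p := mul_pos hlam hp.1
  have h1 : 0 < lam * (1 - p) := mul_pos hlam (by linarith [hp.2])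
  have hsub : Icc s t ⊆ Icc 0 t := Icc_subset_Icc_left hs
  obtain ⟨u, hu0, hu, -⟩ := exists_isGaugeSol h0 h1 ht.le hμ (1 - q, q)
  obtain ⟨z, hz0, hz, -⟩ := exists_isGaugeSol h0 h1 hst (hμ.mono hsub) (0, (u s).2)
  have hun := fun n => exists_isGaugeSol h0 h1 ht.le (hμn n) (1 - q, q)
  choose un hun0 hun' hun'' using hun
  have hzn := fun n => exists_isGaugeSol h0 h1 hst ((hμn n).mono hsub) (0, (un n s).2)
  choose zn hzn0 hzn' hzn'' using hzn
  have hut : ∀ r ∈ Icc 0 t, Tendsto (fun n => un n r) atTop (𝓝 (u r)) := by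
    intro r hr
    have hsub' : Icc 0 r ⊆ Icc 0 t := Icc_subset_Icc_right hr.2
    exact IsGaugeSol.tendsto h0 h1 hr.1 (hμ.mono hsub') (hunif.mono hsub') (hu.mono le_rfl hr.2)
      (fun n => (hun' n).mono le_rfl hr.2) (by simp only [hun0, hu0]; exact tendsto_const_nhds)
  have hzt : Tendsto (fun n => zn n t) atTop (𝓝 (z t)) := by
    refine IsGaugeSol.tendsto h0 h1 hst (hμ.mono hsub) (hunif.mono hsub) hz hzn' ?_
    simp only [hzn0, hz0]
    exact tendsto_const_nhds.prodMk_nhds ((continuous_snd.tendsto _).comp (hut s ⟨hs, hst⟩))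
  have htt : t ∈ Icc 0 t := ⟨ht.le, le_rfl⟩
  have he : Tendsto (fun n => Real.exp (μn n t)) atTop (𝓝 (Real.exp (μ t))) :=
    (Real.continuous_exp.tendsto _).comp (hunif.tendsto_at htt)
  rw [hG.eq_ratio s t hs hst htT u z hu hu0 hz hz0]
  simp only [fun n => (hGn n).eq_ratio s t hs hst htT (un n) (zn n) (hun' n) (hun0 n) (hzn' n)
    (hzn0 n)]
  have c1 := fun {f : ℕ → ℝ × ℝ} {l : ℝ × ℝ} (h : Tendsto f atTop (𝓝 l)) =>
    ((continuous_fst.tendsto _).comp h).add (he.mul ((continuous_snd.tendsto _).comp h))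
  refine (c1 hzt).div (c1 (hut t htt)) ?_
  have := hu.pos_of_lt h0 h1 hμ (by rw [hu0]; simpa using hq.2) (by rw [hu0]; exact hq.1)
    (by rw [hu0]; simp) t ⟨ht, le_rfl⟩
  have h3 := mul_pos (Real.exp_pos (μ t)) this.2
  linarith [this.1]

lemma sum_gridIncrement (c : ℝ → ℝ) (h : ℝ) (N : ℕ) {k : ℕ} (hk : k ≤ N) :
    ∑ j : Fin N, (if (j : ℕ) < k then gridIncrement c h N j else 0) = c (k * h) - c 0 := by
  have h1 : ∑ j : Fin N, (if (j : ℕ) < k then gridIncrement c h N j else 0) =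
      ∑ j ∈ Finset.range N, if j < k then c (((j : ℕ) + 1 : ℝ) * h) - c (j * h) else 0 := by
    rw [Finset.sum_range]; rfl
  have h2 : (Finset.range N).filter (· < k) = Finset.range k := by
    ext j; simp only [Finset.mem_filter, Finset.mem_range]; omega
  rw [h1, ← Finset.sum_filter, h2]
  have := Finset.sum_range_sub (fun j : ℕ => c (j * h)) k
  simpa using this

/-- A family of functions on `[0,t]` with equal values at all dyadic times satisfies closed
inequalities everywhere. -/
lemma abs_le_of_dyadic {t e : ℝ} (ht : 0 < t) {f : ℝ → ℝ} (hf : ContinuousOn f (Icc 0 t))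
    (h : ∀ n k : ℕ, k ≤ 2 ^ n → |f (k * (t / 2 ^ n))| ≤ e) {u : ℝ} (hu : u ∈ Icc 0 t) :
    |f u| ≤ e := by
  have hNh : ∀ n : ℕ, ((2 ^ n : ℕ) : ℝ) * (t / 2 ^ n) = t := fun n => by push_cast; field_simp
  have hpos : ∀ n : ℕ, 0 < t / (2 : ℝ) ^ n := fun n => by positivity
  have hlim : Tendsto (fun n : ℕ => t / (2 : ℝ) ^ n) atTop (𝓝 0) :=
    tendsto_const_nhds.div_atTop (tendsto_pow_atTop_atTop_of_one_lt one_lt_two)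
  have hcell := fun n : ℕ => exists_cell (hpos n) (N := 2 ^ n) (by positivity) (r := u)
    (by rwa [hNh n])
  choose k hk h1 h2 using hcell
  have hkt : Tendsto (fun n => (k n : ℝ) * (t / 2 ^ n)) atTop (𝓝 u) := by
    refine tendsto_of_tendsto_of_tendsto_of_le_of_le (g := fun n : ℕ => u - t / 2 ^ n) ?_
      tendsto_const_nhds (fun n => ?_) h1
    · simpa using (tendsto_const_nhds (x := u)).sub hlim
    · have := h2 n
      rw [add_mul, one_mul] at this
      simp only
      linarith
  have hc := ((hf u hu).tendsto.comp (tendsto_nhdsWithin_iff.2 ⟨hkt, Eventually.of_forall fun n =>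
    ⟨by positivity, (h1 n).trans hu.2⟩⟩)).abs
  exact le_of_tendsto' hc fun n => h n (k n) (hk n).le

/-- A continuous function is uniformly close to a Lipschitz one. -/
lemma exists_lipschitz_near {t e : ℝ} (he : 0 < e) {f : ℝ → ℝ} (hf : ContinuousOn f (Icc 0 t)) :
    ∃ (g : ℝ → ℝ) (L : ℝ), 0 ≤ L ∧ (∀ u ∈ Icc 0 t, |f u - g u| ≤ e) ∧
      ∀ a ∈ Icc 0 t, ∀ b ∈ Icc 0 t, |g a - g b| ≤ L * |a - b| := by
  obtain ⟨P, hP⟩ := exists_polynomial_near_of_continuousOn 0 t f hf e he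
  have hcd : ContDiffOn ℝ 1 (fun u => P.eval u) (Icc 0 t) :=
    (Polynomial.contDiff_aeval P 1).contDiffOn.congr fun u _ => (Polynomial.coe_aeval_eq_eval u ▸ rfl)
  obtain ⟨L, hL⟩ := hcd.exists_lipschitzOnWith one_ne_zero (convex_Icc 0 t) isCompact_Icc
  refine ⟨fun u => P.eval u, L, L.2, fun u hu => ?_, fun a ha b hb => ?_⟩
  · rw [abs_sub_comm]; exact (hP u hu).le
  · have := hL.dist_le_mul a ha b hb
    rwa [Real.dist_eq, Real.dist_eq] at this

namespace IsFilteringModel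

variable {Ω : Type*} [MeasurableSpace Ω] {P : Measure Ω} {lam p q γ : ℝ} {x : ℝ → Ω → ℝ}
  {B : ℝ≥0 → Ω → ℝ} {π : ℝ → ℝ → Ω → ℝ}

lemma continuous_scaledNoise (hM : IsFilteringModel P lam p q γ x B π) (ω : Ω) :
    Continuous fun u : ℝ => 1 / √γ * B u.toNNReal ω :=
  continuous_const.mul ((hM.continuous_noise ω).comp continuous_real_toNNReal)

/-- Some Lipschitz path is close to the noise with positive probability. -/
lemma exists_lipschitz_noise [IsProbabilityMeasure P] (hM : IsFilteringModel P lam p q γ x B π)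
    (t : ℝ) {e : ℝ} (he : 0 < e) :
    ∃ (g : ℝ → ℝ) (L κ : ℝ), 0 ≤ L ∧ 0 < κ ∧
      (∀ a ∈ Icc 0 t, ∀ b ∈ Icc 0 t, |g a - g b| ≤ L * |a - b|) ∧
      ENNReal.ofReal κ ≤ P {ω | ∀ u ∈ Icc 0 t, |1 / √γ * B u.toNNReal ω - g u| ≤ e} := by
  set W : Ω → C(Icc (0 : ℝ) t, ℝ) := fun ω =>
    ⟨fun u => 1 / √γ * B (u : ℝ).toNNReal ω, (hM.continuous_scaledNoise ω).comp continuous_subtype_val⟩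
  set d := TopologicalSpace.denseSeq C(Icc (0 : ℝ) t, ℝ)
  -- Countably many balls cover, so one of them has positive measure. Two trajectories of that ball
  -- are within `3 / 4 * e`, which leaves room for the `e / 8` lost in making the centre Lipschitz.
  set A : ℕ → Set Ω := fun n => {ω | dist (W ω) (d n) ≤ 3 / 8 * e} with hA
  have hU : ⋃ n, A n = univ := by
    refine eq_univ_of_forall fun ω => ?_
    obtain ⟨n, hn⟩ := (TopologicalSpace.denseRange_denseSeq C(Icc (0 : ℝ) t, ℝ)).exists_dist_lt
      (W ω) (by positivity : 0 < 3 / 8 * e)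
    exact mem_iUnion.2 ⟨n, hn.le⟩
  obtain ⟨n, hn⟩ : ∃ n, P (A n) ≠ 0 := by
    by_contra! hcon
    have := measure_iUnion_null hcon
    rw [hU, measure_univ] at this
    exact one_ne_zero this
  obtain ⟨ω₀, hω₀⟩ := nonempty_of_measure_ne_zero hn
  obtain ⟨g, L, hL, hg, hgL⟩ := exists_lipschitz_near (t := t) (e := e / 8) (by positivity)
    (hM.continuous_scaledNoise ω₀).continuousOn
  refine ⟨g, L, (P (A n)).toReal, hL, ENNReal.toReal_pos hn (measure_ne_top _ _), hgL, ?_⟩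
  rw [ENNReal.ofReal_toReal (measure_ne_top _ _)]
  refine measure_mono fun ω hω u hu => ?_
  have h1 : dist (W ω) (W ω₀) ≤ 3 / 4 * e := by
    have := dist_triangle_right (W ω) (W ω₀) (d n)
    have a1 : dist (W ω) (d n) ≤ 3 / 8 * e := hω
    have a2 : dist (W ω₀) (d n) ≤ 3 / 8 * e := hω₀
    linarith
  have h2 := (ContinuousMap.dist_apply_le_dist (f := W ω) (g := W ω₀) ⟨u, hu⟩).trans h1
  have h3 : |1 / √γ * B u.toNNReal ω - 1 / √γ * B u.toNNReal ω₀| ≤ 3 / 4 * e := h2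
  have h4 := abs_le.1 (hg u hu)
  have h5 := abs_le.1 h3
  rw [abs_le]
  constructor <;> linarith [h4.1, h4.2, h5.1, h5.2]

/-- The law of the observation charges every neighbourhood of a continuous path. -/
theorem measure_observation_near_pos [IsProbabilityMeasure P] (hγ : 0 < γ)
    (hM : IsFilteringModel P lam p q γ x B π) {t : ℝ} (ht : 0 < t) {c : ℝ → ℝ}
    (hc : ContinuousOn c (Icc 0 t)) (hc0 : c 0 = 0) {e : ℝ} (he : 0 < e) :
    0 < P {ω | ∀ u ∈ Icc 0 t, |observation γ x B u ω - c u| ≤ e} := by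
  have hNh : ∀ n : ℕ, ((2 ^ n : ℕ) : ℝ) * (t / 2 ^ n) = t := fun n => by push_cast; field_simp
  have hpos : ∀ n : ℕ, 0 < t / (2 : ℝ) ^ n := fun n => by positivity
  have h0t : (0 : ℝ) ∈ Icc 0 t := ⟨le_rfl, ht.le⟩
  obtain ⟨g, L, κ, hL, hκ, hgL, hgκ⟩ := hM.exists_lipschitz_noise t (e := e / 4) (by positivity)
  obtain ⟨c', L', hL', hcc', hcL'⟩ := exists_lipschitz_near (e := e / 4) (by positivity) hc
  -- Adding `d` to the observation turns closeness to the target `c'` into closeness to `g`, which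
  -- the noise achieves with probability at least `κ`.
  set d : ℝ → ℝ := fun u => g u - c' u with hd
  have hg0 : |g 0| ≤ e / 4 := by
    obtain ⟨ω, hω⟩ := nonempty_of_measure_ne_zero
      (((ENNReal.ofReal_pos.2 hκ).trans_le hgκ).ne')
    simpa [hM.noise_zero] using hω 0 h0t
  have hc'0 : |c' 0| ≤ e / 4 := by simpa [hc0] using hcc' 0 h0t
  have hgrid : ∀ n k : ℕ, k ≤ 2 ^ n → (k : ℝ) * (t / 2 ^ n) ∈ Icc 0 t := fun n k hk =>
    ⟨by positivity, by
      have h1 : (k : ℝ) * (t / 2 ^ n) ≤ ((2 ^ n : ℕ) : ℝ) * (t / 2 ^ n) := by gcongr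
      exact h1.trans (hNh n).le⟩
  set D : ℕ → Set Ω := fun n => {ω | ∀ k : ℕ, k ≤ 2 ^ n →
    |observation γ x B (k * (t / 2 ^ n)) ω - c (k * (t / 2 ^ n))| ≤ e} with hD
  have hDm : ∀ n, MeasurableSet (D n) := by
    intro n
    simp only [hD, ofPred_forall]
    refine MeasurableSet.iInter fun k => MeasurableSet.iInter fun hk => ?_
    exact measurableSet_le (((hM.measurable_observation (hgrid n k hk).1).sub_const _).abs)
      measurable_const
  have hDanti : Antitone D := by
    refine antitone_nat_of_succ_le fun n ω hω k hk => ?_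
    have := hω (2 * k) (by rw [pow_succ]; omega)
    have e2 : ((2 * k : ℕ) : ℝ) * (t / 2 ^ (n + 1)) = (k : ℕ) * (t / 2 ^ n) := by
      push_cast; rw [pow_succ]; field_simp
    rwa [e2] at this
  have hDsub : ⋂ n, D n ⊆ {ω | ∀ u ∈ Icc 0 t, |observation γ x B u ω - c u| ≤ e} := by
    intro ω hω u hu
    rw [mem_iInter] at hω
    exact abs_le_of_dyadic ht ((hM.continuousOn_observation ω t).sub hc)
      (fun n k hk => hω n k hk) hu
  -- A bound on the Cameron–Martin cost of the shift that does not depend on `n`: increments of `g`,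
  -- `c'` and the integrated signal over a cell are at most `L * h`, `L' * h` and `h`. The lower
  -- bound therefore survives the intersection over all dyadic levels.
  set E := Real.exp ((L + L' + 1) ^ 2 * γ * t) with hE
  have hDlow : ∀ n, ENNReal.ofReal (κ ^ 2 / E) ≤ P (D n) := by
    intro n
    set h := t / (2 : ℝ) ^ n with hh
    set N := 2 ^ n with hN
    have hh0 : 0 < h := hpos n
    have hv0 : 0 < h / γ := by positivity
    have hv : (h / γ).toNNReal ≠ 0 := (Real.toNNReal_pos.2 hv0).ne'
    set A : Set (Fin N → ℝ) := {z | ∀ k : ℕ, k ≤ N →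
      |∑ j : Fin N, (if (j : ℕ) < k then z j else 0) - g (k * h)| ≤ e / 4} with hA
    have hAm : MeasurableSet A := by
      simp only [hA, ofPred_forall]
      refine MeasurableSet.iInter fun k => MeasurableSet.iInter fun hk => ?_
      refine measurableSet_le (Measurable.abs (Measurable.sub_const ?_ _)) measurable_const
      refine Finset.measurable_sum _ fun j _ => ?_
      split_ifs
      · exact measurable_pi_apply j
      · exact measurable_const
    have hξm := hM.measurable_noiseIncrement (γ := γ) hh0.le N
    have ham := hM.chain.measurable_cellIntegral hh0.le (N := N)
    have hlaw := hM.map_noiseIncrement hγ hh0.le N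
    have hAκ : ENNReal.ofReal κ ≤ noiseLaw N (h / γ).toNNReal A := by
      rw [← hlaw, Measure.map_apply hξm hAm]
      refine hgκ.trans (measure_mono fun ω hω k hk => ?_)
      have := hω (k * h) (hgrid n k hk)
      simp only [noiseIncrement]
      rw [sum_gridIncrement _ _ _ hk]
      simpa [hM.noise_zero] using this
    have hindep : IndepFun (noiseIncrement γ B h N) (IsTwoStateChain.cellIntegral x h N) P := by
      rw [IndepFun_iff_Indep]
      exact indep_of_indep_of_le (hM.indep_noise t)
        (measurable_noiseIncrement_noiseSigma hh0.le _).comap_le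
        (hM.chain.measurable_cellIntegral_past hh0.le (hNh n).le).comap_le
    have hjoint := (indepFun_iff_map_prod_eq_prod_map_map hξm.aemeasurable ham.aemeasurable).1 hindep
    set b : (Fin N → ℝ) → Fin N → ℝ := fun a => gridIncrement d h N + a with hb
    have hbm : Measurable b := by fun_prop
    have hSm : MeasurableSet {w : (Fin N → ℝ) × (Fin N → ℝ) | b w.2 + w.1 ∈ A} :=
      ((hbm.comp measurable_snd).add measurable_fst) hAm
    -- Four errors of size `e / 4` add up: the distance to `g`, the distance between `c` and `c'`,
    -- and the initial values of `g` and `c'`, which appear because increments are summed from time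
    -- `0`.
    have hsubset : {ω | b (IsTwoStateChain.cellIntegral x h N ω) + noiseIncrement γ B h N ω ∈ A} ⊆
        D n := by
      intro ω hω k hk
      have h1 := hω k hk
      have h2 : b (IsTwoStateChain.cellIntegral x h N ω) + noiseIncrement γ B h N ω =
          gridIncrement (fun u => d u + observation γ x B u ω) h N := by
        rw [hb, add_assoc, ← hM.gridIncrement_observation hh0.le]
        ext k; simp only [gridIncrement, Pi.add_apply]; ring
      rw [h2, sum_gridIncrement _ _ _ hk, hM.observation_zero] at h1
      have h3 := hcc' _ (hgrid n k hk)
      simp only [hd] at h1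
      have t1 := abs_le.1 h1
      have t2 := abs_le.1 h3
      have t3 := abs_le.1 hg0
      have t4 := abs_le.1 hc'0
      rw [abs_le]
      constructor <;> linarith [t1.1, t1.2, t2.1, t2.2, t3.1, t3.2, t4.1, t4.2]
    refine le_trans ?_ (measure_mono hsubset)
    have hcalc : P {ω | b (IsTwoStateChain.cellIntegral x h N ω) + noiseIncrement γ B h N ω ∈ A} =
        ∫⁻ ω, noiseLaw N (h / γ).toNNReal
          {z | b (IsTwoStateChain.cellIntegral x h N ω) + z ∈ A} ∂P := by
      have m1 := Measure.map_apply (μ := P) (hξm.prodMk ham) hSm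
      rw [hjoint, hlaw, Measure.prod_apply_symm hSm,
        lintegral_map (measurable_measure_prodMk_right hSm) ham] at m1
      exact m1.symm
    rw [hcalc]
    have hbound : ∀ ω, ENNReal.ofReal (κ ^ 2 / E) ≤ noiseLaw N (h / γ).toNNReal
          {z | b (IsTwoStateChain.cellIntegral x h N ω) + z ∈ A} := by
      intro ω
      refine noiseLaw_shift_ge hv _ hκ.le (Real.exp_pos _) ?_ hAm hAκ
      rw [Real.coe_toNNReal _ hv0.le]
      refine Real.exp_le_exp.2 ?_
      have hbk : ∀ k : Fin N, b (IsTwoStateChain.cellIntegral x h N ω) k ^ 2 / (h / γ) ≤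
          (L + L' + 1) ^ 2 * γ * h := by
        intro k
        have k1 := hgrid n k k.2.le
        have k2 := hgrid n (k + 1) k.2
        push_cast at k2
        have a1 := hgL _ k2 _ k1
        have a2 := hcL' _ k2 _ k1
        have e3 : ((k : ℕ) + 1 : ℝ) * h - (k : ℕ) * h = h := by ring
        rw [e3, abs_of_pos hh0] at a1 a2
        have a3 := hM.chain.cellIntegral_mem hh0.le k ω
        have a4 : |b (IsTwoStateChain.cellIntegral x h N ω) k| ≤ (L + L' + 1) * h := by
          simp only [hb, Pi.add_apply, gridIncrement, hd]
          have t1 := abs_le.1 a1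
          have t2 := abs_le.1 a2
          rw [abs_le]
          constructor <;> linarith [t1.1, t1.2, t2.1, t2.2, a3.1, a3.2]
        rw [div_le_iff₀ hv0, ← sq_abs]
        calc |b (IsTwoStateChain.cellIntegral x h N ω) k| ^ 2 ≤ ((L + L' + 1) * h) ^ 2 := by gcongr
          _ = _ := by field_simp
      calc ∑ k, b (IsTwoStateChain.cellIntegral x h N ω) k ^ 2 / (h / γ)
          ≤ ∑ k : Fin N, (L + L' + 1) ^ 2 * γ * h := Finset.sum_le_sum fun k _ => hbk k
        _ = (L + L' + 1) ^ 2 * γ * (N * h) := by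
            simp only [Finset.sum_const, Finset.card_univ, Fintype.card_fin, nsmul_eq_mul]; ring
        _ = _ := by rw [hN, hh, hNh n]
    calc ENNReal.ofReal (κ ^ 2 / E) = ∫⁻ _, ENNReal.ofReal (κ ^ 2 / E) ∂P := by simp
      _ ≤ _ := lintegral_mono hbound
  have hlim := tendsto_measure_iInter_atTop (μ := P) (fun n => (hDm n).nullMeasurableSet) hDanti
    ⟨0, measure_ne_top _ _⟩
  have hge := ge_of_tendsto' hlim hDlow
  exact (ENNReal.ofReal_pos.2 (by positivity)).trans_le (hge.trans (measure_mono hDsub))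

end IsFilteringModel

/-! ### Identification and adaptedness of the conditional probabilities on every trajectory -/

lemma measurable_integral_likelihood {Ω : Type*} [MeasurableSpace Ω] {P : Measure Ω}
    [IsProbabilityMeasure P] {n : ℕ} (v : ℝ) {a : Ω → Fin n → ℝ} (ha : Measurable a) {U : Ω → ℝ}
    (hU : Measurable U) :
    Measurable fun z : Fin n → ℝ => ∫ ω, U ω * likelihood v (a ω) z ∂P := by
  have hl : Measurable fun w : (Fin n → ℝ) × Ω => likelihood v (a w.2) w.1 :=
    (measurable_likelihood (n := n) v).comp ((ha.comp measurable_snd).prodMk measurable_fst)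
  have : Measurable fun w : (Fin n → ℝ) × Ω => U w.2 * likelihood v (a w.2) w.1 :=
    (hU.comp measurable_snd).mul hl
  exact this.stronglyMeasurable.integral_prod_right'.measurable

namespace IsFilteringModel

variable {Ω : Type*} [MeasurableSpace Ω] {P : Measure Ω} {lam p q γ : ℝ} {x : ℝ → Ω → ℝ}
  {B : ℝ≥0 → Ω → ℝ} {π : ℝ → ℝ → Ω → ℝ}

/-- The log-gauge path of the observation. -/
noncomputable def gaugePath (γ : ℝ) (x : ℝ → Ω → ℝ) (B : ℝ≥0 → Ω → ℝ) (ω : Ω) (r : ℝ) : ℝ :=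
  γ * observation γ x B r ω - γ * r / 2

lemma continuousOn_gaugePath (hM : IsFilteringModel P lam p q γ x B π) (ω : Ω) (t : ℝ) :
    ContinuousOn (gaugePath γ x B ω) (Icc 0 t) := by
  have := hM.continuousOn_observation ω t
  unfold gaugePath
  fun_prop

lemma gaugePath_zero (hM : IsFilteringModel P lam p q γ x B π) (ω : Ω) :
    gaugePath γ x B ω 0 = 0 := by
  simp [gaugePath, hM.observation_zero]

lemma exists_smoother (hlam : 0 < lam) (hp : p ∈ Ioo (0 : ℝ) 1) (hq : q ∈ Icc (0 : ℝ) 1)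
    (hM : IsFilteringModel P lam p q γ x B π) {T : ℝ} (hT : 0 ≤ T) :
    ∃ G : Ω → ℝ → ℝ → ℝ, ∀ ω, IsPathSmoother lam p q T (gaugePath γ x B ω) (G ω) := by
  have := fun ω => IsPathSmoother.exists (lam := lam) (p := p) (q := q) hlam hp hq hT
    (hM.continuousOn_gaugePath ω T)
  choose G hG using this
  exact ⟨G, hG⟩

/-- The conditional probabilities are given by the robust smoother, for every trajectory. -/
theorem eq_smoother [IsProbabilityMeasure P] (hlam : 0 < lam) (hp : p ∈ Ioo (0 : ℝ) 1)
    (hq : q ∈ Icc (0 : ℝ) 1) (hγ : 0 < γ) (hM : IsFilteringModel P lam p q γ x B π) {T : ℝ}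
    {G : Ω → ℝ → ℝ → ℝ} (hG : ∀ ω, IsPathSmoother lam p q T (gaugePath γ x B ω) (G ω)) {s t : ℝ}
    (hs : 0 ≤ s) (hst : s ≤ t) (htT : t ≤ T) (ω : Ω) : π s t ω = G ω s t := by
  obtain ⟨F, hF, hFπ⟩ := hM.version s t hs hst
  have hpath : ∀ ω, ∃ c : C(Icc (0 : ℝ) t, ℝ), ∀ u : Icc (0 : ℝ) t,
      c u = observation γ x B (u : ℝ) ω := fun ω =>
    ⟨⟨_, continuousOn_iff_continuous_domRestrict.1 (hM.continuousOn_observation ω t)⟩,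
      fun u => rfl⟩
  choose c hc using hpath
  rcases (hs.trans hst).eq_or_lt with h | ht
  · -- the initial time
    subst h
    obtain rfl : s = 0 := le_antisymm hst hs
    have hconst : ∀ ω', c ω' = 0 := fun ω' => by
      ext u
      have hu : (u : ℝ) = 0 := le_antisymm u.2.2 u.2.1
      rw [hc, hu, hM.observation_zero]; rfl
    have h1 : ∀ ω', π 0 0 ω' = F 0 := fun ω' => by rw [hFπ ω' (c ω') (hc ω'), hconst]
    have hle : pastSigma (observation γ x B) 0 ≤ (inferInstance : MeasurableSpace Ω) :=
      pastSigma_le_of_measurable fun u hu => hM.measurable_observation hu.1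
    have h2 := integral_congr_ae (hM.condProb 0 0 le_rfl le_rfl)
    rw [integral_condExp hle, integral_indicator (measurableSet_eq_fun
      (hM.chain.measurable 0 le_rfl) measurable_const), setIntegral_const, measureReal_def,
      hM.chain.measure_initial, ENNReal.toReal_ofReal hq.1] at h2
    simp only [h1, integral_const, probReal_univ, smul_eq_mul, one_mul] at h2
    rw [h1, h2, mul_one, (hG ω).initial (hM.gaugePath_zero ω)]
  · have hae := hM.ae_eq_smoother hlam hp hq hγ hs hst ht htT hG
    -- The neighbourhood of the observed path of `ω` has positive probability and the identity holds
    -- almost surely, so it holds at trajectories `w n` whose observed paths converge uniformly to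
    -- that of `ω`. Both sides are continuous along this sequence.
    have hex : ∀ n : ℕ, ∃ ω', (∀ u ∈ Icc 0 t, |observation γ x B u ω' - observation γ x B u ω| ≤
        1 / ((n : ℝ) + 1)) ∧ π s t ω' = G ω' s t := by
      intro n
      have hpos := hM.measure_observation_near_pos hγ ht (hM.continuousOn_observation ω t)
        (hM.observation_zero ω) (e := 1 / ((n : ℝ) + 1)) (by positivity)
      have hfr : ∃ᵐ ω' ∂P, ∀ u ∈ Icc 0 t, |observation γ x B u ω' - observation γ x B u ω| ≤
          1 / ((n : ℝ) + 1) := frequently_ae_iff.2 hpos.ne'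
      exact (hfr.and_eventually hae).exists
    choose w hw1 hw2 using hex
    have hlim0 : Tendsto (fun n : ℕ => 1 / ((n : ℝ) + 1)) atTop (𝓝 0) :=
      tendsto_one_div_add_atTop_nhds_zero_nat
    have hcl : Tendsto (fun n => c (w n)) atTop (𝓝 (c ω)) := by
      rw [tendsto_iff_dist_tendsto_zero]
      refine squeeze_zero (fun _ => dist_nonneg) (fun n => ?_) hlim0
      refine (ContinuousMap.dist_le (by positivity)).2 fun u => ?_
      rw [hc, hc, Real.dist_eq]
      exact hw1 n u u.2
    have l1 : Tendsto (fun n => π s t (w n)) atTop (𝓝 (π s t ω)) := by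
      simp only [fun n => hFπ (w n) (c (w n)) (hc (w n)), hFπ ω (c ω) (hc ω)]
      exact (hF.tendsto _).comp hcl
    refine tendsto_nhds_unique l1 ?_
    simp only [hw2]
    refine IsPathSmoother.tendsto hlam hp hq hs hst htT ht (hM.continuousOn_gaugePath ω t)
      (fun n => hM.continuousOn_gaugePath (w n) t) ?_ (hG ω) (fun n => hG (w n))
    rw [Metric.tendstoUniformlyOn_iff]
    intro e he
    filter_upwards [hlim0.eventually_lt_const (by positivity : 0 < e / γ)] with n hn u hu
    have h1 := (hw1 n u hu).trans_lt hn
    rw [lt_div_iff₀ hγ] at h1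
    rw [dist_comm, Real.dist_eq, gaugePath, gaugePath, sub_sub_sub_cancel_right, ← mul_sub, abs_mul,
      abs_of_pos hγ, mul_comm]
    exact h1

/-- The conditional probabilities are adapted to the observation. -/
theorem measurable_condProb [IsProbabilityMeasure P] (hlam : 0 < lam) (hp : p ∈ Ioo (0 : ℝ) 1)
    (hq : q ∈ Icc (0 : ℝ) 1) (hγ : 0 < γ) (hM : IsFilteringModel P lam p q γ x B π) {s t : ℝ}
    (hs : 0 ≤ s) (hst : s ≤ t) : Measurable[pastSigma (observation γ x B) t] (π s t) := by
  obtain ⟨G, hG⟩ := hM.exists_smoother hlam hp hq (hs.trans hst)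
  have heq := fun ω => hM.eq_smoother hlam hp hq hγ hG hs hst le_rfl ω
  rcases (hs.trans hst).eq_or_lt with h | ht
  · subst h
    obtain rfl : s = 0 := le_antisymm hst hs
    have : π 0 0 = fun _ => q := by
      ext ω; rw [heq, (hG ω).initial (hM.gaugePath_zero ω)]
    rw [this]; exact measurable_const
  · have hNh : ∀ n : ℕ, ((2 ^ n : ℕ) : ℝ) * (t / 2 ^ n) = t := fun n => by push_cast; field_simp
    have hpos : ∀ n : ℕ, 0 < t / (2 : ℝ) ^ n := fun n => by positivity
    have hx := hM.chain
    -- The likelihood ratios are measurable functions of finitely many increments and converge on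
    -- every trajectory, so the limit is measurable for the uncompleted observation σ-algebra.
    set R : (n : ℕ) → (Fin (2 ^ n) → ℝ) → ℝ := fun n z =>
      (∫ ω, x s ω * likelihood (t / 2 ^ n / γ)
        (IsTwoStateChain.cellIntegral x (t / 2 ^ n) (2 ^ n) ω) z ∂P) /
      (∫ ω, likelihood (t / 2 ^ n / γ)
        (IsTwoStateChain.cellIntegral x (t / 2 ^ n) (2 ^ n) ω) z ∂P) with hR
    have hRm : ∀ n, Measurable (R n) := by
      intro n
      have ha := hx.measurable_cellIntegral (hpos n).le (N := 2 ^ n)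
      have h1 := measurable_integral_likelihood (P := P) (t / 2 ^ n / γ) ha (hx.measurable s hs)
      have h2 := measurable_integral_likelihood (P := P) (t / 2 ^ n / γ) ha (U := fun _ => 1)
        measurable_const
      simp only [one_mul] at h2
      exact h1.div h2
    refine @measurable_of_tendsto_metrizable _ _ (pastSigma (observation γ x B) t) _ _ _ _
      (fun n ω => R n (gridIncrement (fun u => observation γ x B u ω) (t / 2 ^ n) (2 ^ n))) _
      (fun n => (hRm n).comp (measurable_gridIncrement (hpos n).le (hNh n).le
        fun u hu => measurable_pastSigma hu)) ?_
    rw [tendsto_pi_nhds]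
    intro ω
    rw [heq]
    exact tendsto_likelihood_ratio hlam hp hq hx hγ ht hs hst (hM.continuousOn_observation ω t)
      (hM.observation_zero ω) le_rfl (hG ω)

end IsFilteringModel

/-! ### The filter along hot times -/

namespace IsFilteringModel

variable {Ω : Type*} [MeasurableSpace Ω] {P : Measure Ω} {lam p q γ : ℝ} {x : ℝ → Ω → ℝ}
  {B : ℝ≥0 → Ω → ℝ} {π : ℝ → ℝ → Ω → ℝ}

lemma pastSigma_observation_le' (hM : IsFilteringModel P lam p q γ x B π) (t : ℝ) :
    pastSigma (observation γ x B) t ≤ (inferInstance : MeasurableSpace Ω) :=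
  pastSigma_le_of_measurable fun _ hu => hM.measurable_observation hu.1

lemma condProb_mem [IsProbabilityMeasure P] (hlam : 0 < lam) (hp : p ∈ Ioo (0 : ℝ) 1)
    (hq : q ∈ Icc (0 : ℝ) 1) (hγ : 0 < γ) (hM : IsFilteringModel P lam p q γ x B π) {s t : ℝ}
    (hs : 0 ≤ s) (hst : s ≤ t) (ω : Ω) : π s t ω ∈ Icc (0 : ℝ) 1 := by
  obtain ⟨G, hG⟩ := hM.exists_smoother hlam hp hq (hs.trans hst)
  rw [hM.eq_smoother hlam hp hq hγ hG hs hst le_rfl ω]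
  exact (hG ω).mem_Icc s t hs hst le_rfl

lemma continuousOn_filter [IsProbabilityMeasure P] (hlam : 0 < lam) (hp : p ∈ Ioo (0 : ℝ) 1)
    (hq : q ∈ Icc (0 : ℝ) 1) (hγ : 0 < γ) (hM : IsFilteringModel P lam p q γ x B π) (T : ℝ) (ω : Ω) :
    ContinuousOn (fun t => π t t ω) (Icc 0 T) := by
  rcases lt_or_ge T 0 with h | h
  · rw [Icc_eq_empty (not_le.2 h)]; exact continuousOn_empty _
  obtain ⟨G, hG⟩ := hM.exists_smoother hlam hp hq h
  exact (hG ω).continuousOn_diag.congr fun t ht =>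
    hM.eq_smoother hlam hp hq hγ hG ht.1 le_rfl ht.2 ω

lemma measurable_filter [IsProbabilityMeasure P] (hlam : 0 < lam) (hp : p ∈ Ioo (0 : ℝ) 1)
    (hq : q ∈ Icc (0 : ℝ) 1) (hγ : 0 < γ) (hM : IsFilteringModel P lam p q γ x B π) {t : ℝ}
    (ht : 0 ≤ t) : Measurable (π t t) :=
  (hM.measurable_condProb hlam hp hq hγ ht le_rfl).mono (hM.pastSigma_observation_le' t) le_rfl

lemma condProb_eq [IsProbabilityMeasure P] (hM : IsFilteringModel P lam p q γ x B π) {t : ℝ}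
    (ht : 0 ≤ t) : π t t =ᵐ[P] P[x t | pastSigma (observation γ x B) t] := by
  have hind : {ω | x t ω = 1}.indicator (fun _ => (1 : ℝ)) = x t := by
    ext ω
    rcases hM.chain.mem_states t ht ω with h | h <;> simp [indicator, h]
  have := hM.condProb t t ht le_rfl
  rwa [hind] at this

lemma integrable_signal [IsProbabilityMeasure P] (hM : IsFilteringModel P lam p q γ x B π) {t : ℝ}
    (ht : 0 ≤ t) : Integrable (x t) P :=
  Integrable.of_bound (hM.chain.measurable t ht).aestronglyMeasurable 1
    (ae_of_all _ fun ω => hM.chain.abs_le_one ht ω)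

lemma integrable_filter [IsProbabilityMeasure P] (hM : IsFilteringModel P lam p q γ x B π) {t : ℝ}
    (ht : 0 ≤ t) : Integrable (π t t) P :=
  integrable_condExp.congr (hM.condProb_eq ht).symm

lemma setIntegral_filter [IsProbabilityMeasure P] (hM : IsFilteringModel P lam p q γ x B π) {t : ℝ}
    (ht : 0 ≤ t) {A : Set Ω} (hA : MeasurableSet[pastSigma (observation γ x B) t] A) :
    ∫ ω in A, π t t ω ∂P = ∫ ω in A, x t ω ∂P := by
  rw [← setIntegral_condExp (hM.pastSigma_observation_le' t) (hM.integrable_signal ht) hA]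
  exact setIntegral_congr_ae ((hM.pastSigma_observation_le' t) A hA)
    ((hM.condProb_eq ht).mono fun ω h _ => h)

/-- At a time where the filter is close to the state opposite to `e`, the signal is rarely
equal to `e`. -/
lemma measure_hot_inter_le [IsProbabilityMeasure P] (hM : IsFilteringModel P lam p q γ x B π)
    {η : ℝ} (hη : 0 ≤ η) (e : Fin 2) {t : ℝ} (ht : 0 ≤ t) {A : Set Ω}
    (hA : MeasurableSet[pastSigma (observation γ x B) t] A)
    (hAη : ∀ ω ∈ A, π t t ω ∈ Icc (0 : ℝ) 1 ∧ 1 - η < |π t t ω - ((e : ℕ) : ℝ)|) :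
    P (A ∩ {ω | x t ω = ((e : ℕ) : ℝ)}) ≤ ENNReal.ofReal η * P A := by
  have hAm : MeasurableSet A := (hM.pastSigma_observation_le' t) A hA
  have hx := hM.chain
  have hS := hx.measurableSet_state ht e
  have key : (P (A ∩ {ω | x t ω = ((e : ℕ) : ℝ)})).toReal ≤ η * (P A).toReal := by
    have h1 := hM.setIntegral_filter ht hA
    have hi1 := (hM.integrable_filter ht).integrableOn (s := A)
    have hi2 := (hM.integrable_signal ht).integrableOn (s := A)
    have h2 : (P (A ∩ {ω | x t ω = ((e : ℕ) : ℝ)})).toReal =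
        ∫ ω in A, {ω | x t ω = ((e : ℕ) : ℝ)}.indicator 1 ω ∂P := by
      rw [setIntegral_indicator hS]; simp [measureReal_def]
    have h3 : η * (P A).toReal = ∫ ω in A, η ∂P := by
      rw [setIntegral_const, smul_eq_mul, measureReal_def, mul_comm]
    rw [h2, h3]
    have hconst : ∀ c : ℝ, IntegrableOn (fun _ => c) A P := fun c => integrable_const c
    obtain rfl | rfl : e = 0 ∨ e = 1 := by fin_cases e <;> simp
    · have e1 : ∀ ω, ({ω | x t ω = (((0 : Fin 2) : ℕ) : ℝ)}.indicator 1 ω : ℝ) = 1 - x t ω := by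
        intro ω
        rcases hx.mem_states t ht ω with h | h <;> simp [indicator, h]
      simp only [e1]
      rw [integral_sub (hconst 1) hi2, ← h1, ← integral_sub (hconst 1) hi1]
      refine setIntegral_mono_on ((hconst 1).sub hi1) (hconst η) hAm fun ω hω => ?_
      obtain ⟨⟨a1, a2⟩, a3⟩ := hAη ω hω
      simp only [Fin.val_zero, Nat.cast_zero, sub_zero] at a3
      rw [abs_of_nonneg a1] at a3
      linarith
    · have e1 : ∀ ω, ({ω | x t ω = (((1 : Fin 2) : ℕ) : ℝ)}.indicator 1 ω : ℝ) = x t ω := by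
        intro ω
        rcases hx.mem_states t ht ω with h | h <;> simp [indicator, h]
      simp only [e1]
      rw [← h1]
      refine setIntegral_mono_on hi1 (hconst η) hAm fun ω hω => ?_
      obtain ⟨⟨a1, a2⟩, a3⟩ := hAη ω hω
      simp only [Fin.val_one, Nat.cast_one] at a3
      rw [abs_of_nonpos (by linarith)] at a3
      linarith
  rw [← ENNReal.ofReal_toReal (measure_ne_top P (A ∩ _)),
    ← ENNReal.ofReal_toReal (measure_ne_top P A), ← ENNReal.ofReal_mul hη]
  exact ENNReal.ofReal_le_ofReal key

/-- Along a finite set of times, the filter rarely comes close to the state opposite to `e` if the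
signal is in `e` shortly afterwards. -/
lemma measure_hot_le [IsProbabilityMeasure P] (hlam : 0 < lam) (hp : p ∈ Ioo (0 : ℝ) 1)
    (hq : q ∈ Icc (0 : ℝ) 1) (hγ : 0 < γ) (hM : IsFilteringModel P lam p q γ x B π)
    {η m : ℝ} (hη : 0 ≤ η) (hm : 0 ≤ m) (e : Fin 2) (F : Finset ℝ) (hF : ∀ s ∈ F, 0 ≤ s)
    {v : ℝ → ℝ} (hv : ∀ s ∈ F, s ≤ v s ∧ v s ≤ s + m) :
    P {ω | (∃ s ∈ F, 1 - η < |π s s ω - ((e : ℕ) : ℝ)|) ∧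
      ∀ s ∈ F, x (v s) ω = ((e : ℕ) : ℝ)} ≤ ENNReal.ofReal (η + lam * m) := by
  have hx := hM.chain
  have hp' : p ∈ Icc (0 : ℝ) 1 := ⟨hp.1.le, hp.2.le⟩
  set hot : ℝ → Set Ω := fun s => {ω | 1 - η < |π s s ω - ((e : ℕ) : ℝ)|} with hhot
  -- On `A s` the first hot time in `F` is `s`. These events are disjoint and each is observable at
  -- its own time, so the estimates at the different times add up to at most one total mass.
  set A : ℝ → Set Ω := fun s => hot s \ ⋃ s' ∈ F.filter (· < s), hot s' with hA
  have hhm : ∀ s t, 0 ≤ s → s ≤ t → MeasurableSet[pastSigma (observation γ x B) t] (hot s) := by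
    intro s t hs hst
    have h1 : Measurable[pastSigma (observation γ x B) t] (π s s) :=
      (hM.measurable_condProb hlam hp hq hγ hs le_rfl).mono
        (pastSigma_le_of_measurable fun u hu => measurable_pastSigma ⟨hu.1, hu.2.trans hst⟩) le_rfl
    have h2 : Measurable fun y : ℝ => |y - ((e : ℕ) : ℝ)| := by fun_prop
    exact (h2.comp h1) measurableSet_Ioi
  have hAm : ∀ s ∈ F, MeasurableSet[pastSigma (observation γ x B) s] (A s) := by
    intro s hs
    refine MeasurableSet.diff (hhm s s (hF s hs) le_rfl) ?_
    refine Finset.measurableSet_biUnion _ fun s' hs' => ?_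
    rw [Finset.mem_filter] at hs'
    exact hhm s' s (hF s' hs'.1) hs'.2.le
  have hcover : {ω | (∃ s ∈ F, 1 - η < |π s s ω - ((e : ℕ) : ℝ)|) ∧
      ∀ s ∈ F, x (v s) ω = ((e : ℕ) : ℝ)} ⊆
      ⋃ s ∈ F, A s ∩ {ω | x (v s) ω = ((e : ℕ) : ℝ)} := by
    rintro ω ⟨⟨s, hs, hsω⟩, hω⟩
    classical
    have hne : (F.filter fun s => ω ∈ hot s).Nonempty :=
      ⟨s, Finset.mem_filter.2 ⟨hs, hsω⟩⟩
    obtain ⟨s₀, hs₀, hmin⟩ := Finset.exists_minimal hne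
    rw [Finset.mem_filter] at hs₀
    refine mem_iUnion₂.2 ⟨s₀, hs₀.1, ⟨hs₀.2, ?_⟩, hω s₀ hs₀.1⟩
    rw [mem_iUnion₂]
    rintro ⟨s', hs', hs'ω⟩
    rw [Finset.mem_filter] at hs'
    exact absurd (hmin (Finset.mem_filter.2 ⟨hs'.1, hs'ω⟩) hs'.2.le) (not_le.2 hs'.2)
  have hdisj : (F : Set ℝ).PairwiseDisjoint A := by
    intro s hs s' hs' hne
    rw [Function.onFun, Set.disjoint_left]
    intro ω h1 h2
    rcases lt_or_gt_of_ne hne with h | h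
    · exact h2.2 (mem_iUnion₂.2 ⟨s, Finset.mem_filter.2 ⟨hs, h⟩, h1.1⟩)
    · exact h1.2 (mem_iUnion₂.2 ⟨s', Finset.mem_filter.2 ⟨hs', h⟩, h2.1⟩)
  have hone : ∀ s ∈ F, P (A s ∩ {ω | x (v s) ω = ((e : ℕ) : ℝ)}) ≤
      ENNReal.ofReal (η + lam * m) * P (A s) := by
    intro s hs
    have hs0 := hF s hs
    obtain ⟨v1, v2⟩ := hv s hs
    -- Either the signal is already in `e` at the hot time, which costs `η` by the definition of the
    -- filter, or it jumps to `e` before `v s`, which costs `lam * m` by the Markov property.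
    have hsplit : A s ∩ {ω | x (v s) ω = ((e : ℕ) : ℝ)} ⊆
        (A s ∩ {ω | x s ω = ((e : ℕ) : ℝ)}) ∪ (A s ∩ ({ω | x s ω = (((1 - e : Fin 2) : ℕ) : ℝ)} ∩
          {ω | x (v s) ω = ((e : ℕ) : ℝ)})) := by
      rintro ω ⟨h1, h2⟩
      rcases hx.mem_states s hs0 ω with h | h <;> fin_cases e
      · exact Or.inl ⟨h1, by simpa using h⟩
      · exact Or.inr ⟨h1, by simpa using h, h2⟩
      · exact Or.inr ⟨h1, by simpa using h, h2⟩
      · exact Or.inl ⟨h1, by simpa using h⟩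
    have b1 := hM.measure_hot_inter_le hη e hs0 (hAm s hs) fun ω hω =>
      ⟨hM.condProb_mem hlam hp hq hγ hs0 le_rfl ω, hω.1⟩
    have b2 : P (A s ∩ ({ω | x s ω = (((1 - e : Fin 2) : ℕ) : ℝ)} ∩
          {ω | x (v s) ω = ((e : ℕ) : ℝ)})) ≤ ENNReal.ofReal (lam * m) * P (A s) := by
      rw [hx.measure_past_noise_inter hlam.le hp' hM.noiseSigma_le (fun t _ => hM.indep_noise t) hs0
        v1 (hM.pastSigma_observation_le s _ (hAm s hs))]
      refine mul_le_mul' (ENNReal.ofReal_le_ofReal ?_) (measure_mono inter_subset_left)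
      refine (transition_le hlam.le hp' (by linarith) (by fin_cases e <;> simp)).trans ?_
      gcongr
      linarith
    calc P (A s ∩ {ω | x (v s) ω = ((e : ℕ) : ℝ)})
        ≤ _ := (measure_mono hsplit).trans (measure_union_le _ _)
      _ ≤ ENNReal.ofReal η * P (A s) + ENNReal.ofReal (lam * m) * P (A s) := add_le_add b1 b2
      _ = _ := by rw [ENNReal.ofReal_add hη (by positivity), add_mul]
  calc _ ≤ P (⋃ s ∈ F, A s ∩ {ω | x (v s) ω = ((e : ℕ) : ℝ)}) := measure_mono hcover
    _ ≤ ∑ s ∈ F, P (A s ∩ {ω | x (v s) ω = ((e : ℕ) : ℝ)}) := measure_biUnion_finset_le _ _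
    _ ≤ ∑ s ∈ F, ENNReal.ofReal (η + lam * m) * P (A s) := Finset.sum_le_sum hone
    _ = ENNReal.ofReal (η + lam * m) * P (⋃ s ∈ F, A s) := by
        rw [← Finset.mul_sum, measure_biUnion_finset hdisj fun s hs =>
          (hM.pastSigma_observation_le' s) _ (hAm s hs)]
    _ ≤ _ := mul_le_of_le_one_right' prob_le_one

/-- The error of the filter dominates the distance between the signal and any other process. -/
lemma integral_abs_sub_le [IsProbabilityMeasure P] (hlam : 0 < lam) (hp : p ∈ Ioo (0 : ℝ) 1)
    (hq : q ∈ Icc (0 : ℝ) 1) (hγ : 0 < γ) (hM : IsFilteringModel P lam p q γ x B π) {t : ℝ}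
    (ht : 0 ≤ t) {Z : Ω → ℝ} (hZ : Measurable Z) (hZ01 : ∀ ω, Z ω = 0 ∨ Z ω = 1) :
    ∫ ω, |x t ω - Z ω| ∂P ≤ 3 * ∫ ω, |π t t ω - Z ω| ∂P := by
  have hx := hM.chain
  set f := π t t with hf
  have hf01 : ∀ ω, f ω ∈ Icc (0 : ℝ) 1 := fun ω => hM.condProb_mem hlam hp hq hγ ht le_rfl ω
  have hfm := hM.measurable_filter hlam hp hq hγ ht
  have hfm' := hM.measurable_condProb hlam hp hq hγ ht le_rfl
  have hxm := hx.measurable t ht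
  have hbdd : ∀ g : Ω → ℝ, Measurable g → (∀ ω, |g ω| ≤ 1) → Integrable g P := fun g hg hg1 =>
    Integrable.of_bound hg.aestronglyMeasurable 1 (ae_of_all _ hg1)
  have hx01 : ∀ ω, x t ω ∈ Icc (0 : ℝ) 1 := fun ω => hx.mem_Icc ht ω
  have hfx : Integrable (fun ω => f ω * x t ω) P := hbdd _ (hfm.mul hxm) fun ω => by
    rw [abs_mul, abs_of_nonneg (hf01 ω).1, abs_of_nonneg (hx01 ω).1]
    exact mul_le_one₀ (hf01 ω).2 (hx01 ω).1 (hx01 ω).2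
  have hff : Integrable (fun ω => f ω * f ω) P := hbdd _ (hfm.mul hfm) fun ω => by
    rw [abs_mul, abs_of_nonneg (hf01 ω).1]
    exact mul_le_one₀ (hf01 ω).2 (hf01 ω).1 (hf01 ω).2
  have hpull : ∫ ω, f ω * x t ω ∂P = ∫ ω, f ω * f ω ∂P := by
    have h1 := condExp_mul_of_stronglyMeasurable_left (μ := P)
      (m := pastSigma (observation γ x B) t) (f := f) (g := x t) hfm'.stronglyMeasurable hfx
      (hM.integrable_signal ht)
    have h2 := integral_condExp (μ := P) (hM.pastSigma_observation_le' t) (f := f * x t)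
    have h3 : ∫ ω, f ω * x t ω ∂P = ∫ ω, (f * x t) ω ∂P := rfl
    rw [h3, ← h2]
    refine integral_congr_ae ?_
    filter_upwards [h1, hM.condProb_eq ht] with ω a1 a2
    rw [a1, Pi.mul_apply, ← a2]
  -- The filter's own error is twice the mean of `f * (1 - f)`, which is bounded pointwise by `|f -
  -- Z|` for any `Z` with values in `{0, 1}`. The triangle inequality then gives the constant `3 = 2
  -- + 1`.
  have hint : ∫ ω, |x t ω - f ω| ∂P = ∫ ω, 2 * (f ω * (1 - f ω)) ∂P := by
    have e1 : ∀ ω, |x t ω - f ω| = x t ω + f ω - 2 * (f ω * x t ω) := by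
      intro ω
      rcases hx.mem_states t ht ω with h | h <;> rw [h]
      · rw [zero_sub, abs_neg, abs_of_nonneg (hf01 ω).1]; ring
      · rw [abs_of_nonneg (by linarith [(hf01 ω).2])]; ring
    have e2 : ∀ ω, 2 * (f ω * (1 - f ω)) = f ω + f ω - 2 * (f ω * f ω) := fun ω => by ring
    have hfi := hM.integrable_filter ht
    have hxi := hM.integrable_signal ht
    have hfx0 : ∫ ω, f ω ∂P = ∫ ω, x t ω ∂P := by
      have := hM.setIntegral_filter ht (A := univ) MeasurableSet.univ
      simpa using this
    simp only [e1, e2]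
    have s1 : Integrable (fun ω => x t ω + f ω) P := hxi.add hfi
    have s2 : Integrable (fun ω => f ω + f ω) P := hfi.add hfi
    rw [integral_sub s1 (hfx.const_mul 2),
      integral_sub s2 (hff.const_mul 2), integral_add hxi hfi, integral_add hfi hfi,
      integral_const_mul, integral_const_mul, hpull, hfx0]
  have hpt : ∀ ω, 2 * (f ω * (1 - f ω)) ≤ 2 * |f ω - Z ω| := by
    intro ω
    obtain ⟨a1, a2⟩ := hf01 ω
    rcases hZ01 ω with h | h <;> rw [h]
    · rw [sub_zero, abs_of_nonneg a1]; nlinarith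
    · rw [abs_sub_comm, abs_of_nonneg (by linarith)]; nlinarith
  have hZ01' : ∀ ω, Z ω ∈ Icc (0 : ℝ) 1 := fun ω => by rcases hZ01 ω with h | h <;> simp [h]
  have i1 : Integrable (fun ω => |f ω - Z ω|) P := hbdd _ (hfm.sub hZ).abs fun ω => by
    rw [abs_abs, abs_le]
    constructor <;> linarith [(hf01 ω).1, (hf01 ω).2, (hZ01' ω).1, (hZ01' ω).2]
  have i2 : Integrable (fun ω => |x t ω - f ω|) P := hbdd _ (hxm.sub hfm).abs fun ω => by
    rw [abs_abs, abs_le]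
    constructor <;> linarith [(hf01 ω).1, (hf01 ω).2, (hx01 ω).1, (hx01 ω).2]
  have i3 : Integrable (fun ω => |x t ω - Z ω|) P := hbdd _ (hxm.sub hZ).abs fun ω => by
    rw [abs_abs, abs_le]
    constructor <;> linarith [(hx01 ω).1, (hx01 ω).2, (hZ01' ω).1, (hZ01' ω).2]
  have i4 : Integrable (fun ω => 2 * (f ω * (1 - f ω))) P := by
    have := ((hM.integrable_filter ht).sub hff).const_mul 2
    refine this.congr (ae_of_all _ fun ω => ?_)
    simp only [Pi.sub_apply]; ring
  calc ∫ ω, |x t ω - Z ω| ∂P ≤ ∫ ω, (|x t ω - f ω| + |f ω - Z ω|) ∂P :=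
        integral_mono i3 (i2.add i1) fun ω => abs_sub_le _ _ _
    _ = ∫ ω, 2 * (f ω * (1 - f ω)) ∂P + ∫ ω, |f ω - Z ω| ∂P := by rw [integral_add i2 i1, hint]
    _ ≤ ∫ ω, 2 * |f ω - Z ω| ∂P + ∫ ω, |f ω - Z ω| ∂P := by
        exact add_le_add_left (integral_mono i4 (i1.const_mul 2) hpt) _
    _ = _ := by rw [integral_const_mul]; ring

end IsFilteringModel

/-! ### Exclusion of full spikes -/

section Exclusion

variable {Ω : Type*} [MeasurableSpace Ω] {P : Measure Ω} [IsProbabilityMeasure P]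
  {lam p q H : ℝ} {x : ℝ → Ω → ℝ} {X : ℝ → ℝ → Ω → ℝ} {B : ℝ → ℝ≥0 → Ω → ℝ}
  {π : ℝ → ℝ → ℝ → Ω → ℝ}

lemma measure_signal_ne_le (hlam : 0 < lam) (hp : p ∈ Ioo (0 : ℝ) 1) (hq : q ∈ Icc (0 : ℝ) 1)
    (hx : IsTwoStateChain P lam p q x) {γ : ℝ} (hγ : 0 < γ)
    (hM : IsFilteringModel P lam p q γ (X γ) (B γ) (π γ)) {t : ℝ} (ht : 0 ≤ t) :
    P {ω | X γ t ω ≠ x t ω} ≤ 3 * ∫⁻ ω, ENNReal.ofReal (min |π γ t t ω - x t ω| 1) ∂P := by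
  have h := hM.integral_abs_sub_le hlam hp hq hγ ht (hx.measurable t ht) (hx.mem_states t ht)
  have hf01 : ∀ ω, π γ t t ω ∈ Icc (0 : ℝ) 1 := fun ω => hM.condProb_mem hlam hp hq hγ ht le_rfl ω
  have hx01 : ∀ ω, x t ω ∈ Icc (0 : ℝ) 1 := fun ω => hx.mem_Icc ht ω
  have hle : ∀ ω, |π γ t t ω - x t ω| ≤ 1 := fun ω => by
    rw [abs_le]; constructor <;> linarith [(hf01 ω).1, (hf01 ω).2, (hx01 ω).1, (hx01 ω).2]
  have hmeas : MeasurableSet {ω | X γ t ω ≠ x t ω} :=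
    (measurableSet_eq_fun (hM.chain.measurable t ht) (hx.measurable t ht)).compl
  have hind : ∀ ω, |X γ t ω - x t ω| = {ω | X γ t ω ≠ x t ω}.indicator 1 ω := by
    intro ω
    rcases hM.chain.mem_states t ht ω with h1 | h1 <;> rcases hx.mem_states t ht ω with h2 | h2 <;>
      simp [indicator, h1, h2]
  simp only [hind] at h
  rw [integral_indicator_one hmeas] at h
  have hi : Integrable (fun ω => |π γ t t ω - x t ω|) P :=
    Integrable.of_bound (((hM.measurable_filter hlam hp hq hγ ht).sub
      (hx.measurable t ht)).abs).aestronglyMeasurable 1 (ae_of_all _ fun ω => by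
        rw [Real.norm_eq_abs, abs_abs]; exact hle ω)
  have e1 : ∫⁻ ω, ENNReal.ofReal (min |π γ t t ω - x t ω| 1) ∂P =
      ENNReal.ofReal (∫ ω, |π γ t t ω - x t ω| ∂P) := by
    rw [ofReal_integral_eq_lintegral_ofReal hi (ae_of_all _ fun ω => abs_nonneg _)]
    exact lintegral_congr fun ω => by rw [min_eq_left (hle ω)]
  have e3 : (3 : ℝ≥0∞) = ENNReal.ofReal 3 := by simp
  rw [e1, e3, ← ENNReal.ofReal_mul (by norm_num), ← ENNReal.ofReal_toReal (measure_ne_top P _)]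
  exact ENNReal.ofReal_le_ofReal h

/-- Almost sure convergence in `dL` becomes convergence in mean, `dL` being bounded by `H`; the
clamped times supply the joint measurability needed to exchange the integrals. -/
lemma tendsto_lintegral_filter_error (hlam : 0 < lam) (hp : p ∈ Ioo (0 : ℝ) 1)
    (hq : q ∈ Icc (0 : ℝ) 1) (hH : 0 < H) (hx : IsTwoStateChain P lam p q x)
    (hmodel : ∀ γ, 0 < γ → IsFilteringModel P lam p q γ (X γ) (B γ) (π γ)) {γ : ℕ → ℝ}
    (hγ : ∀ n, 0 < γ n)
    (hL : ∀ᵐ ω ∂P, Tendsto (fun n => dL H (fun t => π (γ n) t t ω) (fun t => x t ω)) atTop (𝓝 0)) :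
    Tendsto (fun n => ∫⁻ t in Icc 0 H, ∫⁻ ω,
      ENNReal.ofReal (min |π (γ n) t t ω - x t ω| 1) ∂P) atTop (𝓝 0) := by
  set g : ℕ → Ω → ℝ → ℝ≥0∞ := fun n ω t => ENNReal.ofReal (min |π (γ n) (min H (max t 0))
    (min H (max t 0)) ω - x (min H (max t 0)) ω| 1) with hg
  have hgm : ∀ n, Measurable (Function.uncurry (g n)) := by
    intro n
    have hM := hmodel (γ n) (hγ n)
    have h1 := measurable_clamp (x := fun t => π (γ n) t t) hH.le
      (fun u hu => hM.measurable_filter hlam hp hq (hγ n) hu.1) (fun ω u hu => by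
        have := hM.continuousOn_filter hlam hp hq (hγ n) (u + 1) ω u ⟨hu, by linarith⟩
        refine this.mono_of_mem_nhdsWithin ?_
        filter_upwards [self_mem_nhdsWithin, mem_nhdsWithin_of_mem_nhds
          (Iio_mem_nhds (by linarith : u < u + 1))] with w h1 h2
        exact ⟨hu.trans h1, h2.le⟩)
    have h2 := measurable_clamp hH.le (fun u hu => hx.measurable u hu.1) hx.right_continuous
    exact ((((h1.sub h2).abs).min measurable_const).ennreal_ofReal).comp measurable_swap
  have hgeq : ∀ n ω, ∀ t ∈ Icc 0 H, g n ω t = ENNReal.ofReal (min |π (γ n) t t ω - x t ω| 1) := by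
    intro n ω t ht
    simp only [hg, clamp_eq ht]
  have hswap : ∀ n, ∫⁻ t in Icc 0 H, ∫⁻ ω, ENNReal.ofReal (min |π (γ n) t t ω - x t ω| 1) ∂P =
      ∫⁻ ω, dL H (fun t => π (γ n) t t ω) (fun t => x t ω) ∂P := by
    intro n
    calc _ = ∫⁻ t in Icc 0 H, ∫⁻ ω, g n ω t ∂P :=
          setLIntegral_congr_fun measurableSet_Icc fun t ht =>
            lintegral_congr fun ω => (hgeq n ω t ht).symm
      _ = ∫⁻ ω, (∫⁻ t in Icc 0 H, g n ω t) ∂P :=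
          (lintegral_lintegral_swap (hgm n).aemeasurable).symm
      _ = _ := lintegral_congr fun ω =>
          setLIntegral_congr_fun measurableSet_Icc fun t ht => hgeq n ω t ht
  simp only [hswap]
  have hdm : ∀ n, Measurable fun ω => dL H (fun t => π (γ n) t t ω) (fun t => x t ω) := by
    intro n
    have h1 : Measurable fun ω => ∫⁻ t in Icc 0 H, g n ω t := (hgm n).lintegral_prod_right'
    have h2 : (fun ω => ∫⁻ t in Icc 0 H, g n ω t) =
        fun ω => dL H (fun t => π (γ n) t t ω) (fun t => x t ω) := funext fun ω =>
      setLIntegral_congr_fun measurableSet_Icc fun t ht => hgeq n ω t ht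
    rwa [← h2]
  have := tendsto_lintegral_of_dominated_convergence (μ := P)
    (F := fun n ω => dL H (fun t => π (γ n) t t ω) (fun t => x t ω)) (f := fun _ => 0)
    (fun _ => ENNReal.ofReal H) hdm (fun n => ae_of_all _ fun ω => ?_) (by simp) hL
  · simpa using this
  · calc dL H (fun t => π (γ n) t t ω) (fun t => x t ω) ≤ ∫⁻ t in Icc 0 H, 1 :=
          lintegral_mono fun t => by
            rw [← ENNReal.ofReal_one]
            exact ENNReal.ofReal_le_ofReal (min_le_right _ _)
      _ = _ := by simp

/-- The signals converge in probability at each time. -/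
lemma tendsto_measure_signal_ne (hlam : 0 < lam) (hp : p ∈ Ioo (0 : ℝ) 1)
    (hq : q ∈ Icc (0 : ℝ) 1) (hH : 0 < H) (hx : IsTwoStateChain P lam p q x)
    (hmodel : ∀ γ, 0 < γ → IsFilteringModel P lam p q γ (X γ) (B γ) (π γ)) {γ : ℕ → ℝ}
    (hγ : ∀ n, 0 < γ n)
    (hL : ∀ᵐ ω ∂P, Tendsto (fun n => dL H (fun t => π (γ n) t t ω) (fun t => x t ω)) atTop (𝓝 0))
    {v : ℝ} (hv : v ∈ Ioc 0 H) :
    Tendsto (fun n => P {ω | X (γ n) v ω ≠ x v ω}) atTop (𝓝 0) := by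
  have hp' : p ∈ Icc (0 : ℝ) 1 := ⟨hp.1.le, hp.2.le⟩
  set φ : ℕ → ℝ → ℝ≥0∞ := fun n t =>
    ∫⁻ ω, ENNReal.ofReal (min |π (γ n) t t ω - x t ω| 1) ∂P with hφ
  have hlim : Tendsto (fun n => ∫⁻ t in Icc 0 H, φ n t) atTop (𝓝 0) :=
    tendsto_lintegral_filter_error hlam hp hq hH hx hmodel hγ hL
  -- The error is controlled only after integration in time. It is averaged over `[v - h, v]`, the
  -- price being that one of the two chains changes state between `t` and `v`.
  have hbound : ∀ n h, 0 < h → h ≤ v → ENNReal.ofReal h * P {ω | X (γ n) v ω ≠ x v ω} ≤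
      ENNReal.ofReal h * ENNReal.ofReal (2 * (lam * h)) + 3 * ∫⁻ t in Icc 0 H, φ n t := by
    intro n h hh hhv
    have hM := hmodel (γ n) (hγ n)
    have hpt : ∀ t ∈ Icc (v - h) v, P {ω | X (γ n) v ω ≠ x v ω} ≤
        ENNReal.ofReal (2 * (lam * h)) + 3 * φ n t := by
      intro t ht
      have ht0 : 0 ≤ t := by linarith [ht.1]
      have hsub : {ω | X (γ n) v ω ≠ x v ω} ⊆ ({ω | X (γ n) t ω ≠ X (γ n) v ω} ∪
          {ω | x t ω ≠ x v ω}) ∪ {ω | X (γ n) t ω ≠ x t ω} := by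
        intro ω hω
        by_contra hcon
        simp only [mem_union, mem_ofPred_eq, not_or, not_not] at hcon
        exact hω (by rw [← hcon.1.1, hcon.2, hcon.1.2])
      have b : lam * (v - t) ≤ lam * h := by gcongr; linarith [ht.1]
      calc P {ω | X (γ n) v ω ≠ x v ω} ≤ _ := measure_mono hsub
        _ ≤ (P {ω | X (γ n) t ω ≠ X (γ n) v ω} + P {ω | x t ω ≠ x v ω}) +
            P {ω | X (γ n) t ω ≠ x t ω} :=
          (measure_union_le _ _).trans (add_le_add_left (measure_union_le _ _) _)
        _ ≤ (ENNReal.ofReal (lam * h) + ENNReal.ofReal (lam * h)) + 3 * φ n t := by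
          gcongr
          · exact (hM.chain.measure_ne_le hlam.le hp' ht0 ht.2).trans (ENNReal.ofReal_le_ofReal b)
          · exact (hx.measure_ne_le hlam.le hp' ht0 ht.2).trans (ENNReal.ofReal_le_ofReal b)
          · exact measure_signal_ne_le hlam hp hq hx (hγ n) hM ht0
        _ = _ := by rw [two_mul, ENNReal.ofReal_add (by positivity) (by positivity)]
    have hvol : volume (Icc (v - h) v) = ENNReal.ofReal h := by rw [Real.volume_Icc]; congr 1; ring
    calc ENNReal.ofReal h * P {ω | X (γ n) v ω ≠ x v ω}
        = ∫⁻ t in Icc (v - h) v, P {ω | X (γ n) v ω ≠ x v ω} := by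
          rw [setLIntegral_const, hvol, mul_comm]
      _ ≤ ∫⁻ t in Icc (v - h) v, (ENNReal.ofReal (2 * (lam * h)) + 3 * φ n t) :=
          setLIntegral_mono' measurableSet_Icc hpt
      _ = ENNReal.ofReal h * ENNReal.ofReal (2 * (lam * h)) + 3 * ∫⁻ t in Icc (v - h) v, φ n t := by
          rw [lintegral_add_left measurable_const, setLIntegral_const, hvol,
            lintegral_const_mul' _ _ (by simp), mul_comm]
      _ ≤ _ := by
          gcongr
          · linarith
          · exact hv.2
  rw [ENNReal.tendsto_nhds_zero] at hlim ⊢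
  intro e he
  obtain ⟨e', he'0, he'⟩ : ∃ e' : ℝ, 0 < e' ∧ ENNReal.ofReal e' ≤ e := by
    rcases eq_or_ne e ∞ with rfl | hne
    · exact ⟨1, one_pos, le_top⟩
    · exact ⟨e.toReal, ENNReal.toReal_pos he.ne' hne, ENNReal.ofReal_toReal_le⟩
  set h := min v (e' / (4 * lam)) with hh
  have hh0 : 0 < h := lt_min hv.1 (by positivity)
  have h1 : 2 * (lam * h) ≤ e' / 2 := by
    have : h ≤ e' / (4 * lam) := min_le_right _ _
    calc 2 * (lam * h) ≤ 2 * (lam * (e' / (4 * lam))) := by gcongr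
      _ = _ := by field_simp; ring
  filter_upwards [hlim (ENNReal.ofReal (h * e' / 6)) (ENNReal.ofReal_pos.2 (by positivity))]
    with n hn
  refine le_trans ?_ he'
  have h2 := hbound n h hh0 (min_le_left _ _)
  have h3 : ENNReal.ofReal h * ENNReal.ofReal (2 * (lam * h)) + 3 * ∫⁻ t in Icc 0 H, φ n t ≤
      ENNReal.ofReal h * ENNReal.ofReal e' := by
    have e3 : (3 : ℝ≥0∞) = ENNReal.ofReal 3 := by simp
    calc _ ≤ ENNReal.ofReal h * ENNReal.ofReal (e' / 2) + 3 * ENNReal.ofReal (h * e' / 6) := by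
          gcongr
      _ = _ := by
          rw [e3, ← ENNReal.ofReal_mul hh0.le, ← ENNReal.ofReal_mul (by norm_num),
            ← ENNReal.ofReal_mul hh0.le, ← ENNReal.ofReal_add (by positivity) (by positivity)]
          congr 1; ring
  exact (ENNReal.mul_le_mul_iff_right (ENNReal.ofReal_pos.2 hh0).ne' ENNReal.ofReal_ne_top).1
    (h2.trans h3)

/-- The limiting chain is almost surely not constant equal to `e` near a place where the filters
come close to the other state. -/
lemma ae_not_hot (hlam : 0 < lam) (hp : p ∈ Ioo (0 : ℝ) 1)
    (hq : q ∈ Icc (0 : ℝ) 1) (hH : 0 < H) (hx : IsTwoStateChain P lam p q x)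
    (hmodel : ∀ γ, 0 < γ → IsFilteringModel P lam p q γ (X γ) (B γ) (π γ)) {γ : ℕ → ℝ}
    (hγ : ∀ n, 0 < γ n)
    (hL : ∀ᵐ ω ∂P, Tendsto (fun n => dL H (fun t => π (γ n) t t ω) (fun t => x t ω)) atTop (𝓝 0))
    (a b : ℝ) {r : ℝ} (hr : 0 < r) (e : Fin 2) :
    ∀ᵐ ω ∂P, ¬ ((∀ u ∈ Icc a (b + r) ∩ Icc 0 H, x u ω = ((e : ℕ) : ℝ)) ∧
      ∀ η > 0, ∀ᶠ n in atTop, ∃ s ∈ Ioo a b ∩ Icc 0 H,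
        1 - η < |π (γ n) s s ω - ((e : ℕ) : ℝ)|) := by
  rw [ae_iff]
  simp only [not_not]
  set bad := {ω | (∀ u ∈ Icc a (b + r) ∩ Icc 0 H, x u ω = ((e : ℕ) : ℝ)) ∧
      ∀ η > 0, ∀ᶠ n in atTop, ∃ s ∈ Ioo a b ∩ Icc 0 H,
        1 - η < |π (γ n) s s ω - ((e : ℕ) : ℝ)|} with hbad
  -- The parameter `m` serves both as hot threshold `η` and as delay after the hot time.
  suffices hmain : ∀ m, 0 < m → m ≤ r → P bad ≤ ENNReal.ofReal (m + lam * m) by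
    refine le_antisymm (ENNReal.le_of_forall_pos_le_add fun e' he' _ => ?_) zero_le
    rw [zero_add]
    set m := min r ((e' : ℝ) / (1 + lam)) with hm
    have hm0 : 0 < m := lt_min hr (by have : (0 : ℝ) < e' := he'; positivity)
    refine (hmain m hm0 (min_le_left _ _)).trans ?_
    rw [← ENNReal.ofReal_coe_nnreal]
    refine ENNReal.ofReal_le_ofReal ?_
    have : m ≤ (e' : ℝ) / (1 + lam) := min_le_right _ _
    rw [le_div_iff₀ (by positivity)] at this
    linarith
  intro m hm0 hmr
  -- The filter is continuous in time, so a hot time can be moved to the truncation of a rational.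
  -- Countably many times, exhausted by finite sets, bring the event within reach of
  -- `measure_hot_le`.
  set cl : ℚ → ℝ := fun k => min H (max (k : ℝ) 0) with hcl
  have hcl01 : ∀ k, cl k ∈ Icc 0 H := fun k =>
    ⟨le_min hH.le (le_max_right _ _), min_le_left _ _⟩
  -- The state is only inspected at the next point of a grid of mesh `m`. Finitely many fixed times
  -- are thus involved, where the signals may be replaced by the limiting chain up to vanishing
  -- probability.
  set vj : ℕ → ℝ := fun j => min (((j : ℝ) + 1) * m) H with hvj
  have hvj0 : ∀ j, vj j ∈ Ioc 0 H := fun j => ⟨lt_min (by positivity) hH, min_le_right _ _⟩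
  set v : ℝ → ℝ := fun s => vj ⌊s / m⌋₊ with hv
  set J := ⌊H / m⌋₊ + 1 with hJ
  have hvs : ∀ s ∈ Icc 0 H, s ≤ v s ∧ v s ≤ s + m := by
    intro s hs
    have h1 := (Nat.lt_floor_add_one (s / m)).le
    rw [div_le_iff₀ hm0] at h1
    have h2 := Nat.floor_le (div_nonneg hs.1 hm0.le)
    rw [le_div_iff₀ hm0] at h2
    refine ⟨le_min h1 hs.2, (min_le_left _ _).trans ?_⟩
    rw [add_mul, one_mul]; linarith
  have hJs : ∀ s ∈ Icc 0 H, ⌊s / m⌋₊ ∈ Finset.range J := fun s hs => by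
    rw [Finset.mem_range, hJ, Nat.lt_succ_iff]
    exact Nat.floor_mono (by gcongr; exact hs.2)
  set A : ℕ → Set Ω := fun n => {ω | (∃ k : ℚ, cl k ∈ Ioo a b ∧
    1 - m < |π (γ n) (cl k) (cl k) ω - ((e : ℕ) : ℝ)|) ∧
    ∀ j ∈ Finset.range J, vj j ∈ Icc a (b + r) → x (vj j) ω = ((e : ℕ) : ℝ)} with hA
  have hbadA : bad ⊆ ⋃ N, ⋂ n ≥ N, A n := by
    rintro ω ⟨hω1, hω2⟩
    obtain ⟨N, hN⟩ := eventually_atTop.1 (hω2 m hm0)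
    refine mem_iUnion.2 ⟨N, mem_iInter₂.2 fun n hn => ⟨?_, fun j _ hj =>
      hω1 _ ⟨hj, (hvj0 j).1.le, (hvj0 j).2⟩⟩⟩
    obtain ⟨s, ⟨hs1, hs2⟩, hs3⟩ := hN n hn
    have hM := hmodel (γ n) (hγ n)
    have hclc : Continuous fun u : ℝ => min H (max u 0) := by fun_prop
    have hfc : Continuous fun u : ℝ => π (γ n) (min H (max u 0)) (min H (max u 0)) ω :=
      (hM.continuousOn_filter hlam hp hq (hγ n) H ω).comp_continuous hclc fun u =>
        ⟨le_min hH.le (le_max_right _ _), min_le_left _ _⟩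
    have hopen : IsOpen {u : ℝ | min H (max u 0) ∈ Ioo a b ∧
        1 - m < |π (γ n) (min H (max u 0)) (min H (max u 0)) ω - ((e : ℕ) : ℝ)|} :=
      (isOpen_Ioo.preimage hclc).inter (isOpen_lt continuous_const
        ((hfc.sub continuous_const).abs))
    obtain ⟨k, hk⟩ := Rat.denseRange_cast.exists_mem_open hopen ⟨s, by
      simp only [mem_ofPred_eq, clamp_eq hs2]; exact ⟨hs1, hs3⟩⟩
    exact ⟨k, hk⟩
  have hAn : ∀ n, P (A n) ≤ ENNReal.ofReal (m + lam * m) +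
      ∑ j ∈ Finset.range J, P {ω | X (γ n) (vj j) ω ≠ x (vj j) ω} := by
    intro n
    have hM := hmodel (γ n) (hγ n)
    set C : Finset ℚ → Set Ω := fun F => {ω | (∃ k ∈ F, cl k ∈ Ioo a b ∧
      1 - m < |π (γ n) (cl k) (cl k) ω - ((e : ℕ) : ℝ)|) ∧
      ∀ j ∈ Finset.range J, vj j ∈ Icc a (b + r) → X (γ n) (vj j) ω = ((e : ℕ) : ℝ)} with hC
    have hsub : A n ⊆ (⋃ F, C F) ∪ ⋃ j ∈ Finset.range J, {ω | X (γ n) (vj j) ω ≠ x (vj j) ω} := by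
      rintro ω ⟨⟨k, hk⟩, hω⟩
      by_cases h : ∃ j ∈ Finset.range J, X (γ n) (vj j) ω ≠ x (vj j) ω
      · obtain ⟨j, hj, hne⟩ := h
        exact Or.inr (mem_iUnion₂.2 ⟨j, hj, hne⟩)
      · push Not at h
        refine Or.inl (mem_iUnion.2 ⟨{k}, ⟨k, Finset.mem_singleton_self k, hk⟩,
          fun j hj hj' => ?_⟩)
        rw [h j hj, hω j hj hj']
    have hCF : ∀ F, P (C F) ≤ ENNReal.ofReal (m + lam * m) := by
      intro F
      classical
      set F' : Finset ℝ := (F.filter fun k => cl k ∈ Ioo a b).image cl with hF'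
      have hmem : ∀ s ∈ F', s ∈ Icc 0 H ∧ s ∈ Ioo a b := by
        intro s hs
        obtain ⟨k, hk, rfl⟩ := Finset.mem_image.1 hs
        exact ⟨hcl01 k, (Finset.mem_filter.1 hk).2⟩
      refine (measure_mono ?_).trans (hM.measure_hot_le hlam hp hq (hγ n) hm0.le hm0.le e F'
        (fun s hs => (hmem s hs).1.1) (v := v) fun s hs => hvs s (hmem s hs).1)
      rintro ω ⟨⟨k, hkF, hk1, hk2⟩, hω⟩
      refine ⟨⟨cl k, Finset.mem_image.2 ⟨k, Finset.mem_filter.2 ⟨hkF, hk1⟩, rfl⟩, hk2⟩,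
        fun s hs => ?_⟩
      obtain ⟨h1, h2⟩ := hmem s hs
      obtain ⟨h3, h4⟩ := hvs s h1
      exact hω _ (hJs s h1) ⟨h2.1.le.trans h3, by linarith [h2.2]⟩
    have hmono : Monotone C := by
      rintro F F' hFF' ω ⟨⟨k, hk, hk'⟩, hω⟩
      exact ⟨⟨k, hFF' hk, hk'⟩, hω⟩
    calc P (A n) ≤ P (⋃ F, C F) + P (⋃ j ∈ Finset.range J, {ω | X (γ n) (vj j) ω ≠ x (vj j) ω}) :=
          (measure_mono hsub).trans (measure_union_le _ _)
      _ ≤ _ := by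
          gcongr
          · rw [hmono.directed_le.measure_iUnion]
            exact iSup_le hCF
          · exact measure_biUnion_finset_le _ _
  have hlim : Tendsto (fun n => ENNReal.ofReal (m + lam * m) +
      ∑ j ∈ Finset.range J, P {ω | X (γ n) (vj j) ω ≠ x (vj j) ω}) atTop
      (𝓝 (ENNReal.ofReal (m + lam * m))) := by
    have h1 : Tendsto (fun n => ∑ j ∈ Finset.range J, P {ω | X (γ n) (vj j) ω ≠ x (vj j) ω}) atTop
        (𝓝 (∑ j ∈ Finset.range J, (0 : ℝ≥0∞))) :=
      tendsto_finsetSum _ fun j _ => tendsto_measure_signal_ne hlam hp hq hH hx hmodel hγ hL (hvj0 j)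
    have := (tendsto_const_nhds (x := ENNReal.ofReal (m + lam * m))).add h1
    simpa using this
  refine (measure_mono hbadA).trans ?_
  have hmonoN : Monotone fun N => ⋂ n ≥ N, A n := by
    intro N N' hNN' ω hω
    simp only [mem_iInter] at hω ⊢
    exact fun n hn => hω n (hNN'.trans hn)
  rw [hmonoN.directed_le.measure_iUnion]
  refine iSup_le fun N => ge_of_tendsto hlim ?_
  filter_upwards [eventually_ge_atTop N] with n hn
  exact (measure_mono (iInter₂_subset n hn)).trans (hAn n)

end Exclusion

/-! ### Points of the plane -/

/-- The point of the plane with coordinates `s` and `y`. -/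
noncomputable def planePoint (s y : ℝ) : EuclideanSpace ℝ (Fin 2) := !₂[s, y]

@[simp] lemma planePoint_zero (s y : ℝ) : planePoint s y 0 = s := by simp [planePoint]

@[simp] lemma planePoint_one (s y : ℝ) : planePoint s y 1 = y := by simp [planePoint]

lemma eq_planePoint (z : EuclideanSpace ℝ (Fin 2)) : z = planePoint (z 0) (z 1) := by
  ext i; fin_cases i <;> simp

lemma dist_planePoint_le (s y s' y' : ℝ) :
    dist (planePoint s y) (planePoint s' y') ≤ |s - s'| + |y - y'| := by
  rw [EuclideanSpace.dist_eq, Fin.sum_univ_two]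
  simp only [planePoint_zero, planePoint_one, Real.dist_eq]
  rw [Real.sqrt_le_left (by positivity)]
  nlinarith [abs_nonneg (s - s'), abs_nonneg (y - y')]

lemma abs_sub_le_dist (z w : EuclideanSpace ℝ (Fin 2)) (i : Fin 2) : |z i - w i| ≤ dist z w := by
  rw [EuclideanSpace.dist_eq, ← Real.dist_eq]
  refine Real.le_sqrt_of_sq_le ?_
  exact Finset.single_le_sum (f := fun i => dist (z i) (w i) ^ 2) (fun j _ => sq_nonneg _)
    (Finset.mem_univ i)

lemma continuous_planePoint_left (y : ℝ) : Continuous fun s => planePoint s y := by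
  refine Metric.continuous_iff.2 fun s e he => ⟨e, he, fun s' hs' => ?_⟩
  refine (dist_planePoint_le _ _ _ _).trans_lt ?_
  rwa [sub_self, abs_zero, add_zero, ← Real.dist_eq]

lemma mem_graph_of_continuousOn {I : Set ℝ} {f : ℝ → ℝ} (hf : ContinuousOn f I)
    {z : EuclideanSpace ℝ (Fin 2)} : z ∈ graph I f ↔ z 0 ∈ I ∧ z 1 = f (z 0) := by
  simp only [graph, mem_ofPred_eq]
  constructor
  · rintro ⟨h1, h2 | h2⟩
    · exact ⟨h1, h2.2⟩
    · exact absurd (hf _ h1) h2.1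
  · rintro ⟨h1, h2⟩
    exact ⟨h1, Or.inl ⟨hf _ h1, h2⟩⟩

/-- If no full spike occurs where `path` is constant equal to `e`, then the functions whose graph is
close to the limit set stay away from the other state. -/
lemma exists_separation {H : ℝ} {path : ℝ → ℝ} {K : Set (EuclideanSpace ℝ (Fin 2))} (e : Fin 2)
    (hK : ∀ s ∈ Icc 0 H, ∀ ε > 0, (∀ u ∈ Icc (s - ε) (s + ε) ∩ Icc 0 H, path u = ((e : ℕ) : ℝ)) →
      planePoint s (1 - (e : ℕ)) ∉ closure K) {ε : ℝ} (hε : 0 < ε) :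
    ∃ η > 0, ∀ f : ℝ → ℝ, ContinuousOn f (Icc 0 H) →
      Metric.hausdorffEDist (graph (Icc 0 H) f) K < ENNReal.ofReal η → ∀ s ∈ Icc 0 H,
      (∀ u ∈ Icc (s - ε) (s + ε) ∩ Icc 0 H, path u = ((e : ℕ) : ℝ)) →
      η ≤ |f s - (1 - ((e : ℕ) : ℝ))| := by
  -- The times at distance at least `ε` from every point where `path` differs from `e`. This is a
  -- closed condition, it contains all admissible times, and it still guarantees a constant path on
  -- windows of radius `ε / 2`. The compact set of forbidden points above `S'` then has positive
  -- distance `ρ` to the closure of `K`.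
  set S' : Set ℝ := Icc 0 H ∩ ⋂ u ∈ {u | u ∈ Icc 0 H ∧ path u ≠ ((e : ℕ) : ℝ)}, {s | ε ≤ |u - s|}
    with hS'
  have hS'c : IsCompact S' := by
    refine isCompact_Icc.inter_right (isClosed_biInter fun u _ => ?_)
    exact isClosed_le continuous_const (by fun_prop)
  have hS'mem : ∀ s ∈ S', s ∈ Icc 0 H ∧
      ∀ u ∈ Icc (s - ε / 2) (s + ε / 2) ∩ Icc 0 H, path u = ((e : ℕ) : ℝ) := by
    rintro s ⟨h1, h2⟩
    refine ⟨h1, fun u ⟨hu1, hu2⟩ => ?_⟩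
    by_contra hne
    have h3 : ε ≤ |u - s| := mem_iInter₂.1 h2 u ⟨hu2, hne⟩
    have h4 : |u - s| ≤ ε / 2 := abs_le.2 ⟨by linarith [hu1.1], by linarith [hu1.2]⟩
    linarith
  have hdisj : Disjoint ((fun s => planePoint s (1 - ((e : ℕ) : ℝ))) '' S') (closure K) := by
    rw [Set.disjoint_left]
    rintro _ ⟨s, hs, rfl⟩
    obtain ⟨h1, h2⟩ := hS'mem s hs
    exact hK s h1 (ε / 2) (by positivity) h2
  obtain ⟨ρ, hρ, hρ'⟩ := Metric.exists_pos_forall_lt_edist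
    (hS'c.image (continuous_planePoint_left _)) isClosed_closure hdisj
  refine ⟨ρ / 2, by positivity, fun f hf hd s hs hpath => ?_⟩
  have hsS : s ∈ S' := by
    refine ⟨hs, mem_iInter₂.2 fun u hu => ?_⟩
    by_contra hlt
    rw [mem_ofPred_eq, not_le, abs_lt] at hlt
    exact hu.2 (hpath u ⟨⟨by linarith [hlt.1], by linarith [hlt.2]⟩, hu.1⟩)
  by_contra hlt
  push Not at hlt
  have hg : planePoint s (f s) ∈ graph (Icc 0 H) f := by
    rw [mem_graph_of_continuousOn hf]; simp [hs.1, hs.2]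
  obtain ⟨w, hw, hwd⟩ := Metric.exists_edist_lt_of_hausdorffEDist_lt hg hd
  have h1 := hρ' _ ⟨s, hsS, rfl⟩ w (subset_closure hw)
  have h2 : dist (planePoint s (1 - ((e : ℕ) : ℝ))) (planePoint s (f s)) ≤ ρ / 2 := by
    refine (dist_planePoint_le _ _ _ _).trans ?_
    rw [sub_self, abs_zero, zero_add, abs_sub_comm]; exact hlt.le
  have h3 : edist (planePoint s (1 - ((e : ℕ) : ℝ))) w ≤ ENNReal.ofReal (ρ / 2) +
      ENNReal.ofReal (ρ / 2) := by
    refine (edist_triangle _ (planePoint s (f s)) _).trans (add_le_add ?_ hwd.le)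
    rw [edist_dist]; exact ENNReal.ofReal_le_ofReal h2
  rw [← ENNReal.ofReal_add (by positivity) (by positivity), add_halves,
    ENNReal.ofReal_coe_nnreal] at h3
  exact absurd h1 (not_lt.2 h3)

/-! ### No full spike in the limit of the graphs -/

section Exclusion

variable {Ω : Type*} [MeasurableSpace Ω] {P : Measure Ω} [IsProbabilityMeasure P]
  {lam p q H : ℝ} {x : ℝ → Ω → ℝ} {X : ℝ → ℝ → Ω → ℝ} {B : ℝ → ℝ≥0 → Ω → ℝ}
  {π : ℝ → ℝ → ℝ → Ω → ℝ}

/-- The limit set of the graphs of the filters contains no full spike. -/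
lemma ae_notMem_closure (hlam : 0 < lam) (hp : p ∈ Ioo (0 : ℝ) 1)
    (hq : q ∈ Icc (0 : ℝ) 1) (hH : 0 < H) (hx : IsTwoStateChain P lam p q x)
    (hmodel : ∀ γ, 0 < γ → IsFilteringModel P lam p q γ (X γ) (B γ) (π γ))
    (hL : ∀ᵐ ω ∂P, Tendsto (fun γ => dL H (fun t => π γ t t ω) (fun t => x t ω)) atTop (𝓝 0))
    {K : Ω → Set (EuclideanSpace ℝ (Fin 2))}
    (hK : ∀ᵐ ω ∂P, Tendsto (fun γ => Metric.hausdorffEDist (graph (Icc 0 H) (fun t => π γ t t ω))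
      (K ω)) atTop (𝓝 0)) :
    ∀ᵐ ω ∂P, ∀ e : Fin 2, ∀ s ∈ Icc 0 H, ∀ ε > 0,
      (∀ u ∈ Icc (s - ε) (s + ε) ∩ Icc 0 H, x u ω = ((e : ℕ) : ℝ)) →
      planePoint s (1 - (e : ℕ)) ∉ closure (K ω) := by
  -- The limit set does not depend on the way `γ` tends to infinity, so one sequence is enough to
  -- exclude full spikes; rational `a`, `b`, `r` then make the exceptional events countable.
  set γ : ℕ → ℝ := fun n => (n : ℝ) + 1 with hγdef
  have hγ : ∀ n, 0 < γ n := fun n => by positivity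
  have hγt : Tendsto γ atTop atTop :=
    tendsto_atTop_add_const_right _ _ tendsto_natCast_atTop_atTop
  have hLn : ∀ᵐ ω ∂P, Tendsto (fun n => dL H (fun t => π (γ n) t t ω) (fun t => x t ω)) atTop
      (𝓝 0) := hL.mono fun ω h => h.comp hγt
  have hnot : ∀ᵐ ω ∂P, ∀ (a b : ℚ) (r : {r : ℚ // 0 < r}) (e : Fin 2),
      ¬ ((∀ u ∈ Icc (a : ℝ) (b + (r : ℚ)) ∩ Icc 0 H, x u ω = ((e : ℕ) : ℝ)) ∧
      ∀ η > 0, ∀ᶠ n in atTop, ∃ s ∈ Ioo (a : ℝ) b ∩ Icc 0 H,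
        1 - η < |π (γ n) s s ω - ((e : ℕ) : ℝ)|) := by
    simp only [ae_all_iff]
    intro a b r e
    exact ae_not_hot hlam hp hq hH hx hmodel hγ hLn a b (by exact_mod_cast r.2) e
  filter_upwards [hnot, hK] with ω h1 h2 e s hs ε hε hpath hmem
  obtain ⟨a, ha1, ha2⟩ := exists_rat_btwn (by linarith : s - ε < s)
  obtain ⟨b, hb1, hb2⟩ := exists_rat_btwn (by linarith : s < s + ε / 2)
  obtain ⟨r, hr1, hr2⟩ := exists_rat_btwn (by linarith : 0 < ε / 2)
  refine h1 a b ⟨r, by exact_mod_cast hr1⟩ e ⟨fun u hu => hpath u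
    ⟨⟨by linarith [hu.1.1], by have := hu.1.2; simp only at this; linarith⟩, hu.2⟩, fun η hη => ?_⟩
  -- A graph point within `ρ` of the forbidden point has its time in `(a, b)` and its value within
  -- `η` of the state `1 - e`: it is a hot time.
  set ρ := min η (min (s - a) (b - s)) with hρ
  have hρ0 : 0 < ρ := lt_min hη (lt_min (by linarith) (by linarith))
  filter_upwards [(h2.comp hγt).eventually_lt_const (ENNReal.ofReal_pos.2 hρ0)] with n hn
  have hM := hmodel (γ n) (hγ n)
  have hfc := hM.continuousOn_filter hlam hp hq (hγ n) H ω
  have hinf : Metric.infEDist (planePoint s (1 - ((e : ℕ) : ℝ)))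
      (graph (Icc 0 H) fun t => π (γ n) t t ω) < ENNReal.ofReal ρ := by
    have := Metric.infEDist_le_infEDist_add_hausdorffEDist
      (x := planePoint s (1 - ((e : ℕ) : ℝ))) (s := K ω)
      (t := graph (Icc 0 H) fun t => π (γ n) t t ω)
    rw [Metric.mem_closure_iff_infEDist_zero.1 hmem, zero_add, Metric.hausdorffEDist_comm] at this
    exact this.trans_lt hn
  obtain ⟨z, hz, hzd⟩ := Metric.infEDist_lt_iff.1 hinf
  rw [mem_graph_of_continuousOn hfc] at hz
  rw [edist_dist, ENNReal.ofReal_lt_ofReal_iff hρ0] at hzd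
  have c0 := (abs_sub_le_dist (planePoint s (1 - ((e : ℕ) : ℝ))) z 0).trans_lt hzd
  have c1 := (abs_sub_le_dist (planePoint s (1 - ((e : ℕ) : ℝ))) z 1).trans_lt hzd
  rw [planePoint_zero, abs_lt] at c0
  rw [planePoint_one, hz.2, abs_lt] at c1
  have m1 : ρ ≤ η := min_le_left _ _
  have m2 : ρ ≤ s - a := (min_le_right _ _).trans (min_le_left _ _)
  have m3 : ρ ≤ b - s := (min_le_right _ _).trans (min_le_right _ _)
  refine ⟨z 0, ⟨⟨by linarith, by linarith⟩, hz.1⟩, ?_⟩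
  fin_cases e
  · simp only [Nat.cast_zero, sub_zero] at c1 ⊢
    exact lt_of_lt_of_le (by linarith) (le_abs_self _)
  · simp only [Nat.cast_one, sub_self] at c1 ⊢
    exact lt_of_lt_of_le (by linarith) (neg_le_abs _)

end Exclusion

/-- The chain has almost surely no jump at a given time. -/
lemma IsTwoStateChain.ae_continuousWithinAt {Ω : Type*} [MeasurableSpace Ω] {P : Measure Ω}
    [IsProbabilityMeasure P] {lam p q H : ℝ} {x : ℝ → Ω → ℝ} (hlam : 0 ≤ lam)
    (hp : p ∈ Icc (0 : ℝ) 1) (hx : IsTwoStateChain P lam p q x) (hH : 0 < H) :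
    ∀ᵐ ω ∂P, ContinuousWithinAt (fun t => x t ω) (Icc 0 H) H := by
  set s : ℕ → ℝ := fun n => H - H / (n + 1) with hs
  have hs0 : ∀ n, 0 ≤ s n := fun n => by
    have : H / ((n : ℝ) + 1) ≤ H := div_le_self hH.le (by linarith [Nat.cast_nonneg (α := ℝ) n])
    simp only [hs]; linarith
  have hsH : ∀ n, s n < H := fun n => by
    have : 0 < H / ((n : ℝ) + 1) := by positivity
    simp only [hs]; linarith
  have hst : Tendsto s atTop (𝓝 H) := by
    have h1 : Tendsto (fun n : ℕ => H / ((n : ℝ) + 1)) atTop (𝓝 0) := by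
      have := (tendsto_one_div_add_atTop_nhds_zero_nat (𝕜 := ℝ)).const_mul H
      simpa [div_eq_mul_inv] using this
    simpa using (tendsto_const_nhds (x := H)).sub h1
  rw [ae_iff]
  set bad : Set Ω := {ω | ¬ ContinuousWithinAt (fun t => x t ω) (Icc 0 H) H} with hbad
  -- A jump at `H` forces the values along `s n ↑ H` to differ from the value at `H` from some rank
  -- on, which continuity in probability makes null.
  have hsub : bad ⊆ ⋃ N : ℕ, ⋂ n ≥ N, {ω | x (s n) ω ≠ x H ω} := by
    intro ω hω
    obtain ⟨l, hl⟩ := hx.left_limits ω H hH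
    have hne : l ≠ x H ω := by
      intro h
      refine hω ?_
      have h1 : ContinuousWithinAt (fun t => x t ω) (Iio H) H := by
        rw [ContinuousWithinAt, ← h]; exact hl
      have h2 : ContinuousWithinAt (fun t => x t ω) (Iic H) H :=
        continuousWithinAt_Iio_iff_Iic.1 h1
      exact h2.mono fun t ht => ht.2
    have h3 : Tendsto (fun n => x (s n) ω) atTop (𝓝 l) :=
      hl.comp (tendsto_nhdsWithin_iff.2 ⟨hst, Eventually.of_forall hsH⟩)
    obtain ⟨N, hN⟩ := eventually_atTop.1 (h3.eventually_ne hne)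
    exact mem_iUnion.2 ⟨N, mem_iInter₂.2 fun n hn => hN n hn⟩
  have hnull : ∀ N : ℕ, P (⋂ n ≥ N, {ω | x (s n) ω ≠ x H ω}) = 0 := by
    intro N
    have hlim : Tendsto (fun n => ENNReal.ofReal (lam * (H - s n))) atTop (𝓝 0) := by
      have := (hst.const_sub H).const_mul lam
      rw [sub_self, mul_zero] at this
      simpa using ENNReal.tendsto_ofReal this
    refine le_antisymm (ge_of_tendsto hlim ?_) zero_le
    filter_upwards [eventually_ge_atTop N] with n hn
    exact (measure_mono (iInter₂_subset n hn)).trans (hx.measure_ne_le hlam hp (hs0 n) (hsH n).le)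
  exact measure_mono_null hsub (measure_iUnion_null hnull)

/-! ### Càdlàg paths with values in `{0, 1}` -/

/-- A càdlàg path with values in `{0, 1}`, without jump at the horizon `H`. -/
structure IsBinaryPath (H : ℝ) (g : ℝ → ℝ) : Prop where
  mem_states : ∀ t, 0 ≤ t → g t = 0 ∨ g t = 1
  right_continuous : ∀ t, 0 ≤ t → ContinuousWithinAt g (Ici t) t
  left_limits : ∀ t, 0 < t → ∃ l, Tendsto g (𝓝[<] t) (𝓝 l)
  horizon : ContinuousWithinAt g (Icc 0 H) H

/-- The jump times of the path in `[0,H]`. -/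
def jumpSet (H : ℝ) (g : ℝ → ℝ) : Set ℝ :=
  {t | t ∈ Icc 0 H ∧ ¬ ContinuousWithinAt g (Icc 0 H) t}

namespace IsBinaryPath

variable {H : ℝ} {g : ℝ → ℝ}

lemma eventually_eq_of_tendsto (hg : IsBinaryPath H g) {F : Filter ℝ} [F.NeBot] {l : ℝ}
    (hF : ∀ᶠ u in F, 0 ≤ u) (h : Tendsto g F (𝓝 l)) : (l = 0 ∨ l = 1) ∧ ∀ᶠ u in F, g u = l := by
  have hcl : IsClosed ({0, 1} : Set ℝ) := (Set.toFinite _).isClosed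
  have hl : l ∈ ({0, 1} : Set ℝ) := hcl.mem_of_tendsto h (hF.mono fun u hu => hg.mem_states u hu)
  have hl' : l = 0 ∨ l = 1 := hl
  refine ⟨hl', ?_⟩
  filter_upwards [hF, h.eventually (Metric.ball_mem_nhds l one_pos)] with u hu hd
  rw [Real.dist_eq] at hd
  rcases hl' with rfl | rfl <;> rcases hg.mem_states u hu with h1 | h1 <;> simp [h1] at hd ⊢

lemma exists_right (hg : IsBinaryPath H g) {t : ℝ} (ht : 0 ≤ t) :
    ∃ ρ > 0, ∀ u ∈ Ico t (t + ρ), g u = g t := by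
  have h0 : ∀ᶠ u in 𝓝[≥] t, 0 ≤ u := by
    filter_upwards [self_mem_nhdsWithin] with u hu using ht.trans hu
  obtain ⟨-, h⟩ := hg.eventually_eq_of_tendsto h0 (hg.right_continuous t ht)
  obtain ⟨b, hb, hb'⟩ := mem_nhdsGE_iff_exists_Ico_subset.1 h
  exact ⟨b - t, sub_pos.2 hb, fun u hu => hb' ⟨hu.1, by linarith [hu.2]⟩⟩

lemma exists_left (hg : IsBinaryPath H g) {t : ℝ} (ht : 0 < t) :
    ∃ l, (l = 0 ∨ l = 1) ∧ Tendsto g (𝓝[<] t) (𝓝 l) ∧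
      ∃ ρ > 0, ∀ u ∈ Ioo (t - ρ) t, g u = l := by
  obtain ⟨l, hl⟩ := hg.left_limits t ht
  have h0 : ∀ᶠ u in 𝓝[<] t, 0 ≤ u := by
    filter_upwards [mem_nhdsWithin_of_mem_nhds (Ioi_mem_nhds ht)] with u hu using le_of_lt hu
  obtain ⟨h1, h2⟩ := hg.eventually_eq_of_tendsto h0 hl
  obtain ⟨a, ha, ha'⟩ := mem_nhdsLT_iff_exists_Ioo_subset.1 h2
  exact ⟨l, h1, hl, t - a, sub_pos.2 ha, fun u hu => ha' ⟨by linarith [hu.1], hu.2⟩⟩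

lemma continuousWithinAt_of_eqOn {t ρ c : ℝ} (hρ : 0 < ρ) {I : Set ℝ}
    (h : ∀ u ∈ Ioo (t - ρ) (t + ρ) ∩ I, g u = c) (ht : t ∈ I) : ContinuousWithinAt g I t := by
  refine (continuousWithinAt_const (b := c)).congr_of_eventuallyEq ?_
    (h t ⟨⟨by linarith, by linarith⟩, ht⟩)
  filter_upwards [self_mem_nhdsWithin, mem_nhdsWithin_of_mem_nhds
    (Ioo_mem_nhds (by linarith : t - ρ < t) (by linarith : t < t + ρ))] with u h1 h2
  exact h u ⟨h2, h1⟩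

/-- One-sided limits in a discrete set make the path constant on each side of every time, so jump
times are isolated in a uniform sense around each point of `[0,H]`; compactness concludes. -/
lemma finite_jumpSet (hg : IsBinaryPath H g) : (jumpSet H g).Finite := by
  have hnhds : ∀ t ∈ Icc 0 H, ∃ ρ > 0, jumpSet H g ∩ Ioo (t - ρ) (t + ρ) ⊆ {t} := by
    intro t ht
    obtain ⟨ρ₁, hρ₁, h1⟩ := hg.exists_right ht.1
    obtain ⟨ρ₂, hρ₂, l, h2⟩ : ∃ ρ > 0, ∃ l, ∀ u ∈ Ioo (t - ρ) t ∩ Icc 0 H, g u = l := by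
      rcases ht.1.eq_or_lt with h | h
      · exact ⟨1, one_pos, 0, fun u hu => absurd hu.2.1 (not_le.2 (h ▸ hu.1.2))⟩
      · obtain ⟨l, -, -, ρ, hρ, h'⟩ := hg.exists_left h
        exact ⟨ρ, hρ, l, fun u hu => h' u hu.1⟩
    refine ⟨min ρ₁ ρ₂, lt_min hρ₁ hρ₂, ?_⟩
    rintro u ⟨⟨hu1, hu2⟩, hu3⟩
    have m1 := min_le_left ρ₁ ρ₂
    have m2 := min_le_right ρ₁ ρ₂
    by_contra hne
    rcases lt_or_gt_of_ne (show u ≠ t from hne) with hlt | hgt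
    · refine hu2 (continuousWithinAt_of_eqOn (c := l) (lt_min (by linarith [hu3.1] :
        0 < u - (t - ρ₂)) (by linarith : 0 < t - u)) (fun w hw => h2 w ⟨⟨?_, ?_⟩, hw.2⟩) hu1)
      · have := hw.1.1; have := min_le_left (u - (t - ρ₂)) (t - u); linarith
      · have := hw.1.2; have := min_le_right (u - (t - ρ₂)) (t - u); linarith
    · refine hu2 (continuousWithinAt_of_eqOn (c := g t) (lt_min (by linarith [hu3.2] :
        0 < t + ρ₁ - u) (by linarith : 0 < u - t)) (fun w hw => h1 w ⟨?_, ?_⟩) hu1)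
      · have := hw.1.1; have := min_le_right (t + ρ₁ - u) (u - t); linarith
      · have := hw.1.2; have := min_le_left (t + ρ₁ - u) (u - t); linarith
  choose! ρ hρ hρ' using hnhds
  obtain ⟨T, hT, hcov⟩ := isCompact_Icc.elim_nhds_subcover (fun t => Ioo (t - ρ t) (t + ρ t))
    fun t ht => Ioo_mem_nhds (by linarith [hρ t ht] : t - ρ t < t) (by linarith [hρ t ht])
  refine T.finite_toSet.subset fun u hu => ?_
  obtain ⟨t, htT, hut⟩ := mem_iUnion₂.1 (hcov hu.1)
  have := hρ' t (hT t htT) ⟨hu, hut⟩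
  rw [mem_singleton_iff] at this
  rwa [this]

/-- The shape of the path near a jump. -/
lemma exists_jump_shape (hg : IsBinaryPath H g) {j : ℝ} (hj : j ∈ jumpSet H g) :
    ∃ ρ > 0, ρ < j - ρ ∧ j + ρ < H ∧ ∃ l, (l = 0 ∨ l = 1) ∧ (∀ u ∈ Ioo (j - ρ) j, g u = l) ∧
      ∀ u ∈ Ioo j (j + ρ), g u = 1 - l := by
  obtain ⟨⟨hj0, hjH⟩, hjc⟩ := hj
  -- Right-continuity excludes a jump at `0`, where only the right side is seen, and the horizon
  -- condition excludes `H`; a jump is thus two-sided.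
  have hpos : 0 < j := by
    rcases hj0.eq_or_lt with h | h
    · exact absurd ((hg.right_continuous j hj0).mono fun u hu => (h ▸ hu.1 : j ≤ u)) hjc
    · exact h
  have hlt : j < H := by
    rcases hjH.eq_or_lt with h | h
    · exact absurd (h ▸ hg.horizon) hjc
    · exact h
  obtain ⟨l, hl, hlt', ρ₂, hρ₂, h2⟩ := hg.exists_left hpos
  obtain ⟨ρ₁, hρ₁, h1⟩ := hg.exists_right hj0
  have hne : g j ≠ l := by
    intro h
    refine hjc (ContinuousWithinAt.mono ?_ (subset_univ _))
    rw [← Iio_union_Ici (a := j)]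
    refine ContinuousWithinAt.union ?_ (hg.right_continuous j hj0)
    rw [ContinuousWithinAt, h]; exact hlt'
  have hgj : g j = 1 - l := by
    rcases hl with rfl | rfl <;> rcases hg.mem_states j hj0 with h | h <;> simp_all
  refine ⟨min (min ρ₁ ρ₂) (min (j / 3) ((H - j) / 2)), lt_min (lt_min hρ₁ hρ₂) (lt_min (by linarith)
    (by linarith)), ?_, ?_, l, hl, fun u hu => ?_, fun u hu => ?_⟩
  all_goals
    have m1 := (min_le_left (min ρ₁ ρ₂) (min (j / 3) ((H - j) / 2))).trans (min_le_left _ _)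
    have m2 := (min_le_left (min ρ₁ ρ₂) (min (j / 3) ((H - j) / 2))).trans (min_le_right _ _)
    have m3 := (min_le_right (min ρ₁ ρ₂) (min (j / 3) ((H - j) / 2))).trans (min_le_left _ _)
    have m4 := (min_le_right (min ρ₁ ρ₂) (min (j / 3) ((H - j) / 2))).trans (min_le_right _ _)
  · linarith
  · linarith
  · exact h2 u ⟨by linarith [hu.1], hu.2⟩
  · rw [h1 u ⟨hu.1.le, by linarith [hu.2]⟩, hgj]

/-- The path is constant away from its jumps. -/
lemma eq_of_far (hg : IsBinaryPath H g) {t ε : ℝ} (ht : t ∈ Icc 0 H) (hε : 0 ≤ ε)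
    (hfar : ∀ j ∈ jumpSet H g, ε < |t - j|) :
    ∀ u ∈ Icc (t - ε) (t + ε) ∩ Icc 0 H, g u = g t := by
  have hpc : IsPreconnected (Icc (t - ε) (t + ε) ∩ Icc 0 H) := by
    rw [Icc_inter_Icc]; exact isPreconnected_Icc
  have hc : ContinuousOn g (Icc (t - ε) (t + ε) ∩ Icc 0 H) := by
    intro u hu
    by_contra hcon
    have huj : u ∈ jumpSet H g := ⟨hu.2, fun h => hcon (h.mono inter_subset_right)⟩
    have := hfar u huj
    have h2 : |t - u| ≤ ε := abs_le.2 ⟨by linarith [hu.1.2], by linarith [hu.1.1]⟩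
    linarith
  have hm : MapsTo g (Icc (t - ε) (t + ε) ∩ Icc 0 H) ({0, 1} : Set ℝ) := fun u hu =>
    hg.mem_states u hu.2.1
  intro u hu
  exact hpc.constant_of_mapsTo (Set.toFinite ({0, 1} : Set ℝ)).isDiscrete hc hm hu ⟨⟨by linarith, by linarith⟩, ht⟩

end IsBinaryPath

/-! ### Convergence of the smoothed paths -/

/-- The value of the damped filter. -/
noncomputable def dampedValue (lam p δ : ℝ) (path f : ℝ → ℝ) (t : ℝ) : ℝ :=
  path t + (f t - path t) * expNeg (damping lam p f (t - δ) t)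

/-- The properties of the filter and of the smoother on `[0,H]` that enter the convergence. -/
structure IsDampedFamily (lam p H : ℝ) (F : ℝ → ℝ → ℝ) : Prop where
  mem_Icc : ∀ s t, 0 ≤ s → s ≤ t → t ≤ H → F s t ∈ Icc (0 : ℝ) 1
  continuousOn_shift : ∀ δ, 0 ≤ δ → ContinuousOn (fun t => F (t - δ) t) (Icc δ H)
  bound : ∀ (e : Fin 2) (s t η : ℝ), 0 ≤ s → s ≤ t → t ≤ H → 0 < η →
    (∀ u ∈ Icc s t, η ≤ |F u u - (1 - ((e : ℕ) : ℝ))|) →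
    |F s t - (((e : ℕ) : ℝ) + (F t t - ((e : ℕ) : ℝ)) *
      expNeg (damping lam p (fun u => F u u) s t))| ≤ (t - s) * (lam / η)

lemma IsPathSmoother.isDampedFamily {lam p q H : ℝ} (hlam : 0 < lam) (hp : p ∈ Ioo (0 : ℝ) 1)
    {μ : ℝ → ℝ} {G F : ℝ → ℝ → ℝ} (hG : IsPathSmoother lam p q H μ G)
    (hFG : ∀ s t, 0 ≤ s → s ≤ t → t ≤ H → F s t = G s t) : IsDampedFamily lam p H F where
  mem_Icc s t hs hst htH := hFG s t hs hst htH ▸ hG.mem_Icc s t hs hst htH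
  continuousOn_shift δ hδ := (hG.continuousOn_shift hδ).congr fun t ht =>
    hFG _ _ (by linarith [ht.1]) (by linarith) ht.2
  bound e s t η hs hst htH hη hf := by
    have hD : damping lam p (fun u => F u u) s t = damping lam p (fun u => G u u) s t :=
      setLIntegral_congr_fun measurableSet_Icc fun u hu => by
        simp only [hFG u u (hs.trans hu.1) le_rfl (hu.2.trans htH)]
    rw [hD, hFG s t hs hst htH, hFG t t (hs.trans hst) le_rfl htH]
    have hf' : ∀ u ∈ Icc s t, η ≤ |G u u - (1 - ((e : ℕ) : ℝ))| ∧ G u u ∈ Icc (0 : ℝ) 1 :=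
      fun u hu => by
        have h := hf u hu
        rw [hFG u u (hs.trans hu.1) le_rfl (hu.2.trans htH)] at h
        exact ⟨h, hG.mem_Icc u u (hs.trans hu.1) le_rfl (hu.2.trans htH)⟩
    obtain rfl | rfl : e = 0 ∨ e = 1 := by fin_cases e <;> simp
    · have := hG.damping_bound_zero hlam hp hs hst htH hη fun u hu => by
        obtain ⟨h1, h2⟩ := hf' u hu
        rw [Fin.val_zero, Nat.cast_zero, sub_zero, abs_of_nonpos (by linarith [h2.2])] at h1
        linarith
      simpa using this
    · have := hG.damping_bound_one hlam hp hs hst htH hη fun u hu => by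
        obtain ⟨h1, h2⟩ := hf' u hu
        rw [Fin.val_one, Nat.cast_one, sub_self, sub_zero, abs_of_nonneg h2.1] at h1
        exact h1
      simpa using this

/-- Markov's inequality: if the distance were at least `κ` throughout the interval, `dL` would be at
least `κ * (b - a)`. -/
lemma exists_near_of_dL_lt {H a b κ : ℝ} {f g : ℝ → ℝ} (hab : a < b) (hsub : Ioo a b ⊆ Icc 0 H)
    (hκ1 : κ ≤ 1) (h : dL H f g < ENNReal.ofReal (κ * (b - a))) :
    ∃ t ∈ Ioo a b, |f t - g t| < κ := by
  by_contra! hcon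
  refine absurd h (not_lt.2 ?_)
  calc ENNReal.ofReal (κ * (b - a)) = ∫⁻ _ in Ioo a b, ENNReal.ofReal κ := by
        rw [setLIntegral_const, Real.volume_Ioo, ← ENNReal.ofReal_mul' (by linarith)]
    _ ≤ ∫⁻ t in Ioo a b, ENNReal.ofReal (min |f t - g t| 1) :=
        setLIntegral_mono' measurableSet_Ioo fun t ht =>
          ENNReal.ofReal_le_ofReal (le_min (hcon t ht) hκ1)
    _ ≤ _ := lintegral_mono_set hsub

section Convergence

variable {lam p H : ℝ} {g : ℝ → ℝ} {F : ℝ → ℝ → ℝ → ℝ} {δ : ℝ → ℝ}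

lemma dampedValue_mem (hg : IsBinaryPath H g) {f : ℝ → ℝ} {d t : ℝ} (ht : 0 ≤ t)
    (hf : f t ∈ Icc (0 : ℝ) 1) : dampedValue lam p d g f t ∈ Icc (0 : ℝ) 1 := by
  have h0 := expNeg_nonneg (damping lam p f (t - d) t)
  have h1 := expNeg_le_one (damping lam p f (t - d) t)
  rw [dampedValue]
  rcases hg.mem_states t ht with h | h <;> rw [h]
  · constructor <;> nlinarith [hf.1, hf.2]
  · constructor <;> nlinarith [hf.1, hf.2]

lemma abs_dampedValue_sub_le (f : ℝ → ℝ) (d t : ℝ) :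
    |dampedValue lam p d g f t - g t| ≤ |f t - g t| := by
  have h0 := expNeg_nonneg (damping lam p f (t - d) t)
  have h1 := expNeg_le_one (damping lam p f (t - d) t)
  rw [dampedValue, add_sub_cancel_left, abs_mul, abs_of_nonneg h0]
  exact mul_le_of_le_one_right (abs_nonneg _) h1

/-- Away from the jumps, the smoother is uniformly close to the damped filter. -/
lemma eventually_abs_sub_dampedValue_le (hg : IsBinaryPath H g)
    (hF : ∀ γ, 0 < γ → IsDampedFamily lam p H (F γ)) (hδ0 : ∀ᶠ γ in atTop, 0 ≤ δ γ)
    (hδ : Tendsto δ atTop (𝓝 0))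
    (hsep : ∀ (e : Fin 2), ∀ ε > 0, ∃ η > 0, ∀ᶠ γ in atTop, ∀ s ∈ Icc 0 H,
      (∀ u ∈ Icc (s - ε) (s + ε) ∩ Icc 0 H, g u = ((e : ℕ) : ℝ)) →
      η ≤ |F γ s s - (1 - ((e : ℕ) : ℝ))|) {ε κ : ℝ} (hε : 0 < ε) (hκ : 0 < κ) :
    ∀ᶠ γ in atTop, ∀ t ∈ Icc (δ γ) H, (∀ j ∈ jumpSet H g, 2 * ε < |t - j|) →
      |F γ (t - δ γ) t - dampedValue lam p (δ γ) g (fun u => F γ u u) t| ≤ κ := by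
  obtain ⟨η₀, hη₀, h0⟩ := hsep 0 ε hε
  obtain ⟨η₁, hη₁, h1⟩ := hsep 1 ε hε
  set η := min η₀ η₁ with hη
  have hη0 : 0 < η := lt_min hη₀ hη₁
  have hlim : Tendsto (fun γ => δ γ * (lam / η)) atTop (𝓝 0) := by
    simpa using hδ.mul_const (lam / η)
  filter_upwards [hδ0, hδ.eventually_lt_const hε, hlim.eventually_lt_const hκ, h0, h1,
    eventually_gt_atTop 0] with γ a1 a2 a3 a4 a5 hγ t ht hfar
  have ht0 : t ∈ Icc 0 H := ⟨a1.trans ht.1, ht.2⟩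
  have hconst := hg.eq_of_far ht0 (by linarith : 0 ≤ 2 * ε) hfar
  obtain ⟨e, he⟩ : ∃ e : Fin 2, g t = ((e : ℕ) : ℝ) := by
    rcases hg.mem_states t ht0.1 with h | h
    · exact ⟨0, by simpa using h⟩
    · exact ⟨1, by simpa using h⟩
  -- Since `δ γ < ε`, each point of the window has its `ε`-neighbourhood inside the `2 *
  -- ε`-neighbourhood of `t`, where the chain is constant.
  have hη' : ∀ u ∈ Icc (t - δ γ) t, η ≤ |F γ u u - (1 - ((e : ℕ) : ℝ))| := by
    intro u hu
    have hu0 : u ∈ Icc 0 H := ⟨by linarith [hu.1, ht.1], hu.2.trans ht.2⟩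
    have hloc : ∀ w ∈ Icc (u - ε) (u + ε) ∩ Icc 0 H, g w = ((e : ℕ) : ℝ) := fun w hw => by
      rw [← he]
      exact hconst w ⟨⟨by linarith [hw.1.1, hu.1], by linarith [hw.1.2, hu.2]⟩, hw.2⟩
    obtain rfl | rfl : e = 0 ∨ e = 1 := by fin_cases e <;> simp
    · exact (min_le_left _ _).trans (a4 u hu0 hloc)
    · exact (min_le_right _ _).trans (a5 u hu0 hloc)
  have := (hF γ hγ).bound e (t - δ γ) t η (by linarith [ht.1]) (by linarith) ht.2 hη0 hη'
  rw [dampedValue, he]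
  refine this.trans ?_
  rw [sub_sub_cancel]
  exact a3.le

/-- Convergence of the smoothed filter in the distance `dL`. -/
theorem tendsto_dL_smoother (hH : 0 < H) (hg : IsBinaryPath H g)
    (hF : ∀ γ, 0 < γ → IsDampedFamily lam p H (F γ)) (hδ0 : ∀ᶠ γ in atTop, 0 ≤ δ γ)
    (hδ : Tendsto δ atTop (𝓝 0))
    (hsep : ∀ (e : Fin 2), ∀ ε > 0, ∃ η > 0, ∀ᶠ γ in atTop, ∀ s ∈ Icc 0 H,
      (∀ u ∈ Icc (s - ε) (s + ε) ∩ Icc 0 H, g u = ((e : ℕ) : ℝ)) →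
      η ≤ |F γ s s - (1 - ((e : ℕ) : ℝ))|)
    (hL : Tendsto (fun γ => dL H (fun t => F γ t t) g) atTop (𝓝 0)) :
    Tendsto (fun γ => dL H (fun t => F γ (t - δ γ) t) g) atTop (𝓝 0) := by
  set J := hg.finite_jumpSet.toFinset with hJ
  rw [ENNReal.tendsto_nhds_zero]
  intro ξ' hξ'
  obtain ⟨ξ, hξ, hξξ'⟩ : ∃ ξ : ℝ, 0 < ξ ∧ ENNReal.ofReal ξ ≤ ξ' := by
    rcases eq_or_ne ξ' ∞ with rfl | hne
    · exact ⟨1, one_pos, le_top⟩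
    · exact ⟨ξ'.toReal, ENNReal.toReal_pos hξ'.ne' hne, ENNReal.ofReal_toReal_le⟩
  -- The total error `ξ` is split into four quarters: the initial interval `[0, δ γ]`, the jump
  -- neighbourhoods of length `4 * ε` each, the uniform error `κ` over a length `H`, and the
  -- distance of the filter to the chain.
  set ε := ξ / (16 * (J.card + 1)) with hε
  set κ := ξ / (4 * H) with hκ
  have hε0 : 0 < ε := by positivity
  have hκ0 : 0 < κ := by positivity
  filter_upwards [eventually_abs_sub_dampedValue_le hg hF hδ0 hδ hsep hε0 hκ0, hδ0,
    hδ.eventually_lt_const (by positivity : 0 < ξ / 4),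
    hL.eventually_lt_const (ENNReal.ofReal_pos.2 (by positivity : 0 < ξ / 4))] with γ a1 a2 a3 a4
  refine le_trans ?_ hξξ'
  set ι : ℝ → ℝ≥0∞ := fun t => (Icc 0 (δ γ)).indicator 1 t +
    ∑ j ∈ J, (Icc (j - 2 * ε) (j + 2 * ε)).indicator 1 t + ENNReal.ofReal κ with hι
  have hιm : Measurable ι := by
    refine ((measurable_one.indicator measurableSet_Icc).add ?_).add measurable_const
    exact Finset.measurable_sum _ fun j _ => measurable_one.indicator measurableSet_Icc
  have hpt : ∀ t ∈ Icc 0 H, ENNReal.ofReal (min |F γ (t - δ γ) t - g t| 1) ≤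
      ι t + ENNReal.ofReal (min |F γ t t - g t| 1) := by
    intro t ht
    have hle1 : ENNReal.ofReal (min |F γ (t - δ γ) t - g t| 1) ≤ 1 := by
      rw [← ENNReal.ofReal_one]; exact ENNReal.ofReal_le_ofReal (min_le_right _ _)
    rcases lt_or_ge t (δ γ) with h | h
    · refine hle1.trans ?_
      have : (Icc 0 (δ γ)).indicator (1 : ℝ → ℝ≥0∞) t = 1 :=
        indicator_of_mem (show t ∈ Icc 0 (δ γ) from ⟨ht.1, h.le⟩) _
      simp only [hι]; rw [this, add_assoc, add_assoc]; exact le_self_add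
    · by_cases hfar : ∀ j ∈ jumpSet H g, 2 * ε < |t - j|
      · have b1 := a1 t ⟨h, ht.2⟩ hfar
        have b2 := abs_dampedValue_sub_le (lam := lam) (p := p) (g := g) (fun u => F γ u u) (δ γ) t
        have b3 : min |F γ (t - δ γ) t - g t| 1 ≤ κ + min |F γ t t - g t| 1 := by
          have := abs_sub_le (F γ (t - δ γ) t) (dampedValue lam p (δ γ) g (fun u => F γ u u) t) (g t)
          rcases le_total |F γ t t - g t| 1 with h1 | h1
          · rw [min_eq_left h1]
            exact (min_le_left _ _).trans (by linarith)
          · rw [min_eq_right h1]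
            exact (min_le_right _ _).trans (by linarith)
        calc ENNReal.ofReal (min |F γ (t - δ γ) t - g t| 1)
            ≤ ENNReal.ofReal (κ + min |F γ t t - g t| 1) := ENNReal.ofReal_le_ofReal b3
          _ = ENNReal.ofReal κ + ENNReal.ofReal (min |F γ t t - g t| 1) :=
              ENNReal.ofReal_add hκ0.le (le_min (abs_nonneg _) zero_le_one)
          _ ≤ _ := by
              gcongr
              exact le_add_self
      · push Not at hfar
        obtain ⟨j, hj, hjt⟩ := hfar
        refine hle1.trans ?_
        have hjJ : j ∈ J := hg.finite_jumpSet.mem_toFinset.2 hj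
        have h1 : (1 : ℝ≥0∞) ≤ ∑ j ∈ J, (Icc (j - 2 * ε) (j + 2 * ε)).indicator 1 t := by
          have h2 : (Icc (j - 2 * ε) (j + 2 * ε)).indicator (1 : ℝ → ℝ≥0∞) t = 1 := by
            have := abs_le.1 hjt
            exact indicator_of_mem (show t ∈ Icc (j - 2 * ε) (j + 2 * ε) from
              ⟨by linarith, by linarith⟩) _
          rw [← h2]
          exact Finset.single_le_sum (f := fun j : ℝ =>
            (Icc (j - 2 * ε) (j + 2 * ε)).indicator (1 : ℝ → ℝ≥0∞) t) (fun _ _ => zero_le) hjJ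
        refine h1.trans ?_
        simp only [hι]
        exact le_add_self.trans (le_self_add.trans le_self_add)
  have hind : ∀ a b : ℝ, ∫⁻ t in Icc 0 H, (Icc a b).indicator 1 t ≤ ENNReal.ofReal (b - a) := by
    intro a b
    calc ∫⁻ t in Icc 0 H, (Icc a b).indicator 1 t ≤ ∫⁻ t, (Icc a b).indicator 1 t :=
          setLIntegral_le_lintegral _ _
      _ = _ := by rw [lintegral_indicator_one measurableSet_Icc, Real.volume_Icc]
  have hιint : (∫⁻ t in Icc 0 H, ι t) ≤ ENNReal.ofReal (δ γ + J.card * (4 * ε) + κ * H) := by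
    simp only [hι]
    rw [lintegral_add_right _ measurable_const, lintegral_add_left
      (measurable_one.indicator measurableSet_Icc), lintegral_finsetSum _
      fun j _ => measurable_one.indicator measurableSet_Icc, setLIntegral_const, Real.volume_Icc,
      sub_zero, ← ENNReal.ofReal_mul hκ0.le, ENNReal.ofReal_add (by positivity) (by positivity),
      ENNReal.ofReal_add a2 (by positivity)]
    gcongr
    · simpa using hind 0 (δ γ)
    · calc ∑ j ∈ J, ∫⁻ t in Icc 0 H, (Icc (j - 2 * ε) (j + 2 * ε)).indicator 1 t
          ≤ ∑ j ∈ J, ENNReal.ofReal (4 * ε) := Finset.sum_le_sum fun j _ =>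
            (hind _ _).trans (ENNReal.ofReal_le_ofReal (by linarith))
        _ = _ := by
            rw [Finset.sum_const, nsmul_eq_mul, ← ENNReal.ofReal_natCast,
              ← ENNReal.ofReal_mul (by positivity)]
  calc dL H (fun t => F γ (t - δ γ) t) g
      ≤ ∫⁻ t in Icc 0 H, (ι t + ENNReal.ofReal (min |F γ t t - g t| 1)) :=
        setLIntegral_mono' measurableSet_Icc hpt
    _ = (∫⁻ t in Icc 0 H, ι t) + dL H (fun t => F γ t t) g := by rw [lintegral_add_left hιm]; rfl
    _ ≤ ENNReal.ofReal (δ γ + J.card * (4 * ε) + κ * H) + ENNReal.ofReal (ξ / 4) :=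
        add_le_add hιint a4.le
    _ ≤ ENNReal.ofReal ξ := by
        rw [← ENNReal.ofReal_add (by positivity) (by positivity)]
        refine ENNReal.ofReal_le_ofReal ?_
        have e1 : κ * H = ξ / 4 := by rw [hκ]; field_simp
        have e2 : (J.card : ℝ) * (4 * ε) ≤ ξ / 4 := by
          rw [hε]
          have : (J.card : ℝ) * (4 * (ξ / (16 * (J.card + 1)))) =
              ξ / 4 * (J.card / (J.card + 1)) := by field_simp; ring
          rw [this]
          refine mul_le_of_le_one_right (by positivity) ((div_le_one (by positivity)).2 (by linarith))
        linarith

/-- Near a jump the smoothed filter takes nearly all values in `[0,1]`. -/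
lemma eventually_exists_value (hg : IsBinaryPath H g)
    (hF : ∀ γ, 0 < γ → IsDampedFamily lam p H (F γ)) (hδ0 : ∀ᶠ γ in atTop, 0 ≤ δ γ)
    (hδ : Tendsto δ atTop (𝓝 0))
    (hL : Tendsto (fun γ => dL H (fun t => F γ (t - δ γ) t) g) atTop (𝓝 0)) {j : ℝ}
    (hj : j ∈ jumpSet H g) {ε κ : ℝ} (hε : 0 < ε) (hκ : 0 < κ) (hκ2 : κ < 1 / 2) :
    ∀ᶠ γ in atTop, j ∈ Icc (δ γ) H ∧ ∀ y ∈ Icc (0 : ℝ) 1, ∃ t ∈ Icc (δ γ) H,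
      |t - j| ≤ ε ∧ |F γ (t - δ γ) t - y| ≤ κ := by
  obtain ⟨ρ, hρ, hρj, hρH, l, hl, hleft, hright⟩ := hg.exists_jump_shape hj
  set r := min ρ ε with hr
  have hr0 : 0 < r := lt_min hρ hε
  have hrρ : r ≤ ρ := min_le_left _ _
  have hrε : r ≤ ε := min_le_right _ _
  filter_upwards [hδ0, hδ.eventually_lt_const hρ, eventually_gt_atTop 0,
    hL.eventually_lt_const (ENNReal.ofReal_pos.2 (by positivity : 0 < κ * r))] with γ a1 a2 hγ a3
  -- Closeness in `dL` provides a time just before the jump and one just after it where the smoother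
  -- is within `κ` of the two opposite states. The intermediate value theorem yields everything
  -- between them.
  obtain ⟨t1, ht1, h1⟩ := exists_near_of_dL_lt (H := H) (a := j - r) (b := j) (κ := κ) (by linarith)
    (fun u hu => ⟨by linarith [hu.1], by linarith [hu.2]⟩) (by linarith)
    (f := fun t => F γ (t - δ γ) t) (g := g) (by rwa [sub_sub_cancel])
  obtain ⟨t2, ht2, h2⟩ := exists_near_of_dL_lt (H := H) (a := j) (b := j + r) (κ := κ) (by linarith)
    (fun u hu => ⟨by linarith [hu.1], by linarith [hu.2]⟩) (by linarith)
    (f := fun t => F γ (t - δ γ) t) (g := g) (by rwa [add_sub_cancel_left])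
  rw [hleft t1 ⟨by linarith [ht1.1], ht1.2⟩] at h1
  rw [hright t2 ⟨ht2.1, by linarith [ht2.2]⟩] at h2
  have h12 : t1 ≤ t2 := (ht1.2.trans ht2.1).le
  have hsub : Icc t1 t2 ⊆ Icc (δ γ) H := Icc_subset_Icc (by linarith [ht1.1]) (by linarith [ht2.2])
  have hc := ((hF γ hγ).continuousOn_shift (δ γ) a1).mono hsub
  refine ⟨⟨by linarith, by linarith⟩, fun y hy => ?_⟩
  -- The extreme values near `0` and `1` need not be attained, so `y` is moved into `[κ, 1 - κ]`, a
  -- displacement of at most `κ`.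
  set y' := max κ (min (1 - κ) y) with hy'
  have hy1 : κ ≤ y' := le_max_left _ _
  have hy2 : y' ≤ 1 - κ := max_le (by linarith) (min_le_left _ _)
  have hyy : |y' - y| ≤ κ := by
    rw [abs_le, hy']
    constructor
    · have : y - κ ≤ min (1 - κ) y := le_min (by linarith [hy.2]) (by linarith)
      linarith [le_max_right κ (min (1 - κ) y)]
    · have : max κ (min (1 - κ) y) ≤ y + κ :=
        max_le (by linarith [hy.1]) ((min_le_right _ _).trans (by linarith))
      linarith
  have hmem : y' ∈ uIcc (F γ (t1 - δ γ) t1) (F γ (t2 - δ γ) t2) := by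
    rw [abs_lt] at h1 h2
    rcases hl with rfl | rfl
    · exact Icc_subset_uIcc ⟨by linarith [h1.2], by linarith [h2.1]⟩
    · exact Icc_subset_uIcc' ⟨by linarith [h2.2], by linarith [h1.1]⟩
  obtain ⟨t, ht, hty⟩ := intermediate_value_uIcc (f := fun t => F γ (t - δ γ) t)
    (by rwa [uIcc_of_le h12]) hmem
  rw [uIcc_of_le h12] at ht
  refine ⟨t, hsub ht, ?_, ?_⟩
  · rw [abs_le]; constructor <;> linarith [ht.1, ht.2, ht1.1, ht2.2]
  · simp only at hty; rw [hty]; exact hyy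

/-- Convergence of the graph of the smoothed filter to the damped graph. -/
theorem tendsto_hausdorffEDist_smoother (hg : IsBinaryPath H g)
    (hF : ∀ γ, 0 < γ → IsDampedFamily lam p H (F γ)) (hδ0 : ∀ᶠ γ in atTop, 0 ≤ δ γ)
    (hδ : Tendsto δ atTop (𝓝 0))
    (hsep : ∀ (e : Fin 2), ∀ ε > 0, ∃ η > 0, ∀ᶠ γ in atTop, ∀ s ∈ Icc 0 H,
      (∀ u ∈ Icc (s - ε) (s + ε) ∩ Icc 0 H, g u = ((e : ℕ) : ℝ)) →
      η ≤ |F γ s s - (1 - ((e : ℕ) : ℝ))|)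
    (hL : Tendsto (fun γ => dL H (fun t => F γ (t - δ γ) t) g) atTop (𝓝 0)) :
    Tendsto (fun γ => Metric.hausdorffEDist (graph (Icc (δ γ) H) fun t => F γ (t - δ γ) t)
      (dampedGraph lam p H (δ γ) g fun t => F γ t t)) atTop (𝓝 0) := by
  rw [ENNReal.tendsto_nhds_zero]
  intro ξ' hξ'
  obtain ⟨ε, hε, hε4, hεξ⟩ : ∃ ε : ℝ, 0 < ε ∧ ε ≤ 1 / 4 ∧ ENNReal.ofReal (4 * ε) ≤ ξ' := by
    rcases eq_or_ne ξ' ∞ with rfl | hne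
    · exact ⟨1 / 4, by norm_num, le_rfl, le_top⟩
    · have h0 := ENNReal.toReal_pos hξ'.ne' hne
      refine ⟨min (1 / 4) (ξ'.toReal / 4), lt_min (by norm_num) (by positivity), min_le_left _ _, ?_⟩
      refine (ENNReal.ofReal_le_ofReal ?_).trans ENNReal.ofReal_toReal_le
      have := min_le_right (1 / 4 : ℝ) (ξ'.toReal / 4)
      linarith
  have hjumps : ∀ᶠ γ in atTop, ∀ j ∈ jumpSet H g, j ∈ Icc (δ γ) H ∧ ∀ y ∈ Icc (0 : ℝ) 1,
      ∃ t ∈ Icc (δ γ) H, |t - j| ≤ ε ∧ |F γ (t - δ γ) t - y| ≤ ε :=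
    (hg.finite_jumpSet.eventually_all).2 fun j hj =>
      eventually_exists_value hg hF hδ0 hδ hL hj hε hε (by linarith)
  filter_upwards [eventually_abs_sub_dampedValue_le hg hF hδ0 hδ hsep hε hε, hjumps, hδ0,
    eventually_gt_atTop 0] with γ a1 a2 a3 hγ
  refine le_trans ?_ hεξ
  have hc := (hF γ hγ).continuousOn_shift (δ γ) a3
  have hedist : ∀ s y s' y', |s - s'| + |y - y'| ≤ 4 * ε →
      edist (planePoint s y) (planePoint s' y') ≤ ENNReal.ofReal (4 * ε) := fun s y s' y' h => by
    rw [edist_dist]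
    exact ENNReal.ofReal_le_ofReal ((dist_planePoint_le _ _ _ _).trans h)
  refine Metric.hausdorffEDist_le_of_mem_edist ?_ ?_
  · intro z hz
    rw [mem_graph_of_continuousOn hc] at hz
    obtain ⟨hz0, hz1⟩ := hz
    set t := z 0 with ht
    have hzt : z = planePoint t (F γ (t - δ γ) t) := by rw [← hz1]; exact eq_planePoint z
    have ht0 : t ∈ Icc 0 H := ⟨a3.trans hz0.1, hz0.2⟩
    -- Far from the jumps, points are matched vertically. Otherwise the point is matched
    -- horizontally with the full bar at a jump `j` within `2 * ε`, which contains its height.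
    by_cases hfar : ∀ j ∈ jumpSet H g, 2 * ε < |t - j|
    · have hcont : ContinuousWithinAt g (Icc 0 H) t := by
        by_contra hcon
        have := hfar t ⟨ht0, hcon⟩
        rw [sub_self, abs_zero] at this
        linarith
      refine ⟨planePoint t (dampedValue lam p (δ γ) g (fun u => F γ u u) t), ?_, ?_⟩
      · refine ⟨by simpa using hz0, Or.inl ⟨by simpa using hcont, ?_⟩⟩
        rw [planePoint_zero, planePoint_one, dampedValue]
      · rw [hzt]
        refine hedist _ _ _ _ ?_
        rw [sub_self, abs_zero, zero_add]
        exact (a1 t hz0 hfar).trans (by linarith)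
    · push Not at hfar
      obtain ⟨j, hj, hjt⟩ := hfar
      refine ⟨planePoint j (F γ (t - δ γ) t), ?_, ?_⟩
      · refine ⟨by simpa using (a2 j hj).1, Or.inr ⟨by simpa using hj.2, ?_⟩⟩
        rw [planePoint_one]
        exact (hF γ hγ).mem_Icc _ _ (by linarith [hz0.1]) (by linarith) hz0.2
      · rw [hzt]
        refine hedist _ _ _ _ ?_
        rw [sub_self, abs_zero, add_zero]
        linarith
  · intro z hz
    obtain ⟨hz0, hz1⟩ := hz
    set t := z 0 with ht
    have hzt : z = planePoint t (z 1) := eq_planePoint z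
    have ht0 : t ∈ Icc 0 H := ⟨a3.trans hz0.1, hz0.2⟩
    by_cases hfar : ∀ j ∈ jumpSet H g, 2 * ε < |t - j|
    · have hcont : ContinuousWithinAt g (Icc 0 H) t := by
        by_contra hcon
        have := hfar t ⟨ht0, hcon⟩
        rw [sub_self, abs_zero] at this
        linarith
      have hval : z 1 = dampedValue lam p (δ γ) g (fun u => F γ u u) t := by
        rcases hz1 with h | h
        · exact h.2
        · exact absurd hcont h.1
      refine ⟨planePoint t (F γ (t - δ γ) t), ?_, ?_⟩
      · rw [mem_graph_of_continuousOn hc]; simpa using hz0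
      · rw [hzt, hval]
        refine hedist _ _ _ _ ?_
        rw [sub_self, abs_zero, zero_add, abs_sub_comm]
        exact (a1 t hz0 hfar).trans (by linarith)
    · push Not at hfar
      obtain ⟨j, hj, hjt⟩ := hfar
      have hy : z 1 ∈ Icc (0 : ℝ) 1 := by
        rcases hz1 with h | h
        · rw [h.2]
          exact dampedValue_mem (f := fun u => F γ u u) hg ht0.1
            ((hF γ hγ).mem_Icc t t ht0.1 le_rfl ht0.2)
        · exact h.2
      -- A point of the damped graph near a jump, bar included, is matched with a time where the
      -- smoother takes almost the same value: `2 * ε` from `t` to `j`, `ε` from `j` to `t'` and `ε`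
      -- in height, hence the bound `4 * ε`.
      obtain ⟨t', ht', h1, h2⟩ := (a2 j hj).2 (z 1) hy
      refine ⟨planePoint t' (F γ (t' - δ γ) t'), ?_, ?_⟩
      · rw [mem_graph_of_continuousOn hc]; simpa using ht'
      · rw [hzt]
        refine hedist _ _ _ _ ?_
        have := abs_sub_le t j t'
        rw [abs_sub_comm] at h1 h2
        linarith

end Convergence

end WonhamFilter

theorem mainTheorem4 {Ω : Type*} [MeasurableSpace Ω] (P : Measure Ω) [IsProbabilityMeasure P]
    (lam p q H : ℝ) (hlam : 0 < lam) (hp : p ∈ Ioo (0 : ℝ) 1) (hq : q ∈ Icc (0 : ℝ) 1)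
    (hH : 0 < H)
    -- the smoothing window
    (δ : ℝ → ℝ) (hδ_nonneg : ∀ᶠ γ in atTop, 0 ≤ δ γ) (hδ : Tendsto δ atTop (𝓝 0))
    -- the limiting jump process and the spike process that decorates it
    (x : ℝ → Ω → ℝ) (hx : WonhamFilter.IsTwoStateChain P lam p q x)
    (S : Ω → Set (ℝ × ℝ)) (R : Ω → ℝ) (hS : WonhamFilter.IsSpikeDecoration P lam p q H x S R)
    -- for each γ, the signal (for instance `X γ = x`), the noise, and the conditional
    -- probabilities; no assumption is made on the joint law for different values of γ
    (X : ℝ → ℝ → Ω → ℝ) (B : ℝ → ℝ≥0 → Ω → ℝ) (π : ℝ → ℝ → ℝ → Ω → ℝ)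
    (hmodel : ∀ γ, 0 < γ → WonhamFilter.IsFilteringModel P lam p q γ (X γ) (B γ) (π γ))
    -- the coupling
    (hcouplingL : ∀ᵐ ω ∂P, Tendsto
      (fun γ => WonhamFilter.dL H (fun t => π γ t t ω) (fun t => x t ω)) atTop (𝓝 0))
    (hcouplingH : ∀ᵐ ω ∂P, Tendsto
      (fun γ => Metric.hausdorffEDist
        (WonhamFilter.graph (Icc 0 H) (fun t => π γ t t ω))
        (WonhamFilter.spikeSet H (fun t => x t ω) (S ω) (R ω))) atTop (𝓝 0)) :
    (∀ᵐ ω ∂P, Tendsto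
      (fun γ => WonhamFilter.dL H (fun t => π γ (t - δ γ) t ω) (fun t => x t ω)) atTop (𝓝 0)) ∧
    (∀ᵐ ω ∂P, Tendsto
      (fun γ => Metric.hausdorffEDist
        (WonhamFilter.graph (Icc (δ γ) H) (fun t => π γ (t - δ γ) t ω))
        (WonhamFilter.dampedGraph lam p H (δ γ) (fun t => x t ω) (fun t => π γ t t ω)))
      atTop (𝓝 0)) := by
  -- All the probability is gathered in one almost sure event: no jump at `H`, the damping estimates
  -- for all `γ > 0` at once, and the separation from the opposite state. On it, both convergences
  -- are deterministic.
  have hA : ∀ᵐ ω ∂P, WonhamFilter.IsBinaryPath H (fun t => x t ω) ∧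
      (∀ γ, 0 < γ → WonhamFilter.IsDampedFamily lam p H fun s t => π γ s t ω) ∧
      (∀ (e : Fin 2), ∀ ε > 0, ∃ η > 0, ∀ᶠ γ in atTop, ∀ s ∈ Icc 0 H,
        (∀ u ∈ Icc (s - ε) (s + ε) ∩ Icc 0 H, x u ω = ((e : ℕ) : ℝ)) →
        η ≤ |π γ s s ω - (1 - ((e : ℕ) : ℝ))|) := by
    filter_upwards [WonhamFilter.ae_notMem_closure hlam hp hq hH hx hmodel hcouplingL hcouplingH,
      hx.ae_continuousWithinAt hlam.le (Ioo_subset_Icc_self hp) hH, hcouplingH] with ω h1 h2 h3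
    refine ⟨⟨fun t ht => hx.mem_states t ht ω, hx.right_continuous ω, hx.left_limits ω, h2⟩,
      fun γ hγ => ?_, fun e ε hε => ?_⟩
    · obtain ⟨G, hG⟩ := (hmodel γ hγ).exists_smoother hlam hp hq hH.le
      exact (hG ω).isDampedFamily hlam hp fun s t hs hst htH =>
        (hmodel γ hγ).eq_smoother hlam hp hq hγ hG hs hst htH ω
    · obtain ⟨η, hη, h⟩ := WonhamFilter.exists_separation e (h1 e) hε
      refine ⟨η, hη, ?_⟩
      filter_upwards [h3.eventually_lt_const (ENNReal.ofReal_pos.2 hη), eventually_gt_atTop 0]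
        with γ h4 hγ
      exact h _ ((hmodel γ hγ).continuousOn_filter hlam hp hq hγ H ω) h4
  have hB : ∀ᵐ ω ∂P, Tendsto
      (fun γ => WonhamFilter.dL H (fun t => π γ (t - δ γ) t ω) (fun t => x t ω)) atTop (𝓝 0) := by
    filter_upwards [hA, hcouplingL] with ω h hL
    exact WonhamFilter.tendsto_dL_smoother (F := fun γ s t => π γ s t ω) hH h.1 h.2.1 hδ_nonneg hδ
      h.2.2 hL
  refine ⟨hB, ?_⟩
  filter_upwards [hA, hB] with ω h hL
  exact WonhamFilter.tendsto_hausdorffEDist_smoother (F := fun γ s t => π γ s t ω) h.1 h.2.1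
    hδ_nonneg hδ h.2.2 hL
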